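/- Write $\mathfrak N$ for the set of finite integer-valued Borel measures on $(0,\infty)$, $\mathfrak N^\circ=\mathfrak N\setminus\{\mathbf 0\}$, $B$ for the bounded Borel functions on $(0,\infty)$, $B^+$ for its nonnegative elements, and $\langle\nu,f\rangle=\int f\,d\nu$. Functions on $(0,\infty)$ are extended by $0$ to $(-\infty,0]$. Let $\alpha\ge 0$ be a bounded $C^1$ function on $(0,\infty)$ with bounded derivative; for every $x>0$ let $(p(x,i))_{i\ge 0}$ be a probability distribution on $\mathbb N$ such that each $p(\cdot,i)$ is $C^1$ with bounded derivative, with generating function $g(x,z)=\sum_i p(x,i)z^i$ and $\sup_{x>0} g'(x,1-)=\sup_{x>0}\sum_i i\,p(x,i)<\infty$ (derivatives of $g$ are in $z$); let $G$ be an atomless probability measure on $(0,\infty)$; let $L$ be a finite measure on $\mathfrak N^\circ$ and $\psi(f)=\int(1-e^{-\langle\nu,f\rangle})L(d\nu)$. For $f\in B^+$ let $u_tf$ be the unique nonnegative locally bounded solution of $$u_tf(x)=f(x-t)+\int_0^t\alpha(x-s)\big[1-g(x-s,\langle G,e^{-u_{t-s}f}\rangle)\big]ds .$$ Let $Y=(Y_t)_{t\ge0}$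 be a (jointly measurable, e.g. right-continuous) Markov process in $\mathfrak N$ started at $\sigma\in\mathfrak N$ under $\mathbf P_\sigma$, with transition semigroup $(P_t)$ given by $$\int e^{-\langle\nu,f\rangle}P_t(\sigma,d\nu)=\exp\Big\{-\langle\sigma,u_tf\rangle-\int_0^t\psi(u_sf)\,ds\Big\},\qquad f\in B^+,$$ and let $Z_t=\int_0^tY_s\,ds$. For $f\in B$ let $\pi_tf$ be the unique locally bounded solution of $$\pi_tf(x)=f(x-t)+\int_0^t\alpha(x-s)g'(x-s,1-)\langle G,\pi_{t-s}f\rangle\,ds .$$ Assume: 1. $\rho_1:=\int_0^\infty ds\int_{(s,\infty)}\alpha(x-s)g'(x-s,1-)G(dx)<1$, and there is $\alpha_1\in(0,\infty)$ such that $t\mapsto e^{\alpha_1t}G((t,\infty))$ is directly Riemann integrable on $[0,\infty)$ and $\int_0^\infty e^{\alpha_1s}ds\int_{(s,\infty)}\alpha(x-s)g'(x-s,1-)G(dx)=1$; 2. $\int e^{2\alpha_1x}G(dx)<\infty$ and $\sup_{x>0}g''(x,1-)<\infty$; 3. $\int_{\mathfrak N^\circ}\big(\int e^{\alpha_1x}\nu(dx)\big)^2L(d\nu)<\infty$.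 For $f\in B$ put $\Pi_\infty f(x)=\int_0^\infty\pi_sf(x)\,ds$, $$a_2(f)=\frac1{1-\rho_1}\int G(dx)\int_0^x\alpha(x-s)\big[g''(x-s,1-)\langle G,\Pi_\infty f\rangle^2+g'(x-s,1-)\langle G,(\Pi_\infty f)^2\rangle\big]ds,$$ $$\Gamma_\infty f(x)=\int_0^x\alpha(x-s)\big\{g''(x-s,1-)\langle G,\Pi_\infty f\rangle^2+g'(x-s,1-)\big[\langle G,(\Pi_\infty f)^2\rangle+a_2(f)\big]\big\}ds .$$ Then, for every $\sigma\in\mathfrak N$ and $f\in B$, these quantities are well defined ($s\mapsto\pi_sf(x)$ is integrable on $(0,\infty)$ for every $x$, $\Pi_\infty f\in L^2(G)$, $\langle Z_t,f\rangle$ is $\mathbf P_\sigma$-integrable for every $t$, and $\nu\mapsto\langle\nu,\Gamma_\infty f\rangle+\langle\nu,\Pi_\infty f\rangle^2$ is $L$-integrable), and as $t\to\infty$ the distribution of $$\frac1{\sqrt t}\big(\langle Z_t,f\rangle-\mathbf P_\sigma\langle Z_t,f\rangle\big)$$ under $\mathbf P_\sigma$ converges weakly to the Gaussian distribution with mean $0$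 and variance $$\int_{\mathfrak N^\circ}\big(\langle\nu,\Gamma_\infty f\rangle+\langle\nu,\Pi_\infty f\rangle^2\big)L(d\nu).$$ -/

import Mathlib

open MeasureTheory ProbabilityTheory Filter Topology
open scoped NNReal ENNReal

noncomputable section

namespace RLBranching

/-! Functions on `(0,∞)` are represented by functions on `ℝ` that vanish on `(-∞,0]`, and measures
on `(0,∞)` by measures on `ℝ` that do not charge `(-∞,0]`. -/

/-- Bounded Borel functions on `(0,∞)`, extended by zero. -/
structure MemB (f : ℝ → ℝ) : Prop where
  measurable : Measurable f
  bounded : ∃ C : ℝ, ∀ x, |f x| ≤ C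
  zero_of_nonpos : ∀ x ≤ 0, f x = 0

/-- Nonnegative bounded `C¹` functions on `(0,∞)` with bounded derivative, extended by zero. -/
structure MemC1Pos (h : ℝ → ℝ) : Prop where
  contDiffOn : ContDiffOn ℝ 1 h (Set.Ioi 0)
  nonneg : ∀ x, 0 ≤ h x
  bounded : ∃ C : ℝ, ∀ x > 0, h x ≤ C
  deriv_bounded : ∃ C : ℝ, ∀ x > 0, |deriv h x| ≤ C
  zero_of_nonpos : ∀ x ≤ 0, h x = 0

/-- Finite integer-valued Borel measures on `(0,∞)`. As a subtype of `Measure ℝ` it carries the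
`σ`-algebra generated by the maps `ν ↦ ν B`, which is the Borel `σ`-algebra of the weak topology. -/
abbrev IntMeas : Type :=
  {ν : Measure ℝ // IsFiniteMeasure ν ∧ ν (Set.Iic 0) = 0 ∧
    ∀ B : Set ℝ, MeasurableSet B → ∃ n : ℕ, ν B = n}

/-- The pairing `⟨ν, f⟩`. -/
def pair (ν : Measure ℝ) (f : ℝ → ℝ) : ℝ := ∫ x, f x ∂ν

/-- The generating function `g(x, z) = ∑ i, p(x, i) z ^ i`. -/
def gen (p : ℕ → ℝ → ℝ) (x z : ℝ) : ℝ := ∑' i : ℕ, p i x * z ^ i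

/-- `g'(x, 1-) = ∑ i, i p(x, i)`. -/
def gen₁ (p : ℕ → ℝ → ℝ) (x : ℝ) : ℝ := ∑' i : ℕ, (i : ℝ) * p i x

/-- `g''(x, 1-) = ∑ i, i (i - 1) p(x, i)`. -/
def gen₂ (p : ℕ → ℝ → ℝ) (x : ℝ) : ℝ := ∑' i : ℕ, (i : ℝ) * ((i : ℝ) - 1) * p i x

/-- The parameters of the branching mechanism: birth rate `α`, offspring laws `p i x = p(x, i)`
with `‖g'(·, 1-)‖ < ∞`, and a continuous life-length distribution `G` on `(0,∞)`. -/
structure IsBranchingMechanism (α : ℝ → ℝ) (p : ℕ → ℝ → ℝ) (G : Measure ℝ) : Prop where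
  rate : MemC1Pos α
  offspring : ∀ i, MemC1Pos (p i)
  offspring_sum : ∀ x > 0, HasSum (fun i => p i x) 1
  mean_bounded : ∃ C : ℝ, ∀ x > 0, Summable (fun i : ℕ => (i : ℝ) * p i x) ∧ gen₁ p x ≤ C
  prob : IsProbabilityMeasure G
  pos : G (Set.Iic 0) = 0
  noAtoms : NullSingletonClass G

/-- `‖g''(·, 1-)‖ < ∞`. -/
def SecondMomentBounded (p : ℕ → ℝ → ℝ) : Prop :=
  ∃ C : ℝ, ∀ x > 0, Summable (fun i : ℕ => (i : ℝ) * ((i : ℝ) - 1) * p i x) ∧ gen₂ p x ≤ C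

/-- `u` is a nonnegative locally bounded Borel solution of
`u_t(x) = f(x - t) + ∫_0^t α(x - s) [1 - g(x - s, ⟨G, e^{-u_{t-s}}⟩)] ds`. -/
structure IsCumulantSolution (α : ℝ → ℝ) (p : ℕ → ℝ → ℝ) (G : Measure ℝ) (f : ℝ → ℝ)
    (u : ℝ → ℝ → ℝ) : Prop where
  measurable : Measurable (Function.uncurry u)
  nonneg : ∀ t x, 0 ≤ u t x
  locallyBounded : ∀ T : ℝ, ∃ C : ℝ, ∀ t ∈ Set.Icc 0 T, ∀ x, u t x ≤ C
  eqn : ∀ t ≥ 0, ∀ x, u t x = f (x - t) +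
    ∫ s in (0 : ℝ)..t,
      α (x - s) * (1 - gen p (x - s) (pair G fun y => Real.exp (-u (t - s) y)))

/-- `u_t f(x)`, the solution of the above equation, unique for `t ≥ 0`. -/
def cumulant (α : ℝ → ℝ) (p : ℕ → ℝ → ℝ) (G : Measure ℝ) (f : ℝ → ℝ) : ℝ → ℝ → ℝ :=
  Classical.epsilon (IsCumulantSolution α p G f)

/-- `ψ(f) = ∫ (1 - e^{-⟨ν, f⟩}) L(dν)`. -/
def immigration (L : Measure IntMeas) (f : ℝ → ℝ) : ℝ :=
  ∫ ν, (1 - Real.exp (-pair ν.1 f)) ∂L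

/-- `P` is the transition semigroup with Laplace functionals
`∫ e^{-⟨ν, f⟩} P_t(σ, dν) = exp (-⟨σ, u_t f⟩ - ∫_0^t ψ(u_s f) ds)`. -/
def IsTransitionSemigroup (α : ℝ → ℝ) (p : ℕ → ℝ → ℝ) (G : Measure ℝ) (L : Measure IntMeas)
    (P : ℝ≥0 → Kernel IntMeas IntMeas) : Prop :=
  (∀ t, IsMarkovKernel (P t)) ∧
  ∀ (t : ℝ≥0) (σ : IntMeas) (f : ℝ → ℝ), MemB f → (∀ x, 0 ≤ f x) →
    ∫ ν, Real.exp (-pair ν.1 f) ∂(P t σ) =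
      Real.exp (-pair σ.1 (cumulant α p G f t) -
        ∫ s in (0 : ℝ)..t, immigration L (cumulant α p G f s))

/-- `Y` is a branching process with immigration with parameters `(α, g, G, ψ)`: a Markov process
for the filtration `ℱ` with the above transition semigroup. -/
structure IsImmigrationProcess {Ω : Type*} {mΩ : MeasurableSpace Ω} (α : ℝ → ℝ) (p : ℕ → ℝ → ℝ)
    (G : Measure ℝ) (L : Measure IntMeas) (μ : Measure Ω) (ℱ : Filtration ℝ≥0 mΩ)
    (Y : ℝ≥0 → Ω → IntMeas) : Prop where
  adapted : ∀ t, Measurable[ℱ t] (Y t)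
  markov : ∃ P : ℝ≥0 → Kernel IntMeas IntMeas, IsTransitionSemigroup α p G L P ∧
    ∀ (s t : ℝ≥0) (F : IntMeas → ℝ), Measurable F → (∃ C : ℝ, ∀ ν, |F ν| ≤ C) →
      μ[fun ω => F (Y (s + t) ω) | ℱ s] =ᵐ[μ] fun ω => ∫ ν, F ν ∂(P t (Y s ω))

/-- The occupation time measure `Z_t(ω) = ∫_0^t Y_s(ω) ds`. -/
def occupation {Ω : Type*} (Y : ℝ≥0 → Ω → IntMeas) (t : ℝ) (ω : Ω) : Measure ℝ :=
  (volume.restrict (Set.Ioc 0 t)).bind fun s => (Y s.toNNReal ω).1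

/-- Direct Riemann integrability over `[0,∞)` of a nonnegative function. -/
def DirectlyRiemannIntegrable (h : ℝ → ℝ) : Prop :=
  let upper : ℝ → ℝ≥0∞ := fun a => ∑' n : ℕ, ENNReal.ofReal a *
    ⨆ x ∈ Set.Icc ((n : ℝ) * a) (((n : ℝ) + 1) * a), ENNReal.ofReal (h x)
  let lower : ℝ → ℝ≥0∞ := fun a => ∑' n : ℕ, ENNReal.ofReal a *
    ⨅ x ∈ Set.Icc ((n : ℝ) * a) (((n : ℝ) + 1) * a), ENNReal.ofReal (h x)
  (∀ a > 0, upper a < ⊤) ∧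
    ∃ l : ℝ≥0∞, Tendsto upper (𝓝[>] 0) (𝓝 l) ∧ Tendsto lower (𝓝[>] 0) (𝓝 l)

/-- The reproduction density `s ↦ ∫_{(s,∞)} α(x - s) g'(x - s, 1-) G(dx)`. -/
def reproduction (α : ℝ → ℝ) (p : ℕ → ℝ → ℝ) (G : Measure ℝ) (s : ℝ) : ℝ :=
  ∫ x in Set.Ioi s, α (x - s) * gen₁ p (x - s) ∂G

/-- The mean total number `ρ₁` of children of an individual. -/
def rho (α : ℝ → ℝ) (p : ℕ → ℝ → ℝ) (G : Measure ℝ) : ℝ :=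
  ∫ s in Set.Ioi (0 : ℝ), reproduction α p G s

/-- Subcriticality with Malthusian exponent `-α₁`. The last equation forces the integrand there,
hence also the integrand of `rho`, to be integrable. -/
structure SubcriticalMalthusian (α : ℝ → ℝ) (p : ℕ → ℝ → ℝ) (G : Measure ℝ) (α₁ : ℝ) :
    Prop where
  subcritical : rho α p G < 1
  pos : 0 < α₁
  tail : DirectlyRiemannIntegrable fun t => Real.exp (α₁ * t) * (1 - G.real (Set.Ioc 0 t))
  malthus : ∫ s in Set.Ioi (0 : ℝ), Real.exp (α₁ * s) * reproduction α p G s = 1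

/-- `π` is a locally bounded Borel solution of
`π_t(x) = f(x - t) + ∫_0^t α(x - s) g'(x - s, 1-) ⟨G, π_{t-s}⟩ ds`. -/
structure IsMeanSolution (α : ℝ → ℝ) (p : ℕ → ℝ → ℝ) (G : Measure ℝ) (f : ℝ → ℝ)
    (π : ℝ → ℝ → ℝ) : Prop where
  measurable : Measurable (Function.uncurry π)
  locallyBounded : ∀ T : ℝ, ∃ C : ℝ, ∀ t ∈ Set.Icc 0 T, ∀ x, |π t x| ≤ C
  eqn : ∀ t ≥ 0, ∀ x, π t x = f (x - t) +
    ∫ s in (0 : ℝ)..t, α (x - s) * gen₁ p (x - s) * pair G (π (t - s))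

/-- `π_t f(x)`, the solution of the above equation, unique for `t ≥ 0`. -/
def meanSemigroup (α : ℝ → ℝ) (p : ℕ → ℝ → ℝ) (G : Measure ℝ) (f : ℝ → ℝ) : ℝ → ℝ → ℝ :=
  Classical.epsilon (IsMeanSolution α p G f)

/-- `Π_∞ f(x) = ∫_0^∞ π_s f(x) ds`. -/
def PiInf (α : ℝ → ℝ) (p : ℕ → ℝ → ℝ) (G : Measure ℝ) (f : ℝ → ℝ) (x : ℝ) : ℝ :=
  ∫ s in Set.Ioi (0 : ℝ), meanSemigroup α p G f s x

/-- The constant `a₂(f) = (1 - ρ₁)⁻¹ ∫ G(dx) ∫_0^x α(x - s) [g''(x - s, 1-) ⟨G, Π_∞ f⟩² +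
g'(x - s, 1-) ⟨G, (Π_∞ f)²⟩] ds`. -/
def aTwo (α : ℝ → ℝ) (p : ℕ → ℝ → ℝ) (G : Measure ℝ) (f : ℝ → ℝ) : ℝ :=
  (1 - rho α p G)⁻¹ * ∫ x, (∫ s in (0 : ℝ)..x,
    α (x - s) * (gen₂ p (x - s) * pair G (PiInf α p G f) ^ 2 +
      gen₁ p (x - s) * pair G (fun y => PiInf α p G f y ^ 2))) ∂G

/-- `Γ_∞ f(x) = ∫_0^x α(x - s) {g''(x - s, 1-) ⟨G, Π_∞ f⟩² +
g'(x - s, 1-) [⟨G, (Π_∞ f)²⟩ + a₂(f)]} ds`. -/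
def GammaInf (α : ℝ → ℝ) (p : ℕ → ℝ → ℝ) (G : Measure ℝ) (f : ℝ → ℝ) (x : ℝ) : ℝ :=
  ∫ s in (0 : ℝ)..x,
    α (x - s) * (gen₂ p (x - s) * pair G (PiInf α p G f) ^ 2 +
      gen₁ p (x - s) * (pair G (fun y => PiInf α p G f y ^ 2) + aTwo α p G f))

end RLBranching

end

noncomputable section

namespace RLBranching

/-! For a nonnegative test function `F` the Laplace transform of `⟨Z_t, F⟩` is explicit: it equals
`exp(-⟨σ, v_t⟩ - ∫_0^t ψ(v_s) ds)`, where `v` solves the cumulant equation with forcing `∫_0^t F(x -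
s) ds` (`laplace_occupation`). The Markov property gives such a formula for finitely many
observations (`laplace_obs`). The occupation time is reached through Riemann sums on a grid shifted
by a uniform `θ`: for a path that is only measurable and integrable these converge in mean over `θ`
(`shiftedSum_tendsto_param`), and stability of the Volterra equation under `L¹` perturbations of the
forcing (`volterra_stability`) carries this convergence over to the cumulants.

Replace `F` by `ε F` and write `v^ε = ε M - ε² d^ε`, where `M` solves the linearized equation.
Averaged over `G`, `d^ε` satisfies a renewal equation whose kernel is the reproduction density, of
total mass `ρ₁ < 1`, and whose source is the second order remainder of the birth term. Because the
equation is defective, `d^ε_t(x)` is at most a multiple of the residual life `x`, uniformly in `ε`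
and `t`, and it tends to `Γ_∞F(x)/2` as `ε → 0` and `t → ∞` jointly (`tendsto_of_renewal`,
`tendsto_deviation`). The first order term of the exponent is `ε` times the mean occupation time, so
centring removes it. With `ε = t^{-1/2}` what is left is a term of order `1/t` from `σ` and the
average over `s ∈ [0, t]` of `∫ (⟨ν, d^ε_s⟩ + (e^{-y} - 1 + y)/ε²) L(dν)` with `y = ⟨ν, v^ε_s⟩`; it
tends to half the limit variance (`tendsto_exponent`, `tendsto_laplace`).

A signed `f` is split as `f⁺ - f⁻`. The combinations `a f⁺ + b f⁻` with `a, b ≥ 0` are covered by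
the above, and the variance is a quadratic form in `f` (`exists_limitVariance_quadForm`), so the
Laplace transforms of the pair of fluctuations converge on the closed positive quadrant to those of
a Gaussian pair. A centred `X` has `E|X| ≤ 2 E e^{-X}`, whence tightness. For any limit law the
transform on the quadrant continues analytically, after an exponential tilt, to the imaginary
multiples of `(1, -1)`, which determines the law of the difference (`tilted_charFun_eq`,
`tendstoInDistribution_sub_of_laplace`). -/

lemma intervalIntegrable_of_bounded {h : ℝ → ℝ} (hm : Measurable h) {t B : ℝ} (ht : 0 ≤ t)
    (hB : ∀ s ∈ Set.Icc 0 t, |h s| ≤ B) : IntervalIntegrable h volume 0 t := by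
  rw [intervalIntegrable_iff_integrableOn_Ioc_of_le ht]
  refine Measure.integrableOn_of_bounded (M := B) (by simp) hm.aestronglyMeasurable ?_
  filter_upwards [ae_restrict_mem measurableSet_Ioc] with s hs
  exact hB s ⟨hs.1.le, hs.2⟩

lemma integrable_of_bounded {β : Type*} [MeasurableSpace β] {m : Measure β} [IsFiniteMeasure m]
    {h : β → ℝ} (hm : Measurable h) {B : ℝ} (hB : ∀ s, |h s| ≤ B) : Integrable h m :=
  Integrable.of_bound hm.aestronglyMeasurable B (ae_of_all _ hB)

/-- An interval integral is the difference of the integrals over `(0, τ b]` and `(τ b, 0]`. Both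
domains are sections of measurable subsets of `β × ℝ`, so a moving endpoint becomes an indicator in
the integrand. -/
lemma measurable_intervalIntegral_param {β : Type*} [MeasurableSpace β] {τ : β → ℝ}
    (hτ : Measurable τ) {h : β → ℝ → ℝ} (hh : Measurable (Function.uncurry h)) :
    Measurable fun b => ∫ s in (0 : ℝ)..τ b, h b s := by
  have key : ∀ (A : Set (β × ℝ)), MeasurableSet A →
      Measurable fun b => ∫ s, A.indicator (Function.uncurry h) (b, s) := by
    intro A hA
    exact ((hh.indicator hA).stronglyMeasurable.integral_prod_right' (ν := volume)).measurable
  have hA1 : MeasurableSet {p : β × ℝ | p.2 ∈ Set.Ioc 0 (τ p.1)} :=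
    (measurableSet_lt measurable_const measurable_snd).inter
      (measurableSet_le measurable_snd (hτ.comp measurable_fst))
  have hA2 : MeasurableSet {p : β × ℝ | p.2 ∈ Set.Ioc (τ p.1) 0} :=
    (measurableSet_lt (hτ.comp measurable_fst) measurable_snd).inter
      (measurableSet_le measurable_snd measurable_const)
  convert (key _ hA1).sub (key _ hA2) using 2 with b
  rw [intervalIntegral, ← integral_indicator measurableSet_Ioc,
    ← integral_indicator measurableSet_Ioc]
  rfl

/-- Integral form of Grönwall's inequality for bounded measurable functions. -/
lemma gronwall_integral {I : ℝ → ℝ} {A C B T : ℝ} (hC : 0 < C)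
    (hI : Measurable I) (hB : ∀ t ∈ Set.Icc 0 T, |I t| ≤ B)
    (h : ∀ t ∈ Set.Icc 0 T, I t ≤ A + C * ∫ s in (0 : ℝ)..t, I s) {t : ℝ} (ht : t ∈ Set.Icc 0 T) :
    I t ≤ 2 * max A 0 * Real.exp (2 * C * t) := by
  set A' := max A 0
  have hT : 0 ≤ T := ht.1.trans ht.2
  -- In the norm weighted by `e^{-2Ct}` the operator `C ∫_0^t` has norm at most `1/2`. Hence `S ≤ A'
  -- + S/2`, which is the source of both the factor `2` and the exponent `2C` in the conclusion.
  set Sset := (fun t => Real.exp (-(2 * C * t)) * I t) '' Set.Icc 0 T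
  have hbdd : BddAbove Sset := by
    refine ⟨B, ?_⟩
    rintro _ ⟨s, hs, rfl⟩
    have h1 : Real.exp (-(2 * C * s)) ≤ 1 := by
      rw [Real.exp_le_one_iff]; have := mul_nonneg hC.le hs.1; linarith
    calc Real.exp (-(2 * C * s)) * I s ≤ Real.exp (-(2 * C * s)) * |I s| := by
          gcongr; exact le_abs_self _
      _ ≤ 1 * |I s| := by gcongr
      _ ≤ B := by rw [one_mul]; exact hB s hs
  set S := max (sSup Sset) 0
  have hS : ∀ s ∈ Set.Icc 0 T, I s ≤ S * Real.exp (2 * C * s) := by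
    intro s hs
    have h1 : Real.exp (-(2 * C * s)) * I s ≤ S :=
      (le_csSup hbdd ⟨s, hs, rfl⟩).trans (le_max_left _ _)
    have h2 := mul_le_mul_of_nonneg_right h1 (Real.exp_pos (2 * C * s)).le
    rwa [mul_right_comm, ← Real.exp_add, neg_add_cancel, Real.exp_zero, one_mul] at h2
  have hint : ∀ s : ℝ, ∫ r in (0 : ℝ)..s, Real.exp (2 * C * r) =
      (Real.exp (2 * C * s) - 1) / (2 * C) := by
    intro s
    have hd : ∀ r ∈ Set.uIcc 0 s, HasDerivAt (fun r => Real.exp (2 * C * r) / (2 * C))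
        (Real.exp (2 * C * r)) r := by
      intro r _
      have := (((hasDerivAt_id r).const_mul (2 * C)).exp).div_const (2 * C)
      refine this.congr_deriv ?_
      rw [id, mul_one, mul_div_assoc, div_self (by positivity), mul_one]
    rw [intervalIntegral.integral_eq_sub_of_hasDerivAt hd
      (Continuous.intervalIntegrable (by fun_prop) _ _)]
    simp; ring
  have hstep : ∀ s ∈ Set.Icc 0 T, Real.exp (-(2 * C * s)) * I s ≤ A' + S / 2 := by
    intro s hs
    have h1 : ∫ r in (0 : ℝ)..s, I r ≤ ∫ r in (0 : ℝ)..s, S * Real.exp (2 * C * r) := by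
      refine intervalIntegral.integral_mono_on hs.1
        (intervalIntegrable_of_bounded hI hs.1 fun r hr => hB r ⟨hr.1, hr.2.trans hs.2⟩)
        (Continuous.intervalIntegrable (by fun_prop) _ _) fun r hr => hS r ⟨hr.1, hr.2.trans hs.2⟩
    rw [intervalIntegral.integral_const_mul, hint] at h1
    have h2 : I s ≤ A' + S / 2 * (Real.exp (2 * C * s) - 1) := by
      refine (h s hs).trans (add_le_add (le_max_left _ _) ?_)
      refine (mul_le_mul_of_nonneg_left h1 hC.le).trans (le_of_eq ?_)
      field_simp
    have hexp : 1 ≤ Real.exp (2 * C * s) :=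
      Real.one_le_exp (mul_nonneg (by positivity) hs.1)
    have h3 : I s ≤ (A' + S / 2) * Real.exp (2 * C * s) := by
      have hA' : 0 ≤ A' := le_max_right _ _
      have hS0 : 0 ≤ S := le_max_right _ _
      nlinarith
    calc Real.exp (-(2 * C * s)) * I s
        ≤ Real.exp (-(2 * C * s)) * ((A' + S / 2) * Real.exp (2 * C * s)) := by gcongr
      _ = A' + S / 2 := by
        rw [mul_comm, mul_assoc, ← Real.exp_add, add_neg_cancel, Real.exp_zero, mul_one]
  have hSle : S ≤ A' + S / 2 := by
    refine max_le (csSup_le ⟨_, _, ht, rfl⟩ ?_) ?_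
    · rintro _ ⟨s, hs, rfl⟩; exact hstep s hs
    · have hA' : 0 ≤ A' := le_max_right _ _
      have hS0 : 0 ≤ S := le_max_right _ _
      positivity
  calc I t ≤ S * Real.exp (2 * C * t) := hS t ht
    _ ≤ 2 * A' * Real.exp (2 * C * t) := by gcongr; linarith

/-! ### Volterra equations: existence and stability -/

/-- The nonlinearity of a Volterra equation `u_t(x) = J_t(x) + ∫_0^t c(x - s, ⟨G, φ(u_{t-s})⟩) ds`:
both `c` and `φ` vanish at zero, are nondecreasing and Lipschitz. -/
structure VolterraKernel (c : ℝ → ℝ → ℝ) (φ : ℝ → ℝ) (C : ℝ) : Prop where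
  pos : 0 < C
  meas : Measurable (Function.uncurry c)
  zero : ∀ y, c y 0 = 0
  mono : ∀ y q q', 0 ≤ q → q ≤ q' → c y q ≤ c y q'
  lip : ∀ y q q', 0 ≤ q → q ≤ q' → c y q' - c y q ≤ C * (q' - q)
  meas' : Measurable φ
  zero' : φ 0 = 0
  mono' : ∀ u u', 0 ≤ u → u ≤ u' → φ u ≤ φ u'
  lip' : ∀ u u', 0 ≤ u → u ≤ u' → φ u' - φ u ≤ u' - u

namespace VolterraKernel

variable {c : ℝ → ℝ → ℝ} {φ : ℝ → ℝ} {C : ℝ}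

lemma nonneg (hK : VolterraKernel c φ C) (y : ℝ) {q : ℝ} (hq : 0 ≤ q) : 0 ≤ c y q := by
  have := hK.mono y 0 q le_rfl hq; rwa [hK.zero] at this

lemma le (hK : VolterraKernel c φ C) (y : ℝ) {q : ℝ} (hq : 0 ≤ q) : c y q ≤ C * q := by
  have := hK.lip y 0 q le_rfl hq; rw [hK.zero] at this; linarith

lemma nonneg' (hK : VolterraKernel c φ C) {u : ℝ} (hu : 0 ≤ u) : 0 ≤ φ u := by
  have := hK.mono' 0 u le_rfl hu; rwa [hK.zero'] at this

lemma le' (hK : VolterraKernel c φ C) {u : ℝ} (hu : 0 ≤ u) : φ u ≤ u := by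
  have := hK.lip' 0 u le_rfl hu; rw [hK.zero'] at this; linarith

lemma abs_sub_le (hK : VolterraKernel c φ C) (y : ℝ) {q q' : ℝ} (hq : 0 ≤ q) (hq' : 0 ≤ q') :
    |c y q - c y q'| ≤ C * |q - q'| := by
  rcases le_total q q' with h | h
  · rw [abs_sub_comm, abs_sub_comm q, abs_of_nonneg (sub_nonneg.2 (hK.mono y q q' hq h)),
      abs_of_nonneg (sub_nonneg.2 h)]
    exact hK.lip y q q' hq h
  · rw [abs_of_nonneg (sub_nonneg.2 (hK.mono y q' q hq' h)), abs_of_nonneg (sub_nonneg.2 h)]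
    exact hK.lip y q' q hq' h

lemma abs_sub_le' (hK : VolterraKernel c φ C) {u u' : ℝ} (hu : 0 ≤ u) (hu' : 0 ≤ u') :
    |φ u - φ u'| ≤ |u - u'| := by
  rcases le_total u u' with h | h
  · rw [abs_sub_comm, abs_sub_comm u, abs_of_nonneg (sub_nonneg.2 (hK.mono' u u' hu h)),
      abs_of_nonneg (sub_nonneg.2 h)]
    exact hK.lip' u u' hu h
  · rw [abs_of_nonneg (sub_nonneg.2 (hK.mono' u' u hu' h)), abs_of_nonneg (sub_nonneg.2 h)]
    exact hK.lip' u' u hu' h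

end VolterraKernel

/-- Nonnegative locally bounded Borel solutions of the Volterra equation with forcing `J`. -/
structure IsVolterraSolution (c : ℝ → ℝ → ℝ) (φ : ℝ → ℝ) (G : Measure ℝ) (J : ℝ → ℝ → ℝ)
    (u : ℝ → ℝ → ℝ) : Prop where
  measurable : Measurable (Function.uncurry u)
  nonneg : ∀ t x, 0 ≤ u t x
  locallyBounded : ∀ T : ℝ, ∃ B : ℝ, ∀ t ∈ Set.Icc 0 T, ∀ x, u t x ≤ B
  eqn : ∀ t ≥ 0, ∀ x, u t x = J t x + ∫ s in (0 : ℝ)..t, c (x - s) (∫ y, φ (u (t - s) y) ∂G)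

/-- Admissible forcing terms: nonnegative, Borel and locally bounded. -/
structure IsForcing (J : ℝ → ℝ → ℝ) : Prop where
  measurable : Measurable (Function.uncurry J)
  nonneg : ∀ t ≥ 0, ∀ x, 0 ≤ J t x
  locallyBounded : ∀ T : ℝ, ∃ B : ℝ, ∀ t ∈ Set.Icc 0 T, ∀ x, J t x ≤ B

section Existence

variable {c : ℝ → ℝ → ℝ} {φ : ℝ → ℝ} {C : ℝ} {G : Measure ℝ} [IsProbabilityMeasure G]

lemma measurable_integral_snd {h : ℝ → ℝ → ℝ} (hh : Measurable (Function.uncurry h))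
    (hφ : Measurable φ) : Measurable fun t => ∫ y, φ (h t y) ∂G :=
  ((hφ.comp hh).stronglyMeasurable.integral_prod_right' (ν := G)).measurable

lemma measurable_volterra_integrand (hK : VolterraKernel c φ C) {q : ℝ → ℝ} (hq : Measurable q) :
    Measurable (Function.uncurry fun (p : ℝ × ℝ) s => c (p.2 - s) (q (p.1 - s))) := by
  have : Measurable fun a : (ℝ × ℝ) × ℝ => (a.1.2 - a.2, q (a.1.1 - a.2)) := by fun_prop
  exact hK.meas.comp this

lemma measurable_volterra_integral (hK : VolterraKernel c φ C) {q : ℝ → ℝ} (hq : Measurable q) :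
    Measurable fun p : ℝ × ℝ => ∫ s in (0 : ℝ)..p.1, c (p.2 - s) (q (p.1 - s)) :=
  measurable_intervalIntegral_param measurable_fst (measurable_volterra_integrand hK hq)

lemma intervalIntegrable_volterra (hK : VolterraKernel c φ C) {q : ℝ → ℝ} (hq : Measurable q)
    {t B : ℝ} (ht : 0 ≤ t) (hB : ∀ s ∈ Set.Icc 0 t, 0 ≤ q s ∧ q s ≤ B) (x : ℝ) :
    IntervalIntegrable (fun s => c (x - s) (q (t - s))) volume 0 t := by
  have hm : Measurable fun s => c (x - s) (q (t - s)) := by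
    have : Measurable fun s : ℝ => ((t, x), s) := by fun_prop
    exact (measurable_volterra_integrand hK hq).comp this
  refine intervalIntegrable_of_bounded hm ht (B := C * B) fun s hs => ?_
  have := hB (t - s) ⟨by linarith [hs.2], by linarith [hs.1]⟩
  rw [abs_of_nonneg (hK.nonneg _ this.1)]
  exact (hK.le _ this.1).trans (mul_le_mul_of_nonneg_left this.2 hK.pos.le)

/-- Picard iterates. -/
def volterraIter (c : ℝ → ℝ → ℝ) (φ : ℝ → ℝ) (G : Measure ℝ) (J : ℝ → ℝ → ℝ) :
    ℕ → ℝ → ℝ → ℝ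
  | 0 => fun _ _ => 0
  -- Solutions must be nonnegative for every real `t`, while at negative times the forcing and the
  -- interval integral have no sign; the iterates are therefore set to `0` there.
  | n + 1 => fun t x => if 0 ≤ t then J t x + ∫ s in (0 : ℝ)..t,
      c (x - s) (∫ y, φ (volterraIter c φ G J n (t - s) y) ∂G) else 0

variable {J : ℝ → ℝ → ℝ}

lemma integral_phi_nonneg {m : Measure ℝ} (hK : VolterraKernel c φ C) {u : ℝ → ℝ}
    (hu : ∀ y, 0 ≤ u y) : 0 ≤ ∫ y, φ (u y) ∂m :=
  integral_nonneg fun y => hK.nonneg' (hu y)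

lemma integrable_phi (hK : VolterraKernel c φ C) {u : ℝ → ℝ} (hm : Measurable u)
    (hu : ∀ y, 0 ≤ u y) {B : ℝ} (hB : ∀ y, u y ≤ B) : Integrable (fun y => φ (u y)) G :=
  integrable_of_bounded (hK.meas'.comp hm) (B := B) fun y => by
    rw [abs_of_nonneg (hK.nonneg' (hu y))]; exact (hK.le' (hu y)).trans (hB y)

lemma integral_phi_le (hK : VolterraKernel c φ C) {u : ℝ → ℝ} (hm : Measurable u)
    (hu : ∀ y, 0 ≤ u y) {B : ℝ} (hB : ∀ y, u y ≤ B) : ∫ y, φ (u y) ∂G ≤ B := by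
  calc ∫ y, φ (u y) ∂G ≤ ∫ _, B ∂G :=
        integral_mono (integrable_phi hK hm hu hB) (integrable_const _)
          fun y => (hK.le' (hu y)).trans (hB y)
    _ = B := by simp

/-- The function `y(t) = B e^{Ct}` solves `y = B + C ∫_0^t y`, so the Picard map preserves the bound
by it. The bound is uniform in the number of iterations, which is what the passage to the limit
needs. -/
lemma volterraIter_spec (hK : VolterraKernel c φ C) (hJ : IsForcing J) (n : ℕ) :
    Measurable (Function.uncurry (volterraIter c φ G J n)) ∧
    (∀ t x, 0 ≤ volterraIter c φ G J n t x) ∧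
    (∀ T B : ℝ, (∀ t ∈ Set.Icc 0 T, ∀ x, J t x ≤ B) → ∀ t ≤ T, ∀ x,
      volterraIter c φ G J n t x ≤ max B 0 * Real.exp (C * t)) := by
  induction n with
  | zero => exact ⟨measurable_const, fun _ _ => le_rfl, fun T B _ t _ x => by
      have : 0 ≤ max B 0 := le_max_right _ _
      simp only [volterraIter]; positivity⟩
  | succ n ih =>
    obtain ⟨ihm, ih0, ihB⟩ := ih
    have hq : Measurable fun t => ∫ y, φ (volterraIter c φ G J n t y) ∂G :=
      measurable_integral_snd ihm hK.meas'
    refine ⟨?_, ?_, ?_⟩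
    · refine Measurable.ite (measurableSet_le measurable_const measurable_fst) ?_ measurable_const
      exact hJ.measurable.add (measurable_volterra_integral hK hq)
    · intro t x
      simp only [volterraIter]
      split_ifs with ht
      · refine add_nonneg (hJ.nonneg t ht x) (intervalIntegral.integral_nonneg ht fun s _ => ?_)
        exact hK.nonneg _ (integral_phi_nonneg hK (ih0 _))
      · exact le_rfl
    · intro T B hB t htT x
      have hB0 : 0 ≤ max B 0 := le_max_right _ _
      simp only [volterraIter]
      split_ifs with ht
      swap
      · positivity
      have hq0 : ∀ s, 0 ≤ ∫ y, φ (volterraIter c φ G J n s y) ∂G :=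
        fun s => integral_phi_nonneg hK (ih0 _)
      have hqB : ∀ s ≤ T, ∫ y, φ (volterraIter c φ G J n s y) ∂G ≤ max B 0 * Real.exp (C * s) :=
        fun s hs => integral_phi_le hK (ihm.comp measurable_prodMk_left) (ih0 s)
          fun y => ihB T B hB s hs y
      have h1 : ∫ s in (0 : ℝ)..t, c (x - s) (∫ y, φ (volterraIter c φ G J n (t - s) y) ∂G) ≤
          ∫ s in (0 : ℝ)..t, C * (max B 0 * Real.exp (C * (t - s))) := by
        refine intervalIntegral.integral_mono_on ht
          (intervalIntegrable_volterra hK hq ht (B := max B 0 * Real.exp (C * T)) ?_ x)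
          (Continuous.intervalIntegrable (by fun_prop) _ _) ?_
        · intro s hs
          refine ⟨hq0 s, (hqB s (hs.2.trans htT)).trans ?_⟩
          have := hK.pos
          gcongr
          exact hs.2.trans htT
        · intro s hs
          exact (hK.le _ (hq0 _)).trans
            (mul_le_mul_of_nonneg_left (hqB _ (by linarith [hs.1])) hK.pos.le)
      have h2 : ∫ s in (0 : ℝ)..t, C * (max B 0 * Real.exp (C * (t - s))) =
          max B 0 * Real.exp (C * t) - max B 0 := by
        have hd : ∀ r ∈ Set.uIcc 0 t, HasDerivAt (fun r => -(max B 0 * Real.exp (C * (t - r))))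
            (C * (max B 0 * Real.exp (C * (t - r)))) r := by
          intro r _
          have h := ((((hasDerivAt_id r).const_sub t).const_mul C).exp.const_mul (max B 0)).neg
          refine h.congr_deriv ?_
          rw [id]; ring
        rw [intervalIntegral.integral_eq_sub_of_hasDerivAt hd
          (Continuous.intervalIntegrable (by fun_prop) _ _)]
        simp; ring
      have := hB t ⟨ht, htT⟩ x
      have := le_max_left B 0
      linarith

/-- The iteration starts from `0`, below its first iterate, and the Picard map is order preserving
because `c` and `φ` are nondecreasing on the nonnegative half-line. -/
lemma volterraIter_mono (hK : VolterraKernel c φ C) (hJ : IsForcing J) (n : ℕ) (t x : ℝ) :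
    volterraIter c φ G J n t x ≤ volterraIter c φ G J (n + 1) t x := by
  induction n generalizing t x with
  | zero => exact (volterraIter_spec (G := G) hK hJ 1).2.1 t x
  | succ n ih =>
    rw [volterraIter, volterraIter]
    beta_reduce
    split_ifs with ht
    swap
    · exact le_rfl
    obtain ⟨B, hB⟩ := hJ.locallyBounded t
    have hsp := fun k => volterraIter_spec (G := G) hK hJ k
    have hbd : ∀ k, ∀ s ≤ t, ∀ y, volterraIter c φ G J k s y ≤ max B 0 * Real.exp (C * t) := by
      intro k s hs y
      refine ((hsp k).2.2 t B hB s hs y).trans ?_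
      have := hK.pos
      have : 0 ≤ max B 0 := le_max_right _ _
      gcongr
    have hmx : ∀ k s, Measurable (volterraIter c φ G J k s) :=
      fun k s => (hsp k).1.comp measurable_prodMk_left
    have hint : ∀ k, IntervalIntegrable (fun s =>
        c (x - s) (∫ y, φ (volterraIter c φ G J k (t - s) y) ∂G)) volume 0 t := fun k =>
      intervalIntegrable_volterra hK (measurable_integral_snd (hsp k).1 hK.meas') ht
        (fun s hs => ⟨integral_phi_nonneg hK ((hsp k).2.1 s),
          integral_phi_le hK (hmx k s) ((hsp k).2.1 s) (hbd k s hs.2)⟩) x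
    gcongr
    refine intervalIntegral.integral_mono_on ht (hint n) (hint (n + 1)) fun s hs => ?_
    refine hK.mono _ _ _ (integral_phi_nonneg hK ((hsp n).2.1 _)) ?_
    refine integral_mono
      (integrable_phi hK (hmx n _) ((hsp n).2.1 _) (hbd n _ (by linarith [hs.1])))
      (integrable_phi hK (hmx _ _) ((hsp _).2.1 _) (hbd _ _ (by linarith [hs.1]))) fun y => ?_
    exact hK.mono' _ _ ((hsp n).2.1 _ _) (ih _ _)

/-- The iterates increase and are locally bounded, so they converge pointwise to their supremum. The
Lipschitz bounds on `c` and `φ` and two dominated convergences, in `y` and then in `s`, pass the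
recursion to the limit. -/
theorem exists_isVolterraSolution (hK : VolterraKernel c φ C) (hJ : IsForcing J) :
    ∃ u, IsVolterraSolution c φ G J u := by
  have hsp := fun k => volterraIter_spec (G := G) hK hJ k
  have hmono : ∀ t x, Monotone fun n => volterraIter c φ G J n t x :=
    fun t x => monotone_nat_of_le_succ fun n => volterraIter_mono hK hJ n t x
  have hbd : ∀ T, ∃ B, ∀ k, ∀ t ≤ T, ∀ x, volterraIter c φ G J k t x ≤ B := by
    intro T
    obtain ⟨B, hB⟩ := hJ.locallyBounded T
    refine ⟨max B 0 * Real.exp (C * T), fun k s hs y => ?_⟩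
    refine ((hsp k).2.2 T B hB s hs y).trans ?_
    have := hK.pos
    have : 0 ≤ max B 0 := le_max_right _ _
    gcongr
  set u : ℝ → ℝ → ℝ := fun t x => ⨆ n, volterraIter c φ G J n t x with hu
  have hlim : ∀ t x, Tendsto (fun n => volterraIter c φ G J n t x) atTop (𝓝 (u t x)) := by
    intro t x
    obtain ⟨B, hB⟩ := hbd t
    refine tendsto_atTop_ciSup (hmono t x) ⟨B, ?_⟩
    rintro _ ⟨n, rfl⟩
    exact hB n t le_rfl x
  have hu0 : ∀ t x, 0 ≤ u t x := fun t x => ge_of_tendsto' (hlim t x) fun n => (hsp n).2.1 t x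
  have huB : ∀ T, ∃ B, ∀ t ≤ T, ∀ x, u t x ≤ B := fun T => by
    obtain ⟨B, hB⟩ := hbd T
    exact ⟨B, fun t ht x => le_of_tendsto' (hlim t x) fun n => hB n t ht x⟩
  have hum : Measurable (Function.uncurry u) :=
    measurable_of_tendsto_metrizable (fun n => (hsp n).1)
      (tendsto_pi_nhds.2 fun p => hlim p.1 p.2)
  refine ⟨u, hum, hu0, fun T => ?_, ?_⟩
  · obtain ⟨B, hB⟩ := huB T
    exact ⟨B, fun t ht => hB t ht.2⟩
  intro t ht x
  obtain ⟨B, hB⟩ := hbd t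
  have hmx : ∀ k s, Measurable (volterraIter c φ G J k s) :=
    fun k s => (hsp k).1.comp measurable_prodMk_left
  have hq : ∀ s ≤ t, Tendsto (fun n => ∫ y, φ (volterraIter c φ G J n s y) ∂G) atTop
      (𝓝 (∫ y, φ (u s y) ∂G)) := by
    intro s hs
    refine tendsto_integral_of_dominated_convergence (fun _ => B)
      (fun n => (hK.meas'.comp (hmx n s)).aestronglyMeasurable) (integrable_const _)
      (fun n => ae_of_all _ fun y => ?_) (ae_of_all _ fun y => ?_)
    · rw [Real.norm_of_nonneg (hK.nonneg' ((hsp n).2.1 s y))]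
      exact (hK.le' ((hsp n).2.1 s y)).trans (hB n s hs y)
    · rw [tendsto_iff_dist_tendsto_zero]
      refine squeeze_zero (fun _ => dist_nonneg) (fun n => ?_)
        (tendsto_iff_dist_tendsto_zero.1 (hlim s y))
      exact hK.abs_sub_le' ((hsp n).2.1 s y) (hu0 s y)
  have hqle : ∀ n, ∀ s ≤ t, ∫ y, φ (volterraIter c φ G J n s y) ∂G ≤ B := fun n s hs =>
    integral_phi_le hK (hmx n s) ((hsp n).2.1 s) (hB n s hs)
  have hmain : Tendsto (fun n => volterraIter c φ G J (n + 1) t x) atTop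
      (𝓝 (J t x + ∫ s in (0 : ℝ)..t, c (x - s) (∫ y, φ (u (t - s) y) ∂G))) := by
    simp only [volterraIter, if_pos ht]
    refine tendsto_const_nhds.add ?_
    refine intervalIntegral.tendsto_integral_filter_of_dominated_convergence (fun _ => C * B)
      (Eventually.of_forall fun n => ?_) (Eventually.of_forall fun n => ae_of_all _ fun s hs => ?_)
      intervalIntegrable_const (ae_of_all _ fun s hs => ?_)
    · have : Measurable fun s : ℝ => ((t, x), s) := by fun_prop
      exact ((measurable_volterra_integrand hK
        (measurable_integral_snd (hsp n).1 hK.meas')).comp this).aestronglyMeasurable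
    · rw [Set.uIoc_of_le ht] at hs
      have h0 := integral_phi_nonneg (m := G) hK ((hsp n).2.1 (t - s))
      rw [Real.norm_of_nonneg (hK.nonneg _ h0)]
      exact (hK.le _ h0).trans (mul_le_mul_of_nonneg_left (hqle n _ (by linarith [hs.1])) hK.pos.le)
    · rw [Set.uIoc_of_le ht] at hs
      have hs' : t - s ≤ t := by linarith [hs.1]
      rw [tendsto_iff_dist_tendsto_zero]
      refine squeeze_zero (fun _ => dist_nonneg) (fun n => ?_)
        ((tendsto_iff_dist_tendsto_zero.1 (hq _ hs')).const_mul C |>.trans (by simp))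
      exact hK.abs_sub_le _ (integral_phi_nonneg hK ((hsp n).2.1 _))
        (integral_phi_nonneg hK (hu0 _))
  exact tendsto_nhds_unique ((tendsto_add_atTop_iff_nat 1).2 (hlim t x)) hmain

end Existence

section Stability

variable {c : ℝ → ℝ → ℝ} {φ : ℝ → ℝ} {C : ℝ} {G : Measure ℝ} [IsProbabilityMeasure G]

/-- Stability of the Volterra equation with respect to the forcing term. -/
theorem volterra_stability (hK : VolterraKernel c φ C) (T : ℝ) :
    ∃ K : ℝ, 0 ≤ K ∧ ∀ J J' u u' : ℝ → ℝ → ℝ, IsForcing J → IsForcing J' →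
      IsVolterraSolution c φ G J u → IsVolterraSolution c φ G J' u' →
      ∀ t ∈ Set.Icc 0 T, ∀ x, |(u t x - J t x) - (u' t x - J' t x)| ≤
        K * ∫ s in (0 : ℝ)..T, ∫ y, |J s y - J' s y| ∂G := by
  refine ⟨C * (2 * Real.exp (2 * C * T)), by have := hK.pos; positivity, ?_⟩
  intro J J' u u' hJ hJ' hu hu' t₀ ht₀ x₀
  have hT : 0 ≤ T := ht₀.1.trans ht₀.2
  obtain ⟨B, hB⟩ := hu.locallyBounded T
  obtain ⟨B', hB'⟩ := hu'.locallyBounded T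
  obtain ⟨A, hA⟩ := hJ.locallyBounded T
  obtain ⟨A', hA'⟩ := hJ'.locallyBounded T
  set δ : ℝ → ℝ := fun s => ∫ y, |u s y - u' s y| ∂G with hδ
  set j : ℝ → ℝ := fun s => ∫ y, |J s y - J' s y| ∂G with hj
  have hδm : Measurable δ := measurable_integral_snd (φ := fun z => |z|)
    (h := fun s y => u s y - u' s y) (hu.measurable.sub hu'.measurable) measurable_norm
  have hjm : Measurable j := measurable_integral_snd (φ := fun z => |z|)
    (h := fun s y => J s y - J' s y) (hJ.measurable.sub hJ'.measurable) measurable_norm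
  have hux : ∀ s, Measurable (u s) := fun s => hu.measurable.comp measurable_prodMk_left
  have hux' : ∀ s, Measurable (u' s) := fun s => hu'.measurable.comp measurable_prodMk_left
  have hJx : ∀ s, Measurable (J s) := fun s => hJ.measurable.comp measurable_prodMk_left
  have hJx' : ∀ s, Measurable (J' s) := fun s => hJ'.measurable.comp measurable_prodMk_left
  have hdiff : ∀ s ∈ Set.Icc 0 T, ∀ y, |u s y - u' s y| ≤ B + B' := fun s hs y => by
    rw [abs_le]; constructor <;> linarith [hu.nonneg s y, hu'.nonneg s y, hB s hs y, hB' s hs y]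
  have hdiffJ : ∀ s ∈ Set.Icc 0 T, ∀ y, |J s y - J' s y| ≤ A + A' := fun s hs y => by
    rw [abs_le]
    constructor <;> linarith [hJ.nonneg s hs.1 y, hJ'.nonneg s hs.1 y, hA s hs y, hA' s hs y]
  have hδint : ∀ s ∈ Set.Icc 0 T, Integrable (fun y => |u s y - u' s y|) G := fun s hs =>
    integrable_of_bounded ((hux s).sub (hux' s)).abs (B := B + B')
      fun y => by rw [abs_abs]; exact hdiff s hs y
  have hjint : ∀ s ∈ Set.Icc 0 T, Integrable (fun y => |J s y - J' s y|) G := fun s hs =>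
    integrable_of_bounded ((hJx s).sub (hJx' s)).abs (B := A + A')
      fun y => by rw [abs_abs]; exact hdiffJ s hs y
  have hδ0 : ∀ s, 0 ≤ δ s := fun s => integral_nonneg fun y => abs_nonneg _
  have hj0 : ∀ s, 0 ≤ j s := fun s => integral_nonneg fun y => abs_nonneg _
  have hδB : ∀ s ∈ Set.Icc 0 T, δ s ≤ B + B' := fun s hs =>
    (integral_mono (hδint s hs) (integrable_const _) (hdiff s hs)).trans (by simp)
  have hjB : ∀ s ∈ Set.Icc 0 T, j s ≤ A + A' := fun s hs =>
    (integral_mono (hjint s hs) (integrable_const _) (hdiffJ s hs)).trans (by simp)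
  have hδI : ∀ a ∈ Set.Icc 0 T, IntervalIntegrable δ volume 0 a := fun a ha =>
    intervalIntegrable_of_bounded hδm ha.1 (B := B + B') fun s hs => by
      rw [abs_of_nonneg (hδ0 s)]; exact hδB s ⟨hs.1, hs.2.trans ha.2⟩
  have hjI : ∀ a ∈ Set.Icc 0 T, IntervalIntegrable j volume 0 a := fun a ha =>
    intervalIntegrable_of_bounded hjm ha.1 (B := A + A') fun s hs => by
      rw [abs_of_nonneg (hj0 s)]; exact hjB s ⟨hs.1, hs.2.trans ha.2⟩
  -- After subtraction of the forcing only the integral terms remain; they depend on the solutions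
  -- through their `G`-averages alone, so the estimate is uniform in `x`.
  have key : ∀ t ∈ Set.Icc 0 T, ∀ x, |(u t x - J t x) - (u' t x - J' t x)| ≤
      C * ∫ s in (0 : ℝ)..t, δ s := by
    intro t ht x
    have hsub : ∀ s ∈ Set.Icc 0 t, s ∈ Set.Icc 0 T := fun s hs => ⟨hs.1, hs.2.trans ht.2⟩
    have i1 := intervalIntegrable_volterra hK
        (measurable_integral_snd (G := G) hu.measurable hK.meas') ht.1
        (B := B) (fun s hs => ⟨integral_phi_nonneg hK (hu.nonneg s),
          integral_phi_le hK (hux s) (hu.nonneg s) (hB s (hsub s hs))⟩) x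
    have i2 := intervalIntegrable_volterra hK
        (measurable_integral_snd (G := G) hu'.measurable hK.meas') ht.1
        (B := B') (fun s hs => ⟨integral_phi_nonneg hK (hu'.nonneg s),
          integral_phi_le hK (hux' s) (hu'.nonneg s) (hB' s (hsub s hs))⟩) x
    rw [hu.eqn t ht.1 x, hu'.eqn t ht.1 x, add_sub_cancel_left, add_sub_cancel_left,
      ← intervalIntegral.integral_sub i1 i2]
    have hrefl : ∫ s in (0 : ℝ)..t, δ s = ∫ s in (0 : ℝ)..t, δ (t - s) := by
      rw [intervalIntegral.integral_comp_sub_left]; simp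
    rw [hrefl, ← intervalIntegral.integral_const_mul]
    have hδr : IntervalIntegrable (fun s => C * δ (t - s)) volume 0 t := by
      refine intervalIntegrable_of_bounded (by fun_prop) ht.1 (B := C * (B + B')) fun s hs => ?_
      rw [abs_of_nonneg (mul_nonneg hK.pos.le (hδ0 _))]
      exact mul_le_mul_of_nonneg_left
        (hδB _ ⟨by linarith [hs.2], by linarith [hs.1, ht.2]⟩) hK.pos.le
    rw [← Real.norm_eq_abs]
    refine (intervalIntegral.norm_integral_le_integral_norm ht.1).trans ?_
    refine intervalIntegral.integral_mono_on ht.1 (i1.sub i2).norm hδr fun s hs => ?_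
    have hs' : t - s ∈ Set.Icc 0 T := ⟨by linarith [hs.2], by linarith [hs.1, ht.2]⟩
    refine (hK.abs_sub_le _ (integral_phi_nonneg hK (hu.nonneg _))
      (integral_phi_nonneg hK (hu'.nonneg _))).trans ?_
    refine mul_le_mul_of_nonneg_left ?_ hK.pos.le
    have e1 := integrable_phi (G := G) hK (hux (t - s)) (hu.nonneg _) (hB _ hs')
    have e2 := integrable_phi (G := G) hK (hux' (t - s)) (hu'.nonneg _) (hB' _ hs')
    rw [← integral_sub e1 e2]
    refine (abs_integral_le_integral_abs).trans ?_
    exact integral_mono (e1.sub e2).abs (hδint _ hs')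
      fun y => hK.abs_sub_le' (hu.nonneg _ _) (hu'.nonneg _ _)
  have hδle : ∀ t ∈ Set.Icc 0 T, δ t ≤ j t + C * ∫ s in (0 : ℝ)..t, δ s := by
    intro t ht
    calc δ t ≤ ∫ y, (|J t y - J' t y| + C * ∫ s in (0 : ℝ)..t, δ s) ∂G := by
          refine integral_mono (hδint t ht) ((hjint t ht).add (integrable_const _)) fun y => ?_
          have h1 := key t ht y
          have h2 : u t y - u' t y =
            (J t y - J' t y) + ((u t y - J t y) - (u' t y - J' t y)) := by ring
          have h3 := abs_add_le (J t y - J' t y) ((u t y - J t y) - (u' t y - J' t y))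
          rw [← h2] at h3
          linarith
      _ = j t + C * ∫ s in (0 : ℝ)..t, δ s := by
          rw [integral_add (hjint t ht) (integrable_const _)]; simp [hj]
  -- Grönwall is applied to the primitive of `δ` and not to `δ` itself. This leaves only the `L¹`
  -- distance of the forcings in the bound, the sole distance that tends to zero for Riemann sums.
  set I : ℝ → ℝ := fun t => ∫ s in (0 : ℝ)..t, δ s with hI
  have hIm : Measurable I := measurable_intervalIntegral_param (β := ℝ) (h := fun _ s => δ s)
    measurable_id (hδm.comp measurable_snd)
  have hI0 : ∀ t ∈ Set.Icc 0 T, 0 ≤ I t := fun t ht =>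
    intervalIntegral.integral_nonneg ht.1 fun s _ => hδ0 s
  have hImono : ∀ t ∈ Set.Icc 0 T, I t ≤ I T := fun t ht =>
    intervalIntegral.integral_mono_interval le_rfl ht.1 ht.2 (ae_of_all _ fun s => hδ0 s)
      (hδI T ⟨hT, le_rfl⟩)
  have hIabs : ∀ t ∈ Set.Icc 0 T, |I t| ≤ I T := fun t ht => by
    rw [abs_of_nonneg (hI0 t ht)]; exact hImono t ht
  have hIle : ∀ t ∈ Set.Icc 0 T, I t ≤ (∫ s in (0 : ℝ)..T, j s) + C * ∫ s in (0 : ℝ)..t, I s := by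
    intro t ht
    have hII : IntervalIntegrable I volume 0 t :=
      intervalIntegrable_of_bounded hIm ht.1 (B := I T) fun s hs => hIabs s ⟨hs.1, hs.2.trans ht.2⟩
    calc I t ≤ ∫ s in (0 : ℝ)..t, (j s + C * I s) :=
          intervalIntegral.integral_mono_on ht.1 (hδI t ht) ((hjI t ht).add (hII.const_mul C))
            fun s hs => hδle s ⟨hs.1, hs.2.trans ht.2⟩
      _ = (∫ s in (0 : ℝ)..t, j s) + C * ∫ s in (0 : ℝ)..t, I s := by
          rw [intervalIntegral.integral_add (hjI t ht) (hII.const_mul C),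
            intervalIntegral.integral_const_mul]
      _ ≤ _ := by
          gcongr
          exact intervalIntegral.integral_mono_interval le_rfl ht.1 ht.2
            (ae_of_all _ fun s => hj0 s) (hjI T ⟨hT, le_rfl⟩)
  have hfin := gronwall_integral hK.pos hIm hIabs hIle ht₀
  have hjT : 0 ≤ ∫ s in (0 : ℝ)..T, j s := intervalIntegral.integral_nonneg hT fun s _ => hj0 s
  rw [max_eq_left hjT] at hfin
  refine (key t₀ ht₀ x₀).trans ?_
  have hC := hK.pos
  calc C * I t₀ ≤ C * (2 * (∫ s in (0 : ℝ)..T, j s) * Real.exp (2 * C * t₀)) := by gcongr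
    _ ≤ C * (2 * (∫ s in (0 : ℝ)..T, j s) * Real.exp (2 * C * T)) := by
        gcongr
        exact ht₀.2
    _ = _ := by ring

end Stability

/-! ### Second order expansion of the generating function and the birth kernels -/

/-- The polynomials `k_i` with `i y - 1 + (1 - y) ^ i = y ^ 2 k_i(y)`. -/
def remPoly : ℕ → ℝ → ℝ
  | 0 => fun _ => 0
  | i + 1 => fun y => (1 - y) * remPoly i y + i

lemma remPoly_spec (i : ℕ) (y : ℝ) : (i : ℝ) * y - 1 + (1 - y) ^ i = y ^ 2 * remPoly i y := by
  induction i with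
  | zero => simp [remPoly]
  | succ i ih =>
    simp only [remPoly]
    rw [mul_add, mul_left_comm, ← ih]
    push_cast; ring

lemma remPoly_nonneg (i : ℕ) {y : ℝ} (hy : y ≤ 1) : 0 ≤ remPoly i y := by
  induction i with
  | zero => simp [remPoly]
  | succ i ih =>
    simp only [remPoly]
    have : 0 ≤ 1 - y := by linarith
    positivity

/-- Since `1 - y ≤ 1`, the recursion adds at most `i` at step `i`, and `0 + 1 + ⋯ + (i - 1) = i(i -
1)/2`, which is also the value at `y = 0`. -/
lemma remPoly_le (i : ℕ) {y : ℝ} (hy0 : 0 ≤ y) (hy : y ≤ 1) :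
    remPoly i y ≤ (i : ℝ) * (i - 1) / 2 := by
  induction i with
  | zero => simp [remPoly]
  | succ i ih =>
    simp only [remPoly]
    have := remPoly_nonneg i hy
    push_cast
    nlinarith

lemma remPoly_zero (i : ℕ) : remPoly i 0 = (i : ℝ) * (i - 1) / 2 := by
  induction i with
  | zero => simp [remPoly]
  | succ i ih => simp only [remPoly, ih]; push_cast; ring

lemma continuous_remPoly (i : ℕ) : Continuous (remPoly i) := by
  induction i with
  | zero => exact continuous_const
  | succ i ih => unfold remPoly; fun_prop

/-- The second order remainder of the generating function at `1`. -/
def genRem (p : ℕ → ℝ → ℝ) (x y : ℝ) : ℝ := ∑' i : ℕ, p i x * remPoly i y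

lemma MemC1Pos.measurable {h : ℝ → ℝ} (hh : MemC1Pos h) : Measurable h := by
  classical
  have : h = (Set.Ioi 0).piecewise h (fun _ => 0) := by
    ext x
    by_cases hx : 0 < x
    · rw [Set.piecewise_eq_of_mem _ _ _ (Set.mem_Ioi.2 hx)]
    · rw [Set.piecewise_eq_of_notMem _ _ _ (by simpa using hx),
        hh.zero_of_nonpos x (not_lt.1 hx)]
  rw [this]
  exact ContinuousOn.measurable_piecewise hh.contDiffOn.continuousOn continuousOn_const
    measurableSet_Ioi

section Gen

variable {α : ℝ → ℝ} {p : ℕ → ℝ → ℝ} {G : Measure ℝ}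

lemma IsBranchingMechanism.prob_nonneg (h : IsBranchingMechanism α p G) (i : ℕ) (x : ℝ) :
    0 ≤ p i x := (h.offspring i).nonneg x

lemma IsBranchingMechanism.prob_zero (h : IsBranchingMechanism α p G) (i : ℕ) {x : ℝ}
    (hx : x ≤ 0) : p i x = 0 := (h.offspring i).zero_of_nonpos x hx

lemma IsBranchingMechanism.summable (h : IsBranchingMechanism α p G) (x : ℝ) :
    Summable fun i => p i x := by
  rcases le_or_gt x 0 with hx | hx
  · simp [h.prob_zero _ hx]
  · exact (h.offspring_sum x hx).summable

lemma IsBranchingMechanism.summable₁ (h : IsBranchingMechanism α p G) (x : ℝ) :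
    Summable fun i : ℕ => (i : ℝ) * p i x := by
  rcases le_or_gt x 0 with hx | hx
  · simp [h.prob_zero _ hx]
  · obtain ⟨C, hC⟩ := h.mean_bounded
    exact (hC x hx).1

lemma IsBranchingMechanism.summable₂ (h : IsBranchingMechanism α p G)
    (h2 : SecondMomentBounded p) (x : ℝ) :
    Summable fun i : ℕ => (i : ℝ) * ((i : ℝ) - 1) * p i x := by
  rcases le_or_gt x 0 with hx | hx
  · simp [h.prob_zero _ hx]
  · obtain ⟨C, hC⟩ := h2
    exact (hC x hx).1

lemma natCast_mul_sub_one_nonneg (i : ℕ) : 0 ≤ (i : ℝ) * ((i : ℝ) - 1) := by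
  rcases Nat.eq_zero_or_pos i with rfl | hi
  · simp
  · have : (1 : ℝ) ≤ i := by exact_mod_cast hi
    exact mul_nonneg (by linarith) (by linarith)

lemma IsBranchingMechanism.gen₁_nonneg (h : IsBranchingMechanism α p G) (x : ℝ) :
    0 ≤ gen₁ p x := tsum_nonneg fun i => mul_nonneg (Nat.cast_nonneg i) (h.prob_nonneg i x)

lemma IsBranchingMechanism.gen₂_nonneg (h : IsBranchingMechanism α p G) (x : ℝ) :
    0 ≤ gen₂ p x :=
  tsum_nonneg fun i => mul_nonneg (natCast_mul_sub_one_nonneg i) (h.prob_nonneg i x)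

lemma IsBranchingMechanism.measurable_prob (h : IsBranchingMechanism α p G) (i : ℕ) :
    Measurable (p i) := (h.offspring i).measurable

lemma IsBranchingMechanism.measurable_gen₁ (h : IsBranchingMechanism α p G) :
    Measurable (gen₁ p) := by
  refine measurable_of_tendsto_metrizable (f := fun n x => ∑ i ∈ Finset.range n, (i : ℝ) * p i x)
    (fun n => Finset.measurable_sum _ fun i _ => (h.measurable_prob i).const_mul _)
    (tendsto_pi_nhds.2 fun x => (h.summable₁ x).hasSum.tendsto_sum_nat)

lemma IsBranchingMechanism.measurable_gen₂ (h : IsBranchingMechanism α p G)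
    (h2 : SecondMomentBounded p) : Measurable (gen₂ p) := by
  refine measurable_of_tendsto_metrizable
    (f := fun n x => ∑ i ∈ Finset.range n, (i : ℝ) * ((i : ℝ) - 1) * p i x)
    (fun n => Finset.measurable_sum _ fun i _ => (h.measurable_prob i).const_mul _)
    (tendsto_pi_nhds.2 fun x => (h.summable₂ h2 x).hasSum.tendsto_sum_nat)

lemma IsBranchingMechanism.summable_pow (h : IsBranchingMechanism α p G) (x : ℝ) {z : ℝ}
    (hz0 : 0 ≤ z) (hz : z ≤ 1) : Summable fun i => p i x * z ^ i :=
  Summable.of_nonneg_of_le (fun i => mul_nonneg (h.prob_nonneg i x) (pow_nonneg hz0 i))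
    (fun i => mul_le_of_le_one_right (h.prob_nonneg i x) (pow_le_one₀ hz0 hz)) (h.summable x)

lemma IsBranchingMechanism.gen_mono (h : IsBranchingMechanism α p G) (x : ℝ) {z z' : ℝ}
    (hz : 0 ≤ z) (hzz : z ≤ z') (hz' : z' ≤ 1) : gen p x z ≤ gen p x z' :=
  (h.summable_pow x hz (hzz.trans hz')).tsum_le_tsum
    (fun i => mul_le_mul_of_nonneg_left (pow_le_pow_left₀ hz hzz i) (h.prob_nonneg i x))
    (h.summable_pow x (hz.trans hzz) hz')

lemma pow_sub_pow_le_mul (i : ℕ) {z z' : ℝ} (hz : 0 ≤ z) (hzz : z ≤ z') (hz' : z' ≤ 1) :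
    z' ^ i - z ^ i ≤ i * (z' - z) := by
  induction i with
  | zero => simp
  | succ i ih =>
    have h1 : z ^ i ≤ 1 := pow_le_one₀ hz (hzz.trans hz')
    have h0 : 0 ≤ z' ^ i - z ^ i := sub_nonneg.2 (pow_le_pow_left₀ hz hzz i)
    have e : z' ^ (i + 1) - z ^ (i + 1) = z' * (z' ^ i - z ^ i) + z ^ i * (z' - z) := by ring
    rw [e]; push_cast
    have := mul_le_of_le_one_left h0 hz'
    have := mul_le_of_le_one_left (sub_nonneg.2 hzz) h1
    linarith

lemma IsBranchingMechanism.gen_lip (h : IsBranchingMechanism α p G) (x : ℝ) {z z' : ℝ}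
    (hz : 0 ≤ z) (hzz : z ≤ z') (hz' : z' ≤ 1) :
    gen p x z' - gen p x z ≤ gen₁ p x * (z' - z) := by
  have s1 := h.summable_pow x hz (hzz.trans hz')
  have s2 := h.summable_pow x (hz.trans hzz) hz'
  rw [gen, gen, gen₁, ← s2.tsum_sub s1, ← tsum_mul_right]
  refine (s2.sub s1).tsum_le_tsum (fun i => ?_) ((h.summable₁ x).mul_right _)
  rw [← mul_sub]
  have := mul_le_mul_of_nonneg_left (pow_sub_pow_le_mul i hz hzz hz') (h.prob_nonneg i x)
  linarith

lemma IsBranchingMechanism.gen_one (h : IsBranchingMechanism α p G) {x : ℝ} (hx : 0 < x) :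
    gen p x 1 = 1 := by
  simp only [gen, one_pow, mul_one]
  exact (h.offspring_sum x hx).tsum_eq

lemma IsBranchingMechanism.summable_rem (h : IsBranchingMechanism α p G)
    (h2 : SecondMomentBounded p) (x : ℝ) {y : ℝ} (hy0 : 0 ≤ y) (hy : y ≤ 1) :
    Summable fun i => p i x * remPoly i y := by
  refine Summable.of_nonneg_of_le
    (fun i => mul_nonneg (h.prob_nonneg i x) (remPoly_nonneg i hy)) (fun i => ?_)
    ((h.summable₂ h2 x).div_const 2)
  have := mul_le_mul_of_nonneg_left (remPoly_le i hy0 hy) (h.prob_nonneg i x)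
  linarith

lemma IsBranchingMechanism.genRem_nonneg (h : IsBranchingMechanism α p G) (x : ℝ) {y : ℝ}
    (hy : y ≤ 1) : 0 ≤ genRem p x y :=
  tsum_nonneg fun i => mul_nonneg (h.prob_nonneg i x) (remPoly_nonneg i hy)

lemma IsBranchingMechanism.genRem_le (h : IsBranchingMechanism α p G)
    (h2 : SecondMomentBounded p) (x : ℝ) {y : ℝ} (hy0 : 0 ≤ y) (hy : y ≤ 1) :
    genRem p x y ≤ gen₂ p x / 2 := by
  rw [genRem, gen₂, ← tsum_div_const]
  refine (h.summable_rem h2 x hy0 hy).tsum_le_tsum (fun i => ?_) ((h.summable₂ h2 x).div_const 2)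
  have := mul_le_mul_of_nonneg_left (remPoly_le i hy0 hy) (h.prob_nonneg i x)
  linarith

/-- Dominated convergence for series: the terms are continuous in `y` and dominated by `p_i(x) i(i -
1)/2`, summable by the second moment condition. -/
lemma IsBranchingMechanism.genRem_tendsto (h : IsBranchingMechanism α p G)
    (h2 : SecondMomentBounded p) (x : ℝ) {β : Type*} {l : Filter β} {y : β → ℝ}
    (hy0 : ∀ᶠ b in l, 0 ≤ y b) (hy : Tendsto y l (𝓝 0)) :
    Tendsto (fun b => genRem p x (y b)) l (𝓝 (gen₂ p x / 2)) := by
  have e : gen₂ p x / 2 = ∑' i, p i x * remPoly i 0 := by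
    rw [gen₂, ← tsum_div_const]
    refine tsum_congr fun i => ?_
    rw [remPoly_zero]; ring
  rw [e]
  refine tendsto_tsum_of_dominated_convergence ((h.summable₂ h2 x).div_const 2) (fun i => ?_) ?_
  · exact ((continuous_remPoly i).tendsto 0 |>.comp hy).const_mul _
  · filter_upwards [hy0, hy.eventually (ge_mem_nhds (show (0 : ℝ) < 1 by norm_num))] with b hb hb1 i
    rw [Real.norm_of_nonneg (mul_nonneg (h.prob_nonneg i x) (remPoly_nonneg i hb1))]
    have := mul_le_mul_of_nonneg_left (remPoly_le i hb hb1) (h.prob_nonneg i x)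
    linarith

/-- The factor `α x` is kept so that the identity also holds for `x ≤ 0`, where the offspring
weights vanish and do not sum to one. -/
lemma IsBranchingMechanism.gen_expand (h : IsBranchingMechanism α p G)
    (h2 : SecondMomentBounded p) (x : ℝ) {y : ℝ} (hy0 : 0 ≤ y) (hy : y ≤ 1) :
    α x * (1 - gen p x (1 - y)) = α x * gen₁ p x * y - α x * genRem p x y * y ^ 2 := by
  rcases le_or_gt x 0 with hx | hx
  · simp [h.rate.zero_of_nonpos x hx]
  have s0 := (h.offspring_sum x hx)
  have s1 := (h.summable₁ x).hasSum.mul_right y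
  have s2 := (h.summable_pow x (z := 1 - y) (by linarith) (by linarith)).hasSum
  have s3 := (h.summable_rem h2 x hy0 hy).hasSum.mul_right (y ^ 2)
  have e : (fun i : ℕ => p i x * remPoly i y * y ^ 2) =
      fun i : ℕ => (i : ℝ) * p i x * y - p i x + p i x * (1 - y) ^ i := by
    ext i
    have := remPoly_spec i y
    linear_combination - p i x * this
  rw [e] at s3
  have := ((s1.sub s0).add s2).unique s3
  change gen₁ p x * y - 1 + gen p x (1 - y) = genRem p x y * y ^ 2 at this
  linear_combination α x * (-this)

/-- The nonlinearity `c(y, q) = α(y) (1 - g(y, 1 - q))`, with `q` clamped to `[0, 1]`. -/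
def birth (α : ℝ → ℝ) (p : ℕ → ℝ → ℝ) (y q : ℝ) : ℝ :=
  α y * (1 - gen p y (1 - max 0 (min q 1)))

/-- The linearization of `birth` at `q = 0`. -/
def meanBirth (α : ℝ → ℝ) (p : ℕ → ℝ → ℝ) (y q : ℝ) : ℝ := α y * gen₁ p y * q

/-- `u ↦ 1 - e^{-u}`. -/
def oneSubExp (u : ℝ) : ℝ := 1 - Real.exp (-u)

lemma IsBranchingMechanism.exists_bound (h : IsBranchingMechanism α p G) :
    ∃ C : ℝ, 0 < C ∧ ∀ x, α x * gen₁ p x ≤ C := by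
  obtain ⟨A, hA⟩ := h.rate.bounded
  obtain ⟨B, hB⟩ := h.mean_bounded
  refine ⟨max 0 A * max 0 B + 1, by positivity, fun x => ?_⟩
  rcases le_or_gt x 0 with hx | hx
  · rw [h.rate.zero_of_nonpos x hx, zero_mul]; positivity
  · have : α x * gen₁ p x ≤ max 0 A * max 0 B :=
      mul_le_mul ((hA x hx).trans (le_max_right _ _)) ((hB x hx).2.trans (le_max_right _ _))
        (h.gen₁_nonneg x) (le_max_left _ _)
    linarith

lemma IsBranchingMechanism.exists_bound₂ (h : IsBranchingMechanism α p G)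
    (h2 : SecondMomentBounded p) : ∃ C : ℝ, 0 < C ∧ ∀ x, α x * gen₂ p x ≤ C := by
  obtain ⟨A, hA⟩ := h.rate.bounded
  obtain ⟨B, hB⟩ := h2
  refine ⟨max 0 A * max 0 B + 1, by positivity, fun x => ?_⟩
  rcases le_or_gt x 0 with hx | hx
  · rw [h.rate.zero_of_nonpos x hx, zero_mul]; positivity
  · have : α x * gen₂ p x ≤ max 0 A * max 0 B :=
      mul_le_mul ((hA x hx).trans (le_max_right _ _)) ((hB x hx).2.trans (le_max_right _ _))
        (h.gen₂_nonneg x) (le_max_left _ _)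
    linarith

lemma oneSubExp_nonneg {u : ℝ} (hu : 0 ≤ u) : 0 ≤ oneSubExp u := by
  rw [oneSubExp, sub_nonneg, Real.exp_le_one_iff]; linarith

lemma oneSubExp_le (u : ℝ) : oneSubExp u ≤ u := by
  have := Real.add_one_le_exp (-u); rw [oneSubExp]; linarith

lemma oneSubExp_le_one (u : ℝ) : oneSubExp u ≤ 1 := by
  have := Real.exp_pos (-u); rw [oneSubExp]; linarith

lemma measurable_oneSubExp : Measurable oneSubExp := by unfold oneSubExp; fun_prop

lemma oneSubExp_mono {u u' : ℝ} (h : u ≤ u') : oneSubExp u ≤ oneSubExp u' := by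
  unfold oneSubExp; gcongr

lemma oneSubExp_sub_le {u u' : ℝ} (hu : 0 ≤ u) (h : u ≤ u') :
    oneSubExp u' - oneSubExp u ≤ u' - u := by
  have h1 := oneSubExp_le (u' - u)
  have h2 := oneSubExp_nonneg (sub_nonneg.2 h)
  have h3 : Real.exp (-u) ≤ 1 := by rw [Real.exp_le_one_iff]; linarith
  have e : oneSubExp u' - oneSubExp u = Real.exp (-u) * oneSubExp (u' - u) := by
    unfold oneSubExp
    rw [mul_sub, ← Real.exp_add]; ring_nf
  rw [e]
  exact (mul_le_of_le_one_left h2 h3).trans h1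

lemma IsBranchingMechanism.measurable_birth (h : IsBranchingMechanism α p G) :
    Measurable (Function.uncurry (birth α p)) := by
  have hg : Measurable fun a : ℝ × ℝ => gen p a.1 (1 - max 0 (min a.2 1)) := by
    refine measurable_of_tendsto_metrizable
      (f := fun n a => ∑ i ∈ Finset.range n, p i a.1 * (1 - max 0 (min a.2 1)) ^ i)
      (fun n => Finset.measurable_sum _ fun i _ =>
        ((h.measurable_prob i).comp measurable_fst).mul (by fun_prop))
      (tendsto_pi_nhds.2 fun a => (h.summable_pow a.1 ?_ ?_).hasSum.tendsto_sum_nat)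
    · rw [sub_nonneg]; exact max_le zero_le_one (min_le_right _ _)
    · have := le_max_left 0 (min a.2 1); linarith
  exact (h.rate.measurable.comp measurable_fst).mul (measurable_const.sub hg)

/-- The clamp keeps the argument of `g` in `[0, 1]`, where `g` is nondecreasing with slope at most
`g'(1-)`. It is this clamp that makes the kernel monotone and Lipschitz for all `q ≥ 0`. -/
lemma IsBranchingMechanism.volterraKernel_birth (h : IsBranchingMechanism α p G) {C : ℝ}
    (hC0 : 0 < C) (hC : ∀ x, α x * gen₁ p x ≤ C) :
    VolterraKernel (birth α p) oneSubExp C := by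
  have hcl : ∀ q : ℝ, 0 ≤ 1 - max 0 (min q 1) ∧ 1 - max 0 (min q 1) ≤ 1 := fun q =>
    ⟨by rw [sub_nonneg]; exact max_le zero_le_one (min_le_right _ _),
      by have := le_max_left 0 (min q 1); linarith⟩
  have hm : ∀ q q' : ℝ, q ≤ q' → 1 - max 0 (min q' 1) ≤ 1 - max 0 (min q 1) := fun q q' hq => by
    gcongr
  refine ⟨hC0, h.measurable_birth, fun y => ?_, fun y q q' _ hq => ?_, fun y q q' hq0 hq => ?_,
    measurable_oneSubExp, by simp [oneSubExp], fun u u' _ hu => oneSubExp_mono hu,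
    fun u u' hu0 hu => oneSubExp_sub_le hu0 hu⟩
  · rcases le_or_gt y 0 with hy | hy
    · simp [birth, h.rate.zero_of_nonpos y hy]
    · simp [birth, h.gen_one hy]
  · have := h.gen_mono y (hcl q').1 (hm q q' hq) (hcl q).2
    unfold birth
    exact mul_le_mul_of_nonneg_left (by linarith) (h.rate.nonneg y)
  · have h1 := h.gen_lip y (hcl q').1 (hm q q' hq) (hcl q).2
    have h2 : max 0 (min q' 1) - max 0 (min q 1) ≤ q' - q := by
      rw [max_eq_right (le_min (hq0.trans hq) zero_le_one), max_eq_right (le_min hq0 zero_le_one)]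
      rcases le_total q' 1 with h' | h'
      · rw [min_eq_left h', min_eq_left (hq.trans h')]
      · rw [min_eq_right h']
        rcases le_total q 1 with h'' | h''
        · rw [min_eq_left h'']; linarith
        · rw [min_eq_right h'']; linarith
    have h3 : gen p y (1 - max 0 (min q 1)) - gen p y (1 - max 0 (min q' 1)) ≤
        gen₁ p y * (q' - q) :=
      h1.trans (mul_le_mul_of_nonneg_left (by linarith) (h.gen₁_nonneg y))
    unfold birth
    have h4 := mul_le_mul_of_nonneg_left h3 (h.rate.nonneg y)
    have h5 := mul_le_mul_of_nonneg_right (hC y) (sub_nonneg.2 hq)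
    linarith

lemma IsBranchingMechanism.volterraKernel_meanBirth (h : IsBranchingMechanism α p G) {C : ℝ}
    (hC0 : 0 < C) (hC : ∀ x, α x * gen₁ p x ≤ C) :
    VolterraKernel (meanBirth α p) id C := by
  refine ⟨hC0, ?_, fun y => by simp [meanBirth], fun y q q' _ hq => ?_, fun y q q' hq0 hq => ?_,
    measurable_id, rfl, fun u u' _ hu => hu, fun u u' hu0 hu => le_rfl⟩
  · exact ((h.rate.measurable.comp measurable_fst).mul
      (h.measurable_gen₁.comp measurable_fst)).mul measurable_snd
  · exact mul_le_mul_of_nonneg_left hq (mul_nonneg (h.rate.nonneg y) (h.gen₁_nonneg y))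
  · unfold meanBirth
    rw [← mul_sub]
    exact mul_le_mul_of_nonneg_right (hC y) (sub_nonneg.2 hq)

/-- The nonlinearity lies below its tangent at `q = 0`, so cumulants can be compared with solutions
of the linear mean equation. -/
lemma IsBranchingMechanism.birth_le (h : IsBranchingMechanism α p G) (y : ℝ) {q : ℝ}
    (hq0 : 0 ≤ q) : birth α p y q ≤ meanBirth α p y q := by
  rcases le_or_gt y 0 with hy | hy
  · simp [birth, meanBirth, h.rate.zero_of_nonpos y hy]
  have h1 := h.gen_lip y (z := 1 - max 0 (min q 1)) (z' := 1)
    (by rw [sub_nonneg]; exact max_le zero_le_one (min_le_right _ _))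
    (by have := le_max_left 0 (min q 1); linarith) le_rfl
  rw [h.gen_one hy, sub_sub_cancel, max_eq_right (le_min hq0 zero_le_one)] at h1
  have h2 := h1.trans (mul_le_mul_of_nonneg_left (min_le_left q 1) (h.gen₁_nonneg y))
  unfold birth meanBirth
  rw [max_eq_right (le_min hq0 zero_le_one), mul_assoc]
  exact mul_le_mul_of_nonneg_left h2 (h.rate.nonneg y)

lemma IsBranchingMechanism.birth_expand (h : IsBranchingMechanism α p G)
    (h2 : SecondMomentBounded p) (x : ℝ) {y : ℝ} (hy0 : 0 ≤ y) (hy : y ≤ 1) :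
    birth α p x y = meanBirth α p x y - α x * genRem p x y * y ^ 2 := by
  rw [birth, min_eq_left hy, max_eq_right hy0, h.gen_expand h2 x hy0 hy, meanBirth]

lemma integral_oneSubExp_mem [IsProbabilityMeasure G] {u : ℝ → ℝ} (hm : Measurable u)
    (hu : ∀ y, 0 ≤ u y) :
    ∫ y, oneSubExp (u y) ∂G = 1 - ∫ y, Real.exp (-u y) ∂G ∧ 0 ≤ ∫ y, oneSubExp (u y) ∂G ∧
      ∫ y, oneSubExp (u y) ∂G ≤ 1 := by
  have hint : Integrable (fun y => Real.exp (-u y)) G :=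
    integrable_of_bounded (by fun_prop) (B := 1) fun y => by
      rw [abs_of_pos (Real.exp_pos _), Real.exp_le_one_iff]; linarith [hu y]
  refine ⟨?_, integral_nonneg fun y => oneSubExp_nonneg (hu y), ?_⟩
  · unfold oneSubExp
    rw [integral_sub (integrable_const _) hint]; simp
  · calc ∫ y, oneSubExp (u y) ∂G ≤ ∫ _, (1 : ℝ) ∂G :=
        integral_mono ((integrable_const (1 : ℝ)).sub hint) (integrable_const _)
          fun y => oneSubExp_le_one _
      _ = 1 := by simp

/-- The average of `1 - e^{-u}` under the probability measure `G` lies in `[0, 1]` when `u ≥ 0`, so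
the clamp in `birth` is inactive along nonnegative functions. -/
lemma isCumulantSolution_iff [IsProbabilityMeasure G] {f : ℝ → ℝ} {u : ℝ → ℝ → ℝ} :
    IsCumulantSolution α p G f u ↔
      IsVolterraSolution (birth α p) oneSubExp G (fun t x => f (x - t)) u := by
  have key : Measurable (Function.uncurry u) → (∀ t x, 0 ≤ u t x) → ∀ t x s,
      birth α p (x - s) (∫ y, oneSubExp (u (t - s) y) ∂G) =
      α (x - s) * (1 - gen p (x - s) (pair G fun y => Real.exp (-u (t - s) y))) := by
    intro hm h0 t x s
    obtain ⟨e, h1, h2⟩ := integral_oneSubExp_mem (G := G) (u := u (t - s))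
      (hm.comp measurable_prodMk_left) (h0 _)
    rw [birth, min_eq_left h2, max_eq_right h1, e, sub_sub_cancel, pair]
  constructor
  · intro h
    refine ⟨h.measurable, h.nonneg, h.locallyBounded, fun t ht x => ?_⟩
    simp only [key h.measurable h.nonneg]
    exact h.eqn t ht x
  · intro h
    refine ⟨h.measurable, h.nonneg, h.locallyBounded, fun t ht x => ?_⟩
    simp only [← key h.measurable h.nonneg]
    exact h.eqn t ht x

lemma isForcing_shift {f : ℝ → ℝ} (hf : MemB f) (h0 : ∀ x, 0 ≤ f x) :
    IsForcing fun t x => f (x - t) := by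
  obtain ⟨C, hC⟩ := hf.bounded
  exact ⟨hf.measurable.comp (measurable_snd.sub measurable_fst), fun t _ x => h0 _,
    fun T => ⟨C, fun t _ x => (le_abs_self _).trans (hC _)⟩⟩

/-- `(t, x) ↦ ∫_0^t f(x - s) ds`. -/
def cumForcing (f : ℝ → ℝ) (t x : ℝ) : ℝ := ∫ s in (0 : ℝ)..t, f (x - s)

lemma isForcing_cumForcing {f : ℝ → ℝ} (hf : MemB f) (h0 : ∀ x, 0 ≤ f x) :
    IsForcing (cumForcing f) := by
  obtain ⟨C, hC⟩ := hf.bounded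
  refine ⟨?_, fun t ht x => intervalIntegral.integral_nonneg ht fun s _ => h0 _, fun T => ?_⟩
  · exact measurable_intervalIntegral_param (β := ℝ × ℝ) (h := fun b s => f (b.2 - s))
      measurable_fst (hf.measurable.comp (by fun_prop))
  · refine ⟨C * T, fun t ht x => ?_⟩
    have hC0 : 0 ≤ C := (abs_nonneg _).trans (hC 0)
    have := intervalIntegral.norm_integral_le_of_norm_le_const (a := 0) (b := t)
      (f := fun s => f (x - s)) (C := C) fun s _ => hC _
    rw [sub_zero, abs_of_nonneg ht.1] at this
    exact (le_abs_self _).trans (this.trans (mul_le_mul_of_nonneg_left ht.2 hC0))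

/-- An epsilon term satisfies its defining property as soon as some object does, so existence is all
that is needed here. -/
lemma IsBranchingMechanism.isCumulantSolution_cumulant (h : IsBranchingMechanism α p G)
    {f : ℝ → ℝ} (hf : MemB f) (h0 : ∀ x, 0 ≤ f x) :
    IsVolterraSolution (birth α p) oneSubExp G (fun t x => f (x - t)) (cumulant α p G f) := by
  have := h.prob
  obtain ⟨C, hC0, hC⟩ := h.exists_bound
  rw [← isCumulantSolution_iff]
  refine Classical.epsilon_spec (p := IsCumulantSolution α p G f) ?_
  obtain ⟨u, hu⟩ := exists_isVolterraSolution (G := G) (h.volterraKernel_birth hC0 hC)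
    (isForcing_shift hf h0)
  exact ⟨u, isCumulantSolution_iff.2 hu⟩

lemma MemB.posPart {f : ℝ → ℝ} (hf : MemB f) : MemB fun x => max (f x) 0 := by
  obtain ⟨C, hC⟩ := hf.bounded
  refine ⟨hf.measurable.max measurable_const, ⟨C, fun x => ?_⟩, fun x hx => by
    simp [hf.zero_of_nonpos x hx]⟩
  rw [abs_of_nonneg (le_max_right _ _)]
  exact max_le ((le_abs_self _).trans (hC x)) ((abs_nonneg _).trans (hC x))

lemma MemB.neg {f : ℝ → ℝ} (hf : MemB f) : MemB fun x => -f x := by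
  obtain ⟨C, hC⟩ := hf.bounded
  exact ⟨hf.measurable.neg, ⟨C, fun x => by rw [abs_neg]; exact hC x⟩, fun x hx => by
    simp [hf.zero_of_nonpos x hx]⟩

/-- The existence theorem treats nonnegative forcings only. The mean equation is linear, so the
solutions for `f⁺` and `f⁻` are subtracted. -/
lemma IsBranchingMechanism.isMeanSolution_meanSemigroup (h : IsBranchingMechanism α p G)
    {f : ℝ → ℝ} (hf : MemB f) : IsMeanSolution α p G f (meanSemigroup α p G f) := by
  have := h.prob
  obtain ⟨C, hC0, hC⟩ := h.exists_bound
  have hK := h.volterraKernel_meanBirth hC0 hC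
  refine Classical.epsilon_spec (p := IsMeanSolution α p G f) ?_
  obtain ⟨u, hu⟩ := exists_isVolterraSolution (G := G) hK
    (isForcing_shift hf.posPart fun x => le_max_right _ _)
  obtain ⟨v, hv⟩ := exists_isVolterraSolution (G := G) hK
    (isForcing_shift hf.neg.posPart fun x => le_max_right _ _)
  refine ⟨fun t x => u t x - v t x, hu.measurable.sub hv.measurable, fun T => ?_,
    fun t ht x => ?_⟩
  · obtain ⟨A, hA⟩ := hu.locallyBounded T
    obtain ⟨B, hB⟩ := hv.locallyBounded T
    refine ⟨A + B, fun t ht x => ?_⟩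
    have := hA t ht x
    have := hB t ht x
    have := hu.nonneg t x
    have := hv.nonneg t x
    rw [abs_le]; constructor <;> linarith
  · obtain ⟨A, hA⟩ := hu.locallyBounded t
    obtain ⟨B, hB⟩ := hv.locallyBounded t
    have hux : ∀ s, Measurable (u s) := fun s => hu.measurable.comp measurable_prodMk_left
    have hvx : ∀ s, Measurable (v s) := fun s => hv.measurable.comp measurable_prodMk_left
    have hui : ∀ s ∈ Set.Icc 0 t, Integrable (u s) G := fun s hs =>
      integrable_phi hK (hux s) (hu.nonneg s) (hA s hs)
    have hvi : ∀ s ∈ Set.Icc 0 t, Integrable (v s) G := fun s hs =>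
      integrable_phi hK (hvx s) (hv.nonneg s) (hB s hs)
    have i1 := intervalIntegrable_volterra hK (measurable_integral_snd (G := G) hu.measurable
        hK.meas') ht (B := A) (fun s hs => ⟨integral_phi_nonneg hK (hu.nonneg s),
          integral_phi_le hK (hux s) (hu.nonneg s) (hA s hs)⟩) x
    have i2 := intervalIntegrable_volterra hK (measurable_integral_snd (G := G) hv.measurable
        hK.meas') ht (B := B) (fun s hs => ⟨integral_phi_nonneg hK (hv.nonneg s),
          integral_phi_le hK (hvx s) (hv.nonneg s) (hB s hs)⟩) x
    have e : ∫ s in (0 : ℝ)..t, α (x - s) * gen₁ p (x - s) *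
        pair G (fun x => u (t - s) x - v (t - s) x) =
        ∫ s in (0 : ℝ)..t, (meanBirth α p (x - s) (∫ y, id (u (t - s) y) ∂G) -
          meanBirth α p (x - s) (∫ y, id (v (t - s) y) ∂G)) := by
      refine intervalIntegral.integral_congr fun s hs => ?_
      rw [Set.uIcc_of_le ht] at hs
      have hs' : t - s ∈ Set.Icc 0 t := ⟨by linarith [hs.2], by linarith [hs.1]⟩
      simp only [pair, meanBirth, id]
      rw [integral_sub (hui _ hs') (hvi _ hs')]
      ring
    rw [e, intervalIntegral.integral_sub i1 i2]
    have e1 := hu.eqn t ht x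
    have e2 := hv.eqn t ht x
    have e3 : f (x - t) = max (f (x - t)) 0 - max (-f (x - t)) 0 := by
      rcases le_total (f (x - t)) 0 with h' | h'
      · rw [max_eq_right h', max_eq_left (by linarith)]; ring
      · rw [max_eq_left h', max_eq_right (by linarith)]; ring
    rw [e3]
    beta_reduce at e1 e2
    linarith

end Gen

/-! ### Gaussian differences from Laplace transforms on a quadrant -/

section Bivariate

/-- The quadratic form with matrix `(A, B; B, D)`. -/
def quadForm (A B D a b : ℝ) : ℝ := a ^ 2 * A + 2 * a * b * B + b ^ 2 * D

variable {Λ : Measure (ℝ × ℝ)} {A B D : ℝ}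

/-- Analytic continuation of a bivariate Gaussian Laplace transform to the imaginary direction
`(1, -1)`, after tilting by `e^{-ε(x + y)}`. -/
lemma tilted_charFun_eq
    (hint : ∀ a b : ℝ, 0 ≤ a → 0 ≤ b → Integrable (fun z => Real.exp (-(a * z.1 + b * z.2))) Λ)
    (hval : ∀ a b : ℝ, 0 ≤ a → 0 ≤ b →
      ∫ z, Real.exp (-(a * z.1 + b * z.2)) ∂Λ = Real.exp (quadForm A B D a b / 2))
    {ε : ℝ} (hε : 0 < ε) (θ : ℝ) :
    ∫ z, (Real.exp (-(ε * z.1 + ε * z.2)) : ℂ) *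
        Complex.exp (θ * Complex.I * ((z.1 - z.2 : ℝ) : ℂ)) ∂Λ =
      Complex.exp ((ε ^ 2 * (A + 2 * B + D) + 2 * ε * (θ * Complex.I) * (D - A) +
        (θ * Complex.I) ^ 2 * (A - 2 * B + D)) / 2) := by
  set d : ℝ × ℝ → ℝ≥0∞ := fun z => ENNReal.ofReal (Real.exp (-(ε * z.1 + ε * z.2))) with hd
  have hdm : Measurable d := by fun_prop
  have hdt : ∀ᵐ z ∂Λ, d z < ⊤ := ae_of_all _ fun z => ENNReal.ofReal_lt_top
  have hdr : ∀ z, (d z).toReal = Real.exp (-(ε * z.1 + ε * z.2)) := fun z =>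
    ENNReal.toReal_ofReal (Real.exp_pos _).le
  set κ := Λ.withDensity d
  set X : ℝ × ℝ → ℝ := fun z => z.1 - z.2 with hX
  have hexp : ∀ s : ℝ, ∀ z : ℝ × ℝ, (d z).toReal • Real.exp (s * X z) =
      Real.exp (-((ε - s) * z.1 + (ε + s) * z.2)) := fun s z => by
    rw [hdr, smul_eq_mul, ← Real.exp_add]; congr 1; simp only [hX]; ring
  -- Under the tilted measure the exponential moment of `x - y` at `s` is the Laplace transform of
  -- `Λ` at `(ε - s, ε + s)`, which stays in the closed quadrant exactly when `|s| ≤ ε`. Without the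
  -- tilt only `s = 0` would be available.
  have hIcc : Set.Icc (-ε) ε ⊆ integrableExpSet X κ := by
    intro s hs
    change Integrable _ κ
    rw [integrable_withDensity_iff_integrable_smul' hdm hdt]
    simp only [hexp]
    exact hint _ _ (by linarith [hs.2]) (by linarith [hs.1])
  have hIoo : Set.Ioo (-ε) ε ⊆ interior (integrableExpSet X κ) := by
    rw [← interior_Icc]; exact interior_mono hIcc
  set U : Set ℂ := {z | z.re ∈ Set.Ioo (-ε) ε} with hU
  have hU1 : AnalyticOnNhd ℂ (complexMGF X κ) U :=
    analyticOnNhd_complexMGF.mono fun z hz => hIoo hz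
  set F : ℂ → ℂ := fun w => Complex.exp ((ε ^ 2 * (A + 2 * B + D) + 2 * ε * w * (D - A) +
        w ^ 2 * (A - 2 * B + D)) / 2) with hF
  have hU2 : AnalyticOnNhd ℂ F U := by
    refine DifferentiableOn.analyticOnNhd ?_ ?_
    · exact (by fun_prop : Differentiable ℂ F).differentiableOn
    · exact isOpen_Ioo.preimage Complex.continuous_re
  have hreal : ∀ s ∈ Set.Ioo (-ε) ε, complexMGF X κ (s : ℂ) = F s := by
    intro s hs
    rw [complexMGF_ofReal, mgf, integral_withDensity_eq_integral_toReal_smul hdm hdt]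
    simp only [hexp]
    rw [hval _ _ (by linarith [hs.2]) (by linarith [hs.1]), Complex.ofReal_exp, hF]
    congr 1
    simp only [quadForm]; push_cast; ring
  -- Both sides are analytic on the vertical strip and agree on its real segment, hence on the
  -- strip. The imaginary axis lies inside it, and evaluation at `iθ` gives the claim.
  have hEq : Set.EqOn (complexMGF X κ) F U := by
    refine hU1.eqOn_of_preconnected_of_frequently_eq hU2
      ((convex_Ioo _ _).linear_preimage Complex.reLm).isPreconnected (z₀ := ((0 : ℝ) : ℂ))
      (by simp [hU, hε]) ?_
    have h_real : ∃ᶠ (x : ℝ) in 𝓝[≠] 0, complexMGF X κ (x : ℂ) = F x := by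
      refine Eventually.frequently ?_
      have : Set.Ioo (-ε) ε ∈ 𝓝[≠] (0 : ℝ) :=
        mem_nhdsWithin_of_mem_nhds (Ioo_mem_nhds (by linarith) hε)
      filter_upwards [this] with x hx using hreal x hx
    rw [frequently_iff_seq_forall] at h_real ⊢
    obtain ⟨xs, hx_tendsto, hx_eq⟩ := h_real
    refine ⟨fun n ↦ xs n, ?_, fun n ↦ ?_⟩
    · rw [tendsto_nhdsWithin_iff] at hx_tendsto ⊢
      constructor
      · exact (Complex.continuous_ofReal.tendsto _).comp hx_tendsto.1
      · simpa using hx_tendsto.2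
    · simp [hx_eq]
  have h0 := hEq (show (θ * Complex.I : ℂ) ∈ U by simp [hU, hε])
  rw [complexMGF, integral_withDensity_eq_integral_toReal_smul hdm hdt] at h0
  refine Eq.trans ?_ h0
  refine integral_congr_ae (ae_of_all _ fun z => ?_)
  simp only [hdr, Complex.real_smul, hX]

/-- Let the tilt `ε` tend to `0` in `tilted_charFun_eq`. For `ε ≤ 1` the tilt is dominated by `1 +
e^{-(x + y)}`, which is integrable by the hypothesis at `a = b = 1`. -/
lemma map_sub_eq_gaussianReal [IsProbabilityMeasure Λ]
    (hint : ∀ a b : ℝ, 0 ≤ a → 0 ≤ b → Integrable (fun z => Real.exp (-(a * z.1 + b * z.2))) Λ)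
    (hval : ∀ a b : ℝ, 0 ≤ a → 0 ≤ b →
      ∫ z, Real.exp (-(a * z.1 + b * z.2)) ∂Λ = Real.exp (quadForm A B D a b / 2))
    {v : ℝ≥0} (hv : (v : ℝ) = quadForm A B D 1 (-1)) :
    Λ.map (fun z => z.1 - z.2) = gaussianReal 0 v := by
  have hm : Measurable fun z : ℝ × ℝ => z.1 - z.2 := by fun_prop
  have := Measure.isProbabilityMeasure_map (μ := Λ) hm.aemeasurable
  refine Measure.ext_of_charFun ?_
  ext θ
  rw [charFun_gaussianReal, charFun_apply_real, integral_map hm.aemeasurable (by fun_prop)]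
  have hA : Tendsto (fun ε : ℝ => ∫ z, (Real.exp (-(ε * z.1 + ε * z.2)) : ℂ) *
        Complex.exp (θ * Complex.I * ((z.1 - z.2 : ℝ) : ℂ)) ∂Λ) (𝓝[>] 0)
      (𝓝 (∫ z, Complex.exp (θ * ((z.1 - z.2 : ℝ) : ℂ) * Complex.I) ∂Λ)) := by
    refine tendsto_integral_filter_of_dominated_convergence
      (fun z => 1 + Real.exp (-(1 * z.1 + 1 * z.2)))
      (Eventually.of_forall fun ε => ?_) ?_
      ((integrable_const _).add (hint 1 1 zero_le_one zero_le_one)) (ae_of_all _ fun z => ?_)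
    · exact Continuous.aestronglyMeasurable (by fun_prop)
    · have : Set.Ioo (0 : ℝ) 1 ∈ 𝓝[>] 0 := Ioo_mem_nhdsGT zero_lt_one
      filter_upwards [this] with ε hε
      refine ae_of_all _ fun z => ?_
      have e : θ * Complex.I * ((z.1 - z.2 : ℝ) : ℂ) =
        ((θ * (z.1 - z.2) : ℝ) : ℂ) * Complex.I := by push_cast; ring
      rw [norm_mul, e, Complex.norm_exp_ofReal_mul_I, mul_one, Complex.norm_real,
        Real.norm_of_nonneg (Real.exp_pos _).le]
      rcases le_total 0 (z.1 + z.2) with h | h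
      · have : Real.exp (-(ε * z.1 + ε * z.2)) ≤ 1 := by
          rw [Real.exp_le_one_iff, ← mul_add]; have := mul_nonneg hε.1.le h; linarith
        have := Real.exp_pos (-(1 * z.1 + 1 * z.2))
        linarith
      · have : Real.exp (-(ε * z.1 + ε * z.2)) ≤ Real.exp (-(1 * z.1 + 1 * z.2)) := by
          rw [Real.exp_le_exp]; nlinarith [hε.2]
        linarith
    · have hc : Continuous fun ε : ℝ => (Real.exp (-(ε * z.1 + ε * z.2)) : ℂ) *
        Complex.exp (θ * Complex.I * ((z.1 - z.2 : ℝ) : ℂ)) := by fun_prop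
      have := (hc.tendsto 0).mono_left (nhdsWithin_le_nhds (s := Set.Ioi 0))
      convert this using 2
      simp; ring_nf
  have hB : Tendsto (fun ε : ℝ => Complex.exp ((ε ^ 2 * (A + 2 * B + D) +
      2 * ε * (θ * Complex.I) * (D - A) + (θ * Complex.I) ^ 2 * (A - 2 * B + D)) / 2)) (𝓝[>] 0)
      (𝓝 (Complex.exp (((θ * Complex.I) ^ 2 * (A - 2 * B + D)) / 2))) := by
    have hc : Continuous fun ε : ℝ => Complex.exp ((ε ^ 2 * (A + 2 * B + D) +
      2 * ε * (θ * Complex.I) * (D - A) + (θ * Complex.I) ^ 2 * (A - 2 * B + D)) / 2) := by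
      fun_prop
    have := (hc.tendsto 0).mono_left (nhdsWithin_le_nhds (s := Set.Ioi 0))
    convert this using 2
    simp
  have hAB := hA.congr' (f₂ := fun ε : ℝ => Complex.exp ((ε ^ 2 * (A + 2 * B + D) +
      2 * ε * (θ * Complex.I) * (D - A) + (θ * Complex.I) ^ 2 * (A - 2 * B + D)) / 2)) (by
    filter_upwards [self_mem_nhdsWithin] with ε hε
    exact tilted_charFun_eq hint hval hε θ)
  rw [tendsto_nhds_unique hAB hB]
  congr 1
  have : ((v : ℝ) : ℂ) = A - 2 * B + D := by rw [hv]; simp only [quadForm]; push_cast; ring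
  rw [this, mul_pow, Complex.I_sq]
  push_cast; ring

end Bivariate

/-! ### From Laplace transforms to convergence in distribution -/

section Limit

variable {Ω : Type*} {mΩ : MeasurableSpace Ω} {μ : Measure Ω}

/-- For a centred variable `E|X| = E(|X| - X) = 2 E X⁻`, and `X⁻ ≤ e^{-X}`. A bound on one Laplace
transform thus gives the `L¹` bound behind tightness. -/
lemma integral_abs_le_of_integral_eq_zero {X : Ω → ℝ} (hX : Integrable X μ) (h0 : ∫ ω, X ω ∂μ = 0)
    (he : Integrable (fun ω => Real.exp (-X ω)) μ) :
    ∫ ω, |X ω| ∂μ ≤ 2 * ∫ ω, Real.exp (-X ω) ∂μ := by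
  have : ∫ ω, |X ω| ∂μ = ∫ ω, (|X ω| - X ω) ∂μ := by
    rw [integral_sub hX.abs hX, h0, sub_zero]
  rw [this, ← integral_const_mul]
  refine integral_mono (hX.abs.sub hX) (he.const_mul 2) fun ω => ?_
  have h1 := Real.add_one_le_exp (-X ω)
  have h2 := Real.exp_pos (-X ω)
  beta_reduce
  rcases abs_cases (X ω) with ⟨h, _⟩ | ⟨h, _⟩ <;> rw [h] <;> linarith

variable {ι : Type*} {l : Filter ι} {X W : ι → Ω → ℝ} {A B D : ℝ}

/-- Passage to the limit in Laplace transforms along a weakly convergent family of laws. -/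
lemma laplace_of_weak_limit {l : Filter ι} [l.NeBot] {Λ : ι → ProbabilityMeasure (ℝ × ℝ)}
    {Λ' : ProbabilityMeasure (ℝ × ℝ)} (hΛ : Tendsto Λ l (𝓝 Λ'))
    {Q : ℝ → ℝ → ℝ}
    (hint : ∀ a b : ℝ, 0 ≤ a → 0 ≤ b → ∀ᶠ i in l,
      Integrable (fun z => Real.exp (-(a * z.1 + b * z.2))) (Λ i : Measure (ℝ × ℝ)))
    (hlim : ∀ a b : ℝ, 0 ≤ a → 0 ≤ b → Tendsto (fun i =>
      ∫ z, Real.exp (-(a * z.1 + b * z.2)) ∂(Λ i : Measure (ℝ × ℝ))) l (𝓝 (Q a b)))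
    {a b : ℝ} (ha : 0 ≤ a) (hb : 0 ≤ b) :
    Integrable (fun z => Real.exp (-(a * z.1 + b * z.2))) (Λ' : Measure (ℝ × ℝ)) ∧
      ∫ z, Real.exp (-(a * z.1 + b * z.2)) ∂(Λ' : Measure (ℝ × ℝ)) = Q a b := by
  set E : ℝ × ℝ → ℝ := fun z => Real.exp (-(a * z.1 + b * z.2)) with hE
  have hE0 : ∀ z, 0 ≤ E z := fun z => (Real.exp_pos _).le
  have hEc : Continuous E := by fun_prop
  -- The square of the exponential is again such an exponential, at `(2a, 2b)`; convergence of its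
  -- integrals gives uniform integrability of `E`.
  have hE2 : ∀ z, E z ^ 2 = Real.exp (-((2 * a) * z.1 + (2 * b) * z.2)) := fun z => by
    rw [hE, ← Real.exp_nat_mul]; congr 1; push_cast; ring
  set C := Q (2 * a) (2 * b)
  have hi2 := hint (2 * a) (2 * b) (by linarith) (by linarith)
  have hl2 := hlim (2 * a) (2 * b) (by linarith) (by linarith)
  have hbc : ∀ K : ℝ, Tendsto (fun i => ∫ z, min (E z) K ∂(Λ i : Measure (ℝ × ℝ))) l
      (𝓝 (∫ z, min (E z) K ∂(Λ' : Measure (ℝ × ℝ)))) := by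
    intro K
    have hb : ∀ z, ‖min (E z) K‖ ≤ |K| := fun z => by
      rw [Real.norm_eq_abs, abs_le]
      constructor
      · rcases le_total (E z) K with h | h
        · rw [min_eq_left h]; have := hE0 z; have := abs_nonneg K; linarith
        · rw [min_eq_right h]; exact neg_abs_le K
      · exact (min_le_right _ _).trans (le_abs_self K)
    exact ProbabilityMeasure.tendsto_iff_forall_integral_tendsto.1 hΛ
      (BoundedContinuousFunction.ofNormedAddCommGroup _ (hEc.min continuous_const) _ hb)
  have hmin_int : ∀ (K : ℝ) (κ : Measure (ℝ × ℝ)) [IsFiniteMeasure κ], 0 ≤ K →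
      Integrable (fun z => min (E z) K) κ := fun K κ _ hK =>
    integrable_of_bounded (hEc.min continuous_const).measurable (B := K) fun z => by
      rw [abs_of_nonneg (le_min (hE0 z) hK)]; exact min_le_right _ _
  have hup : ∀ K : ℝ, 0 < K → ∫ z, min (E z) K ∂(Λ' : Measure (ℝ × ℝ)) ≤ Q a b := by
    intro K hK
    refine le_of_tendsto_of_tendsto (hbc K) (hlim a b ha hb) ?_
    filter_upwards [hint a b ha hb] with i hi
    exact integral_mono (hmin_int K _ hK.le) hi fun z => min_le_left _ _
  -- The part of `E` cut off at level `K` is at most `E²/K`, so truncation costs at most `C/K` in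
  -- the limit.
  have hlow : ∀ K : ℝ, 0 < K → Q a b ≤ ∫ z, min (E z) K ∂(Λ' : Measure (ℝ × ℝ)) + C / K := by
    intro K hK
    refine le_of_tendsto_of_tendsto (hlim a b ha hb) ((hbc K).add (hl2.div_const K)) ?_
    filter_upwards [hint a b ha hb, hi2] with i hi hi2
    rw [← integral_div, ← integral_add (hmin_int K _ hK.le) (hi2.div_const K)]
    refine integral_mono hi ((hmin_int K _ hK.le).add (hi2.div_const K)) fun z => ?_
    beta_reduce
    rw [← hE2]
    change E z ≤ _
    rcases le_total (E z) K with h | h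
    · rw [min_eq_left h]; have : 0 ≤ E z ^ 2 / K := by positivity
      linarith
    · rw [min_eq_right h]
      have : E z ≤ E z ^ 2 / K := by
        rw [le_div_iff₀ hK, sq]; exact mul_le_mul_of_nonneg_left h (hE0 z)
      linarith
  have hmct : Tendsto (fun n : ℕ => ∫⁻ z, ENNReal.ofReal (min (E z) n) ∂(Λ' : Measure (ℝ × ℝ)))
      atTop (𝓝 (∫⁻ z, ENNReal.ofReal (E z) ∂(Λ' : Measure (ℝ × ℝ)))) := by
    refine lintegral_tendsto_of_tendsto_of_monotone (fun n => by fun_prop)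
      (ae_of_all _ fun z n m hnm => ?_) (ae_of_all _ fun z => ?_)
    · have : (n : ℝ) ≤ m := by exact_mod_cast hnm
      exact ENNReal.ofReal_le_ofReal (min_le_min_left _ this)
    · refine ENNReal.tendsto_ofReal (tendsto_const_nhds.congr' ?_)
      filter_upwards [eventually_ge_atTop ⌈E z⌉₊] with n hn
      rw [min_eq_left]
      exact (Nat.le_ceil _).trans (by exact_mod_cast hn)
  have hfin : ∫⁻ z, ENNReal.ofReal (E z) ∂(Λ' : Measure (ℝ × ℝ)) ≤ ENNReal.ofReal (Q a b) := by
    refine le_of_tendsto hmct ?_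
    filter_upwards [eventually_gt_atTop 0] with n hn
    have hn' : (0 : ℝ) < n := by exact_mod_cast hn
    rw [← ofReal_integral_eq_lintegral_ofReal (hmin_int n _ hn'.le)
      (ae_of_all _ fun z => le_min (hE0 z) hn'.le)]
    exact ENNReal.ofReal_le_ofReal (hup n hn')
  have hEint : Integrable E (Λ' : Measure (ℝ × ℝ)) := by
    refine ⟨hEc.aestronglyMeasurable, ?_⟩
    rw [hasFiniteIntegral_iff_ofReal (ae_of_all _ hE0)]
    exact hfin.trans_lt ENNReal.ofReal_lt_top
  refine ⟨hEint, ?_⟩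
  have hdct : Tendsto (fun n : ℕ => ∫ z, min (E z) n ∂(Λ' : Measure (ℝ × ℝ))) atTop
      (𝓝 (∫ z, E z ∂(Λ' : Measure (ℝ × ℝ)))) := by
    refine tendsto_integral_of_dominated_convergence E
      (fun n => (hEc.min continuous_const).aestronglyMeasurable) hEint
      (fun n => ae_of_all _ fun z => ?_) (ae_of_all _ fun z => ?_)
    · rw [Real.norm_of_nonneg (le_min (hE0 z) n.cast_nonneg)]; exact min_le_left _ _
    · refine tendsto_const_nhds.congr' ?_
      filter_upwards [eventually_ge_atTop ⌈E z⌉₊] with n hn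
      rw [min_eq_left]
      exact (Nat.le_ceil _).trans (by exact_mod_cast hn)
  refine le_antisymm (le_of_tendsto hdct ?_) ?_
  · filter_upwards [eventually_gt_atTop 0] with n hn
    exact hup n (by exact_mod_cast hn)
  · have h2 := hdct.add ((tendsto_const_nhds (x := C)).div_atTop tendsto_natCast_atTop_atTop)
    rw [add_zero] at h2
    refine ge_of_tendsto h2 ?_
    filter_upwards [eventually_gt_atTop 0] with n hn
    exact hlow n (by exact_mod_cast hn)

/-- If the Laplace transforms of a centred pair converge to those of a Gaussian vector on the
positive quadrant, then the difference of the two components is asymptotically normal. -/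
theorem tendstoInDistribution_sub_of_laplace [IsProbabilityMeasure μ]
    (hXm : ∀ i, Measurable (X i)) (hWm : ∀ i, Measurable (W i))
    (hXi : ∀ᶠ i in l, Integrable (X i) μ) (hWi : ∀ᶠ i in l, Integrable (W i) μ)
    (hX0 : ∀ᶠ i in l, ∫ ω, X i ω ∂μ = 0) (hW0 : ∀ᶠ i in l, ∫ ω, W i ω ∂μ = 0)
    (hint : ∀ a b : ℝ, 0 ≤ a → 0 ≤ b →
      ∀ᶠ i in l, Integrable (fun ω => Real.exp (-(a * X i ω + b * W i ω))) μ)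
    (hlim : ∀ a b : ℝ, 0 ≤ a → 0 ≤ b → Tendsto
      (fun i => ∫ ω, Real.exp (-(a * X i ω + b * W i ω)) ∂μ) l
      (𝓝 (Real.exp (quadForm A B D a b / 2))))
    {v : ℝ≥0} (hv : (v : ℝ) = quadForm A B D 1 (-1)) :
    TendstoInDistribution (fun i ω => X i ω - W i ω) l (id : ℝ → ℝ) (fun _ => μ)
      (gaussianReal 0 v) := by
  have hXW : ∀ i, Measurable fun ω => (X i ω, W i ω) := fun i => (hXm i).prodMk (hWm i)
  set Λ : ι → ProbabilityMeasure (ℝ × ℝ) := fun i =>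
    ⟨μ.map fun ω => (X i ω, W i ω), Measure.isProbabilityMeasure_map (hXW i).aemeasurable⟩ with hΛ
  have hsub : Measurable fun z : ℝ × ℝ => z.1 - z.2 := by fun_prop
  have hXb : ∃ K : ℝ, ∀ᶠ i in l, ∫ ω, |X i ω| ∂μ ≤ K := by
    refine ⟨2 * (Real.exp (quadForm A B D 1 0 / 2) + 1), ?_⟩
    filter_upwards [hXi, hX0, hint 1 0 zero_le_one le_rfl,
      (hlim 1 0 zero_le_one le_rfl).eventually (ge_mem_nhds (lt_add_one _))] with i h1 h2 h3 h4
    simp only [one_mul, zero_mul, add_zero] at h3 h4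
    exact (integral_abs_le_of_integral_eq_zero h1 h2 h3).trans (by linarith)
  have hWb : ∃ K : ℝ, ∀ᶠ i in l, ∫ ω, |W i ω| ∂μ ≤ K := by
    refine ⟨2 * (Real.exp (quadForm A B D 0 1 / 2) + 1), ?_⟩
    filter_upwards [hWi, hW0, hint 0 1 le_rfl zero_le_one,
      (hlim 0 1 le_rfl zero_le_one).eventually (ge_mem_nhds (lt_add_one _))] with i h1 h2 h3 h4
    simp only [one_mul, zero_mul, zero_add] at h3 h4
    exact (integral_abs_le_of_integral_eq_zero h1 h2 h3).trans (by linarith)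
  obtain ⟨K₁, hK₁⟩ := hXb
  obtain ⟨K₂, hK₂⟩ := hWb
  -- The hypotheses hold only eventually along `l`, so tightness is proved for the laws indexed by
  -- the set where the moment bounds are available.
  set I : Set ι := {i | Integrable (X i) μ ∧ Integrable (W i) μ ∧ ∫ ω, |X i ω| ∂μ ≤ K₁ ∧
    ∫ ω, |W i ω| ∂μ ≤ K₂}
  have hI : ∀ᶠ i in l, i ∈ I := by
    filter_upwards [hXi, hWi, hK₁, hK₂] with i h1 h2 h3 h4 using ⟨h1, h2, h3, h4⟩
  have htight : IsTightMeasureSet {((κ : ProbabilityMeasure (ℝ × ℝ)) : Measure (ℝ × ℝ)) |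
      κ ∈ Λ '' I} := by
    refine isTightMeasureSet_of_tendsto_measure_norm_gt ?_
    have hb : ∀ r > 0, ⨆ κ ∈ {((κ : ProbabilityMeasure (ℝ × ℝ)) : Measure (ℝ × ℝ)) |
      κ ∈ Λ '' I}, κ {z | r < ‖z‖} ≤ ENNReal.ofReal ((K₁ + K₂) / r) := by
      intro r hr
      refine iSup₂_le ?_
      rintro _ ⟨_, ⟨i, hi, rfl⟩, rfl⟩
      change μ.map (fun ω => (X i ω, W i ω)) _ ≤ _
      rw [Measure.map_apply (hXW i) (measurableSet_lt measurable_const measurable_norm)]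
      have h1 := mul_meas_ge_le_integral_of_nonneg (μ := μ) (f := fun ω => |X i ω| + |W i ω|)
        (ae_of_all _ fun ω => add_nonneg (abs_nonneg _) (abs_nonneg _))
        (hi.1.abs.add hi.2.1.abs) r
      rw [integral_add hi.1.abs hi.2.1.abs] at h1
      have h2 : μ.real {ω | r ≤ |X i ω| + |W i ω|} ≤ (K₁ + K₂) / r := by
        rw [le_div_iff₀ hr, mul_comm]; exact h1.trans (add_le_add hi.2.2.1 hi.2.2.2)
      calc μ ((fun ω => (X i ω, W i ω)) ⁻¹' {z | r < ‖z‖})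
          ≤ μ {ω | r ≤ |X i ω| + |W i ω|} := by
            refine measure_mono fun ω hω => ?_
            have hω' : r < max |X i ω| |W i ω| := hω
            rw [Set.mem_ofPred_eq]
            refine hω'.le.trans (max_le ?_ ?_)
            · linarith [abs_nonneg (W i ω)]
            · linarith [abs_nonneg (X i ω)]
        _ = ENNReal.ofReal (μ.real {ω | r ≤ |X i ω| + |W i ω|}) := by simp
        _ ≤ _ := ENNReal.ofReal_le_ofReal h2
    have hz : Tendsto (fun r : ℝ => ENNReal.ofReal ((K₁ + K₂) / r)) atTop (𝓝 0) := by
      rw [← ENNReal.ofReal_zero]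
      exact ENNReal.tendsto_ofReal (tendsto_const_nhds.div_atTop tendsto_id)
    refine tendsto_of_tendsto_of_tendsto_of_le_of_le' tendsto_const_nhds hz
      (Eventually.of_forall fun _ => zero_le) ?_
    filter_upwards [eventually_gt_atTop 0] with r hr using hb r hr
  have hcomp := isCompact_closure_of_isTightMeasureSet htight
  have hLap : ∀ (i : ι) (a b : ℝ), ∫ z, Real.exp (-(a * z.1 + b * z.2)) ∂(Λ i : Measure (ℝ × ℝ)) =
      ∫ ω, Real.exp (-(a * X i ω + b * W i ω)) ∂μ := fun i a b => by
    change ∫ z, Real.exp (-(a * z.1 + b * z.2)) ∂(μ.map fun ω => (X i ω, W i ω)) = _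
    rw [integral_map (hXW i).aemeasurable (by fun_prop)]
  have hLapi : ∀ (i : ι) (a b : ℝ),
      Integrable (fun z => Real.exp (-(a * z.1 + b * z.2))) (Λ i : Measure (ℝ × ℝ)) ↔
      Integrable (fun ω => Real.exp (-(a * X i ω + b * W i ω))) μ := fun i a b => by
    change Integrable _ (μ.map fun ω => (X i ω, W i ω)) ↔ _
    rw [integrable_map_measure (by fun_prop) (hXW i).aemeasurable]
    rfl
  refine ⟨fun i => ((hXm i).sub (hWm i)).aemeasurable, aemeasurable_id, ?_⟩
  -- The filter `l` is arbitrary, so ultrafilters finer than `l` replace subsequences. Along each of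
  -- them the laws of the pair converge by compactness, and every possible limit has the same image
  -- under subtraction.
  refine (tendsto_iff_ultrafilter _ _ _).2 fun g hg => ?_
  obtain ⟨Λ', -, hΛ'⟩ := hcomp.ultrafilter_le_nhds (g.map Λ) (by
    rw [le_principal_iff, Ultrafilter.coe_map, mem_map]
    filter_upwards [hg hI] with i hi using subset_closure ⟨i, hi, rfl⟩)
  have hconv : Tendsto Λ g (𝓝 Λ') := hΛ'
  have hid := fun a b ha hb => laplace_of_weak_limit hconv
    (Q := fun a b => Real.exp (quadForm A B D a b / 2))
    (fun a b ha hb => hg ((hint a b ha hb).mono fun i hi => (hLapi i a b).2 hi))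
    (fun a b ha hb => by simpa only [hLap] using (hlim a b ha hb).mono_left hg) (a := a) (b := b)
    ha hb
  have hgauss := map_sub_eq_gaussianReal (Λ := (Λ' : Measure (ℝ × ℝ)))
    (fun a b ha hb => (hid a b ha hb).1) (fun a b ha hb => (hid a b ha hb).2) hv
  have := ProbabilityMeasure.tendsto_map_of_tendsto_of_continuous Λ Λ' hconv
    (f := fun z : ℝ × ℝ => z.1 - z.2) (by fun_prop)
  have e1 : ∀ i, (Λ i).map (f := fun z : ℝ × ℝ => z.1 - z.2) hsub.aemeasurable =
      (⟨μ.map fun ω => X i ω - W i ω, Measure.isProbabilityMeasure_map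
        ((hXm i).sub (hWm i)).aemeasurable⟩ : ProbabilityMeasure ℝ) := fun i => by
    apply Subtype.ext
    change ((μ.map fun ω => (X i ω, W i ω)).map fun z => z.1 - z.2) = _
    rw [Measure.map_map hsub (hXW i)]
    rfl
  have e2 : Λ'.map (f := fun z : ℝ × ℝ => z.1 - z.2) hsub.aemeasurable =
      (⟨(gaussianReal 0 v).map id, Measure.isProbabilityMeasure_map aemeasurable_id⟩ :
        ProbabilityMeasure ℝ) := by
    apply Subtype.ext
    change (Λ' : Measure (ℝ × ℝ)).map (fun z => z.1 - z.2) = (gaussianReal 0 v).map id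
    rw [hgauss, Measure.map_id]
  rw [e2] at this
  exact this.congr e1

end Limit

/-! ### Riemann sums on randomly shifted grids -/

section Riemann

/-- The substitution `s = (k + θ) h` maps `θ ∈ (0, 1]` onto the `k`-th cell of the grid, so
averaging over the shift turns the sum exactly into the integral. -/
lemma lintegral_shifted_sum {F : ℝ → ℝ≥0∞} (hF : Measurable F) {h : ℝ} (hh : 0 < h) (n : ℕ) :
    ∫⁻ θ in Set.Ioc (0 : ℝ) 1, ENNReal.ofReal h * ∑ k ∈ Finset.range n, F ((k + θ) * h) =
      ∫⁻ s in Set.Ioc 0 (n * h), F s := by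
  have hm : ∀ k : ℕ, Measurable fun θ : ℝ => F ((k + θ) * h) := fun k =>
    hF.comp (by fun_prop)
  have hcv : ∀ k : ℕ, ∫⁻ θ in Set.Ioc (0 : ℝ) 1, ENNReal.ofReal h * F ((k + θ) * h) =
      ∫⁻ s in Set.Ioc (k * h) ((k + 1 : ℕ) * h), F s := by
    intro k
    have himg : (fun θ : ℝ => (k + θ) * h) '' Set.Ioc 0 1 =
        Set.Ioc (k * h) ((k + 1 : ℕ) * h) := by
      ext s
      constructor
      · rintro ⟨θ, hθ, rfl⟩
        push_cast
        exact ⟨by nlinarith [hθ.1], by nlinarith [hθ.2]⟩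
      · intro hs
        push_cast at hs
        refine ⟨s / h - k, ⟨?_, ?_⟩, ?_⟩
        · rw [sub_pos, lt_div_iff₀ hh]; exact hs.1
        · rw [sub_le_iff_le_add, div_le_iff₀ hh, add_comm]; exact hs.2
        · field_simp; ring
    rw [← himg, lintegral_image_eq_lintegral_abs_deriv_mul (f' := fun _ => h) measurableSet_Ioc]
    · simp [abs_of_pos hh]
    · intro θ _
      have := (((hasDerivAt_id θ).const_add (k : ℝ)).mul_const h).hasDerivWithinAt
        (s := Set.Ioc (0 : ℝ) 1)
      simpa using this
    · intro a _ b _ hab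
      have := mul_right_cancel₀ hh.ne' hab
      linarith
  induction n with
  | zero => simp
  | succ n ih =>
    simp only [Finset.sum_range_succ, mul_add]
    rw [lintegral_add_left, ih, hcv, ← lintegral_union measurableSet_Ioc]
    · rw [Set.Ioc_union_Ioc_eq_Ioc (by positivity)]
      push_cast; nlinarith
    · rw [Set.disjoint_left]
      intro s h1 h2
      exact absurd h1.2 (not_le.2 h2.1)
    · exact (Finset.measurable_sum _ fun k _ => hm k).const_mul _

/-- Riemann sums over the shifted grid `(k + θ) h`, `h = T / (n + 1)`. -/
def shiftedSum (T : ℝ) (n : ℕ) (y : ℝ → ℝ) (θ : ℝ) : ℝ :=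
  T / (n + 1) * ∑ k ∈ Finset.range (n + 1), y ((k + θ) * (T / (n + 1)))

/-- The map from a path to its shifted sums is a contraction from `L¹(0, T)` to `L¹(dθ)`, uniformly
in `n`; this is what allows approximation by continuous functions. -/
lemma lintegral_shiftedSum_le {y : ℝ → ℝ} (hy : Measurable y) {T : ℝ} (hT : 0 < T) (n : ℕ) :
    ∫⁻ θ in Set.Ioc (0 : ℝ) 1, ‖shiftedSum T n y θ‖ₑ ≤ ∫⁻ s in Set.Ioc 0 T, ‖y s‖ₑ := by
  have hh : 0 < T / (n + 1) := by positivity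
  have h1 := lintegral_shifted_sum (F := fun s => ‖y s‖ₑ) hy.enorm hh (n + 1)
  have h2 : ((n + 1 : ℕ) : ℝ) * (T / (n + 1)) = T := by push_cast; field_simp
  rw [h2] at h1
  rw [← h1]
  refine lintegral_mono fun θ => ?_
  rw [shiftedSum, enorm_mul, Real.enorm_of_nonneg hh.le]
  gcongr
  exact enorm_sum_le _ _

lemma shiftedSum_sub (T : ℝ) (n : ℕ) (y g : ℝ → ℝ) (θ : ℝ) :
    shiftedSum T n y θ - shiftedSum T n g θ = shiftedSum T n (fun s => y s - g s) θ := by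
  simp only [shiftedSum]
  rw [← mul_sub, Finset.sum_sub_distrib]

lemma measurable_shiftedSum {β : Type*} [MeasurableSpace β] {y : β → ℝ → ℝ}
    (hy : Measurable (Function.uncurry y)) (T : ℝ) (n : ℕ) :
    Measurable fun p : β × ℝ => shiftedSum T n (y p.1) p.2 := by
  unfold shiftedSum
  refine (Finset.measurable_sum _ fun k _ => ?_).const_mul _
  have : Measurable fun p : β × ℝ => (p.1, (k + p.2) * (T / (n + 1))) := by fun_prop
  exact hy.comp this

lemma shiftedSum_continuous {g : ℝ → ℝ} (hg : Continuous g) {T : ℝ} (hT : 0 < T) {ε : ℝ}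
    (hε : 0 < ε) : ∀ᶠ n : ℕ in atTop, ∀ θ ∈ Set.Ioc (0 : ℝ) 1,
      |shiftedSum T n g θ - ∫ s in (0 : ℝ)..T, g s| ≤ ε := by
  have huc := isCompact_Icc.uniformContinuousOn_of_continuous (s := Set.Icc 0 T) hg.continuousOn
  rw [Metric.uniformContinuousOn_iff] at huc
  obtain ⟨δ, hδ, huc⟩ := huc (ε / T) (by positivity)
  have hlim : Tendsto (fun n : ℕ => T / ((n : ℝ) + 1)) atTop (𝓝 0) :=
    tendsto_const_nhds.div_atTop (tendsto_natCast_atTop_atTop.atTop_add tendsto_const_nhds)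
  filter_upwards [hlim.eventually (gt_mem_nhds hδ)] with n hn θ hθ
  set h := T / ((n : ℝ) + 1) with hh
  have hh0 : 0 < h := by positivity
  have hnh : ((n : ℝ) + 1) * h = T := by rw [hh]; field_simp
  have hadj := intervalIntegral.sum_integral_adjacent_intervals (f := g) (μ := volume)
    (a := fun k : ℕ => (k : ℝ) * h) (n := n + 1) fun k _ => hg.intervalIntegrable _ _
  simp only [Nat.cast_zero, zero_mul] at hadj
  rw [show ((n + 1 : ℕ) : ℝ) * h = T by push_cast; exact hnh] at hadj
  rw [shiftedSum, ← hh, ← hadj, Finset.mul_sum, ← Finset.sum_sub_distrib]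
  refine (Finset.abs_sum_le_sum_abs _ _).trans ?_
  have hterm : ∀ k ∈ Finset.range (n + 1), |h * g ((k + θ) * h) -
      ∫ s in ((k : ℝ) * h)..(((k + 1 : ℕ) : ℝ) * h), g s| ≤ ε / T * h := by
    intro k hk
    have hk' : (k : ℝ) + 1 ≤ n + 1 := by
      have := Finset.mem_range.1 hk
      exact_mod_cast this
    have hkT : ((k : ℝ) + 1) * h ≤ T := by rw [← hnh]; gcongr
    have hlen : ((k + 1 : ℕ) : ℝ) * h - k * h = h := by push_cast; ring
    have hc : h * g ((k + θ) * h) =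
        ∫ s in ((k : ℝ) * h)..(((k + 1 : ℕ) : ℝ) * h), g ((k + θ) * h) := by
      rw [intervalIntegral.integral_const, hlen, smul_eq_mul]
    rw [hc, ← intervalIntegral.integral_sub intervalIntegrable_const (hg.intervalIntegrable _ _)]
    have := intervalIntegral.norm_integral_le_of_norm_le_const (a := (k : ℝ) * h)
      (b := ((k + 1 : ℕ) : ℝ) * h) (f := fun s => g ((k + θ) * h) - g s) (C := ε / T) ?_
    · rwa [hlen, abs_of_pos hh0] at this
    · intro s hs
      rw [Set.uIoc_of_le (by push_cast; nlinarith)] at hs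
      push_cast at hs
      have hs0 : 0 ≤ s := le_trans (by positivity) hs.1.le
      have hp0 : 0 ≤ (k + θ) * h := mul_nonneg (add_nonneg k.cast_nonneg hθ.1.le) hh0.le
      have hp1 : (k + θ) * h ≤ (k + 1) * h := by gcongr; exact hθ.2
      have hp2 : k * h ≤ (k + θ) * h := by gcongr; linarith [hθ.1]
      refine (huc _ ⟨hp0, hp1.trans hkT⟩ _ ⟨hs0, hs.2.trans hkT⟩ ?_).le
      rw [Real.dist_eq]
      refine lt_of_le_of_lt ?_ hn
      rw [abs_le]
      constructor <;> nlinarith [hs.1, hs.2]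
  refine (Finset.sum_le_sum hterm).trans (le_of_eq ?_)
  rw [Finset.sum_const, Finset.card_range, nsmul_eq_mul]
  push_cast
  rw [mul_left_comm, hnh]; field_simp

lemma enorm_intervalIntegral_le {y : ℝ → ℝ} {T : ℝ} (hT : 0 ≤ T) :
    ‖∫ s in (0 : ℝ)..T, y s‖ₑ ≤ ∫⁻ s in Set.Ioc 0 T, ‖y s‖ₑ := by
  rw [intervalIntegral.integral_of_le hT]
  exact enorm_integral_le_lintegral_enorm _

lemma lintegral_const_Ioc (c : ℝ≥0∞) : ∫⁻ _ in Set.Ioc (0 : ℝ) 1, c = c := by simp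

/-- Riemann sums on a fixed grid need not converge for an integrable function. On average over the
shift they do: approximate in `L¹` by a continuous `g`, for which the sums converge uniformly in
`θ`, and use the contraction property for `y - g`. -/
lemma shiftedSum_tendsto {y : ℝ → ℝ} (hy : Measurable y) {T : ℝ} (hT : 0 < T)
    (hyi : IntegrableOn y (Set.Ioc 0 T)) :
    Tendsto (fun n => ∫⁻ θ in Set.Ioc (0 : ℝ) 1, ‖shiftedSum T n y θ - ∫ s in (0 : ℝ)..T, y s‖ₑ)
      atTop (𝓝 0) := by
  rw [ENNReal.tendsto_nhds_zero]
  intro ε hε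
  -- Three errors of size `ε'` occur: the shifted sum of `y - g`, the Riemann error of `g`, and the
  -- integral of `y - g`.
  obtain ⟨ε', hε₀, hεle⟩ : ∃ ε' : ℝ≥0, 0 < ε' ∧ ((3 * ε' : ℝ≥0) : ℝ≥0∞) ≤ ε := by
    rcases eq_or_ne ε ⊤ with rfl | h
    · exact ⟨1, one_pos, le_top⟩
    · lift ε to ℝ≥0 using h
      have : 0 < ε := by exact_mod_cast hε
      refine ⟨ε / 3, by positivity, ?_⟩
      rw [mul_div_cancel₀ _ (by norm_num)]
  obtain ⟨g, -, hg1, hg2, hg3⟩ := hyi.exists_hasCompactSupport_lintegral_sub_le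
    (ε := (ε' : ℝ≥0∞)) (by exact_mod_cast hε₀.ne')
  have hgi : IntervalIntegrable g volume 0 T := hg2.intervalIntegrable _ _
  have hyi' : IntervalIntegrable y volume 0 T :=
    (intervalIntegrable_iff_integrableOn_Ioc_of_le hT.le).2 hyi
  filter_upwards [shiftedSum_continuous hg2 hT (ε := ε') (by exact_mod_cast hε₀)] with n hn
  have hsum : ∀ θ ∈ Set.Ioc (0 : ℝ) 1, ‖shiftedSum T n y θ - ∫ s in (0 : ℝ)..T, y s‖ₑ ≤
      ‖shiftedSum T n (fun s => y s - g s) θ‖ₑ + (ε' + ε') := by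
    intro θ hθ
    have e : shiftedSum T n y θ - ∫ s in (0 : ℝ)..T, y s =
        shiftedSum T n (fun s => y s - g s) θ + ((shiftedSum T n g θ - ∫ s in (0 : ℝ)..T, g s) -
          ∫ s in (0 : ℝ)..T, (y s - g s)) := by
      rw [← shiftedSum_sub, intervalIntegral.integral_sub hyi' hgi]; ring
    rw [e]
    refine (enorm_add_le _ _).trans (add_le_add le_rfl ?_)
    refine enorm_sub_le.trans (add_le_add ?_ ?_)
    · have := hn θ hθ
      rw [← Real.norm_eq_abs, ← coe_nnnorm] at this
      exact ENNReal.coe_le_coe.2 (by exact_mod_cast this)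
    · exact (enorm_intervalIntegral_le hT.le).trans hg1
  calc ∫⁻ θ in Set.Ioc (0 : ℝ) 1, ‖shiftedSum T n y θ - ∫ s in (0 : ℝ)..T, y s‖ₑ
      ≤ ∫⁻ θ in Set.Ioc (0 : ℝ) 1, (‖shiftedSum T n (fun s => y s - g s) θ‖ₑ + (ε' + ε')) :=
        setLIntegral_mono' measurableSet_Ioc hsum
    _ = (∫⁻ θ in Set.Ioc (0 : ℝ) 1, ‖shiftedSum T n (fun s => y s - g s) θ‖ₑ) + (ε' + ε') := by
        rw [lintegral_add_right _ measurable_const, lintegral_const_Ioc]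
    _ ≤ ε' + (ε' + ε') := by
        gcongr
        exact (lintegral_shiftedSum_le (hy.sub hg2.measurable) hT n).trans hg1
    _ = ((3 * ε' : ℝ≥0) : ℝ≥0∞) := by push_cast; ring
    _ ≤ ε := hεle

/-- Shifted Riemann sums converge in mean, jointly in a parameter and in the shift. -/
theorem shiftedSum_tendsto_param {β : Type*} [MeasurableSpace β] (κ : Measure β) [SFinite κ]
    {y : β → ℝ → ℝ} (hy : Measurable (Function.uncurry y)) {T : ℝ} (hT : 0 < T)
    (hfin : ∫⁻ b, (∫⁻ s in Set.Ioc 0 T, ‖y b s‖ₑ) ∂κ ≠ ⊤) :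
    Tendsto (fun n => ∫⁻ θ in Set.Ioc (0 : ℝ) 1, ∫⁻ b,
      ‖shiftedSum T n (y b) θ - ∫ s in (0 : ℝ)..T, y b s‖ₑ ∂κ) atTop (𝓝 0) := by
  have hyb : ∀ b, Measurable (y b) := fun b => hy.comp measurable_prodMk_left
  have hIm : Measurable fun b => ∫ s in (0 : ℝ)..T, y b s :=
    measurable_intervalIntegral_param measurable_const hy
  have hJm : Measurable fun b => ∫⁻ s in Set.Ioc 0 T, ‖y b s‖ₑ :=
    Measurable.lintegral_prod_right hy.enorm
  have hm : ∀ n, Measurable fun p : β × ℝ =>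
      ‖shiftedSum T n (y p.1) p.2 - ∫ s in (0 : ℝ)..T, y p.1 s‖ₑ := fun n =>
    ((measurable_shiftedSum hy T n).sub (hIm.comp measurable_fst)).enorm
  have hswap : ∀ n, ∫⁻ θ in Set.Ioc (0 : ℝ) 1, ∫⁻ b,
      ‖shiftedSum T n (y b) θ - ∫ s in (0 : ℝ)..T, y b s‖ₑ ∂κ =
      ∫⁻ b, (∫⁻ θ in Set.Ioc (0 : ℝ) 1,
        ‖shiftedSum T n (y b) θ - ∫ s in (0 : ℝ)..T, y b s‖ₑ) ∂κ := fun n => by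
    rw [lintegral_lintegral_swap]
    exact ((hm n).comp measurable_swap).aemeasurable
  simp only [hswap]
  rw [show (0 : ℝ≥0∞) = ∫⁻ _, 0 ∂κ by simp]
  refine tendsto_lintegral_of_dominated_convergence
    (fun b => 2 * ∫⁻ s in Set.Ioc 0 T, ‖y b s‖ₑ) (fun n => ?_) (fun n => ae_of_all _ fun b => ?_)
    ?_ ?_
  · exact Measurable.lintegral_prod_right (hm n)
  · calc ∫⁻ θ in Set.Ioc (0 : ℝ) 1, ‖shiftedSum T n (y b) θ - ∫ s in (0 : ℝ)..T, y b s‖ₑ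
        ≤ ∫⁻ θ in Set.Ioc (0 : ℝ) 1,
          (‖shiftedSum T n (y b) θ‖ₑ + ∫⁻ s in Set.Ioc 0 T, ‖y b s‖ₑ) :=
          lintegral_mono fun θ => enorm_sub_le.trans
            (add_le_add le_rfl (enorm_intervalIntegral_le hT.le))
      _ = (∫⁻ θ in Set.Ioc (0 : ℝ) 1, ‖shiftedSum T n (y b) θ‖ₑ) +
          ∫⁻ s in Set.Ioc 0 T, ‖y b s‖ₑ := by
          rw [lintegral_add_right _ measurable_const, lintegral_const_Ioc]
      _ ≤ _ := by
          beta_reduce; rw [two_mul]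
          exact add_le_add (lintegral_shiftedSum_le (hyb b) hT n) le_rfl
  · rw [lintegral_const_mul _ hJm]
    exact ENNReal.mul_ne_top (by simp) hfin
  · filter_upwards [ae_lt_top hJm hfin] with b hb
    exact shiftedSum_tendsto (hyb b) hT ⟨(hyb b).aestronglyMeasurable, hb⟩

end Riemann

/-! ### Measurability of pairings and the immigration functional -/

section Pairing

instance (ν : IntMeas) : IsFiniteMeasure ν.1 := ν.2.1

/-- The tautological kernel `ν ↦ ν`. -/
def coordKernel : Kernel IntMeas ℝ := ⟨Subtype.val, measurable_subtype_coe⟩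

/-- The total mass is not bounded on `IntMeas`, but it takes integer values; restricting the kernel
to the measures of mass `n` gives countably many finite kernels that sum to it. -/
instance : IsSFiniteKernel coordKernel := by
  classical
  have hs : ∀ n : ℕ, MeasurableSet {ν : IntMeas | ν.1 Set.univ = n} := fun n =>
    (Measure.measurable_coe MeasurableSet.univ).comp measurable_subtype_coe
      (measurableSet_singleton (n : ℝ≥0∞))
  refine ⟨fun n => Kernel.piecewise (hs n) coordKernel 0, fun n => ?_, ?_⟩
  · refine ⟨(n : ℝ≥0∞), by simp, fun ν => ?_⟩
    rw [Kernel.piecewise_apply']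
    split_ifs with h
    · exact le_of_eq h
    · simp
  · ext ν B hB
    rw [Kernel.sum_apply' _ _ hB]
    obtain ⟨m, hm⟩ := ν.2.2.2 Set.univ MeasurableSet.univ
    rw [tsum_eq_single m]
    · rw [Kernel.piecewise_apply']; exact (if_pos hm).symm
    · intro k hk
      rw [Kernel.piecewise_apply', if_neg]
      · simp
      · intro h
        have h' : ν.1 Set.univ = k := h
        rw [hm] at h'
        exact hk (by exact_mod_cast h'.symm)

lemma measurable_pair_param {β : Type*} [MeasurableSpace β] {u : β → ℝ → ℝ}
    (hu : Measurable (Function.uncurry u)) :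
    Measurable fun q : β × IntMeas => pair q.2.1 (u q.1) := by
  have h1 : Measurable (Function.uncurry fun (q : β × IntMeas) (x : ℝ) => u q.1 x) := by
    have : Measurable fun z : (β × IntMeas) × ℝ => (z.1.1, z.2) := by fun_prop
    exact hu.comp this
  exact (h1.stronglyMeasurable.integral_kernel_prod_right
    (κ := coordKernel.comap Prod.snd measurable_snd)).measurable

lemma measurable_pair {u : ℝ → ℝ} (hu : Measurable u) :
    Measurable fun ν : IntMeas => pair ν.1 u :=
  (measurable_pair_param (β := Unit) (u := fun _ => u) (hu.comp measurable_snd)).comp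
    (measurable_const (a := ()) |>.prodMk measurable_id)

lemma pair_nonneg (ν : Measure ℝ) {u : ℝ → ℝ} (hu : ∀ x, 0 ≤ u x) : 0 ≤ pair ν u :=
  integral_nonneg hu

lemma exp_neg_le_one {y : ℝ} (hy : 0 ≤ y) : Real.exp (-y) ≤ 1 := by
  rw [Real.exp_le_one_iff]; linarith

lemma abs_exp_neg_sub_le {a b : ℝ} (ha : 0 ≤ a) (hb : 0 ≤ b) :
    |Real.exp (-a) - Real.exp (-b)| ≤ |a - b| := by
  have key : ∀ {a b : ℝ}, 0 ≤ a → a ≤ b → Real.exp (-a) - Real.exp (-b) ≤ b - a := by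
    intro a b ha hab
    have := oneSubExp_sub_le ha hab
    simp only [oneSubExp] at this
    linarith
  rcases le_total a b with h | h
  · rw [abs_of_nonneg (sub_nonneg.2 (Real.exp_le_exp.2 (by linarith))), abs_sub_comm,
      abs_of_nonneg (sub_nonneg.2 h)]
    exact key ha h
  · rw [abs_sub_comm, abs_of_nonneg (sub_nonneg.2 (Real.exp_le_exp.2 (by linarith))),
      abs_of_nonneg (sub_nonneg.2 h)]
    exact key hb h

variable {L : Measure IntMeas} [IsFiniteMeasure L]

lemma measurable_immigration {β : Type*} [MeasurableSpace β] {u : β → ℝ → ℝ}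
    (hu : Measurable (Function.uncurry u)) : Measurable fun b => immigration L (u b) := by
  have h1 : Measurable fun q : β × IntMeas => 1 - Real.exp (-pair q.2.1 (u q.1)) :=
    measurable_const.sub (measurable_pair_param hu).neg.exp
  exact (h1.stronglyMeasurable.integral_prod_right' (ν := L)).measurable

lemma immigration_nonneg {L : Measure IntMeas} {u : ℝ → ℝ} (hu : ∀ x, 0 ≤ u x) :
    0 ≤ immigration L u :=
  integral_nonneg fun ν => by
    have := exp_neg_le_one (pair_nonneg ν.1 hu)
    simpa using this

lemma immigration_le {u : ℝ → ℝ} (hu : ∀ x, 0 ≤ u x) : immigration L u ≤ L.real Set.univ := by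
  have := norm_integral_le_of_norm_le_const (μ := L) (C := 1)
    (f := fun ν : IntMeas => 1 - Real.exp (-pair ν.1 u)) (ae_of_all _ fun ν => by
      have h1 := exp_neg_le_one (pair_nonneg ν.1 hu)
      have h2 := Real.exp_pos (-pair ν.1 u)
      rw [Real.norm_eq_abs, abs_le]; constructor <;> linarith)
  rw [one_mul] at this
  exact (le_abs_self _).trans this

lemma integrable_exp_neg_pair {u : ℝ → ℝ} (hm : Measurable u) (hu : ∀ x, 0 ≤ u x) :
    Integrable (fun ν : IntMeas => Real.exp (-pair ν.1 u)) L :=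
  integrable_of_bounded (measurable_pair hm).neg.exp (B := 1) fun ν => by
    rw [abs_of_pos (Real.exp_pos _)]; exact exp_neg_le_one (pair_nonneg ν.1 hu)

lemma intervalIntegrable_immigration {u : ℝ → ℝ → ℝ} (hu : Measurable (Function.uncurry u))
    (h0 : ∀ t x, 0 ≤ u t x) (a b : ℝ) :
    IntervalIntegrable (fun s => immigration L (u s)) volume a b := by
  have key : ∀ c d : ℝ, IntegrableOn (fun s => immigration L (u s)) (Set.Ioc c d) volume :=
    fun c d => Measure.integrableOn_of_bounded (M := L.real Set.univ) (by simp)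
      (measurable_immigration hu).aestronglyMeasurable (ae_of_all _ fun s => by
        rw [Real.norm_of_nonneg (immigration_nonneg (h0 s))]; exact immigration_le (h0 s))
  exact ⟨key a b, key b a⟩

lemma enorm_pair_sub_le (ν : Measure ℝ) [IsFiniteMeasure ν] {u u' : ℝ → ℝ} {B B' : ℝ}
    (hm : Measurable u) (hm' : Measurable u') (hB : ∀ x, |u x| ≤ B) (hB' : ∀ x, |u' x| ≤ B') :
    ‖pair ν u - pair ν u'‖ₑ ≤ ∫⁻ x, ‖u x - u' x‖ₑ ∂ν := by
  rw [pair, pair, ← integral_sub (integrable_of_bounded hm hB) (integrable_of_bounded hm' hB')]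
  exact enorm_integral_le_lintegral_enorm _

lemma enorm_exp_neg_sub_le {a b : ℝ} (ha : 0 ≤ a) (hb : 0 ≤ b) :
    ‖Real.exp (-a) - Real.exp (-b)‖ₑ ≤ ‖a - b‖ₑ := by
  have := abs_exp_neg_sub_le ha hb
  rw [← Real.norm_eq_abs, ← Real.norm_eq_abs] at this
  exact enorm_le_iff_norm_le.2 this

lemma enorm_immigration_sub_le {u u' : ℝ → ℝ} {B B' : ℝ}
    (hm : Measurable u) (hm' : Measurable u') (h0 : ∀ x, 0 ≤ u x) (h0' : ∀ x, 0 ≤ u' x)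
    (hB : ∀ x, u x ≤ B) (hB' : ∀ x, u' x ≤ B') :
    ‖immigration L u - immigration L u'‖ₑ ≤ ∫⁻ ν : IntMeas, ∫⁻ x, ‖u x - u' x‖ₑ ∂ν.1 ∂L := by
  have i1 : Integrable (fun ν : IntMeas => 1 - Real.exp (-pair ν.1 u)) L :=
    (integrable_const (1 : ℝ)).sub (integrable_exp_neg_pair hm h0)
  have i2 : Integrable (fun ν : IntMeas => 1 - Real.exp (-pair ν.1 u')) L :=
    (integrable_const (1 : ℝ)).sub (integrable_exp_neg_pair hm' h0')
  have e : immigration L u - immigration L u' =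
      ∫ ν : IntMeas, (Real.exp (-pair ν.1 u') - Real.exp (-pair ν.1 u)) ∂L := by
    rw [immigration, immigration, ← integral_sub i1 i2]
    congr 1; ext ν; simp
  rw [e]
  refine (enorm_integral_le_lintegral_enorm _).trans (lintegral_mono fun ν => ?_)
  rw [← enorm_neg, neg_sub]
  refine (enorm_exp_neg_sub_le (pair_nonneg _ h0) (pair_nonneg _ h0')).trans ?_
  exact enorm_pair_sub_le ν.1 hm hm' (fun x => by rw [abs_of_nonneg (h0 x)]; exact hB x)
    (fun x => by rw [abs_of_nonneg (h0' x)]; exact hB' x)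

end Pairing

/-! ### Restarted solutions and observations at finitely many times -/

section Flow

variable {c : ℝ → ℝ → ℝ} {φ : ℝ → ℝ} {C : ℝ} {G : Measure ℝ} [IsProbabilityMeasure G]

/-- Restarting a solution at time `τ`. -/
lemma IsVolterraSolution.restart (hK : VolterraKernel c φ C) {J W : ℝ → ℝ → ℝ}
    (hW : IsVolterraSolution c φ G J W) {τ : ℝ} (hτ : 0 ≤ τ) :
    IsVolterraSolution c φ G (fun s x => W τ (x - s) + (J (τ + s) x - J τ (x - s)))
      (fun s x => W (τ + s) x) := by
  refine ⟨?_, fun s x => hW.nonneg _ _, fun T => ?_, fun s hs x => ?_⟩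
  · have : Measurable fun p : ℝ × ℝ => (τ + p.1, p.2) := by fun_prop
    exact hW.measurable.comp this
  · obtain ⟨B, hB⟩ := hW.locallyBounded (τ + T)
    exact ⟨B, fun t ht x => hB _ ⟨by linarith [ht.1], by linarith [ht.2]⟩ x⟩
  · set m : ℝ → ℝ := fun t => ∫ y, φ (W t y) ∂G with hm
    have hmm : Measurable m := measurable_integral_snd hW.measurable hK.meas'
    obtain ⟨B, hB⟩ := hW.locallyBounded (τ + s)
    have hmB : ∀ t ∈ Set.Icc 0 (τ + s), 0 ≤ m t ∧ m t ≤ B := fun t ht =>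
      ⟨integral_phi_nonneg hK (hW.nonneg t), integral_phi_le hK
        (hW.measurable.comp measurable_prodMk_left) (hW.nonneg t) (hB t ht)⟩
    have e1 := hW.eqn (τ + s) (by linarith) x
    have e2 := hW.eqn τ hτ (x - s)
    have hii := intervalIntegrable_volterra hK hmm (by linarith) hmB x
    -- The birth integral over `[0, τ + s]` is cut at `s`: after a shift of the variable, the later
    -- piece is the birth integral of the equation at time `τ` and point `x - s`.
    have hsplit := intervalIntegral.integral_add_adjacent_intervals
      (a := 0) (b := s) (c := τ + s) (μ := volume) (f := fun r => c (x - r) (m (τ + s - r)))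
      (hii.mono_set (by
        rw [Set.uIcc_of_le hs, Set.uIcc_of_le (by linarith)]
        exact Set.Icc_subset_Icc le_rfl (by linarith)))
      (hii.mono_set (by
        rw [Set.uIcc_of_le (by linarith), Set.uIcc_of_le (by linarith)]
        exact Set.Icc_subset_Icc hs le_rfl))
    have hshift : ∫ r in s..(τ + s), c (x - r) (m (τ + s - r)) =
        ∫ r in (0 : ℝ)..τ, c (x - s - r) (m (τ - r)) := by
      have := intervalIntegral.integral_comp_add_right (a := 0) (b := τ)
        (fun r => c (x - r) (m (τ + s - r))) s
      rw [zero_add] at this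
      rw [← this]
      refine intervalIntegral.integral_congr fun r _ => ?_
      rw [show x - (r + s) = x - s - r by ring, show τ + s - (r + s) = τ - r by ring]
    rw [e1, e2]
    change J (τ + s) x + ∫ r in (0 : ℝ)..(τ + s), c (x - r) (m (τ + s - r)) =
      J τ (x - s) + (∫ r in (0 : ℝ)..τ, c (x - s - r) (m (τ - r))) +
        (J (τ + s) x - J τ (x - s)) + ∫ r in (0 : ℝ)..s, c (x - r) (m (τ + (s - r)))
    have e3 : ∫ r in (0 : ℝ)..s, c (x - r) (m (τ + (s - r))) =
        ∫ r in (0 : ℝ)..s, c (x - r) (m (τ + s - r)) := by simp only [add_sub_assoc]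
    rw [e3, ← hsplit, hshift]
    ring

end Flow

section Obs

variable {α : ℝ → ℝ} {p : ℕ → ℝ → ℝ} {G : Measure ℝ}

lemma IsBranchingMechanism.birth_zero (h : IsBranchingMechanism α p G) {y : ℝ} (hy : y ≤ 0)
    (q : ℝ) : birth α p y q = 0 := by
  simp [birth, h.rate.zero_of_nonpos y hy]

lemma IsBranchingMechanism.memB_solution (h : IsBranchingMechanism α p G) {J W : ℝ → ℝ → ℝ}
    (hW : IsVolterraSolution (birth α p) oneSubExp G J W) (hJ : ∀ t ≥ 0, ∀ x ≤ 0, J t x = 0)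
    {t : ℝ} (ht : 0 ≤ t) : MemB (W t) := by
  obtain ⟨B, hB⟩ := hW.locallyBounded t
  refine ⟨hW.measurable.comp measurable_prodMk_left, ⟨B, fun x => ?_⟩, fun x hx => ?_⟩
  · rw [abs_of_nonneg (hW.nonneg t x)]; exact hB t ⟨ht, le_rfl⟩ x
  · rw [hW.eqn t ht x, hJ t ht x hx, zero_add]
    refine (intervalIntegral.integral_congr fun s hs => ?_).trans intervalIntegral.integral_zero
    rw [Set.uIcc_of_le ht] at hs
    exact h.birth_zero (by linarith [hs.1]) _

/-- The forcing term of observations of `F` with weight `h` at the times `t k`, `k ∈ K`, seen at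
remaining time `s` before the horizon `T`. -/
def obsForcing (K : Finset ℕ) (t : ℕ → ℝ≥0) (h : ℝ) (F : ℝ → ℝ) (T s x : ℝ) : ℝ :=
  ∑ k ∈ K, h * if T - s ≤ t k then F (x - (t k - (T - s))) else 0

variable {K : Finset ℕ} {t : ℕ → ℝ≥0} {h : ℝ} {F : ℝ → ℝ} {T : ℝ}

lemma isForcing_obsForcing (hF : MemB F) (h0 : ∀ x, 0 ≤ F x) (hh : 0 ≤ h) :
    IsForcing (obsForcing K t h F T) := by
  obtain ⟨C, hC⟩ := hF.bounded
  have hC0 : 0 ≤ C := (abs_nonneg _).trans (hC 0)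
  refine ⟨?_, fun s _ x => Finset.sum_nonneg fun k _ => mul_nonneg hh ?_, fun S =>
    ⟨∑ _k ∈ K, h * C, fun s _ x => Finset.sum_le_sum fun k _ => mul_le_mul_of_nonneg_left ?_ hh⟩⟩
  · refine Finset.measurable_sum _ fun k _ => Measurable.const_mul ?_ _
    refine Measurable.ite (measurableSet_le (by fun_prop) measurable_const) ?_ measurable_const
    exact hF.measurable.comp (by fun_prop)
  · split_ifs
    · exact h0 _
    · exact le_rfl
  · split_ifs
    · exact (le_abs_self _).trans (hC _)
    · exact hC0

lemma obsForcing_zero (hF : MemB F) (s : ℝ) {x : ℝ} (hx : x ≤ 0) :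
    obsForcing K t h F T s x = 0 := by
  refine Finset.sum_eq_zero fun k _ => ?_
  split_ifs with hk
  · rw [hF.zero_of_nonpos _ (by linarith), mul_zero]
  · rw [mul_zero]

/-- An observation counted at remaining time `τ` and point `x - s` is counted at `τ + s` and point
`x` with the same argument of `F`; the additional terms are nonnegative. This makes the restarted
forcing admissible. -/
lemma obsForcing_shift_le (h0 : ∀ x, 0 ≤ F x) (hh : 0 ≤ h) (τ : ℝ) {s : ℝ}
    (hs : 0 ≤ s) (x : ℝ) :
    obsForcing K t h F T τ (x - s) ≤ obsForcing K t h F T (τ + s) x := by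
  refine Finset.sum_le_sum fun k _ => mul_le_mul_of_nonneg_left ?_ hh
  split_ifs with h1 h2 h2
  · exact le_of_eq (congrArg F (by ring))
  · exact absurd (by linarith) h2
  · exact h0 _
  · exact le_rfl

/-- If there is no observation time in `(r, r')`, the solution between `r'` and `r` is the
cumulant flow, up to the observations at time `r` itself. -/
lemma obsForcing_sub {r r' : ℝ} (hr : r ≤ r') (hno : ∀ k ∈ K, ¬ (r < t k ∧ t k < r')) (x : ℝ) :
    obsForcing K t h F T (T - r) x - obsForcing K t h F T (T - r') (x - (r' - r)) =
      if r < r' then ∑ k ∈ K, h * (if (t k : ℝ) = r then F x else 0) else 0 := by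
  split_ifs with hrr
  · rw [obsForcing, obsForcing, ← Finset.sum_sub_distrib]
    refine Finset.sum_congr rfl fun k hk => ?_
    rw [← mul_sub]
    congr 1
    rw [sub_sub_cancel, sub_sub_cancel]
    rcases lt_trichotomy (t k : ℝ) r with h1 | h1 | h1
    · rw [if_neg (by linarith), if_neg (by linarith), if_neg h1.ne, sub_zero]
    · rw [if_pos h1.ge, if_neg (by linarith), if_pos h1, h1, sub_self, sub_zero, sub_zero]
    · have h2 : r' ≤ t k := not_lt.1 fun h' => hno k hk ⟨h1, h'⟩
      rw [if_pos h1.le, if_pos h2, if_neg h1.ne']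
      rw [sub_eq_zero]; congr 1; ring
  · have : r = r' := le_antisymm hr (not_lt.1 hrr)
    subst this
    simp

/-- Within an open interval free of observation times the forcing is transported along
characteristics. The right endpoint is excluded, since an observation at time `r` itself would enter
there. -/
lemma obsForcing_eq_shift {r r' q : ℝ} (hno : ∀ k ∈ K, ¬ (r < t k ∧ t k < r')) (hq : 0 < q)
    (hq' : q < r' - r) (x : ℝ) :
    obsForcing K t h F T (T - r' + q) x = obsForcing K t h F T (T - r') (x - q) := by
  have := obsForcing_sub (K := K) (t := t) (h := h) (F := F) (T := T) (r := r' - q) (r' := r')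
    (by linarith) (fun k hk hk' => hno k hk ⟨by linarith [hk'.1], hk'.2⟩) x
  rw [if_pos (by linarith), Finset.sum_eq_zero, sub_eq_zero] at this
  · convert this using 2 <;> ring
  · intro k hk
    rw [if_neg, mul_zero]
    intro hk'
    exact hno k hk ⟨by linarith, by linarith⟩

/-- Restarted at remaining time `T - r'`, `W` and the cumulant flow solve the same equation, with
forcings that differ at most at the endpoint `q = r' - r`. Their `L¹` distance is zero, so by
`volterra_stability` the solutions minus their forcings agree at every time, the endpoint included.
-/
lemma IsBranchingMechanism.flow_obs (hm : IsBranchingMechanism α p G) (hF : MemB F)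
    (h0 : ∀ x, 0 ≤ F x) (hh : 0 ≤ h) {W : ℝ → ℝ → ℝ}
    (hW : IsVolterraSolution (birth α p) oneSubExp G (obsForcing K t h F T) W)
    {r r' : ℝ} (hr : r ≤ r') (hr' : r' ≤ T) (hno : ∀ k ∈ K, ¬ (r < t k ∧ t k < r')) :
    ∀ s ∈ Set.Icc 0 (r' - r), ∀ x, W (T - r' + s) x =
      cumulant α p G (W (T - r')) s x + (obsForcing K t h F T (T - r' + s) x -
        obsForcing K t h F T (T - r') (x - s)) := by
  have := hm.prob
  obtain ⟨C, hC0, hC⟩ := hm.exists_bound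
  have hK := hm.volterraKernel_birth hC0 hC
  have hτ : 0 ≤ T - r' := by linarith
  have hWB := hm.memB_solution hW (fun _ _ _ hx => obsForcing_zero hF _ hx) hτ
  have hV := hW.restart hK hτ
  have hu := hm.isCumulantSolution_cumulant hWB (hW.nonneg _)
  have hJ' := isForcing_shift hWB (hW.nonneg _)
  have hJo := isForcing_obsForcing (K := K) (t := t) (T := T) hF h0 hh
  have hJ : IsForcing fun s x => W (T - r') (x - s) + (obsForcing K t h F T (T - r' + s) x -
      obsForcing K t h F T (T - r') (x - s)) := by
    refine ⟨hJ'.measurable.add (Measurable.sub ?_ ?_), fun s hs x => ?_, fun S => ?_⟩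
    · have : Measurable fun p : ℝ × ℝ => (T - r' + p.1, p.2) := by fun_prop
      exact hJo.measurable.comp this
    · have : Measurable fun p : ℝ × ℝ => (T - r', p.2 - p.1) := by fun_prop
      exact hJo.measurable.comp this
    · exact add_nonneg (hW.nonneg _ _) (sub_nonneg.2 (obsForcing_shift_le h0 hh _ hs x))
    · obtain ⟨B, hB⟩ := hWB.bounded
      obtain ⟨B', hB'⟩ := hJo.locallyBounded (T - r' + S)
      refine ⟨B + B', fun s hs x => ?_⟩
      have h1 := (le_abs_self _).trans (hB (x - s))
      have h2 := hB' (T - r' + s) ⟨by linarith [hs.1], by linarith [hs.2]⟩ x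
      have h3 := hJo.nonneg (T - r') hτ (x - s)
      linarith
  obtain ⟨Kc, -, hst⟩ := volterra_stability (G := G) hK (r' - r)
  intro s hs x
  have key := hst _ _ _ _ hJ hJ' hV hu s hs x
  -- Passing to the open interval discards the endpoint where the two forcings may differ.
  have hz : ∫ q in (0 : ℝ)..(r' - r), ∫ y, |(W (T - r') (y - q) +
      (obsForcing K t h F T (T - r' + q) y - obsForcing K t h F T (T - r') (y - q))) -
      W (T - r') (y - q)| ∂G = 0 := by
    rw [intervalIntegral.integral_of_le (by linarith), integral_Ioc_eq_integral_Ioo]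
    refine setIntegral_eq_zero_of_forall_eq_zero fun q hq => ?_
    simp [obsForcing_eq_shift (T := T) (h := h) (F := F) hno hq.1 hq.2]
  rw [hz, mul_zero] at key
  have := abs_eq_zero.1 (le_antisymm key (abs_nonneg _))
  linarith

lemma pair_obs_sum (ν : Measure ℝ) [IsFiniteMeasure ν] (hF : MemB F) (K : Finset ℕ)
    (P : ℕ → Prop) [DecidablePred P] :
    pair ν (fun x => ∑ k ∈ K, h * (if P k then F x else 0)) =
      ∑ k ∈ K, h * (if P k then pair ν F else 0) := by
  obtain ⟨C, hC⟩ := hF.bounded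
  rw [pair, integral_finsetSum]
  · refine Finset.sum_congr rfl fun k _ => ?_
    rw [integral_const_mul]
    split_ifs <;> simp [pair]
  · intro k _
    refine Integrable.const_mul ?_ _
    split_ifs
    · exact integrable_of_bounded hF.measurable hC
    · exact integrable_zero _ _ _

variable {Ω : Type*} {mΩ : MeasurableSpace Ω} {μ : Measure Ω} [IsProbabilityMeasure μ]
  {L : Measure IntMeas} {ℱ : Filtration ℝ≥0 mΩ} {Y : ℝ≥0 → Ω → IntMeas}

/-- Conditioning on `ℱ r` takes the factor `e^{-S}` out, and the Laplace functional of the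
transition kernel over a time `δ` replaces `w` by its cumulant, with a deterministic immigration
factor. -/
lemma IsImmigrationProcess.markov_step (hY : IsImmigrationProcess α p G L μ ℱ Y)
    {w : ℝ → ℝ} (hw : MemB w) (hw0 : ∀ x, 0 ≤ w x) (r δ : ℝ≥0) {S : Ω → ℝ}
    (hS : Measurable[ℱ r] S) (hS0 : ∀ ω, 0 ≤ S ω) :
    ∫ ω, Real.exp (-S ω) * Real.exp (-pair (Y (r + δ) ω).1 w) ∂μ =
      (∫ ω, Real.exp (-S ω) * Real.exp (-pair (Y r ω).1 (cumulant α p G w δ)) ∂μ) *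
        Real.exp (-∫ s in (0 : ℝ)..δ, immigration L (cumulant α p G w s)) := by
  obtain ⟨P, ⟨-, hP⟩, hM⟩ := hY.markov
  have hYm : ∀ s, Measurable (Y s) := fun s => (hY.adapted s).mono (ℱ.le s) le_rfl
  set Fn : IntMeas → ℝ := fun ν => Real.exp (-pair ν.1 w) with hFn
  have hFm : Measurable Fn := (measurable_pair hw.measurable).neg.exp
  have hF1 : ∀ ν, |Fn ν| ≤ 1 := fun ν => by
    rw [abs_of_pos (Real.exp_pos _)]; exact exp_neg_le_one (pair_nonneg _ hw0)
  have hSm : Measurable S := hS.mono (ℱ.le r) le_rfl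
  have hE1 : ∀ ω, |Real.exp (-S ω)| ≤ 1 := fun ω => by
    rw [abs_of_pos (Real.exp_pos _)]; exact exp_neg_le_one (hS0 ω)
  have hc := hM r δ Fn hFm ⟨1, hF1⟩
  have hgi : Integrable (fun ω => Fn (Y (r + δ) ω)) μ :=
    integrable_of_bounded (hFm.comp (hYm _)) fun ω => hF1 _
  have hprod : Integrable ((fun ω => Real.exp (-S ω)) * fun ω => Fn (Y (r + δ) ω)) μ :=
    integrable_of_bounded (hSm.neg.exp.mul (hFm.comp (hYm _))) (B := 1) fun ω => by
      rw [Pi.mul_apply, abs_mul]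
      exact mul_le_one₀ (hE1 ω) (abs_nonneg _) (hF1 _)
  have hpull := condExp_mul_of_stronglyMeasurable_left (m := ℱ r) (μ := μ)
    (f := fun ω => Real.exp (-S ω)) (g := fun ω => Fn (Y (r + δ) ω))
    (Measurable.stronglyMeasurable (hS.neg.exp)) hprod hgi
  calc ∫ ω, Real.exp (-S ω) * Fn (Y (r + δ) ω) ∂μ
      = ∫ ω, (μ[(fun ω => Real.exp (-S ω)) * fun ω => Fn (Y (r + δ) ω) | ℱ r]) ω ∂μ :=
        (integral_condExp (ℱ.le r)).symm
    _ = ∫ ω, Real.exp (-S ω) * (Real.exp (-pair (Y r ω).1 (cumulant α p G w δ)) *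
          Real.exp (-∫ s in (0 : ℝ)..δ, immigration L (cumulant α p G w s))) ∂μ := by
        refine integral_congr_ae ?_
        filter_upwards [hpull, hc] with ω h1 h2
        rw [h1, Pi.mul_apply, h2, hP δ (Y r ω) w hw hw0, sub_eq_add_neg, Real.exp_add]
    _ = _ := by
        rw [← integral_mul_const]
        simp only [mul_assoc]

variable [IsFiniteMeasure L]

/-- Laplace functional of finitely many observations. -/
theorem IsImmigrationProcess.laplace_obs (hm : IsBranchingMechanism α p G)
    (hY : IsImmigrationProcess α p G L μ ℱ Y) (hF : MemB F) (h0 : ∀ x, 0 ≤ F x) (hh : 0 ≤ h)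
    {T : ℝ≥0} (hT : ∀ k ∈ K, t k ≤ T) {W : ℝ → ℝ → ℝ}
    (hW : IsVolterraSolution (birth α p) oneSubExp G (obsForcing K t h F T) W)
    (N : ℕ) : ∀ r : ℝ≥0, r ≤ T → (K.filter fun k => r < t k ∧ t k < T).card ≤ N →
    ∫ ω, Real.exp (-∑ k ∈ K, h * pair (Y (t k) ω).1 F) ∂μ =
      Real.exp (-∫ s in (0 : ℝ)..(T - r), immigration L (W s)) *
      ∫ ω, Real.exp (-((∑ k ∈ K, if t k < r then h * pair (Y (t k) ω).1 F else 0) +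
        pair (Y r ω).1 (W (T - r)))) ∂μ := by
  have hpair : ∀ k ω, 0 ≤ h * pair (Y (t k) ω).1 F := fun k ω => mul_nonneg hh (pair_nonneg _ h0)
  -- at the horizon
  have hbase : ∫ ω, Real.exp (-∑ k ∈ K, h * pair (Y (t k) ω).1 F) ∂μ =
      Real.exp (-∫ s in (0 : ℝ)..((T : ℝ) - T), immigration L (W s)) *
      ∫ ω, Real.exp (-((∑ k ∈ K, if t k < T then h * pair (Y (t k) ω).1 F else 0) +
        pair (Y T ω).1 (W ((T : ℝ) - T)))) ∂μ := by
    rw [sub_self, intervalIntegral.integral_same, neg_zero, Real.exp_zero, one_mul]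
    refine integral_congr_ae (ae_of_all _ fun ω => ?_)
    beta_reduce
    congr 2
    have e : W 0 = fun x => ∑ k ∈ K, h * (if t k = T then F x else 0) := by
      ext x
      rw [hW.eqn 0 le_rfl x, intervalIntegral.integral_same, add_zero, obsForcing]
      refine Finset.sum_congr rfl fun k hk => ?_
      rw [sub_zero]
      by_cases hkT : t k = T
      · rw [if_pos (by rw [hkT]), if_pos hkT, hkT, sub_self, sub_zero]
      · rw [if_neg, if_neg hkT]
        intro h'
        exact hkT (le_antisymm (hT k hk) (by exact_mod_cast h'))
    rw [e, pair_obs_sum _ hF, ← Finset.sum_add_distrib]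
    refine Finset.sum_congr rfl fun k hk => ?_
    rcases (hT k hk).lt_or_eq with h1 | h1
    · rw [if_pos h1, if_neg h1.ne]; ring
    · rw [if_neg (by rw [h1]; exact lt_irrefl _), if_pos h1, h1]; ring
  -- between consecutive observation times
  have hstep : ∀ r r' : ℝ≥0, r < r' → r' ≤ T → (∀ k ∈ K, ¬ (r < t k ∧ t k < r')) →
      Real.exp (-∫ s in (0 : ℝ)..(T - r'), immigration L (W s)) *
      ∫ ω, Real.exp (-((∑ k ∈ K, if t k < r' then h * pair (Y (t k) ω).1 F else 0) +
        pair (Y r' ω).1 (W (T - r')))) ∂μ =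
      Real.exp (-∫ s in (0 : ℝ)..(T - r), immigration L (W s)) *
      ∫ ω, Real.exp (-((∑ k ∈ K, if t k < r then h * pair (Y (t k) ω).1 F else 0) +
        pair (Y r ω).1 (W (T - r)))) ∂μ := by
    intro r r' hr hr' hno
    have hrR : (r : ℝ) < r' := by exact_mod_cast hr
    have hrT : (r' : ℝ) ≤ T := by exact_mod_cast hr'
    have hno' : ∀ k ∈ K, ¬ ((r : ℝ) < t k ∧ (t k : ℝ) < r') := fun k hk hk' =>
      hno k hk (by exact_mod_cast hk')
    -- Observations at time `r` itself belong to `S`, which is still `ℱ r`-measurable. In `e2` they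
    -- are absorbed by the jump of `W` at remaining time `T - r`.
    set S : Ω → ℝ := fun ω => ∑ k ∈ K, if t k ≤ r then h * pair (Y (t k) ω).1 F else 0 with hS
    have hSm : Measurable[ℱ r] S := by
      refine Finset.measurable_sum _ fun k _ => ?_
      by_cases hk : t k ≤ r
      · simp only [if_pos hk]
        exact ((measurable_pair hF.measurable).comp
          ((hY.adapted (t k)).mono (ℱ.mono hk) le_rfl)).const_mul h
      · simp only [if_neg hk]
        exact measurable_const
    have hS0 : ∀ ω, 0 ≤ S ω := fun ω => Finset.sum_nonneg fun k _ => by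
      split_ifs
      · exact hpair k ω
      · exact le_rfl
    set w := W (T - r') with hw
    have hwB : MemB w := hm.memB_solution hW (fun _ _ _ hx => obsForcing_zero hF _ hx)
      (by linarith)
    obtain ⟨δ, hδ⟩ : ∃ δ : ℝ≥0, r' = r + δ := ⟨r' - r, by rw [add_tsub_cancel_of_le hr.le]⟩
    have hδR : (r' : ℝ) = r + δ := by rw [hδ]; push_cast; rfl
    have hms := hY.markov_step hwB (hW.nonneg _) r δ hSm hS0
    have hflow := hm.flow_obs hF h0 hh hW hrR.le hrT hno'
    have e1 : ∀ ω, Real.exp (-((∑ k ∈ K, if t k < r' then h * pair (Y (t k) ω).1 F else 0) +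
        pair (Y r' ω).1 w)) = Real.exp (-S ω) * Real.exp (-pair (Y (r + δ) ω).1 w) := by
      intro ω
      rw [← Real.exp_add, ← hδ, neg_add]
      congr 3
      refine Finset.sum_congr rfl fun k hk => ?_
      by_cases hk1 : t k ≤ r
      · rw [if_pos hk1, if_pos (hk1.trans_lt hr)]
      · rw [if_neg hk1, if_neg fun hk2 => hno k hk ⟨not_le.1 hk1, hk2⟩]
    have hcumB : MemB (cumulant α p G w δ) :=
      hm.memB_solution (hm.isCumulantSolution_cumulant hwB (hW.nonneg _))
        (fun s hs x hx => hwB.zero_of_nonpos _ (by linarith)) δ.coe_nonneg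
    have e2 : ∀ ω, Real.exp (-((∑ k ∈ K, if t k < r then h * pair (Y (t k) ω).1 F else 0) +
        pair (Y r ω).1 (W (T - r)))) =
        Real.exp (-S ω) * Real.exp (-pair (Y r ω).1 (cumulant α p G w δ)) := by
      intro ω
      have ew : W (T - r) = fun x => cumulant α p G w δ x +
          ∑ k ∈ K, h * (if t k = r then F x else 0) := by
        ext x
        have h1 := hflow (r' - r) ⟨by linarith, le_rfl⟩ x
        rw [show (T : ℝ) - r' + (r' - r) = T - r by ring, obsForcing_sub hrR.le hno',
          if_pos hrR, show (r' : ℝ) - r = δ by rw [hδR]; ring] at h1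
        rw [h1]
        simp only [NNReal.coe_inj]
        rfl
      have ep : pair (Y r ω).1 (W (T - r)) = pair (Y r ω).1 (cumulant α p G w δ) +
          ∑ k ∈ K, h * (if t k = r then pair (Y r ω).1 F else 0) := by
        rw [ew, ← pair_obs_sum _ hF K fun k => t k = r, pair, integral_add]
        · rfl
        · obtain ⟨B, hB⟩ := hcumB.bounded
          exact integrable_of_bounded hcumB.measurable hB
        · obtain ⟨B, hB⟩ := hF.bounded
          refine integrable_finsetSum _ fun k _ => Integrable.const_mul ?_ _
          split_ifs
          · exact integrable_of_bounded hF.measurable hB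
          · exact integrable_zero _ _ _
      rw [← Real.exp_add, ep]
      congr 1
      have : ∑ k ∈ K, (if t k ≤ r then h * pair (Y (t k) ω).1 F else 0) =
          ∑ k ∈ K, (if t k < r then h * pair (Y (t k) ω).1 F else 0) +
          ∑ k ∈ K, h * (if t k = r then pair (Y r ω).1 F else 0) := by
        rw [← Finset.sum_add_distrib]
        refine Finset.sum_congr rfl fun k hk => ?_
        rcases lt_trichotomy (t k) r with h1 | h1 | h1
        · rw [if_pos h1.le, if_pos h1, if_neg h1.ne]; ring
        · rw [if_pos h1.le, if_neg (by rw [h1]; exact lt_irrefl _), if_pos h1, h1]; ring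
        · rw [if_neg (not_le.2 h1), if_neg (not_lt.2 h1.le), if_neg h1.ne']; ring
      change S ω = _ at this
      rw [this]; ring
    have e3 : ∫ s in (0 : ℝ)..(T - r), immigration L (W s) =
        (∫ s in (0 : ℝ)..(T - r'), immigration L (W s)) +
          ∫ s in (0 : ℝ)..δ, immigration L (cumulant α p G w s) := by
      rw [← intervalIntegral.integral_add_adjacent_intervals (b := T - r')
        (intervalIntegrable_immigration hW.measurable hW.nonneg _ _)
        (intervalIntegrable_immigration hW.measurable hW.nonneg _ _)]
      congr 1
      have h1 := intervalIntegral.integral_comp_add_left (a := 0) (b := (δ : ℝ))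
        (fun s => immigration L (W s)) (T - r')
      rw [add_zero, show (T : ℝ) - r' + δ = T - r by rw [hδR]; ring] at h1
      -- The flow identity holds without correction only inside the interval; the endpoint, where
      -- `W` may jump, is negligible for the integral.
      rw [← h1, intervalIntegral.integral_of_le δ.coe_nonneg,
        intervalIntegral.integral_of_le δ.coe_nonneg, integral_Ioc_eq_integral_Ioo,
        integral_Ioc_eq_integral_Ioo]
      refine setIntegral_congr_fun measurableSet_Ioo fun s hs => ?_
      congr 1
      ext x
      have hs2 : s < r' - r := by rw [hδR]; have := hs.2; linarith
      rw [hflow s ⟨hs.1.le, hs2.le⟩ x, obsForcing_eq_shift hno' hs.1 hs2, sub_self, add_zero]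
    simp only [e1, e2]
    rw [hms, e3, neg_add, Real.exp_add]
    ring
  induction N with
  | zero =>
    intro r hr hcard
    rcases hr.lt_or_eq with h1 | rfl
    · rw [hbase]
      refine hstep r T h1 le_rfl fun k hk hk' => ?_
      have := Finset.card_eq_zero.1 (Nat.le_zero.1 hcard)
      exact Finset.notMem_empty k (this ▸ Finset.mem_filter.2 ⟨hk, hk'⟩)
    · exact hbase
  | succ N ih =>
    intro r hr hcard
    rcases hr.lt_or_eq with h1 | rfl
    swap
    · exact hbase
    rcases (K.filter fun k => r < t k ∧ t k < T).eq_empty_or_nonempty with he | hne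
    · rw [hbase]
      refine hstep r T h1 le_rfl fun k hk hk' => ?_
      exact Finset.notMem_empty k (he ▸ Finset.mem_filter.2 ⟨hk, hk'⟩)
    -- The induction counts the observation times strictly between `r` and the horizon. Moving from
    -- `r` to the earliest of them crosses no observation and lowers the count.
    · obtain ⟨k, hk, hkmin⟩ := Finset.exists_min_image _ t hne
      obtain ⟨hkK, hk1, hk2⟩ := Finset.mem_filter.1 hk
      have := ih (t k) hk2.le ?_
      · rw [this]
        refine hstep r (t k) hk1 hk2.le fun i hi hi' => ?_
        exact absurd (hkmin i (Finset.mem_filter.2 ⟨hi, hi'.1, hi'.2.trans hk2⟩)) (not_le.2 hi'.2)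
      · have hlt : (K.filter fun i => t k < t i ∧ t i < T).card <
            (K.filter fun i => r < t i ∧ t i < T).card := by
          refine Finset.card_lt_card (Finset.ssubset_iff_of_subset ?_ |>.2 ⟨k, hk, ?_⟩)
          · intro i hi
            obtain ⟨a, b, c⟩ := Finset.mem_filter.1 hi
            exact Finset.mem_filter.2 ⟨a, hk1.trans b, c⟩
          · intro hk'
            exact lt_irrefl _ (Finset.mem_filter.1 hk').2.1
        omega

end Obs

/-! ### First moment of the mass and backward observation paths -/

section Occupation

variable {α : ℝ → ℝ} {p : ℕ → ℝ → ℝ} {G : Measure ℝ}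
variable {Ω : Type*} {mΩ : MeasurableSpace Ω} {μ : Measure Ω} [IsProbabilityMeasure μ]
  {L : Measure IntMeas} {ℱ : Filtration ℝ≥0 mΩ} {Y : ℝ≥0 → Ω → IntMeas}
  {σ : IntMeas} {F : ℝ → ℝ}

/-- The indicator function of `(0,∞)`. -/
def posOne (x : ℝ) : ℝ := Set.indicator (Set.Ioi 0) (fun _ => (1 : ℝ)) x

lemma measurable_posOne : Measurable posOne := measurable_const.indicator measurableSet_Ioi

lemma posOne_nonneg (x : ℝ) : 0 ≤ posOne x := Set.indicator_nonneg (fun _ _ => zero_le_one) x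

lemma posOne_le_one (x : ℝ) : posOne x ≤ 1 :=
  Set.indicator_le' (fun _ _ => le_rfl) (fun _ _ => zero_le_one) x

lemma memB_const_mul_posOne (ε : ℝ) : MemB fun x => ε * posOne x := by
  refine ⟨measurable_posOne.const_mul ε, ⟨|ε|, fun x => ?_⟩, fun x hx => ?_⟩
  · rw [abs_mul, abs_of_nonneg (posOne_nonneg x)]
    exact mul_le_of_le_one_right (abs_nonneg _) (posOne_le_one x)
  · simp [posOne, hx]

lemma pair_posOne (ν : IntMeas) (ε : ℝ) :
    pair ν.1 (fun x => ε * posOne x) = ε * ν.1.real Set.univ := by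
  rw [pair, integral_const_mul]
  congr 1
  have h : ∀ᵐ x ∂ν.1, posOne x = 1 := by
    have h0 : ∀ᵐ x ∂ν.1, x ∉ Set.Iic (0 : ℝ) := measure_eq_zero_iff_ae_notMem.1 ν.2.2.1
    filter_upwards [h0] with x hx
    simp only [posOne]
    exact Set.indicator_of_mem (by simpa using hx) _
  rw [integral_congr_ae h]
  simp

lemma pair_le_of_le (ν : IntMeas) {u : ℝ → ℝ} (hm : Measurable u) (h0 : ∀ x, 0 ≤ u x) {B : ℝ}
    (hB : ∀ x, u x ≤ B) : pair ν.1 u ≤ B * ν.1.real Set.univ := by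
  calc pair ν.1 u ≤ ∫ _, B ∂ν.1 :=
        integral_mono (integrable_of_bounded hm fun x => by rw [abs_of_nonneg (h0 x)]; exact hB x)
          (integrable_const _) hB
    _ = B * ν.1.real Set.univ := by simp [mul_comm]

lemma immigration_le_of_le [IsFiniteMeasure L]
    (hL : Integrable (fun ν : IntMeas => ν.1.real Set.univ) L)
    {u : ℝ → ℝ} (hm : Measurable u) (h0 : ∀ x, 0 ≤ u x) {B : ℝ} (hB : ∀ x, u x ≤ B) :
    immigration L u ≤ B * ∫ ν : IntMeas, ν.1.real Set.univ ∂L := by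
  rw [← integral_const_mul]
  refine integral_mono ((integrable_const _).sub (integrable_exp_neg_pair hm h0))
    (hL.const_mul B) fun ν => ?_
  have := oneSubExp_le (pair ν.1 u)
  exact this.trans (pair_le_of_le ν hm h0 hB)

/-- Comparison with the zero solution, which has zero forcing, in `volterra_stability`. The bound is
linear in `B` with a constant independent of the forcing, as the small-`ε` argument for the mass
requires. -/
lemma IsVolterraSolution.le_of_forcing_le {c : ℝ → ℝ → ℝ} {φ : ℝ → ℝ} {C : ℝ}
    [IsProbabilityMeasure G] (hK : VolterraKernel c φ C) (T : ℝ) :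
    ∃ K : ℝ, 0 ≤ K ∧ ∀ J u : ℝ → ℝ → ℝ, IsForcing J → IsVolterraSolution c φ G J u → ∀ B : ℝ,
      (∀ t ∈ Set.Icc 0 T, ∀ x, J t x ≤ B) → ∀ t ∈ Set.Icc 0 T, ∀ x, u t x ≤ B * K := by
  rcases lt_or_ge T 0 with hT | hT
  · exact ⟨0, le_rfl, fun _ _ _ _ _ _ t ht => absurd (ht.1.trans ht.2) (not_le.2 hT)⟩
  obtain ⟨K, hK0, h⟩ := volterra_stability (G := G) hK T
  refine ⟨1 + K * T, by positivity, fun J u hJ hu B hB t ht x => ?_⟩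
  have hz : IsForcing (fun _ _ => (0 : ℝ)) :=
    ⟨measurable_const, fun _ _ _ => le_rfl, fun _ => ⟨0, fun _ _ _ => le_rfl⟩⟩
  have hz' : IsVolterraSolution c φ G (fun _ _ => (0 : ℝ)) (fun _ _ => 0) :=
    ⟨measurable_const, fun _ _ => le_rfl, fun _ => ⟨0, fun _ _ _ => le_rfl⟩, fun t _ x => by
      simp [hK.zero, hK.zero']⟩
  have h1 := h J _ u _ hJ hz hu hz' t ht x
  simp only [sub_zero] at h1
  have h2 : ∫ s in (0 : ℝ)..T, ∫ y, |J s y| ∂G ≤ B * T := by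
    have := intervalIntegral.norm_integral_le_of_norm_le_const (a := 0) (b := T)
      (f := fun s => ∫ y, |J s y| ∂G) (C := B) fun s hs => by
        rw [Set.uIoc_of_le hT] at hs
        have hs' : s ∈ Set.Icc 0 T := ⟨hs.1.le, hs.2⟩
        have := norm_integral_le_of_norm_le_const (μ := G) (C := B) (f := fun y => |J s y|)
          (ae_of_all _ fun y => by
            rw [Real.norm_eq_abs, abs_abs, abs_of_nonneg (hJ.nonneg s hs'.1 y)]; exact hB s hs' y)
        simpa using this
    rw [sub_zero, abs_of_nonneg hT] at this
    exact (le_abs_self _).trans this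
  have h3 := (le_abs_self _).trans (h1.trans (mul_le_mul_of_nonneg_left h2 hK0))
  have := hB t ht x
  linarith

lemma IsImmigrationProcess.laplace_marginal (hY : IsImmigrationProcess α p G L μ ℱ Y)
    (hY0 : ∀ᵐ ω ∂μ, Y 0 ω = σ) (hF : MemB F) (h0 : ∀ x, 0 ≤ F x) (t : ℝ≥0) :
    ∫ ω, Real.exp (-pair (Y t ω).1 F) ∂μ = Real.exp (-(pair σ.1 (cumulant α p G F t) +
      ∫ s in (0 : ℝ)..t, immigration L (cumulant α p G F s))) := by
  have h := hY.markov_step hF h0 0 t (S := fun _ => 0) measurable_const fun _ => le_rfl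
  simp only [neg_zero, Real.exp_zero, one_mul, zero_add] at h
  have e : ∫ ω, Real.exp (-pair (Y 0 ω).1 (cumulant α p G F t)) ∂μ =
      Real.exp (-pair σ.1 (cumulant α p G F t)) := by
    rw [integral_congr_ae (g := fun _ => Real.exp (-pair σ.1 (cumulant α p G F t)))]
    · simp
    · filter_upwards [hY0] with ω hω
      rw [hω]
  rw [h, e, neg_add, Real.exp_add]

variable [IsFiniteMeasure L]

/-- The total mass has locally bounded first moment. -/
lemma IsImmigrationProcess.mass_le (hm : IsBranchingMechanism α p G)
    (hY : IsImmigrationProcess α p G L μ ℱ Y) (hY0 : ∀ᵐ ω ∂μ, Y 0 ω = σ)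
    (hL : Integrable (fun ν : IntMeas => ν.1.real Set.univ) L) (T : ℝ) :
    ∃ M : ℝ, ∀ t : ℝ≥0, t ≤ T →
      ∫⁻ ω, ENNReal.ofReal ((Y t ω).1.real Set.univ) ∂μ ≤ ENNReal.ofReal M := by
  have := hm.prob
  obtain ⟨C, hC0, hC⟩ := hm.exists_bound
  have hK := hm.volterraKernel_birth hC0 hC
  obtain ⟨K, hK0, hKb⟩ := IsVolterraSolution.le_of_forcing_le (G := G) hK T
  set I := ∫ ν : IntMeas, ν.1.real Set.univ ∂L with hI
  have hI0 : 0 ≤ I := integral_nonneg fun ν => measureReal_nonneg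
  have hYm : ∀ s, Measurable (Y s) := fun s => (hY.adapted s).mono (ℱ.le s) le_rfl
  have hmass : Measurable fun ν : IntMeas => ν.1.real Set.univ :=
    ((Measure.measurable_coe MeasurableSet.univ).comp measurable_subtype_coe).ennreal_toReal
  refine ⟨K * σ.1.real Set.univ + K * I * T, fun t ht => ?_⟩
  have ht0 : (0 : ℝ) ≤ t := t.coe_nonneg
  set M := K * σ.1.real Set.univ + K * I * T
  -- With test function `ε` on `(0, ∞)` the cumulant is at most `ε K`, so `E(1 - e^{-ε m}) ≤ ε M`
  -- for the total mass `m` at time `t`. Dividing by `ε` and using Fatou along `ε = 1/(n + 1)`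
  -- bounds `E m` without assuming it finite.
  have key : ∀ ε : ℝ, 0 < ε → ∫⁻ ω, ENNReal.ofReal
      (oneSubExp (ε * (Y t ω).1.real Set.univ) / ε) ∂μ ≤ ENNReal.ofReal M := by
    intro ε hε
    have hf := memB_const_mul_posOne ε
    have hf0 : ∀ x, 0 ≤ ε * posOne x := fun x => mul_nonneg hε.le (posOne_nonneg x)
    have hu := hm.isCumulantSolution_cumulant hf hf0
    have hub : ∀ s ∈ Set.Icc 0 T, ∀ x, cumulant α p G (fun x => ε * posOne x) s x ≤ ε * K :=
      hKb _ _ (isForcing_shift hf hf0) hu ε fun s _ x =>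
        mul_le_of_le_one_right hε.le (posOne_le_one _)
    have hum : ∀ s, Measurable (cumulant α p G (fun x => ε * posOne x) s) := fun s =>
      hu.measurable.comp measurable_prodMk_left
    have hlap := hY.laplace_marginal hY0 hf hf0 t
    simp only [pair_posOne] at hlap
    set A := pair σ.1 (cumulant α p G (fun x => ε * posOne x) t) +
      ∫ s in (0 : ℝ)..t, immigration L (cumulant α p G (fun x => ε * posOne x) s)
    have hA : A ≤ ε * M := by
      have h1 := pair_le_of_le σ (hum t) (hu.nonneg t) (hub t ⟨ht0, ht⟩)
      have h2 : ∫ s in (0 : ℝ)..t, immigration L (cumulant α p G (fun x => ε * posOne x) s) ≤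
          ∫ _ in (0 : ℝ)..t, ε * K * I :=
        intervalIntegral.integral_mono_on ht0
          (intervalIntegrable_immigration hu.measurable hu.nonneg _ _) intervalIntegrable_const
          fun s hs => immigration_le_of_le hL (hum s) (hu.nonneg s)
            (hub s ⟨hs.1, hs.2.trans ht⟩)
      rw [intervalIntegral.integral_const, sub_zero, smul_eq_mul] at h2
      have h3 : (t : ℝ) * (ε * K * I) ≤ T * (ε * K * I) :=
        mul_le_mul_of_nonneg_right ht (by positivity)
      calc A ≤ ε * K * σ.1.real Set.univ + T * (ε * K * I) := add_le_add h1 (h2.trans h3)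
        _ = ε * M := by ring
    have hint : Integrable (fun ω => Real.exp (-(ε * (Y t ω).1.real Set.univ))) μ :=
      integrable_of_bounded ((hmass.comp (hYm t)).const_mul ε).neg.exp (B := 1) fun ω => by
        rw [abs_of_pos (Real.exp_pos _)]
        exact exp_neg_le_one (mul_nonneg hε.le measureReal_nonneg)
    have hint2 : Integrable (fun ω => oneSubExp (ε * (Y t ω).1.real Set.univ) / ε) μ :=
      ((integrable_const (1 : ℝ)).sub hint).div_const ε
    rw [← ofReal_integral_eq_lintegral_ofReal hint2 (ae_of_all _ fun ω =>
      div_nonneg (oneSubExp_nonneg (mul_nonneg hε.le measureReal_nonneg)) hε.le)]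
    refine ENNReal.ofReal_le_ofReal ?_
    have e : ∫ ω, oneSubExp (ε * (Y t ω).1.real Set.univ) / ε ∂μ = oneSubExp A / ε := by
      rw [integral_div]
      unfold oneSubExp
      rw [integral_sub (integrable_const _) hint, hlap]
      simp
    rw [e, div_le_iff₀ hε, mul_comm]
    exact (oneSubExp_le A).trans hA
  have hlim : ∀ y : ℝ, Tendsto (fun n : ℕ => oneSubExp ((1 / ((n : ℝ) + 1)) * y) /
      (1 / ((n : ℝ) + 1))) atTop (𝓝 y) := by
    intro y
    have hd : HasDerivAt (fun e : ℝ => oneSubExp (e * y)) y 0 := by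
      have h1 := (((hasDerivAt_id (0 : ℝ)).mul_const y).neg.exp).const_sub 1
      refine HasDerivAt.congr_deriv (f' := _) h1 ?_
      simp
    have h2 := hd.tendsto_slope_zero
    have h3 : Tendsto (fun n : ℕ => 1 / ((n : ℝ) + 1)) atTop (𝓝[≠] 0) := by
      rw [tendsto_nhdsWithin_iff]
      refine ⟨tendsto_one_div_add_atTop_nhds_zero_nat, Eventually.of_forall fun n => ?_⟩
      have : (0 : ℝ) < 1 / ((n : ℝ) + 1) := by positivity
      exact this.ne'
    refine (h2.comp h3).congr fun n => ?_
    simp only [Function.comp, zero_add, zero_mul, smul_eq_mul]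
    rw [show oneSubExp 0 = 0 by simp [oneSubExp], sub_zero]
    exact (div_eq_inv_mul _ _).symm
  have hmeas : ∀ n : ℕ, Measurable fun ω => ENNReal.ofReal
      (oneSubExp ((1 / ((n : ℝ) + 1)) * (Y t ω).1.real Set.univ) / (1 / ((n : ℝ) + 1))) := fun n =>
    ((measurable_oneSubExp.comp ((hmass.comp (hYm t)).const_mul _)).div_const _).ennreal_ofReal
  calc ∫⁻ ω, ENNReal.ofReal ((Y t ω).1.real Set.univ) ∂μ
      = ∫⁻ ω, liminf (fun n : ℕ => ENNReal.ofReal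
      (oneSubExp ((1 / ((n : ℝ) + 1)) * (Y t ω).1.real Set.univ) / (1 / ((n : ℝ) + 1))))
        atTop ∂μ := by
        refine lintegral_congr fun ω => ?_
        exact (ENNReal.tendsto_ofReal (hlim _)).liminf_eq.symm
    _ ≤ liminf (fun n : ℕ => ∫⁻ ω, ENNReal.ofReal
      (oneSubExp ((1 / ((n : ℝ) + 1)) * (Y t ω).1.real Set.univ) / (1 / ((n : ℝ) + 1))) ∂μ) atTop :=
        lintegral_liminf_le hmeas
    _ ≤ ENNReal.ofReal M := by
        refine (liminf_le_liminf (Eventually.of_forall fun n => key _ (by positivity))).trans ?_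
        simp

/-- The path `s ↦ ⟨Y_s, F⟩`. -/
def pathPair (Y : ℝ≥0 → Ω → IntMeas) (F : ℝ → ℝ) (ω : Ω) (s : ℝ) : ℝ :=
  pair (Y s.toNNReal ω).1 F

lemma measurable_pathPair (hYm : Measurable (Function.uncurry Y)) (hF : Measurable F) :
    Measurable (Function.uncurry (pathPair Y F)) := by
  have : Measurable fun q : Ω × ℝ => (q.2.toNNReal, q.1) := by fun_prop
  exact (measurable_pair hF).comp (hYm.comp this)

lemma IsImmigrationProcess.lintegral_pathPair (hm : IsBranchingMechanism α p G)
    (hY : IsImmigrationProcess α p G L μ ℱ Y) (hYm : Measurable (Function.uncurry Y))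
    (hY0 : ∀ᵐ ω ∂μ, Y 0 ω = σ)
    (hL : Integrable (fun ν : IntMeas => ν.1.real Set.univ) L) (hF : MemB F) (T : ℝ) :
    ∫⁻ ω, (∫⁻ s in Set.Ioc 0 T, ‖pathPair Y F ω s‖ₑ) ∂μ ≠ ⊤ := by
  obtain ⟨M, hM⟩ := hY.mass_le hm hY0 hL T
  obtain ⟨B, hB⟩ := hF.bounded
  rw [lintegral_lintegral_swap (measurable_pathPair hYm hF.measurable).enorm.aemeasurable]
  have hle : ∀ s ∈ Set.Ioc 0 T, ∫⁻ ω, ‖pathPair Y F ω s‖ₑ ∂μ ≤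
      ENNReal.ofReal B * ENNReal.ofReal M := by
    intro s hs
    have hB0 : 0 ≤ B := (abs_nonneg _).trans (hB 0)
    calc ∫⁻ ω, ‖pathPair Y F ω s‖ₑ ∂μ
        ≤ ∫⁻ ω, ENNReal.ofReal B * ENNReal.ofReal ((Y s.toNNReal ω).1.real Set.univ) ∂μ := by
          refine lintegral_mono fun ω => ?_
          rw [← ENNReal.ofReal_mul hB0, ← ofReal_norm]
          refine ENNReal.ofReal_le_ofReal ?_
          exact norm_integral_le_of_norm_le_const (ae_of_all _ hB)
      _ = ENNReal.ofReal B * ∫⁻ ω, ENNReal.ofReal ((Y s.toNNReal ω).1.real Set.univ) ∂μ :=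
          lintegral_const_mul' _ _ ENNReal.ofReal_ne_top
      _ ≤ _ := by
          gcongr
          exact hM _ (by rw [Real.coe_toNNReal _ hs.1.le]; exact hs.2)
  refine ne_top_of_le_ne_top ?_ (setLIntegral_mono' measurableSet_Ioc hle)
  rw [setLIntegral_const]
  exact ENNReal.mul_ne_top (ENNReal.mul_ne_top ENNReal.ofReal_ne_top ENNReal.ofReal_ne_top)
    (by simp)

/-- The contribution at remaining time `b.1` of a particle of residual life `b.2` observed through
`F` at time `r`. -/
def obsPath (F : ℝ → ℝ) (T : ℝ) (b : ℝ × ℝ) (r : ℝ) : ℝ :=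
  if T - b.1 ≤ r then F (b.2 - (r - (T - b.1))) else 0

lemma measurable_obsPath (hF : Measurable F) (T : ℝ) :
    Measurable (Function.uncurry (obsPath F T)) :=
  Measurable.ite (measurableSet_le (by fun_prop) measurable_snd)
    (hF.comp (by fun_prop)) measurable_const

lemma abs_obsPath_le {B : ℝ} (hB : ∀ x, |F x| ≤ B) (T : ℝ) (b : ℝ × ℝ) (r : ℝ) :
    |obsPath F T b r| ≤ B := by
  unfold obsPath
  split_ifs
  · exact hB _
  · rw [abs_zero]; exact (abs_nonneg _).trans (hB 0)

/-- The discretely observed equation has shifted Riemann sums of `obsPath` as forcing. This identity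
makes `cumForcing` their limit; the path vanishes before time `T - s`. -/
lemma integral_obsPath (hF : MemB F) {T s : ℝ} (hs : 0 ≤ s) (hsT : s ≤ T) (x : ℝ) :
    ∫ r in (0 : ℝ)..T, obsPath F T (s, x) r = cumForcing F s x := by
  obtain ⟨B, hB⟩ := hF.bounded
  have hint : ∀ a b : ℝ, IntervalIntegrable (obsPath F T (s, x)) volume a b := fun a b => by
    have key : ∀ c d : ℝ, IntegrableOn (obsPath F T (s, x)) (Set.Ioc c d) volume := fun c d =>
      Measure.integrableOn_of_bounded (M := B) (by simp)
        ((measurable_obsPath hF.measurable T).comp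
          measurable_prodMk_left).aestronglyMeasurable (ae_of_all _ (abs_obsPath_le hB T _))
    exact ⟨key a b, key b a⟩
  rw [← intervalIntegral.integral_add_adjacent_intervals (hint 0 (T - s)) (hint (T - s) T)]
  have e1 : ∫ r in (0 : ℝ)..(T - s), obsPath F T (s, x) r = 0 := by
    rw [intervalIntegral.integral_of_le (by linarith), integral_Ioc_eq_integral_Ioo]
    refine setIntegral_eq_zero_of_forall_eq_zero fun r hr => ?_
    exact if_neg (not_le.2 hr.2)
  have e2 : ∫ r in (T - s)..T, obsPath F T (s, x) r = ∫ r in (0 : ℝ)..s, F (x - r) := by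
    have h1 := intervalIntegral.integral_comp_add_right (a := 0) (b := s)
      (obsPath F T (s, x)) (T - s)
    rw [zero_add, add_sub_cancel] at h1
    rw [← h1]
    refine intervalIntegral.integral_congr fun r hr => ?_
    rw [Set.uIcc_of_le hs] at hr
    simp only [obsPath]
    rw [if_pos (by linarith [hr.1]), add_sub_cancel_right]
  rw [e1, e2, zero_add, cumForcing]

end Occupation

/-! ### Laplace functional of the occupation time -/

section OccupationLaplace

variable {α : ℝ → ℝ} {p : ℕ → ℝ → ℝ} {G : Measure ℝ}
variable {Ω : Type*} {mΩ : MeasurableSpace Ω} {μ : Measure Ω} [IsProbabilityMeasure μ]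
  {L : Measure IntMeas} {ℱ : Filtration ℝ≥0 mΩ} {Y : ℝ≥0 → Ω → IntMeas}
  {σ : IntMeas} {F : ℝ → ℝ}

/-- The exponent `⟨σ, w_T⟩ + ∫_0^T ψ(w_s) ds`. -/
def cumulantExponent (L : Measure IntMeas) (σ : IntMeas) (T : ℝ) (w : ℝ → ℝ → ℝ) : ℝ :=
  pair σ.1 (w T) + ∫ s in (0 : ℝ)..T, immigration L (w s)

lemma cumulantExponent_nonneg {T : ℝ} (hT : 0 ≤ T) {w : ℝ → ℝ → ℝ} (hw : ∀ t x, 0 ≤ w t x) :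
    0 ≤ cumulantExponent L σ T w :=
  add_nonneg (pair_nonneg _ (hw T))
    (intervalIntegral.integral_nonneg hT fun s _ => immigration_nonneg (hw s))

variable [IsFiniteMeasure L]

/-- The error has a pointwise part `d`, small only in mean, and a uniform part `κ` supplied by
stability. The first is integrated against `σ` and against the mean measure of `L`; the second is
multiplied by their masses. -/
lemma enorm_exp_cumulantExponent_sub_le {T : ℝ} (hT : 0 < T) {W v : ℝ → ℝ → ℝ}
    (hW : Measurable (Function.uncurry W)) (hv : Measurable (Function.uncurry v))
    (hW0 : ∀ t x, 0 ≤ W t x) (hv0 : ∀ t x, 0 ≤ v t x) {BW Bv : ℝ}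
    (hBW : ∀ t ∈ Set.Icc 0 T, ∀ x, W t x ≤ BW) (hBv : ∀ t ∈ Set.Icc 0 T, ∀ x, v t x ≤ Bv)
    {d : ℝ × ℝ → ℝ≥0∞} {κ : ℝ≥0∞}
    (hWv : ∀ s ∈ Set.Icc 0 T, ∀ x, ‖W s x - v s x‖ₑ ≤ d (s, x) + κ) :
    ‖Real.exp (-cumulantExponent L σ T W) - Real.exp (-cumulantExponent L σ T v)‖ₑ ≤
      ((∫⁻ x, d (T, x) ∂σ.1) + κ * σ.1 Set.univ) +
      ((∫⁻ s in Set.Ioc 0 T, ∫⁻ x, d (s, x) ∂(L.bind fun ν => ν.1)) +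
        κ * (L.bind fun ν => ν.1) Set.univ * ENNReal.ofReal T) := by
  refine (enorm_exp_neg_sub_le (cumulantExponent_nonneg hT.le hW0)
    (cumulantExponent_nonneg hT.le hv0)).trans ?_
  have hvalm : AEMeasurable (fun ν : IntMeas => ν.1) L := measurable_subtype_coe.aemeasurable
  have hWm : ∀ s, Measurable (W s) := fun s => hW.comp measurable_prodMk_left
  have hvm : ∀ s, Measurable (v s) := fun s => hv.comp measurable_prodMk_left
  have e1 : cumulantExponent L σ T W - cumulantExponent L σ T v =
      (pair σ.1 (W T) - pair σ.1 (v T)) +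
      ∫ s in (0 : ℝ)..T, (immigration L (W s) - immigration L (v s)) := by
    rw [intervalIntegral.integral_sub (intervalIntegrable_immigration hW hW0 _ _)
      (intervalIntegrable_immigration hv hv0 _ _), cumulantExponent, cumulantExponent]
    ring
  have hTm : T ∈ Set.Icc 0 T := ⟨hT.le, le_rfl⟩
  rw [e1]
  refine (enorm_add_le _ _).trans (add_le_add ?_ ?_)
  · refine (enorm_pair_sub_le σ.1 (hWm T) (hvm T)
      (fun x => by rw [abs_of_nonneg (hW0 T x)]; exact hBW T hTm x)
      (fun x => by rw [abs_of_nonneg (hv0 T x)]; exact hBv T hTm x)).trans ?_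
    refine (lintegral_mono fun x => hWv T hTm x).trans (le_of_eq ?_)
    rw [lintegral_add_right _ measurable_const, lintegral_const]
  · refine (enorm_intervalIntegral_le hT.le).trans ?_
    have h1 : ∀ s ∈ Set.Ioc 0 T, ‖immigration L (W s) - immigration L (v s)‖ₑ ≤
        (∫⁻ x, d (s, x) ∂(L.bind fun ν => ν.1)) + κ * (L.bind fun ν => ν.1) Set.univ := by
      intro s hs
      have hs' : s ∈ Set.Icc 0 T := ⟨hs.1.le, hs.2⟩
      refine (enorm_immigration_sub_le (hWm s) (hvm s) (hW0 s) (hv0 s)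
        (hBW s hs') (hBv s hs')).trans ?_
      rw [← Measure.lintegral_bind hvalm (f := fun x => ‖W s x - v s x‖ₑ)
        ((hWm s).sub (hvm s)).enorm.aemeasurable]
      refine (lintegral_mono fun x => hWv s hs' x).trans (le_of_eq ?_)
      rw [lintegral_add_right _ measurable_const, lintegral_const]
    refine (setLIntegral_mono' measurableSet_Ioc h1).trans (le_of_eq ?_)
    rw [lintegral_add_right _ measurable_const, setLIntegral_const, Real.volume_Ioc, sub_zero]

/-- The Laplace functional of a shifted Riemann sum of `s ↦ ⟨Y_s, F⟩`. -/
lemma IsImmigrationProcess.laplace_shiftedSum (hm : IsBranchingMechanism α p G)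
    (hY : IsImmigrationProcess α p G L μ ℱ Y) (hY0 : ∀ᵐ ω ∂μ, Y 0 ω = σ) (hF : MemB F)
    (h0 : ∀ x, 0 ≤ F x) {T : ℝ} (hT : 0 < T) (n : ℕ) {θ : ℝ} (hθ : θ ∈ Set.Ioc (0 : ℝ) 1) :
    IsForcing (fun s x => shiftedSum T n (obsPath F T (s, x)) θ) ∧
    ∃ W, IsVolterraSolution (birth α p) oneSubExp G
        (fun s x => shiftedSum T n (obsPath F T (s, x)) θ) W ∧
      ∫ ω, Real.exp (-shiftedSum T n (pathPair Y F ω) θ) ∂μ =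
        Real.exp (-cumulantExponent L σ T W) := by
  have := hm.prob
  obtain ⟨C, hC0, hC⟩ := hm.exists_bound
  have hK := hm.volterraKernel_birth hC0 hC
  obtain ⟨h, hh⟩ : ∃ h, h = T / ((n : ℝ) + 1) := ⟨_, rfl⟩
  have hh0 : 0 < h := by rw [hh]; positivity
  obtain ⟨t, ht⟩ : ∃ t : ℕ → ℝ≥0, t = fun k : ℕ => (((k : ℝ) + θ) * h).toNNReal := ⟨_, rfl⟩
  have htk : ∀ k, ((t k : ℝ≥0) : ℝ) = (k + θ) * h := fun k => by
    rw [ht]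
    exact Real.coe_toNNReal _ (mul_nonneg (add_nonneg k.cast_nonneg hθ.1.le) hh0.le)
  obtain ⟨T', hT'⟩ : ∃ T' : ℝ≥0, T' = T.toNNReal := ⟨_, rfl⟩
  have hT'c : (T' : ℝ) = T := by rw [hT']; exact Real.coe_toNNReal _ hT.le
  have htT : ∀ k ∈ Finset.range (n + 1), t k ≤ T' := fun k hk => by
    rw [← NNReal.coe_le_coe, htk, hT'c]
    have h1 : (k : ℝ) + 1 ≤ n + 1 := by
      have := Finset.mem_range.1 hk
      exact_mod_cast this
    calc ((k : ℝ) + θ) * h ≤ (n + 1) * h :=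
          mul_le_mul_of_nonneg_right (by linarith [hθ.2]) hh0.le
      _ = T := by rw [hh]; field_simp
  have hJo := isForcing_obsForcing (K := Finset.range (n + 1)) (t := t) (T := (T' : ℝ)) hF h0 hh0.le
  have hJe : obsForcing (Finset.range (n + 1)) t h F T' =
      fun s x => shiftedSum T n (obsPath F T (s, x)) θ := by
    funext s x
    simp only [shiftedSum, Finset.mul_sum, obsForcing, htk, hT'c, obsPath, hh]
  obtain ⟨W, hW⟩ := exists_isVolterraSolution (G := G) hK hJo
  have hlap := hY.laplace_obs hm hF h0 hh0.le htT hW _ 0 zero_le le_rfl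
  rw [hJe] at hJo hW
  refine ⟨hJo, W, hW, ?_⟩
  have hRe : ∀ ω, ∑ k ∈ Finset.range (n + 1), h * pair (Y (t k) ω).1 F =
      shiftedSum T n (pathPair Y F ω) θ := fun ω => by
    rw [shiftedSum, Finset.mul_sum, ht, hh]; rfl
  simp only [hRe] at hlap
  rw [hlap]
  simp only [not_lt_zero, if_false, Finset.sum_const_zero, zero_add, NNReal.coe_zero,
    sub_zero, hT'c]
  rw [integral_congr_ae (g := fun _ => Real.exp (-pair σ.1 (W T)))]
  · rw [integral_const, probReal_univ, one_smul, ← Real.exp_add, cumulantExponent]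
    congr 1; ring
  · filter_upwards [hY0] with ω hω
    rw [hω]

/-- The Laplace functional of the occupation time. -/
theorem IsImmigrationProcess.laplace_occupation (hm : IsBranchingMechanism α p G)
    (hY : IsImmigrationProcess α p G L μ ℱ Y) (hYm : Measurable (Function.uncurry Y))
    (hY0 : ∀ᵐ ω ∂μ, Y 0 ω = σ)
    (hL : Integrable (fun ν : IntMeas => ν.1.real Set.univ) L) (hF : MemB F) (h0 : ∀ x, 0 ≤ F x)
    {T : ℝ} (hT : 0 < T) {v : ℝ → ℝ → ℝ}
    (hv : IsVolterraSolution (birth α p) oneSubExp G (cumForcing F) v) :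
    ∫ ω, Real.exp (-∫ s in (0 : ℝ)..T, pathPair Y F ω s) ∂μ =
      Real.exp (-cumulantExponent L σ T v) := by
  have := hm.prob
  obtain ⟨C, hC0, hC⟩ := hm.exists_bound
  have hK := hm.volterraKernel_birth hC0 hC
  obtain ⟨B, hB⟩ := hF.bounded
  obtain ⟨K, hK0, hst⟩ := volterra_stability (G := G) hK T
  obtain ⟨Bv, hBv⟩ := hv.locallyBounded T
  have hJ := isForcing_cumForcing hF h0
  obtain ⟨Lb, hLb⟩ : ∃ Lb : Measure ℝ, Lb = L.bind (fun ν => ν.1) := ⟨_, rfl⟩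
  have hvalm : AEMeasurable (fun ν : IntMeas => ν.1) L := measurable_subtype_coe.aemeasurable
  have hLbfin : IsFiniteMeasure Lb := by
    refine ⟨?_⟩
    rw [hLb, Measure.bind_apply MeasurableSet.univ hvalm]
    have := hL.2
    rw [hasFiniteIntegral_iff_enorm] at this
    refine lt_of_le_of_lt (lintegral_mono fun ν => ?_) this
    rw [Real.enorm_of_nonneg measureReal_nonneg, ofReal_measureReal]
  obtain ⟨K', hK'⟩ : ∃ K' : ℝ≥0, K' = K.toNNReal * ((σ.1 Set.univ).toNNReal +
    T.toNNReal * (Lb Set.univ).toNNReal) := ⟨_, rfl⟩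
  obtain ⟨vT, hvT⟩ : ∃ vT : Measure ℝ, vT = volume.restrict (Set.Ioc 0 T) := ⟨_, rfl⟩
  have hvTfin : IsFiniteMeasure vT := by rw [hvT]; infer_instance
  -- A single measure collects all the places where the forcing error is integrated: `σ` at time
  -- `T`, the mean immigration measure over `(0, T]`, and `K'` copies of Lebesgue times `G` for the
  -- uniform error from stability. One application of the Riemann sum theorem then controls
  -- everything.
  obtain ⟨Λ, hΛ⟩ : ∃ Λ : Measure (ℝ × ℝ),
    Λ = σ.1.map (fun x => (T, x)) + vT.prod Lb + K' • vT.prod G := ⟨_, rfl⟩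
  have hΛfin : IsFiniteMeasure Λ := by rw [hΛ]; infer_instance
  have hpT : Measurable fun x : ℝ => (T, x) := measurable_prodMk_left
  have hN := hY.lintegral_pathPair hm hYm hY0 hL hF T
  obtain ⟨y, hy⟩ : ∃ y, y = pathPair Y F := ⟨_, rfl⟩
  rw [← hy] at hN ⊢
  have hym : Measurable (Function.uncurry y) := hy ▸ measurable_pathPair hYm hF.measurable
  have hy0 : ∀ ω s, 0 ≤ y ω s := fun ω s => by rw [hy]; exact pair_nonneg _ h0
  have hlim1 := shiftedSum_tendsto_param μ hym hT hN
  have hlim2 := shiftedSum_tendsto_param Λ (measurable_obsPath hF.measurable T) hT (by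
    refine ne_top_of_le_ne_top ?_ (lintegral_mono (g := fun _ => ENNReal.ofReal B *
      ENNReal.ofReal T) fun b => ?_)
    · rw [lintegral_const]
      exact ENNReal.mul_ne_top (ENNReal.mul_ne_top ENNReal.ofReal_ne_top ENNReal.ofReal_ne_top)
        (measure_ne_top _ _)
    · calc ∫⁻ s in Set.Ioc 0 T, ‖obsPath F T b s‖ₑ ≤ ∫⁻ _ in Set.Ioc 0 T, ENNReal.ofReal B := by
            refine lintegral_mono fun r => ?_
            rw [← ofReal_norm]
            exact ENNReal.ofReal_le_ofReal (abs_obsPath_le hB T b r)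
        _ = _ := by rw [setLIntegral_const, Real.volume_Ioc, sub_zero])
  obtain ⟨Z, hZ⟩ : ∃ Z : Ω → ℝ, Z = fun ω => ∫ s in (0 : ℝ)..T, y ω s := ⟨_, rfl⟩
  have hZe : ∀ ω, ∫ s in (0 : ℝ)..T, y ω s = Z ω := fun ω => by rw [hZ]
  have hZm : Measurable Z := hZ ▸ measurable_intervalIntegral_param measurable_const hym
  have hZ0 : ∀ ω, 0 ≤ Z ω := fun ω => by
    rw [← hZe]; exact intervalIntegral.integral_nonneg hT.le fun s _ => hy0 ω s
  simp only [hZe] at hlim1 ⊢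
  obtain ⟨E, hE⟩ : ∃ E, E = ‖∫ ω, Real.exp (-Z ω) ∂μ -
    Real.exp (-cumulantExponent L σ T v)‖ₑ := ⟨_, rfl⟩
  have key : ∀ n : ℕ, ∀ θ ∈ Set.Ioc (0 : ℝ) 1, E ≤
      (∫⁻ ω, ‖shiftedSum T n (y ω) θ - Z ω‖ₑ ∂μ) +
      ∫⁻ b, ‖shiftedSum T n (obsPath F T b) θ - ∫ s in (0 : ℝ)..T, obsPath F T b s‖ₑ ∂Λ := by
    intro n θ hθ
    obtain ⟨hJo, W, hW, hlap⟩ := hY.laplace_shiftedSum hm hY0 hF h0 hT n hθ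
    rw [← hy] at hlap
    obtain ⟨BW, hBW⟩ := hW.locallyBounded T
    have hR0 : ∀ ω, 0 ≤ shiftedSum T n (y ω) θ := fun ω =>
      mul_nonneg (by positivity) (Finset.sum_nonneg fun k _ => hy0 _ _)
    have hRm : Measurable fun ω => shiftedSum T n (y ω) θ := by
      have : Measurable fun ω : Ω => (ω, θ) := by fun_prop
      exact (measurable_shiftedSum hym T n).comp this
    have hA : ‖∫ ω, Real.exp (-Z ω) ∂μ - ∫ ω, Real.exp (-shiftedSum T n (y ω) θ) ∂μ‖ₑ ≤
        ∫⁻ ω, ‖shiftedSum T n (y ω) θ - Z ω‖ₑ ∂μ := by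
      have i1 : Integrable (fun ω => Real.exp (-Z ω)) μ :=
        integrable_of_bounded hZm.neg.exp (B := 1) fun ω => by
          rw [abs_of_pos (Real.exp_pos _)]; exact exp_neg_le_one (hZ0 ω)
      have i2 : Integrable (fun ω => Real.exp (-shiftedSum T n (y ω) θ)) μ :=
        integrable_of_bounded hRm.neg.exp (B := 1) fun ω => by
          rw [abs_of_pos (Real.exp_pos _)]; exact exp_neg_le_one (hR0 ω)
      rw [← integral_sub i1 i2]
      refine (enorm_integral_le_lintegral_enorm _).trans (lintegral_mono fun ω => ?_)
      refine (enorm_exp_neg_sub_le (hZ0 ω) (hR0 ω)).trans (le_of_eq ?_)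
      rw [← enorm_neg, neg_sub]
    obtain ⟨d, hdd⟩ : ∃ d : ℝ × ℝ → ℝ≥0∞, d = fun b =>
      ‖shiftedSum T n (obsPath F T b) θ - ∫ s in (0 : ℝ)..T, obsPath F T b s‖ₑ := ⟨_, rfl⟩
    have hd : ∀ s ∈ Set.Icc 0 T, ∀ x,
        ‖shiftedSum T n (obsPath F T (s, x)) θ - cumForcing F s x‖ₑ = d (s, x) :=
      fun s hs x => by rw [hdd, ← integral_obsPath hF hs.1 hs.2]
    have hdm : Measurable d := by
      have h1 : Measurable fun b : ℝ × ℝ => (b, θ) := by fun_prop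
      rw [hdd]
      exact (((measurable_shiftedSum (measurable_obsPath hF.measurable T) T n).comp h1).sub
        (measurable_intervalIntegral_param measurable_const
          (measurable_obsPath hF.measurable T))).enorm
    obtain ⟨κ, hκ⟩ : ∃ κ : ℝ≥0∞, κ = ENNReal.ofReal K * ∫⁻ s, ∫⁻ x, d (s, x) ∂G ∂vT := ⟨_, rfl⟩
    have hWv : ∀ s ∈ Set.Icc 0 T, ∀ x, ‖W s x - v s x‖ₑ ≤ d (s, x) + κ := by
      intro s hs x
      have h1 := hst _ _ _ _ hJo hJ hW hv s hs x
      have h2 : W s x - v s x = (shiftedSum T n (obsPath F T (s, x)) θ - cumForcing F s x) +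
          ((W s x - shiftedSum T n (obsPath F T (s, x)) θ) - (v s x - cumForcing F s x)) := by ring
      rw [h2]
      refine (enorm_add_le _ _).trans (add_le_add (hd s hs x).le ?_)
      refine (enorm_le_iff_norm_le.2 (h1.trans (Real.le_norm_self _))).trans ?_
      rw [enorm_mul, Real.enorm_of_nonneg hK0, hκ, hvT]
      refine mul_le_mul_right ((enorm_intervalIntegral_le hT.le).trans ?_) _
      refine setLIntegral_mono' measurableSet_Ioc fun q hq => ?_
      refine (enorm_integral_le_lintegral_enorm _).trans (lintegral_mono fun z => ?_)
      rw [← Real.norm_eq_abs, enorm_norm, hd q ⟨hq.1.le, hq.2⟩ z]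
    have hB' := enorm_exp_cumulantExponent_sub_le (L := L) (σ := σ) hT hW.measurable hv.measurable
      hW.nonneg hv.nonneg hBW hBv hWv
    rw [← hLb, ← hvT] at hB'
    have e2 : ∫⁻ b, d b ∂Λ = (∫⁻ x, d (T, x) ∂σ.1) + (∫⁻ s, ∫⁻ x, d (s, x) ∂Lb ∂vT) +
        K' * ∫⁻ s, ∫⁻ x, d (s, x) ∂G ∂vT := by
      rw [hΛ, lintegral_add_measure, lintegral_add_measure, lintegral_map hdm hpT,
        lintegral_prod _ hdm.aemeasurable, lintegral_smul_measure,
        lintegral_prod _ hdm.aemeasurable]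
      rfl
    have e3 : (K' : ℝ≥0∞) * ∫⁻ s, ∫⁻ x, d (s, x) ∂G ∂vT =
        κ * σ.1 Set.univ + κ * Lb Set.univ * ENNReal.ofReal T := by
      rw [hK', hκ]
      push_cast
      rw [ENNReal.coe_toNNReal (measure_ne_top _ _), ENNReal.coe_toNNReal (measure_ne_top _ _)]
      change ENNReal.ofReal K * (σ.1 Set.univ + ENNReal.ofReal T * Lb Set.univ) * _ = _
      ring
    have e0 : ∫ ω, Real.exp (-Z ω) ∂μ - Real.exp (-cumulantExponent L σ T v) =
        (∫ ω, Real.exp (-Z ω) ∂μ - ∫ ω, Real.exp (-shiftedSum T n (y ω) θ) ∂μ) +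
        (Real.exp (-cumulantExponent L σ T W) - Real.exp (-cumulantExponent L σ T v)) := by
      rw [hlap]; ring
    rw [hE, e0]
    refine (enorm_add_le _ _).trans (add_le_add hA (hB'.trans (le_of_eq ?_)))
    rw [hdd] at e2
    rw [e2, ← hdd, e3]
    ring
  -- The error `E` depends on neither `n` nor `θ`. Averaging the bound over the shift leaves two
  -- terms that tend to zero with `n`, so `E = 0`.
  have hle : ∀ n : ℕ, E ≤
      (∫⁻ θ in Set.Ioc (0 : ℝ) 1, ∫⁻ ω, ‖shiftedSum T n (y ω) θ - Z ω‖ₑ ∂μ) +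
      ∫⁻ θ in Set.Ioc (0 : ℝ) 1,
        ∫⁻ b, ‖shiftedSum T n (obsPath F T b) θ - ∫ s in (0 : ℝ)..T, obsPath F T b s‖ₑ ∂Λ := by
    intro n
    have hmeas : Measurable fun θ => ∫⁻ ω, ‖shiftedSum T n (y ω) θ - Z ω‖ₑ ∂μ :=
      Measurable.lintegral_prod_left'
        (f := fun q : Ω × ℝ => ‖shiftedSum T n (y q.1) q.2 - Z q.1‖ₑ)
        ((measurable_shiftedSum hym T n).sub (hZm.comp measurable_fst)).enorm
    rw [← lintegral_add_left hmeas, ← lintegral_const_Ioc E]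
    exact setLIntegral_mono' measurableSet_Ioc (key n)
  have hE0 : E ≤ 0 := ge_of_tendsto' (by simpa using hlim1.add hlim2) hle
  have : E = 0 := le_antisymm hE0 zero_le
  rw [hE, enorm_eq_zero, sub_eq_zero] at this
  exact this

end OccupationLaplace

/-! ### Defective renewal equations -/

section Renewal

variable {ι : Type*} {l : Filter ι} {r : ℝ → ℝ} {ρ : ℝ}

/-- Dominated convergence for convolutions over a growing interval. -/
lemma tendsto_integral_convolution [l.IsCountablyGenerated] {H : ι → ℝ → ℝ → ℝ} {w h : ℝ → ℝ}
    (hw : IntegrableOn w (Set.Ioi 0)) (hH : ∀ i s, Measurable fun q => H i q (s - q))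
    (hb : ∀ᶠ i in l, ∀ q > 0, ∀ u ≥ 0, |H i q u| ≤ w q)
    (hl : ∀ q > 0, Tendsto (fun z : ι × ℝ => H z.1 q z.2) (l ×ˢ atTop) (𝓝 (h q))) :
    Tendsto (fun z : ι × ℝ => ∫ q in (0 : ℝ)..z.2, H z.1 q (z.2 - q)) (l ×ˢ atTop)
      (𝓝 (∫ q in Set.Ioi 0, h q)) := by
  have hev : ∀ c : ℝ, ∀ᶠ z : ι × ℝ in l ×ˢ atTop, c ≤ z.2 := fun c =>
    tendsto_snd.eventually (eventually_ge_atTop c)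
  have hD := tendsto_integral_filter_of_dominated_convergence (l := l ×ˢ (atTop : Filter ℝ))
    (μ := volume.restrict (Set.Ioi (0 : ℝ)))
    (F := fun z q => (Set.Iic z.2).indicator (fun q => H z.1 q (z.2 - q)) q) (f := h)
    (fun q => |w q|)
    (Eventually.of_forall fun z =>
      ((hH z.1 z.2).indicator measurableSet_Iic).aestronglyMeasurable) ?_ hw.abs ?_
  · refine hD.congr' ?_
    filter_upwards [hev 0] with z hz
    rw [setIntegral_indicator measurableSet_Iic, Set.Ioi_inter_Iic,
      intervalIntegral.integral_of_le hz]
  · filter_upwards [tendsto_fst.eventually hb] with z hz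
    filter_upwards [ae_restrict_mem measurableSet_Ioi] with q hq
    by_cases hqz : q ≤ z.2
    · rw [Set.indicator_of_mem (Set.mem_Iic.2 hqz)]
      exact (hz q hq _ (sub_nonneg.2 hqz)).trans (le_abs_self _)
    · rw [Set.indicator_of_notMem (by simpa using hqz), norm_zero]
      exact abs_nonneg _
  · filter_upwards [ae_restrict_mem measurableSet_Ioi] with q hq
    have hs : Tendsto (fun z : ι × ℝ => (z.1, z.2 - q)) (l ×ˢ atTop) (l ×ˢ atTop) :=
      tendsto_fst.prodMk (tendsto_atTop_add_const_right _ (-q) tendsto_snd)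
    refine ((hl q hq).comp hs).congr' ?_
    filter_upwards [hev q] with z hz
    rw [Set.indicator_of_mem (Set.mem_Iic.2 hz)]
    rfl

/-- A subprobability density on `(0,∞)`. -/
structure IsRenewalDensity (r : ℝ → ℝ) (ρ : ℝ) : Prop where
  measurable : Measurable r
  nonneg : ∀ s, 0 ≤ r s
  integrable : IntegrableOn r (Set.Ioi 0)
  integral : ∫ s in Set.Ioi 0, r s = ρ
  lt_one : ρ < 1

namespace IsRenewalDensity

lemma rho_nonneg (hr : IsRenewalDensity r ρ) : 0 ≤ ρ :=
  hr.integral ▸ integral_nonneg fun s => hr.nonneg s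

lemma intervalIntegrable (hr : IsRenewalDensity r ρ) {t : ℝ} (ht : 0 ≤ t) :
    IntervalIntegrable r volume 0 t := by
  rw [intervalIntegrable_iff_integrableOn_Ioc_of_le ht]
  exact hr.integrable.mono_set Set.Ioc_subset_Ioi_self

lemma intervalIntegrable_mul (hr : IsRenewalDensity r ρ) {m : ℝ → ℝ} (hm : Measurable m)
    {t B : ℝ} (ht : 0 ≤ t) (hB : ∀ s ∈ Set.Icc 0 t, |m s| ≤ B) :
    IntervalIntegrable (fun s => r s * m (t - s)) volume 0 t := by
  rw [intervalIntegrable_iff_integrableOn_Ioc_of_le ht]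
  have h := (hr.integrable.mono_set (Set.Ioc_subset_Ioi_self : Set.Ioc 0 t ⊆ Set.Ioi 0))
  refine Integrable.mono' (h.mul_const B)
    (hr.measurable.mul (hm.comp (by fun_prop))).aestronglyMeasurable ?_
  filter_upwards [ae_restrict_mem measurableSet_Ioc] with s hs
  rw [Real.norm_eq_abs, abs_mul, abs_of_nonneg (hr.nonneg s)]
  exact mul_le_mul_of_nonneg_left (hB _ ⟨by linarith [hs.2], by linarith [hs.1]⟩) (hr.nonneg s)

lemma intervalIntegral_le (hr : IsRenewalDensity r ρ) {t : ℝ} (ht : 0 ≤ t) :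
    ∫ s in (0 : ℝ)..t, r s ≤ ρ := by
  rw [intervalIntegral.integral_of_le ht, ← hr.integral]
  exact setIntegral_mono_set hr.integrable (ae_of_all _ hr.nonneg)
    (Set.Ioc_subset_Ioi_self).eventuallyLE

lemma abs_intervalIntegral_mul_le (hr : IsRenewalDensity r ρ) {m : ℝ → ℝ}
    {t B : ℝ} (ht : 0 ≤ t) (hB : ∀ s ∈ Set.Icc 0 t, |m s| ≤ B) :
    |∫ s in (0 : ℝ)..t, r s * m (t - s)| ≤ ρ * B := by
  have hB0 : 0 ≤ B := (abs_nonneg _).trans (hB 0 ⟨le_rfl, ht⟩)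
  calc |∫ s in (0 : ℝ)..t, r s * m (t - s)| ≤ ∫ s in (0 : ℝ)..t, r s * B := by
        rw [← Real.norm_eq_abs]
        refine intervalIntegral.norm_integral_le_of_norm_le ht
          (ae_of_all _ fun s hs => ?_) ((hr.intervalIntegrable ht).mul_const B)
        rw [Real.norm_eq_abs, abs_mul, abs_of_nonneg (hr.nonneg s)]
        exact mul_le_mul_of_nonneg_left (hB _ ⟨by linarith [hs.2], by linarith [hs.1]⟩)
          (hr.nonneg s)
    _ ≤ ρ * B := by
        rw [intervalIntegral.integral_mul_const]
        exact mul_le_mul_of_nonneg_right (hr.intervalIntegral_le ht) hB0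

/-- Boundedness of solutions of a defective renewal inequality. -/
lemma abs_le_of_renewal (hr : IsRenewalDensity r ρ) {m : ℝ → ℝ} {κ : ℝ}
    (hB : ∀ T : ℝ, ∃ B, ∀ t ∈ Set.Icc 0 T, |m t| ≤ B)
    (h : ∀ t ≥ 0, |m t| ≤ κ + ∫ s in (0 : ℝ)..t, r s * |m (t - s)|) {t : ℝ} (ht : 0 ≤ t) :
    |m t| ≤ κ / (1 - ρ) := by
  have hρ := hr.lt_one
  obtain ⟨B, hB⟩ := hB t
  have hbdd : BddAbove ((fun s => |m s|) '' Set.Icc 0 t) := by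
    refine ⟨B, ?_⟩
    rintro _ ⟨s, hs, rfl⟩
    exact hB s hs
  set S := sSup ((fun s => |m s|) '' Set.Icc 0 t)
  have hS : ∀ s ∈ Set.Icc 0 t, |m s| ≤ S := fun s hs => le_csSup hbdd ⟨s, hs, rfl⟩
  have hSle : S ≤ κ + ρ * S := by
    refine csSup_le ⟨_, t, ⟨ht, le_rfl⟩, rfl⟩ ?_
    rintro _ ⟨s, hs, rfl⟩
    have h1 := hr.abs_intervalIntegral_mul_le (m := fun u => |m u|) (t := s) (B := S) hs.1
      fun u hu => by rw [abs_abs]; exact hS u ⟨hu.1, hu.2.trans hs.2⟩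
    exact (h s hs.1).trans (by linarith [le_abs_self (∫ u in (0 : ℝ)..s, r u * |m (s - u)|)])
  rw [le_div_iff₀ (by linarith)]
  have := hS t ⟨ht, le_rfl⟩
  nlinarith

/-- Integrability of solutions of a defective renewal inequality. -/
lemma integrableOn_of_renewal (hr : IsRenewalDensity r ρ) {m k : ℝ → ℝ} (hm : Measurable m)
    (hB : ∀ T : ℝ, ∃ B, ∀ t ∈ Set.Icc 0 T, |m t| ≤ B) (hk : IntegrableOn k (Set.Ioi 0))
    (hk0 : ∀ t, 0 ≤ k t)
    (h : ∀ t ≥ 0, |m t| ≤ k t + ∫ s in (0 : ℝ)..t, r s * |m (t - s)|) :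
    IntegrableOn m (Set.Ioi 0) := by
  have hρ := hr.lt_one
  have hint : ∀ T, IntegrableOn m (Set.Ioc 0 T) := fun T => by
    obtain ⟨B, hB⟩ := hB T
    refine Measure.integrableOn_of_bounded (M := B) (by simp) hm.aestronglyMeasurable ?_
    filter_upwards [ae_restrict_mem measurableSet_Ioc] with s hs
    exact hB s ⟨hs.1.le, hs.2⟩
  refine integrableOn_Ioi_of_intervalIntegral_norm_bounded ((∫ t in Set.Ioi 0, k t) / (1 - ρ)) 0
    hint tendsto_id ?_
  filter_upwards [eventually_ge_atTop (0 : ℝ)] with T hT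
  -- The function is cut off at `T` so that it is integrable and the convolution has integral `ρ ∫
  -- mT`. Absorbing this term gives a bound on `∫_0^T |m|` that does not depend on `T`.
  set mT : ℝ → ℝ := (Set.Iic T).indicator fun t => |m t| with hmT
  have hmT0 : ∀ t, 0 ≤ mT t := Set.indicator_nonneg fun _ _ => abs_nonneg _
  have hmTi : IntegrableOn mT (Set.Ioi 0) := by
    rw [IntegrableOn, hmT, integrable_indicator_iff measurableSet_Iic, IntegrableOn,
      Measure.restrict_restrict measurableSet_Iic, Set.inter_comm, Set.Ioi_inter_Iic]
    exact (hint T).abs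
  have hmTe : ∫ t in Set.Ioi 0, mT t = ∫ t in (0 : ℝ)..T, |m t| := by
    rw [hmT, setIntegral_indicator measurableSet_Iic, Set.Ioi_inter_Iic,
      intervalIntegral.integral_of_le hT]
  have hci := integrable_posConvolution hr.integrable hmTi (ContinuousLinearMap.mul ℝ ℝ)
    (μ := volume) (ν := volume)
  have hce := integral_posConvolution hr.integrable hmTi (ContinuousLinearMap.mul ℝ ℝ)
    (μ := volume) (ν := volume)
  simp only [ContinuousLinearMap.mul_apply'] at hce
  have hci' : IntegrableOn (fun t => ∫ s in (0 : ℝ)..t, r s * mT (t - s)) (Set.Ioi 0) := by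
    rw [posConvolution, integrable_indicator_iff measurableSet_Ioi] at hci
    exact hci
  rw [hr.integral, hmTe] at hce
  have h1 : ∫ t in (0 : ℝ)..T, |m t| ≤
      ∫ t in Set.Ioi 0, (k t + ∫ s in (0 : ℝ)..t, r s * mT (t - s)) := by
    rw [← hmTe]
    refine setIntegral_mono_on hmTi (hk.add hci') measurableSet_Ioi fun t ht => ?_
    have ht0 : (0 : ℝ) ≤ t := le_of_lt ht
    by_cases htT : t ≤ T
    · rw [hmT, Set.indicator_of_mem (Set.mem_Iic.2 htT), ← hmT]
      refine (h t ht0).trans (le_of_eq ?_)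
      congr 1
      refine intervalIntegral.integral_congr fun s hs => ?_
      rw [Set.uIcc_of_le ht0] at hs
      simp only [hmT]
      rw [Set.indicator_of_mem (Set.mem_Iic.2 (by linarith [hs.1]))]
    · rw [hmT, Set.indicator_of_notMem (by simpa using htT), ← hmT]
      exact add_nonneg (hk0 t) (intervalIntegral.integral_nonneg ht0 fun s _ =>
        mul_nonneg (hr.nonneg s) (hmT0 _))
  rw [integral_add hk hci', hce] at h1
  rw [le_div_iff₀ (by linarith)]
  simp only [Real.norm_eq_abs]
  linarith

lemma tendsto_convolution [l.IsCountablyGenerated] (hr : IsRenewalDensity r ρ)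
    {φ : ι → ℝ → ℝ} {B c : ℝ} (hφ : ∀ i, Measurable (φ i))
    (hB : ∀ᶠ i in l, ∀ s ≥ 0, |φ i s| ≤ B)
    (hl : Tendsto (fun z : ι × ℝ => φ z.1 z.2) (l ×ˢ atTop) (𝓝 c)) :
    Tendsto (fun z : ι × ℝ => ∫ q in (0 : ℝ)..z.2, r q * φ z.1 (z.2 - q)) (l ×ˢ atTop)
      (𝓝 (ρ * c)) := by
  have := tendsto_integral_convolution (l := l) (H := fun i q u => r q * φ i u)
    (w := fun q => r q * B) (h := fun q => r q * c) (hr.integrable.mul_const B)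
    (fun i s => hr.measurable.mul ((hφ i).comp (by fun_prop)))
    (by
      filter_upwards [hB] with i hi q _ u hu
      rw [abs_mul, abs_of_nonneg (hr.nonneg q)]
      exact mul_le_mul_of_nonneg_left (hi u hu) (hr.nonneg q))
    (fun q _ => hl.const_mul _)
  rwa [integral_mul_const, hr.integral] at this

/-- The renewal theorem for a defective renewal equation, uniformly in a parameter. -/
theorem tendsto_of_renewal [l.IsCountablyGenerated] (hr : IsRenewalDensity r ρ)
    {d K : ι → ℝ → ℝ} {B c : ℝ} (hd : ∀ i, Measurable (d i))
    (hB : ∀ᶠ i in l, ∀ s ≥ 0, |d i s| ≤ B)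
    (he : ∀ᶠ i in l, ∀ s ≥ 0, d i s = K i s + ∫ q in (0 : ℝ)..s, r q * d i (s - q))
    (hK : Tendsto (fun z : ι × ℝ => K z.1 z.2) (l ×ˢ atTop) (𝓝 c)) :
    Tendsto (fun z : ι × ℝ => d z.1 z.2) (l ×ˢ atTop) (𝓝 (c / (1 - ρ))) := by
  have hρ := hr.lt_one
  have hρ0 := hr.rho_nonneg
  set c' := c / (1 - ρ) with hc'
  have hcc : c' = c + ρ * c' := by
    have : (1 - ρ) ≠ 0 := by linarith
    rw [hc']; field_simp; ring
  have hev : ∀ c : ℝ, ∀ᶠ z : ι × ℝ in l ×ˢ atTop, c ≤ z.2 := fun c =>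
    tendsto_snd.eventually (eventually_ge_atTop c)
  have hr1 : Tendsto (fun z : ι × ℝ => ∫ q in (0 : ℝ)..z.2, r q) (l ×ˢ atTop) (𝓝 ρ) := by
    have := hr.tendsto_convolution (l := l) (φ := fun _ _ => 1) (B := 1) (c := 1)
      (fun _ => measurable_const) (by simp) tendsto_const_nhds
    simpa using this
  -- One pass through the equation improves an eventual bound `b` on the distance to the limit by
  -- the factor `(1 + ρ)/2`. This number lies strictly between `ρ` and `1`, which leaves room for
  -- the vanishing errors.
  have hstep : ∀ b > 0, (∀ᶠ z : ι × ℝ in l ×ˢ atTop, |d z.1 z.2 - c'| ≤ b) →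
      ∀ᶠ z : ι × ℝ in l ×ˢ atTop, |d z.1 z.2 - c'| ≤ (1 + ρ) / 2 * b := by
    intro b hb hev'
    -- The bound `b` holds only eventually. The function `max b |d - c'|` dominates the distance
    -- everywhere, is bounded at all nonnegative times, and is eventually equal to `b`.
    have hconv := hr.tendsto_convolution (l := l) (φ := fun i u => max b |d i u - c'|)
      (B := max b (B + |c'|)) (c := b)
      (fun i => measurable_const.max ((hd i).sub_const _).abs)
      (by
        filter_upwards [hB] with i hi s hs
        rw [abs_of_nonneg (hb.le.trans (le_max_left _ _))]
        exact max_le_max_left _ ((abs_sub _ _).trans (by linarith [hi s hs])))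
      (tendsto_const_nhds.congr' (by
        filter_upwards [hev'] with z hz
        rw [max_eq_left hz]))
    have hT : Tendsto (fun z : ι × ℝ => |K z.1 z.2 - c| +
        (∫ q in (0 : ℝ)..z.2, r q * max b |d z.1 (z.2 - q) - c'|) +
        |c'| * |(∫ q in (0 : ℝ)..z.2, r q) - ρ|) (l ×ˢ atTop) (𝓝 (|c - c| + ρ * b +
          |c'| * |ρ - ρ|)) :=
      (((hK.sub_const c).abs).add hconv).add (((hr1.sub_const ρ).abs).const_mul _)
    simp only [sub_self, abs_zero, mul_zero, zero_add, add_zero] at hT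
    have hlt : ρ * b < (1 + ρ) / 2 * b := by nlinarith
    filter_upwards [hT.eventually_lt_const hlt, hev 0, tendsto_fst.eventually he,
      tendsto_fst.eventually hB] with z hz hz0 hez hBz
    refine le_trans ?_ hz.le
    have i1 := hr.intervalIntegrable_mul (hd z.1) hz0 (B := B) fun s hs => hBz s hs.1
    have i2 : IntervalIntegrable (fun q => r q * max b |d z.1 (z.2 - q) - c'|) volume 0 z.2 :=
      hr.intervalIntegrable_mul (m := fun u => max b |d z.1 u - c'|) (B := max b (B + |c'|))
        (measurable_const.max ((hd z.1).sub_const _).abs) hz0 fun s hs => by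
          rw [abs_of_nonneg (hb.le.trans (le_max_left _ _))]
          exact max_le_max_left _ ((abs_sub _ _).trans (by linarith [hBz s hs.1]))
    have e : d z.1 z.2 - c' = (K z.1 z.2 - c) +
        (∫ q in (0 : ℝ)..z.2, r q * (d z.1 (z.2 - q) - c')) +
        c' * ((∫ q in (0 : ℝ)..z.2, r q) - ρ) := by
      have : ∫ q in (0 : ℝ)..z.2, r q * (d z.1 (z.2 - q) - c') =
          (∫ q in (0 : ℝ)..z.2, r q * d z.1 (z.2 - q)) - (∫ q in (0 : ℝ)..z.2, r q) * c' := by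
        rw [← intervalIntegral.integral_mul_const, ← intervalIntegral.integral_sub i1
          ((hr.intervalIntegrable hz0).mul_const _)]
        simp only [mul_sub]
      rw [hez z.2 hz0, this]
      linear_combination -hcc
    rw [e]
    refine (abs_add_le _ _).trans (add_le_add ((abs_add_le _ _).trans (add_le_add le_rfl ?_)) ?_)
    · rw [← Real.norm_eq_abs]
      refine intervalIntegral.norm_integral_le_of_norm_le hz0 (ae_of_all _ fun q _ => ?_) i2
      rw [Real.norm_eq_abs, abs_mul, abs_of_nonneg (hr.nonneg q)]
      exact mul_le_mul_of_nonneg_left (le_max_right _ _) (hr.nonneg q)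
    · rw [abs_mul]
  have hiter : ∀ n : ℕ, ∀ᶠ z : ι × ℝ in l ×ˢ atTop,
      |d z.1 z.2 - c'| ≤ ((1 + ρ) / 2) ^ n * (|B| + |c'| + 1) := by
    intro n
    induction n with
    | zero =>
      filter_upwards [hev 0, tendsto_fst.eventually hB] with z hz0 hBz
      have := hBz z.2 hz0
      have h2 := abs_sub (d z.1 z.2) c'
      have := le_abs_self B
      rw [pow_zero, one_mul]
      linarith
    | succ n ih =>
      have := hstep _ (by positivity) ih
      filter_upwards [this] with z hz
      rw [pow_succ', mul_assoc]
      exact hz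
  rw [tendsto_iff_norm_sub_tendsto_zero]
  have hgeo : Tendsto (fun n : ℕ => ((1 + ρ) / 2) ^ n * (|B| + |c'| + 1)) atTop (𝓝 0) := by
    have := (tendsto_pow_atTop_nhds_zero_of_lt_one (r := (1 + ρ) / 2) (by linarith)
      (by linarith)).mul_const (|B| + |c'| + 1)
    rwa [zero_mul] at this
  refine Metric.tendsto_nhds.2 fun η hη => ?_
  obtain ⟨n, hn⟩ := (hgeo.eventually_lt_const hη).exists
  filter_upwards [hiter n] with z hz
  rw [Real.dist_eq, sub_zero, Real.norm_eq_abs, abs_abs]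
  exact hz.trans_lt hn

end IsRenewalDensity

end Renewal

/-! ### Integrals along characteristics -/

section Shift

variable {G : Measure ℝ} {b : ℝ → ℝ}

/-- The integrand is zero from `x` on, so the effective length of the interval is at most `x⁺`. This
is the source of every bound that is linear in the residual life and uniform in time. -/
lemma abs_intervalIntegral_le_mul_max {h : ℝ → ℝ} {t x C : ℝ} (ht : 0 ≤ t)
    (hC : ∀ s ∈ Set.Icc 0 t, |h s| ≤ C) (h0 : ∀ s, x ≤ s → h s = 0) :
    |∫ s in (0 : ℝ)..t, h s| ≤ C * max x 0 := by
  have hC0 : 0 ≤ C := (abs_nonneg _).trans (hC 0 ⟨le_rfl, ht⟩)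
  have hsub : Set.Ioc 0 (min t (max x 0)) ⊆ Set.Ioc 0 t :=
    Set.Ioc_subset_Ioc_right (min_le_left _ _)
  rw [intervalIntegral.integral_of_le ht,
    setIntegral_eq_of_subset_of_forall_sdiff_eq_zero measurableSet_Ioc hsub fun s hs => ?_]
  · have h1 := norm_setIntegral_le_of_norm_le_const (μ := volume) (f := h) (C := C)
      (s := Set.Ioc 0 (min t (max x 0))) (by simp)
      fun s hs => hC s ⟨(hsub hs).1.le, (hsub hs).2⟩
    rw [Real.norm_eq_abs, Real.volume_real_Ioc_of_le (le_min ht (le_max_right _ _)), sub_zero] at h1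
    exact h1.trans (mul_le_mul_of_nonneg_left (min_le_right _ _) hC0)
  · have : ¬ s ≤ min t (max x 0) := fun hle => hs.2 ⟨hs.1.1, hle⟩
    rw [le_min_iff, not_and] at this
    have := not_le.1 (this hs.1.2)
    exact h0 s ((le_max_left _ _).trans this.le)

lemma MemB.abs_integral_shift_le {C : ℝ} (hb : MemB b) (hC : ∀ x, |b x| ≤ C) {t : ℝ} (ht : 0 ≤ t)
    (x : ℝ) : |∫ s in (0 : ℝ)..t, b (x - s)| ≤ C * max x 0 :=
  abs_intervalIntegral_le_mul_max ht (fun _ _ => hC _)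
    fun s hs => hb.zero_of_nonpos _ (by linarith)

lemma integrableOn_indicator_Iic (x C : ℝ) :
    IntegrableOn ((Set.Iic x).indicator fun _ => C) (Set.Ioi 0) := by
  rw [IntegrableOn, integrable_indicator_iff measurableSet_Iic, IntegrableOn,
    Measure.restrict_restrict measurableSet_Iic, Set.inter_comm, Set.Ioi_inter_Iic]
  exact integrable_const C

lemma abs_le_indicator_Iic {h : ℝ → ℝ} {x C s : ℝ} (hC : |h s| ≤ C) (h0 : x ≤ s → h s = 0) :
    |h s| ≤ (Set.Iic x).indicator (fun _ => C) s := by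
  by_cases hs : s ≤ x
  · rw [Set.indicator_of_mem (Set.mem_Iic.2 hs)]; exact hC
  · rw [Set.indicator_of_notMem (by simpa using hs), h0 (not_le.1 hs).le, abs_zero]

lemma MemB.integrableOn_shift (hb : MemB b) (x : ℝ) :
    IntegrableOn (fun s => b (x - s)) (Set.Ioi 0) := by
  obtain ⟨C, hC⟩ := hb.bounded
  refine Integrable.mono' (integrableOn_indicator_Iic x C)
    (hb.measurable.comp (by fun_prop)).aestronglyMeasurable (ae_of_all _ fun s => ?_)
  exact abs_le_indicator_Iic (h := fun s => b (x - s)) (hC _) fun hs =>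
    hb.zero_of_nonpos _ (by linarith)

lemma MemB.integral_shift_Ioi (hb : MemB b) (x : ℝ) :
    ∫ s in Set.Ioi 0, b (x - s) = ∫ s in (0 : ℝ)..x, b (x - s) := by
  rcases le_total 0 x with hx | hx
  · rw [intervalIntegral.integral_of_le hx]
    refine setIntegral_eq_of_subset_of_forall_sdiff_eq_zero measurableSet_Ioi
      Set.Ioc_subset_Ioi_self fun s hs => hb.zero_of_nonpos _ ?_
    have : ¬ s ≤ x := fun h => hs.2 ⟨hs.1, h⟩
    linarith
  · rw [intervalIntegral.integral_of_ge hx, setIntegral_eq_zero_of_forall_eq_zero,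
      setIntegral_eq_zero_of_forall_eq_zero, neg_zero]
    · intro s hs
      exact hb.zero_of_nonpos _ (by linarith [hs.1])
    · intro s hs
      have : (0 : ℝ) < s := hs
      exact hb.zero_of_nonpos _ (by linarith)

lemma MemB.abs (hb : MemB b) : MemB fun x => |b x| := by
  obtain ⟨C, hC⟩ := hb.bounded
  exact ⟨hb.measurable.abs, ⟨C, fun x => by rw [abs_abs]; exact hC x⟩,
    fun x hx => by rw [hb.zero_of_nonpos x hx, abs_zero]⟩

lemma MemB.measurable_integral_shift (hb : MemB b) :
    Measurable fun x => ∫ s in (0 : ℝ)..x, b (x - s) :=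
  measurable_intervalIntegral_param (h := fun x s => b (x - s)) measurable_id
    (hb.measurable.comp (by fun_prop))

lemma MemB.abs_integral_shift_self_le {C : ℝ} (hb : MemB b) (hC : ∀ x, |b x| ≤ C) (x : ℝ) :
    |∫ s in (0 : ℝ)..x, b (x - s)| ≤ C * max x 0 := by
  rcases le_total 0 x with hx | hx
  · exact hb.abs_integral_shift_le hC hx x
  · rw [← hb.integral_shift_Ioi, setIntegral_eq_zero_of_forall_eq_zero, abs_zero]
    · exact mul_nonneg ((abs_nonneg _).trans (hC 0)) (le_max_right _ _)
    · intro s hs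
      have : (0 : ℝ) < s := hs
      exact hb.zero_of_nonpos _ (by linarith)

/-- The density `q ↦ ∫ b(x - q) G(dx)`. -/
def shiftMean (G : Measure ℝ) (b : ℝ → ℝ) (q : ℝ) : ℝ := ∫ x, b (x - q) ∂G

lemma measurable_shiftMean [IsProbabilityMeasure G] (hb : Measurable b) :
    Measurable (shiftMean G b) :=
  measurable_integral_snd (φ := id) (h := fun q x => b (x - q)) (hb.comp (by fun_prop))
    measurable_id

/-- By Tonelli the integral in `q` comes first; it is at most `C x⁺`, so a first moment of `G`
suffices. -/
lemma MemB.integrable_shift_prod [IsProbabilityMeasure G] (hb : MemB b)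
    (hG : Integrable (fun x => max x 0) G) :
    Integrable (fun q : ℝ × ℝ => b (q.2 - q.1)) ((volume.restrict (Set.Ioi 0)).prod G) := by
  obtain ⟨C, hC⟩ := hb.bounded
  have hm : Measurable fun q : ℝ × ℝ => b (q.2 - q.1) := hb.measurable.comp (by fun_prop)
  rw [integrable_prod_iff' hm.aestronglyMeasurable]
  refine ⟨ae_of_all _ fun x => hb.integrableOn_shift x, ?_⟩
  simp only [Real.norm_eq_abs, hb.abs.integral_shift_Ioi]
  refine Integrable.mono' (hG.const_mul C) hb.abs.measurable_integral_shift.aestronglyMeasurable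
    (ae_of_all _ fun x => ?_)
  exact hb.abs.abs_integral_shift_self_le (fun y => by rw [abs_abs]; exact hC y) x

lemma MemB.integrableOn_shiftMean [IsProbabilityMeasure G] (hb : MemB b)
    (hG : Integrable (fun x => max x 0) G) : IntegrableOn (shiftMean G b) (Set.Ioi 0) :=
  (hb.integrable_shift_prod hG).integral_prod_left

lemma MemB.integral_shiftMean [IsProbabilityMeasure G] (hb : MemB b)
    (hG : Integrable (fun x => max x 0) G) :
    ∫ q in Set.Ioi 0, shiftMean G b q = ∫ x, (∫ s in (0 : ℝ)..x, b (x - s)) ∂G := by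
  simp only [← hb.integral_shift_Ioi]
  exact integral_integral_swap (hb.integrable_shift_prod hG)

lemma integral_intervalIntegral_swap_of_bounded [IsProbabilityMeasure G] {h : ℝ → ℝ → ℝ}
    (hh : Measurable (Function.uncurry h)) {t C : ℝ} (ht : 0 ≤ t)
    (hC : ∀ q ∈ Set.Icc 0 t, ∀ x, |h q x| ≤ C) :
    ∫ x, (∫ q in (0 : ℝ)..t, h q x) ∂G = ∫ q in (0 : ℝ)..t, ∫ x, h q x ∂G := by
  rw [intervalIntegral_integral_swap]
  rw [Set.uIoc_of_le ht]
  refine Integrable.of_bound hh.aestronglyMeasurable C ?_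
  have : ∀ᵐ q ∂(volume.restrict (Set.Ioc 0 t)).prod G, q.1 ∈ Set.Ioc 0 t :=
    Measure.quasiMeasurePreserving_fst.ae (ae_restrict_mem measurableSet_Ioc)
  filter_upwards [this] with q hq
  exact hC q.1 ⟨hq.1.le, hq.2⟩ q.2

end Shift

/-! ### The mean semigroup and its potential -/

section Mean

variable {α : ℝ → ℝ} {p : ℕ → ℝ → ℝ} {G : Measure ℝ} {f : ℝ → ℝ}

/-- A subcritical branching mechanism with second moments. -/
structure IsSubcritical (α : ℝ → ℝ) (p : ℕ → ℝ → ℝ) (G : Measure ℝ) : Prop where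
  mech : IsBranchingMechanism α p G
  second : SecondMomentBounded p
  rho_lt_one : rho α p G < 1
  moment : Integrable (fun x => max x 0 ^ 2) G

/-- The mean birth rate `α(x) g'(x, 1-)`. -/
def meanRate (α : ℝ → ℝ) (p : ℕ → ℝ → ℝ) (x : ℝ) : ℝ := α x * gen₁ p x

lemma meanRate_nonneg (h : IsSubcritical α p G) (x : ℝ) : 0 ≤ meanRate α p x :=
  mul_nonneg (h.mech.rate.nonneg x) (h.mech.gen₁_nonneg x)

lemma memB_meanRate (h : IsSubcritical α p G) : MemB (meanRate α p) := by
  obtain ⟨C, _, hC⟩ := h.mech.exists_bound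
  exact ⟨h.mech.rate.measurable.mul h.mech.measurable_gen₁,
    ⟨C, fun x => by rw [abs_of_nonneg (meanRate_nonneg h x)]; exact hC x⟩,
    fun x hx => by rw [meanRate, h.mech.rate.zero_of_nonpos x hx, zero_mul]⟩

lemma IsSubcritical.moment_one (h : IsSubcritical α p G) : Integrable (fun x => max x 0) G := by
  have := h.mech.prob
  refine Integrable.mono' (h.moment.add (integrable_const (1 : ℝ)))
    (measurable_id.max measurable_const).aestronglyMeasurable (ae_of_all _ fun x => ?_)
  rw [Real.norm_of_nonneg (le_max_right _ _)]
  simp only [Pi.add_apply]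
  nlinarith [sq_nonneg (max x 0 - 1), le_max_right x 0]

/-- The restriction to `x > s` is automatic, because the mean birth rate vanishes at nonpositive
arguments. -/
lemma reproduction_eq (h : IsSubcritical α p G) (s : ℝ) :
    reproduction α p G s = shiftMean G (meanRate α p) s := by
  rw [reproduction, shiftMean, ← integral_indicator measurableSet_Ioi]
  congr 1
  funext x
  by_cases hx : x ∈ Set.Ioi s
  · rw [Set.indicator_of_mem hx]; rfl
  · rw [Set.indicator_of_notMem hx, (memB_meanRate h).zero_of_nonpos]
    have : x ≤ s := by simpa using hx
    linarith

lemma IsSubcritical.isRenewalDensity (h : IsSubcritical α p G) :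
    IsRenewalDensity (shiftMean G (meanRate α p)) (rho α p G) := by
  have := h.mech.prob
  refine ⟨measurable_shiftMean (memB_meanRate h).measurable,
    fun s => integral_nonneg fun x => meanRate_nonneg h _,
    (memB_meanRate h).integrableOn_shiftMean h.moment_one, ?_, h.rho_lt_one⟩
  rw [rho]
  simp only [reproduction_eq h]

lemma rho_eq (h : IsSubcritical α p G) :
    rho α p G = ∫ x, (∫ s in (0 : ℝ)..x, meanRate α p (x - s)) ∂G := by
  have := h.mech.prob
  rw [← h.isRenewalDensity.integral, (memB_meanRate h).integral_shiftMean h.moment_one]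

/-- `⟨G, Π_∞ f⟩` in explicit form. -/
def meanMass (α : ℝ → ℝ) (p : ℕ → ℝ → ℝ) (G : Measure ℝ) (f : ℝ → ℝ) : ℝ :=
  (1 - rho α p G)⁻¹ * ∫ x, (∫ s in (0 : ℝ)..x, f (x - s)) ∂G

lemma integral_shift_mul_eq (h : IsSubcritical α p G) {m : ℝ → ℝ} (hm : Measurable m)
    {t B : ℝ} (ht : 0 ≤ t) (hB : ∀ s ∈ Set.Icc 0 t, |m s| ≤ B) :
    ∫ x, (∫ s in (0 : ℝ)..t, meanRate α p (x - s) * m (t - s)) ∂G =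
      ∫ s in (0 : ℝ)..t, shiftMean G (meanRate α p) s * m (t - s) := by
  have := h.mech.prob
  obtain ⟨C, hC⟩ := (memB_meanRate h).bounded
  have hC0 : 0 ≤ C := (abs_nonneg _).trans (hC 0)
  rw [integral_intervalIntegral_swap_of_bounded (C := C * B)
    (h := fun s x => meanRate α p (x - s) * m (t - s)) _ ht]
  · refine intervalIntegral.integral_congr fun s _ => ?_
    simp only [integral_mul_const, shiftMean]
  · intro s hs x
    rw [abs_mul]
    exact mul_le_mul (hC _) (hB _ ⟨by linarith [hs.2], by linarith [hs.1]⟩) (abs_nonneg _) hC0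
  · exact ((memB_meanRate h).measurable.comp (by fun_prop)).mul (hm.comp (by fun_prop))

lemma integrable_integral_shift (h : IsSubcritical α p G) (hf : MemB f) :
    Integrable (fun x => ∫ s in (0 : ℝ)..x, f (x - s)) G := by
  obtain ⟨C, hC⟩ := hf.bounded
  exact Integrable.mono' (h.moment_one.const_mul C)
    hf.measurable_integral_shift.aestronglyMeasurable
    (ae_of_all _ fun x => hf.abs_integral_shift_self_le hC x)

/-- Integrability in time of the mean semigroup, and its potential. -/
theorem meanSemigroup_potential (h : IsSubcritical α p G) (hf : MemB f) (x : ℝ) :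
    IntegrableOn (fun s => meanSemigroup α p G f s x) (Set.Ioi 0) ∧
    PiInf α p G f x = (∫ s in (0 : ℝ)..x, f (x - s)) +
      (∫ s in (0 : ℝ)..x, meanRate α p (x - s)) * meanMass α p G f := by
  have := h.mech.prob
  have hr := h.isRenewalDensity
  have hπ := h.mech.isMeanSolution_meanSemigroup hf
  obtain ⟨Cf, hCf⟩ := hf.bounded
  set π := meanSemigroup α p G f with hπe
  set m : ℝ → ℝ := fun t => pair G (π t) with hm
  have hmm : Measurable m := measurable_integral_snd (φ := id) hπ.measurable measurable_id
  have hmB : ∀ T : ℝ, ∃ B, ∀ t ∈ Set.Icc 0 T, |m t| ≤ B := fun T => by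
    obtain ⟨B, hB⟩ := hπ.locallyBounded T
    refine ⟨B, fun t ht => ?_⟩
    have := norm_integral_le_of_norm_le_const (μ := G) (f := π t) (C := B)
      (ae_of_all _ fun x => hB t ht x)
    rwa [probReal_univ, mul_one] at this
  -- Averaging the mean equation over `G` closes it: `m(t) = ⟨G, π_t f⟩` solves a scalar defective
  -- renewal equation.
  have heq : ∀ t ≥ 0, m t = shiftMean G f t +
      ∫ s in (0 : ℝ)..t, shiftMean G (meanRate α p) s * m (t - s) := by
    intro t ht
    obtain ⟨B, hB⟩ := hmB t
    rw [← integral_shift_mul_eq h hmm ht hB, shiftMean, ← integral_add]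
    · exact integral_congr_ae (ae_of_all _ fun x => hπ.eqn t ht x)
    · exact integrable_of_bounded (hf.measurable.comp (by fun_prop)) fun s => hCf _
    · obtain ⟨C, hC⟩ := (memB_meanRate h).bounded
      obtain ⟨B', hB'⟩ := hπ.locallyBounded t
      refine integrable_of_bounded (B := B' + Cf) ?_ fun y => ?_
      · exact measurable_intervalIntegral_param (β := ℝ)
          (h := fun x s => meanRate α p (x - s) * m (t - s)) measurable_const
          (((memB_meanRate h).measurable.comp (by fun_prop)).mul (hmm.comp (by fun_prop)))
      · have e := hπ.eqn t ht y
        have h1 := hB' t ⟨ht, le_rfl⟩ y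
        have h2 := hCf (y - t)
        have e2 : ∫ s in (0 : ℝ)..t, meanRate α p (y - s) * m (t - s) = π t y - f (y - t) := by
          rw [e]; simp only [meanRate, hm]; ring
        rw [e2]
        exact (abs_sub _ _).trans (add_le_add h1 h2)
  have hmi : IntegrableOn m (Set.Ioi 0) := by
    refine hr.integrableOn_of_renewal (k := shiftMean G fun x => |f x|) hmm hmB
      (hf.abs.integrableOn_shiftMean h.moment_one)
      (fun t => integral_nonneg fun x => abs_nonneg _) fun t ht => ?_
    rw [heq t ht]
    refine (abs_add_le _ _).trans (add_le_add ?_ ?_)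
    · exact abs_integral_le_integral_abs
    · refine (intervalIntegral.abs_integral_le_integral_abs ht).trans (le_of_eq ?_)
      simp only [abs_mul, abs_of_nonneg (hr.nonneg _)]
  -- Integrated over all times, the renewal equation reads `∫ m = ∫∫ f + ρ₁ ∫ m`, which is solved
  -- for `∫ m`.
  have hM : ∫ t in Set.Ioi 0, m t = meanMass α p G f := by
    have e1 : ∫ t in Set.Ioi 0, m t = ∫ t in Set.Ioi 0, (shiftMean G f t +
        ∫ s in (0 : ℝ)..t, shiftMean G (meanRate α p) s * m (t - s)) :=
      setIntegral_congr_fun measurableSet_Ioi fun t ht => heq t (le_of_lt ht)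
    have hci := integrable_posConvolution hr.integrable hmi (ContinuousLinearMap.mul ℝ ℝ)
      (μ := volume) (ν := volume)
    have hce := integral_posConvolution hr.integrable hmi (ContinuousLinearMap.mul ℝ ℝ)
      (μ := volume) (ν := volume)
    rw [posConvolution, integrable_indicator_iff measurableSet_Ioi] at hci
    simp only [ContinuousLinearMap.mul_apply'] at hce hci
    rw [integral_add (hf.integrableOn_shiftMean h.moment_one) hci, hce, hr.integral,
      hf.integral_shiftMean h.moment_one] at e1
    have : 1 - rho α p G ≠ 0 := by linarith [h.rho_lt_one]
    rw [meanMass, eq_inv_mul_iff_mul_eq₀ this]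
    linear_combination e1
  have hax := (memB_meanRate h).integrableOn_shift x
  have hci := integrable_posConvolution hax hmi (ContinuousLinearMap.mul ℝ ℝ)
    (μ := volume) (ν := volume)
  have hce := integral_posConvolution hax hmi (ContinuousLinearMap.mul ℝ ℝ)
    (μ := volume) (ν := volume)
  rw [posConvolution, integrable_indicator_iff measurableSet_Ioi] at hci
  simp only [ContinuousLinearMap.mul_apply'] at hce hci
  have hfx := hf.integrableOn_shift x
  have hpe : Set.EqOn (fun s => π s x) (fun t => f (x - t) +
      ∫ s in (0 : ℝ)..t, meanRate α p (x - s) * m (t - s)) (Set.Ioi 0) :=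
    fun t ht => hπ.eqn t (le_of_lt ht) x
  refine ⟨(integrableOn_congr_fun hpe measurableSet_Ioi).2 (hfx.add hci), ?_⟩
  rw [PiInf, setIntegral_congr_fun measurableSet_Ioi hpe, integral_add hfx hci, hce, hM,
    (memB_meanRate h).integral_shift_Ioi, hf.integral_shift_Ioi]

/-- Linearity in `f`, measurability and linear growth of the potential are all read off from this
explicit form. -/
lemma PiInf_eq (h : IsSubcritical α p G) (hf : MemB f) (x : ℝ) :
    PiInf α p G f x = (∫ s in (0 : ℝ)..x, f (x - s)) +
      (∫ s in (0 : ℝ)..x, meanRate α p (x - s)) * meanMass α p G f :=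
  (meanSemigroup_potential h hf x).2

lemma measurable_PiInf (h : IsSubcritical α p G) (hf : MemB f) : Measurable (PiInf α p G f) := by
  have : PiInf α p G f = fun x => (∫ s in (0 : ℝ)..x, f (x - s)) +
      (∫ s in (0 : ℝ)..x, meanRate α p (x - s)) * meanMass α p G f := funext (PiInf_eq h hf)
  rw [this]
  exact hf.measurable_integral_shift.add
    ((memB_meanRate h).measurable_integral_shift.mul_const _)

lemma exists_abs_PiInf_le (h : IsSubcritical α p G) (hf : MemB f) :
    ∃ C, 0 ≤ C ∧ ∀ x, |PiInf α p G f x| ≤ C * max x 0 := by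
  obtain ⟨C, hC⟩ := hf.bounded
  obtain ⟨A, hA⟩ := (memB_meanRate h).bounded
  have hC0 : 0 ≤ C := (abs_nonneg _).trans (hC 0)
  have hA0 : 0 ≤ A := (abs_nonneg _).trans (hA 0)
  refine ⟨C + A * |meanMass α p G f|, by positivity, fun x => ?_⟩
  rw [PiInf_eq h hf]
  refine (abs_add_le _ _).trans ?_
  rw [abs_mul]
  have h1 := hf.abs_integral_shift_self_le hC x
  have h2 := mul_le_mul_of_nonneg_right ((memB_meanRate h).abs_integral_shift_self_le hA x)
    (abs_nonneg (meanMass α p G f))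
  nlinarith

lemma memLp_PiInf (h : IsSubcritical α p G) (hf : MemB f) : MemLp (PiInf α p G f) 2 G := by
  obtain ⟨C, _, hC⟩ := exists_abs_PiInf_le h hf
  rw [memLp_two_iff_integrable_sq (measurable_PiInf h hf).aestronglyMeasurable]
  refine Integrable.mono' (h.moment.const_mul (C ^ 2))
    ((measurable_PiInf h hf).pow_const 2).aestronglyMeasurable (ae_of_all _ fun x => ?_)
  rw [Real.norm_eq_abs, abs_pow, ← mul_pow]
  exact pow_le_pow_left₀ (abs_nonneg _) (hC x) 2

end Mean

/-! ### Taylor remainders of the exponential -/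

section QuadRem

/-- The second order remainder `e^{-v} - 1 + v`. -/
def quadRem (v : ℝ) : ℝ := v - oneSubExp v

lemma quadRem_nonneg (v : ℝ) : 0 ≤ quadRem v := sub_nonneg.2 (oneSubExp_le v)

lemma measurable_quadRem : Measurable quadRem := measurable_id.sub measurable_oneSubExp

/-- From `e^v ≥ 1 + v + v²/2` and `(1 + v + v²/2)(1 - v + v²/2) = 1 + v⁴/4 ≥ 1` it follows that
`e^{-v} ≤ 1 - v + v²/2`. -/
lemma quadRem_le {v : ℝ} (hv : 0 ≤ v) : quadRem v ≤ v ^ 2 / 2 := by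
  have h1 := Real.quadratic_le_exp_of_nonneg hv
  have h2 : Real.exp (-v) * Real.exp v = 1 := by rw [← Real.exp_add]; simp
  have h3 := Real.exp_pos (-v)
  have h4 : Real.exp (-v) * (1 + v + v ^ 2 / 2) ≤ 1 :=
    (mul_le_mul_of_nonneg_left h1 h3.le).trans h2.le
  have h5 : 0 < 1 + v + v ^ 2 / 2 := by positivity
  have h6 : Real.exp (-v) ≤ 1 - v + v ^ 2 / 2 := by
    refine le_of_mul_le_mul_right (h4.trans ?_) h5
    nlinarith [sq_nonneg (v ^ 2)]
  rw [quadRem, oneSubExp]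
  linarith

/-- For `v ≤ 1` this is Taylor's formula of order three. For `v ≥ 1` the remainder lies between `0`
and `v²/2`, and `v²/2 ≤ v³`. -/
lemma abs_quadRem_sub_le {v : ℝ} (hv : 0 ≤ v) : |quadRem v - v ^ 2 / 2| ≤ v ^ 3 := by
  have h0 := quadRem_le hv
  rw [abs_sub_comm, abs_of_nonneg (sub_nonneg.2 h0)]
  rcases le_total v 1 with h1 | h1
  · have h := Real.exp_bound (x := -v) (by rw [abs_neg, abs_of_nonneg hv]; exact h1)
      (n := 3) (by norm_num)
    simp only [Finset.sum_range_succ, Finset.sum_range_zero, abs_neg, abs_of_nonneg hv,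
      Nat.factorial] at h
    norm_num at h
    have h2 := (abs_le.1 h).1
    rw [quadRem, oneSubExp]
    have h3 : 0 ≤ v ^ 3 := by positivity
    nlinarith
  · have := quadRem_nonneg v
    nlinarith [mul_nonneg (sq_nonneg v) (sub_nonneg.2 h1), sq_nonneg v]

end QuadRem

/-! ### A priori bounds for the occupation mean and cumulant -/

section Perturbation

variable {α : ℝ → ℝ} {p : ℕ → ℝ → ℝ} {G : Measure ℝ} {F : ℝ → ℝ} {M : ℝ → ℝ → ℝ}
  {v : ℝ → ℝ → ℝ → ℝ}

/-- A priori bound for subcritical Volterra equations. -/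
lemma IsVolterraSolution.le_mul_max {c : ℝ → ℝ → ℝ} {φ : ℝ → ℝ} {C A B : ℝ} {J u : ℝ → ℝ → ℝ}
    (h : IsSubcritical α p G) (hK : VolterraKernel c φ C)
    (hc : ∀ y q, 0 ≤ q → c y q ≤ meanRate α p y * q) (hA : ∀ x, |meanRate α p x| ≤ A)
    (hu : IsVolterraSolution c φ G J u)
    (hJ : ∀ t ≥ 0, ∀ x, J t x ≤ B * max x 0) {t : ℝ} (ht : 0 ≤ t) :
    (∫ x, u t x ∂G ≤ B * (∫ x, max x 0 ∂G) / (1 - rho α p G)) ∧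
    ∀ x, u t x ≤ (B + A * (B * (∫ x, max x 0 ∂G) / (1 - rho α p G))) * max x 0 := by
  have := h.mech.prob
  have hr := h.isRenewalDensity
  have hum : ∀ s, Measurable (u s) := fun s => hu.measurable.comp measurable_prodMk_left
  set w : ℝ → ℝ := fun s => ∫ x, u s x ∂G with hw
  have hwm : Measurable w := measurable_integral_snd (φ := id) hu.measurable measurable_id
  have hw0 : ∀ s, 0 ≤ w s := fun s => integral_nonneg (hu.nonneg s)
  have hwB : ∀ T : ℝ, ∃ B, ∀ s ∈ Set.Icc 0 T, |w s| ≤ B := fun T => by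
    obtain ⟨B, hB⟩ := hu.locallyBounded T
    refine ⟨B, fun s hs => ?_⟩
    have := norm_integral_le_of_norm_le_const (μ := G) (f := u s) (C := B)
      (ae_of_all _ fun x => by
        rw [Real.norm_of_nonneg (hu.nonneg s x)]; exact hB s hs x)
    rwa [probReal_univ, mul_one] at this
  have hqw : ∀ s ≥ 0, 0 ≤ ∫ y, φ (u s y) ∂G ∧ ∫ y, φ (u s y) ∂G ≤ w s := fun s hs => by
    obtain ⟨B, hB⟩ := hu.locallyBounded s
    refine ⟨integral_phi_nonneg hK (hu.nonneg s), ?_⟩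
    exact integral_mono (integrable_phi hK (hum s) (hu.nonneg s) (hB s ⟨hs, le_rfl⟩))
      (integrable_of_bounded (hum s) (B := B) fun x => by
        rw [abs_of_nonneg (hu.nonneg s x)]; exact hB s ⟨hs, le_rfl⟩ x)
      fun x => hK.le' (hu.nonneg s x)
  have hqm : Measurable fun s => ∫ y, φ (u s y) ∂G :=
    measurable_integral_snd hu.measurable hK.meas'
  have hAm := (memB_meanRate h).measurable
  have hA0 : 0 ≤ A := (abs_nonneg _).trans (hA 0)
  have hii : ∀ s ≥ 0, ∀ x, IntervalIntegrable (fun q => meanRate α p (x - q) * w (s - q))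
      volume 0 s := fun s hs x => by
    obtain ⟨B, hB⟩ := hwB s
    refine intervalIntegrable_of_bounded (h := fun q => meanRate α p (x - q) * w (s - q))
      (B := A * B) ((hAm.comp (by fun_prop)).mul (hwm.comp (by fun_prop))) hs fun q hq => ?_
    rw [abs_mul]
    exact mul_le_mul (hA _) (hB _ ⟨by linarith [hq.2], by linarith [hq.1]⟩) (abs_nonneg _) hA0
  have hle : ∀ s ≥ 0, ∀ x, u s x ≤ B * max x 0 +
      ∫ q in (0 : ℝ)..s, meanRate α p (x - q) * w (s - q) := by
    intro s hs x
    rw [hu.eqn s hs x]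
    obtain ⟨B', hB'⟩ := hwB s
    refine add_le_add (hJ s hs x) (intervalIntegral.integral_mono_on hs
      (intervalIntegrable_volterra hK hqm (B := B') hs (fun q hq => ⟨(hqw q hq.1).1,
        (hqw q hq.1).2.trans ((le_abs_self _).trans (hB' q hq))⟩) x) (hii s hs x) fun q hq => ?_)
    have hsq : 0 ≤ s - q := by linarith [hq.2]
    refine (hc _ _ (hqw _ hsq).1).trans ?_
    exact mul_le_mul_of_nonneg_left (hqw _ hsq).2 (meanRate_nonneg h _)
  -- The `G`-average of the pointwise inequality is a defective renewal inequality, whose solutions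
  -- are bounded uniformly in time. Inserted back into it, this bound gives the estimate for every
  -- `x`.
  have hwle : ∀ s ≥ 0, |w s| ≤ B * (∫ x, max x 0 ∂G) / (1 - rho α p G) := by
    intro s hs
    refine hr.abs_le_of_renewal hwB (fun s hs => ?_) hs
    obtain ⟨Bw, hBw⟩ := hwB s
    obtain ⟨Bu, hBu⟩ := hu.locallyBounded s
    have hi1 : Integrable (fun x => ∫ q in (0 : ℝ)..s, meanRate α p (x - q) * w (s - q)) G := by
      refine Integrable.mono' (h.moment_one.const_mul (A * Bw))
        (measurable_intervalIntegral_param (β := ℝ)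
          (h := fun x q => meanRate α p (x - q) * w (s - q)) measurable_const
          ((hAm.comp (by fun_prop)).mul (hwm.comp (by fun_prop)))).aestronglyMeasurable
        (ae_of_all _ fun x => ?_)
      refine abs_intervalIntegral_le_mul_max hs (fun q hq => ?_) fun q hq => ?_
      · rw [abs_mul]
        exact mul_le_mul (hA _) (hBw _ ⟨by linarith [hq.2], by linarith [hq.1]⟩)
          (abs_nonneg _) hA0
      · rw [(memB_meanRate h).zero_of_nonpos _ (by linarith), zero_mul]
    simp only [abs_of_nonneg (hw0 _)]
    rw [← integral_shift_mul_eq h hwm hs hBw, ← integral_const_mul,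
      ← integral_add (h.moment_one.const_mul B) hi1]
    exact integral_mono (integrable_of_bounded (hum s) (B := Bu) fun x => by
        rw [abs_of_nonneg (hu.nonneg s x)]; exact hBu s ⟨hs, le_rfl⟩ x)
      ((h.moment_one.const_mul B).add hi1) (hle s hs)
  refine ⟨(le_abs_self _).trans (hwle t ht), fun x => (hle t ht x).trans ?_⟩
  rw [add_mul]
  refine add_le_add le_rfl ((le_abs_self _).trans ?_)
  refine abs_intervalIntegral_le_mul_max ht (fun q hq => ?_) fun q hq => ?_
  · rw [abs_mul]
    exact mul_le_mul (hA _) (hwle _ (by linarith [hq.2])) (abs_nonneg _) hA0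
  · rw [(memB_meanRate h).zero_of_nonpos _ (by linarith), zero_mul]

/-- `M` is the mean and `v ε` the cumulant of the occupation time, with test functions `F`
and `ε F`. -/
structure IsOccupationCumulant (α : ℝ → ℝ) (p : ℕ → ℝ → ℝ) (G : Measure ℝ) (F : ℝ → ℝ)
    (M : ℝ → ℝ → ℝ) (v : ℝ → ℝ → ℝ → ℝ) : Prop where
  sub : IsSubcritical α p G
  memB : MemB F
  nonneg : ∀ x, 0 ≤ F x
  mean : IsVolterraSolution (meanBirth α p) id G (cumForcing F) M
  measurable : ∀ ε, Measurable (Function.uncurry (v ε))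
  cumulant : ∀ ε > 0, IsVolterraSolution (birth α p) oneSubExp G
    (cumForcing fun x => ε * F x) (v ε)

lemma cumForcing_const_mul (ε t x : ℝ) :
    cumForcing (fun x => ε * F x) t x = ε * cumForcing F t x := by
  simp only [cumForcing, intervalIntegral.integral_const_mul]

lemma MemB.const_mul (hF : MemB F) (ε : ℝ) : MemB fun x => ε * F x := by
  obtain ⟨C, hC⟩ := hF.bounded
  exact ⟨hF.measurable.const_mul ε, ⟨|ε| * C, fun x => by
    rw [abs_mul]; exact mul_le_mul_of_nonneg_left (hC x) (abs_nonneg _)⟩,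
    fun x hx => by rw [hF.zero_of_nonpos x hx, mul_zero]⟩

/-- For `ε ≤ 0` the equation is not required, and the zero function is chosen. Only joint
measurability must hold for every `ε`, because the convergence lemmas ask for it at every index. -/
lemma IsSubcritical.exists_isOccupationCumulant (h : IsSubcritical α p G) (hF : MemB F)
    (h0 : ∀ x, 0 ≤ F x) : ∃ M v, IsOccupationCumulant α p G F M v := by
  have := h.mech.prob
  obtain ⟨C, hC0, hC⟩ := h.mech.exists_bound
  obtain ⟨M, hM⟩ := exists_isVolterraSolution (G := G) (h.mech.volterraKernel_meanBirth hC0 hC)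
    (isForcing_cumForcing hF h0)
  have hex : ∀ ε : ℝ, ∃ w, Measurable (Function.uncurry w) ∧ (0 < ε →
      IsVolterraSolution (birth α p) oneSubExp G (cumForcing fun x => ε * F x) w) := fun ε => by
    by_cases hε : 0 < ε
    · obtain ⟨w, hw⟩ := exists_isVolterraSolution (G := G) (h.mech.volterraKernel_birth hC0 hC)
        (isForcing_cumForcing (hF.const_mul ε) fun x => mul_nonneg hε.le (h0 x))
      exact ⟨w, hw.measurable, fun _ => hw⟩
    · exact ⟨fun _ _ => 0, measurable_const, fun h => absurd h hε⟩
  choose v hv1 hv2 using hex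
  exact ⟨M, v, h, hF, h0, hM, hv1, hv2⟩

namespace IsOccupationCumulant

/-- Linear growth of the mean and of the cumulant. -/
lemma exists_bound (h : IsOccupationCumulant α p G F M v) :
    ∃ C, 0 ≤ C ∧ (∀ t ≥ 0, ∀ x, M t x ≤ C * max x 0) ∧ (∀ t ≥ 0, ∫ x, M t x ∂G ≤ C) ∧
      ∀ ε > 0, ∀ t ≥ 0, (∀ x, v ε t x ≤ ε * C * max x 0) ∧ ∫ x, v ε t x ∂G ≤ ε * C := by
  have := h.sub.mech.prob
  obtain ⟨C, hC0, hC⟩ := h.sub.mech.exists_bound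
  obtain ⟨B, hB⟩ := h.memB.bounded
  obtain ⟨A, hA⟩ := (memB_meanRate h.sub).bounded
  have hB0 : 0 ≤ B := (abs_nonneg _).trans (hB 0)
  have hA0 : 0 ≤ A := (abs_nonneg _).trans (hA 0)
  have hρ := h.sub.rho_lt_one
  set μ₁ := ∫ x, max x 0 ∂G with hμ₁
  have hμ0 : 0 ≤ μ₁ := integral_nonneg fun x => le_max_right _ _
  have hJ : ∀ t ≥ 0, ∀ x, cumForcing F t x ≤ B * max x 0 := fun t ht x =>
    (le_abs_self _).trans (h.memB.abs_integral_shift_le hB ht x)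
  set W := B * μ₁ / (1 - rho α p G) with hW
  have hW0 : 0 ≤ W := div_nonneg (by positivity) (by linarith)
  have hmax : ∀ x : ℝ, 0 ≤ max x 0 := fun x => le_max_right _ _
  refine ⟨B + A * W + W, by positivity, fun t ht x => ?_, fun t ht => ?_, fun ε hε t ht => ?_⟩
  · have := (h.mean.le_mul_max h.sub (h.sub.mech.volterraKernel_meanBirth hC0 hC)
      (fun y q _ => le_rfl) hA hJ ht).2 x
    exact this.trans (mul_le_mul_of_nonneg_right (by linarith) (hmax x))
  · have := (h.mean.le_mul_max h.sub (h.sub.mech.volterraKernel_meanBirth hC0 hC)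
      (fun y q _ => le_rfl) hA hJ ht).1
    have h2 : 0 ≤ A * W := by positivity
    linarith
  · have key := (h.cumulant ε hε).le_mul_max (B := ε * B) h.sub
      (h.sub.mech.volterraKernel_birth hC0 hC) (fun y q hq => h.sub.mech.birth_le y hq) hA
      (fun s hs x => by
          rw [cumForcing_const_mul, mul_assoc]
          exact mul_le_mul_of_nonneg_left (hJ s hs x) hε.le) ht
    have e : ε * B * μ₁ / (1 - rho α p G) = ε * W := by rw [hW]; ring
    rw [← hμ₁, e] at key
    refine ⟨fun x => (key.2 x).trans (mul_le_mul_of_nonneg_right ?_ (hmax x)), key.1.trans ?_⟩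
    · have : 0 ≤ ε * W := by positivity
      linarith
    · have : 0 ≤ ε * (B + A * W) := by positivity
      linarith

lemma measurable_mean (h : IsOccupationCumulant α p G F M v) (t : ℝ) : Measurable (M t) :=
  h.mean.measurable.comp measurable_prodMk_left

lemma measurable_cumulant (h : IsOccupationCumulant α p G F M v) (ε t : ℝ) : Measurable (v ε t) :=
  (h.measurable ε).comp measurable_prodMk_left

lemma integrable_mean (h : IsOccupationCumulant α p G F M v) {t : ℝ} (ht : 0 ≤ t)
    (m : Measure ℝ) [IsFiniteMeasure m] : Integrable (M t) m := by
  obtain ⟨B, hB⟩ := h.mean.locallyBounded t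
  exact integrable_of_bounded (h.measurable_mean t) (B := B) fun x => by
    rw [abs_of_nonneg (h.mean.nonneg t x)]; exact hB t ⟨ht, le_rfl⟩ x

lemma integrable_cumulant (h : IsOccupationCumulant α p G F M v) {ε t : ℝ} (hε : 0 < ε)
    (ht : 0 ≤ t) (m : Measure ℝ) [IsFiniteMeasure m] : Integrable (v ε t) m := by
  obtain ⟨B, hB⟩ := (h.cumulant ε hε).locallyBounded t
  exact integrable_of_bounded (h.measurable_cumulant ε t) (B := B) fun x => by
    rw [abs_of_nonneg ((h.cumulant ε hε).nonneg t x)]; exact hB t ⟨ht, le_rfl⟩ x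

/-- Convergence of the mean occupation measure. -/
lemma tendsto_mean (h : IsOccupationCumulant α p G F M v) (x : ℝ) :
    Tendsto (fun z : ℝ × ℝ => M z.2 x) (𝓝[>] 0 ×ˢ atTop) (𝓝 (PiInf α p G F x)) := by
  have := h.sub.mech.prob
  have hr := h.sub.isRenewalDensity
  obtain ⟨C, hC0, -, hMC, -⟩ := h.exists_bound
  have hPm : Measurable fun t => ∫ x, M t x ∂G :=
    measurable_integral_snd (φ := id) h.mean.measurable measurable_id
  have hP0 : ∀ t, 0 ≤ ∫ x, M t x ∂G := fun t => integral_nonneg (h.mean.nonneg t)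
  have hPB : ∀ t ≥ 0, |∫ x, M t x ∂G| ≤ C := fun t ht => by
    rw [abs_of_nonneg (hP0 t)]; exact hMC t ht
  obtain ⟨BF, hBF⟩ := h.memB.bounded
  obtain ⟨A, hA⟩ := (memB_meanRate h.sub).bounded
  have hA0 : 0 ≤ A := (abs_nonneg _).trans (hA 0)
  have heq : ∀ t ≥ 0, ∫ x, M t x ∂G = (∫ q in (0 : ℝ)..t, shiftMean G F q) +
      ∫ q in (0 : ℝ)..t, shiftMean G (meanRate α p) q * ∫ x, M (t - q) x ∂G := by
    intro t ht
    rw [← integral_shift_mul_eq h.sub hPm ht fun s hs => hPB s hs.1]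
    simp only [shiftMean]
    rw [← integral_intervalIntegral_swap_of_bounded (C := BF) (h := fun q x => F (x - q))
      (h.memB.measurable.comp (by fun_prop)) ht (fun _ _ _ => hBF _), ← integral_add]
    · exact integral_congr_ae (ae_of_all _ fun x => h.mean.eqn t ht x)
    · refine Integrable.mono' (h.sub.moment_one.const_mul BF)
        (measurable_intervalIntegral_param (β := ℝ) (h := fun x s => F (x - s)) measurable_const
          (h.memB.measurable.comp (by fun_prop))).aestronglyMeasurable (ae_of_all _ fun x => ?_)
      exact h.memB.abs_integral_shift_le hBF ht x
    · refine Integrable.mono' (h.sub.moment_one.const_mul (A * C))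
        (measurable_intervalIntegral_param (β := ℝ)
          (h := fun x s => meanRate α p (x - s) * ∫ x, M (t - s) x ∂G) measurable_const
          (((memB_meanRate h.sub).measurable.comp (by fun_prop)).mul
            (hPm.comp (by fun_prop)))).aestronglyMeasurable (ae_of_all _ fun x => ?_)
      refine abs_intervalIntegral_le_mul_max ht (fun q hq => ?_) fun q hq => ?_
      · rw [abs_mul]
        exact mul_le_mul (hA _) (hPB _ (by linarith [hq.2])) (abs_nonneg _) hA0
      · rw [(memB_meanRate h.sub).zero_of_nonpos _ (by linarith), zero_mul]
  have hK := tendsto_integral_convolution (l := 𝓝[>] (0 : ℝ)) (H := fun _ q _ => shiftMean G F q)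
    (h := shiftMean G F) (h.memB.integrableOn_shiftMean h.sub.moment_one).abs
    (fun _ _ => measurable_shiftMean h.memB.measurable)
    (Eventually.of_forall fun _ _ _ _ _ => le_rfl) fun _ _ => tendsto_const_nhds
  -- The mean does not depend on `ε`; its limit is taken along the filter in `(ε, t)` so that it can
  -- be combined with the limits of the cumulant.
  have hP := hr.tendsto_of_renewal (l := 𝓝[>] (0 : ℝ)) (d := fun _ t => ∫ x, M t x ∂G)
    (K := fun _ t => ∫ q in (0 : ℝ)..t, shiftMean G F q) (fun _ => hPm)
    (Eventually.of_forall fun _ => hPB) (Eventually.of_forall fun _ => heq) hK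
  have hM : (∫ q in Set.Ioi 0, shiftMean G F q) / (1 - rho α p G) = meanMass α p G F := by
    rw [meanMass, h.memB.integral_shiftMean h.sub.moment_one, div_eq_inv_mul]
  rw [hM] at hP
  have hlim := tendsto_integral_convolution (l := 𝓝[>] (0 : ℝ))
    (H := fun _ q u => F (x - q) + meanRate α p (x - q) * ∫ y, M u y ∂G)
    (h := fun q => F (x - q) + meanRate α p (x - q) * meanMass α p G F)
    (integrableOn_indicator_Iic x (BF + A * C))
    (fun _ s => (h.memB.measurable.comp (by fun_prop)).add
      (((memB_meanRate h.sub).measurable.comp (by fun_prop)).mul (hPm.comp (by fun_prop))))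
    (Eventually.of_forall fun _ q _ u hu => by
      refine abs_le_indicator_Iic
        (h := fun q => F (x - q) + meanRate α p (x - q) * ∫ y, M u y ∂G) ?_ fun hq => ?_
      · refine (abs_add_le _ _).trans (add_le_add (hBF _) ?_)
        rw [abs_mul]
        exact mul_le_mul (hA _) (hPB _ hu) (abs_nonneg _) hA0
      · rw [(memB_meanRate h.sub).zero_of_nonpos _ (by linarith),
          h.memB.zero_of_nonpos _ (by linarith), zero_mul, add_zero])
    fun q _ => (hP.const_mul _).const_add _
  rw [integral_add (h.memB.integrableOn_shift x)
    (((memB_meanRate h.sub).integrableOn_shift x).mul_const _), integral_mul_const,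
    h.memB.integral_shift_Ioi, (memB_meanRate h.sub).integral_shift_Ioi,
    ← PiInf_eq h.sub h.memB] at hlim
  refine hlim.congr' ?_
  filter_upwards [tendsto_snd.eventually (eventually_ge_atTop (0 : ℝ))] with z hz
  rw [h.mean.eqn z.2 hz x, intervalIntegral.integral_add]
  · rfl
  · exact intervalIntegrable_of_bounded (h.memB.measurable.comp (by fun_prop)) hz
      fun _ _ => hBF _
  · refine intervalIntegrable_of_bounded
      (h := fun q => meanRate α p (x - q) * ∫ y, M (z.2 - q) y ∂G) (B := A * C)
      (((memB_meanRate h.sub).measurable.comp (by fun_prop)).mul (hPm.comp (by fun_prop))) hz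
      fun q hq => ?_
    rw [abs_mul]
    exact mul_le_mul (hA _) (hPB _ (by linarith [hq.2])) (abs_nonneg _) hA0

end IsOccupationCumulant

end Perturbation

/-! ### The normalized deviation and its renewal equation -/

section Deviation

variable {α : ℝ → ℝ} {p : ℕ → ℝ → ℝ} {G : Measure ℝ} {F : ℝ → ℝ} {M : ℝ → ℝ → ℝ}
  {v : ℝ → ℝ → ℝ → ℝ}

/-- The normalized deviation of the cumulant from its linearization. -/
def deviation (M : ℝ → ℝ → ℝ) (v : ℝ → ℝ → ℝ → ℝ) (ε s x : ℝ) : ℝ := (ε * M s x - v ε s x) / ε ^ 2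

/-- The normalized second order part of the birth term. -/
def excess (α : ℝ → ℝ) (p : ℕ → ℝ → ℝ) (G : Measure ℝ) (v : ℝ → ℝ → ℝ → ℝ) (ε u z : ℝ) : ℝ :=
  (meanRate α p z * (∫ y, v ε u y ∂G) - birth α p z (∫ y, oneSubExp (v ε u y) ∂G)) / ε ^ 2

/-- The limit of `excess`. -/
def excessInf (α : ℝ → ℝ) (p : ℕ → ℝ → ℝ) (G : Measure ℝ) (f : ℝ → ℝ) (z : ℝ) : ℝ :=
  α z * (gen₂ p z * pair G (PiInf α p G f) ^ 2 +
    gen₁ p z * pair G (fun y => PiInf α p G f y ^ 2)) / 2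

lemma memB_excessInf (h : IsSubcritical α p G) (f : ℝ → ℝ) : MemB (excessInf α p G f) := by
  obtain ⟨C₁, _, hC₁⟩ := h.mech.exists_bound
  obtain ⟨C₂, _, hC₂⟩ := h.mech.exists_bound₂ h.second
  set a := pair G (PiInf α p G f) ^ 2
  set b := pair G (fun y => PiInf α p G f y ^ 2)
  have ha : 0 ≤ a := sq_nonneg _
  have hb : 0 ≤ b := integral_nonneg fun y => sq_nonneg _
  refine ⟨?_, ⟨(C₂ * a + C₁ * b) / 2, fun z => ?_⟩, fun z hz => ?_⟩
  · exact (h.mech.rate.measurable.mul (((h.mech.measurable_gen₂ h.second).mul_const _).add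
      (h.mech.measurable_gen₁.mul_const _))).div_const _
  · have h1 := mul_le_mul_of_nonneg_right (hC₁ z) hb
    have h2 := mul_le_mul_of_nonneg_right (hC₂ z) ha
    have h3 : 0 ≤ excessInf α p G f z :=
      div_nonneg (mul_nonneg (h.mech.rate.nonneg z) (add_nonneg (mul_nonneg
        (h.mech.gen₂_nonneg z) ha) (mul_nonneg (h.mech.gen₁_nonneg z) hb))) zero_le_two
    rw [abs_of_nonneg h3, excessInf]
    change α z * (gen₂ p z * a + gen₁ p z * b) / 2 ≤ _
    linarith
  · rw [excessInf, h.mech.rate.zero_of_nonpos z hz, zero_mul, zero_div]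

namespace IsOccupationCumulant

lemma measurable_deviation (h : IsOccupationCumulant α p G F M v) (ε : ℝ) :
    Measurable (Function.uncurry (deviation M v ε)) :=
  ((h.mean.measurable.const_mul ε).sub (h.measurable ε)).div_const _

lemma measurable_excess (h : IsOccupationCumulant α p G F M v) (ε : ℝ) :
    Measurable (Function.uncurry (excess α p G v ε)) := by
  have := h.sub.mech.prob
  have h1 : Measurable fun u => ∫ y, v ε u y ∂G :=
    measurable_integral_snd (φ := id) (h.measurable ε) measurable_id
  have h2 : Measurable fun u => ∫ y, oneSubExp (v ε u y) ∂G :=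
    measurable_integral_snd (h.measurable ε) measurable_oneSubExp
  exact ((((memB_meanRate h.sub).measurable.comp measurable_snd).mul (h1.comp measurable_fst)).sub
    (h.sub.mech.measurable_birth.comp (measurable_snd.prodMk (h2.comp measurable_fst)))).div_const _

lemma integrable_oneSubExp (h : IsOccupationCumulant α p G F M v) {ε u : ℝ} (hε : 0 < ε) :
    Integrable (fun y => oneSubExp (v ε u y)) G := by
  have := h.sub.mech.prob
  exact integrable_of_bounded (measurable_oneSubExp.comp (h.measurable_cumulant ε u)) (B := 1)
    fun y => by
      rw [abs_of_nonneg (oneSubExp_nonneg ((h.cumulant ε hε).nonneg u y))]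
      exact oneSubExp_le_one _

/-- There are two second order effects: the curvature of `v ↦ 1 - e^{-v}` under the linear birth
rate, and the curvature of `g` at `1`. Both terms are nonnegative. -/
lemma excess_expand (h : IsOccupationCumulant α p G F M v) {ε u : ℝ} (hε : 0 < ε) (hu : 0 ≤ u)
    (z : ℝ) : excess α p G v ε u z =
      meanRate α p z * (∫ y, quadRem (v ε u y) / ε ^ 2 ∂G) +
      α z * genRem p z (∫ y, oneSubExp (v ε u y) ∂G) *
        ((∫ y, oneSubExp (v ε u y) ∂G) / ε) ^ 2 := by
  have := h.sub.mech.prob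
  have hy := integral_oneSubExp_mem (G := G) (h.measurable_cumulant ε u)
    ((h.cumulant ε hε).nonneg u)
  rw [excess, h.sub.mech.birth_expand h.sub.second z hy.2.1 hy.2.2, meanBirth, integral_div]
  simp only [quadRem]
  rw [integral_sub (h.integrable_cumulant hε hu G) (h.integrable_oneSubExp hε), meanRate]
  ring

lemma integrable_quadRem (h : IsOccupationCumulant α p G F M v) {ε u C : ℝ} (hε : 0 < ε)
    (hC : ∀ x, v ε u x ≤ ε * C * max x 0) :
    Integrable (fun y => quadRem (v ε u y) / ε ^ 2) G ∧
    ∀ y, quadRem (v ε u y) / ε ^ 2 ≤ C ^ 2 * max y 0 ^ 2 / 2 := by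
  have := h.sub.mech.prob
  have hv0 := (h.cumulant ε hε).nonneg u
  have hle : ∀ y, quadRem (v ε u y) / ε ^ 2 ≤ C ^ 2 * max y 0 ^ 2 / 2 := fun y => by
    rw [div_le_iff₀ (by positivity)]
    refine (quadRem_le (hv0 y)).trans ?_
    have := pow_le_pow_left₀ (hv0 y) (hC y) 2
    nlinarith
  refine ⟨Integrable.mono' ((h.sub.moment.const_mul (C ^ 2)).div_const 2)
    ((measurable_quadRem.comp (h.measurable_cumulant ε u)).div_const _).aestronglyMeasurable
    (ae_of_all _ fun y => ?_), hle⟩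
  rw [Real.norm_of_nonneg (div_nonneg (quadRem_nonneg _) (by positivity))]
  exact hle y

lemma excess_of_nonpos (h : IsOccupationCumulant α p G F M v) (ε u : ℝ) {z : ℝ} (hz : z ≤ 0) :
    excess α p G v ε u z = 0 := by
  rw [excess, (memB_meanRate h.sub).zero_of_nonpos z hz, h.sub.mech.birth_zero hz]
  simp

/-- Since `v^ε ≤ ε C x⁺`, dividing by `ε²` leaves a bound independent of `ε` and time. It uses the
second moment of `G` for the exponential remainder and the bound on `g''(·, 1-)` for the generating
function. -/
lemma exists_excess_bound (h : IsOccupationCumulant α p G F M v) :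
    ∃ C, 0 ≤ C ∧ ∀ ε > 0, ∀ u ≥ 0, ∀ z, |excess α p G v ε u z| ≤ C := by
  have := h.sub.mech.prob
  obtain ⟨C, hC0, -, -, hv⟩ := h.exists_bound
  obtain ⟨C₁, hC₁0, hC₁⟩ := h.sub.mech.exists_bound
  obtain ⟨C₂, hC₂0, hC₂⟩ := h.sub.mech.exists_bound₂ h.sub.second
  set μ₂ := ∫ x, max x 0 ^ 2 ∂G
  have hμ₂ : 0 ≤ μ₂ := integral_nonneg fun x => sq_nonneg _
  refine ⟨C₁ * (C ^ 2 * μ₂ / 2) + C₂ / 2 * C ^ 2, by positivity, fun ε hε u hu z => ?_⟩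
  obtain ⟨hv1, hv2⟩ := hv ε hε u hu
  obtain ⟨hqi, hqle⟩ := h.integrable_quadRem hε hv1
  have hy := integral_oneSubExp_mem (G := G) (h.measurable_cumulant ε u)
    ((h.cumulant ε hε).nonneg u)
  have hκ0 : 0 ≤ ∫ y, quadRem (v ε u y) / ε ^ 2 ∂G :=
    integral_nonneg fun y => div_nonneg (quadRem_nonneg _) (by positivity)
  have hκ : ∫ y, quadRem (v ε u y) / ε ^ 2 ∂G ≤ C ^ 2 * μ₂ / 2 := by
    refine (integral_mono hqi ((h.sub.moment.const_mul (C ^ 2)).div_const 2) hqle).trans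
      (le_of_eq ?_)
    rw [integral_div, integral_const_mul]
  have hye : (∫ y, oneSubExp (v ε u y) ∂G) / ε ≤ C := by
    rw [div_le_iff₀ hε, mul_comm]
    refine le_trans (integral_mono (h.integrable_oneSubExp hε) (h.integrable_cumulant hε hu G)
      fun y => oneSubExp_le _) hv2
  have hye0 : 0 ≤ (∫ y, oneSubExp (v ε u y) ∂G) / ε := div_nonneg hy.2.1 hε.le
  rw [h.excess_expand hε hu]
  have g0 := h.sub.mech.genRem_nonneg z hy.2.2
  have g1 := h.sub.mech.genRem_le h.sub.second z hy.2.1 hy.2.2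
  have a0 := h.sub.mech.rate.nonneg z
  have t1 : α z * genRem p z (∫ y, oneSubExp (v ε u y) ∂G) ≤ C₂ / 2 := by
    have := mul_le_mul_of_nonneg_left g1 a0
    linarith [hC₂ z]
  rw [abs_of_nonneg (add_nonneg (mul_nonneg (meanRate_nonneg h.sub z) hκ0)
    (mul_nonneg (mul_nonneg a0 g0) (sq_nonneg _)))]
  refine add_le_add (mul_le_mul (hC₁ z) hκ hκ0 hC₁0.le) ?_
  exact mul_le_mul t1 (pow_le_pow_left₀ hye0 hye 2) (sq_nonneg _) (by positivity)

lemma measurable_integral_deviation (h : IsOccupationCumulant α p G F M v) (ε : ℝ) :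
    Measurable fun u => ∫ y, deviation M v ε u y ∂G := by
  have := h.sub.mech.prob
  exact measurable_integral_snd (φ := id) (h.measurable_deviation ε) measurable_id

lemma integral_deviation (h : IsOccupationCumulant α p G F M v) {ε u : ℝ} (hε : 0 < ε)
    (hu : 0 ≤ u) (m : Measure ℝ) [IsFiniteMeasure m] : ∫ y, deviation M v ε u y ∂m =
      (ε * (∫ y, M u y ∂m) - ∫ y, v ε u y ∂m) / ε ^ 2 := by
  simp only [deviation]
  rw [integral_div, integral_sub ((h.integrable_mean hu m).const_mul ε)
    (h.integrable_cumulant hε hu m), integral_const_mul]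

/-- The bound is of order `1/ε`. It serves only as the finiteness needed to apply the renewal
estimate, which then yields a bound uniform in `ε`. -/
lemma exists_integral_deviation_bound_of_pos (h : IsOccupationCumulant α p G F M v) {ε : ℝ}
    (hε : 0 < ε) : ∃ B, ∀ u ≥ 0, |∫ y, deviation M v ε u y ∂G| ≤ B := by
  have := h.sub.mech.prob
  obtain ⟨C, hC0, -, hM, hv⟩ := h.exists_bound
  refine ⟨(ε * C + ε * C) / ε ^ 2, fun u hu => ?_⟩
  rw [h.integral_deviation hε hu, abs_div, abs_of_pos (show 0 < ε ^ 2 by positivity)]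
  have h1 : 0 ≤ ∫ y, M u y ∂G := integral_nonneg (h.mean.nonneg u)
  have h2 : 0 ≤ ∫ y, v ε u y ∂G := integral_nonneg ((h.cumulant ε hε).nonneg u)
  gcongr
  refine (abs_sub _ _).trans (add_le_add ?_ ?_)
  · rw [abs_of_nonneg (mul_nonneg hε.le h1)]
    exact mul_le_mul_of_nonneg_left (hM u hu) hε.le
  · rw [abs_of_nonneg h2]
    exact (hv ε hε u hu).2

/-- The renewal type equation of the deviation. -/
lemma deviation_eqn (h : IsOccupationCumulant α p G F M v) {ε s : ℝ} (hε : 0 < ε) (hs : 0 ≤ s)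
    (x : ℝ) : deviation M v ε s x =
      ∫ q in (0 : ℝ)..s, (meanRate α p (x - q) * (∫ y, deviation M v ε (s - q) y ∂G) +
        excess α p G v ε (s - q) (x - q)) := by
  have := h.sub.mech.prob
  obtain ⟨C₁, hC₁0, hC₁⟩ := h.sub.mech.exists_bound
  obtain ⟨C, hC0, -, hM, hv⟩ := h.exists_bound
  have hPm : Measurable fun t => ∫ x, M t x ∂G :=
    measurable_integral_snd (φ := id) h.mean.measurable measurable_id
  have hym : Measurable fun t => ∫ x, oneSubExp (v ε t x) ∂G :=
    measurable_integral_snd (h.measurable ε) measurable_oneSubExp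
  have i1 := intervalIntegrable_volterra (h.sub.mech.volterraKernel_meanBirth hC₁0 hC₁) hPm hs
    (B := C) (fun u hu => ⟨integral_nonneg (h.mean.nonneg u), hM u hu.1⟩) x
  have i2 := intervalIntegrable_volterra (h.sub.mech.volterraKernel_birth hC₁0 hC₁) hym hs
    (B := 1) (fun u hu => (integral_oneSubExp_mem (G := G) (h.measurable_cumulant ε u)
    ((h.cumulant ε hε).nonneg u)).2) x
  have hMe := h.mean.eqn s hs x
  simp only [id] at hMe
  -- The forcing of `v ε` is exactly `ε` times that of `M`, so the forcings cancel and only the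
  -- birth terms remain.
  rw [deviation, hMe, (h.cumulant ε hε).eqn s hs x, cumForcing_const_mul,
    mul_add, add_sub_add_left_eq_sub, ← intervalIntegral.integral_const_mul,
    ← intervalIntegral.integral_sub (i1.const_mul ε) i2, ← intervalIntegral.integral_div]
  refine intervalIntegral.integral_congr fun q hq => ?_
  rw [Set.uIcc_of_le hs] at hq
  have hsq : 0 ≤ s - q := by linarith [hq.2]
  simp only [excess, meanBirth]
  rw [h.integral_deviation hε hsq, meanRate]
  have : ε ≠ 0 := hε.ne'
  field_simp
  ring

/-- Averaging `deviation_eqn` over `G` closes it into a scalar renewal equation with the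
reproduction density as kernel and the averaged excess as source. -/
lemma integral_deviation_eqn (h : IsOccupationCumulant α p G F M v) {ε s : ℝ} (hε : 0 < ε)
    (hs : 0 ≤ s) : ∫ x, deviation M v ε s x ∂G =
      (∫ q in (0 : ℝ)..s, ∫ x, excess α p G v ε (s - q) (x - q) ∂G) +
      ∫ q in (0 : ℝ)..s, shiftMean G (meanRate α p) q * ∫ x, deviation M v ε (s - q) x ∂G := by
  have := h.sub.mech.prob
  obtain ⟨B, hB⟩ := h.exists_integral_deviation_bound_of_pos hε
  obtain ⟨C, hC0, hC⟩ := h.exists_excess_bound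
  obtain ⟨A, hA⟩ := (memB_meanRate h.sub).bounded
  have hA0 : 0 ≤ A := (abs_nonneg _).trans (hA 0)
  have hdm := h.measurable_integral_deviation ε
  have hem := h.measurable_excess ε
  have m1 : Measurable (Function.uncurry fun x q => meanRate α p (x - q) *
      ∫ y, deviation M v ε (s - q) y ∂G) :=
    ((memB_meanRate h.sub).measurable.comp (by fun_prop)).mul (hdm.comp (by fun_prop))
  have m2 : Measurable (Function.uncurry fun x q => excess α p G v ε (s - q) (x - q)) :=
    hem.comp (f := fun z : ℝ × ℝ => (s - z.2, z.1 - z.2)) (by fun_prop)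
  have b1 : ∀ q ∈ Set.Icc 0 s, ∀ x, |meanRate α p (x - q) *
      ∫ y, deviation M v ε (s - q) y ∂G| ≤ A * B := fun q hq x => by
    rw [abs_mul]
    exact mul_le_mul (hA _) (hB _ (by linarith [hq.2])) (abs_nonneg _) hA0
  have b2 : ∀ q ∈ Set.Icc 0 s, ∀ x, |excess α p G v ε (s - q) (x - q)| ≤ C :=
    fun q hq x => hC ε hε _ (by linarith [hq.2]) _
  have e : ∀ x, deviation M v ε s x =
      (∫ q in (0 : ℝ)..s, excess α p G v ε (s - q) (x - q)) +
      ∫ q in (0 : ℝ)..s, meanRate α p (x - q) * (∫ y, deviation M v ε (s - q) y ∂G) := fun x => by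
    rw [h.deviation_eqn hε hs, intervalIntegral.integral_add, add_comm]
    · exact intervalIntegrable_of_bounded (m1.comp measurable_prodMk_left) hs
        fun q hq => b1 q hq x
    · exact intervalIntegrable_of_bounded (m2.comp measurable_prodMk_left) hs
        fun q hq => b2 q hq x
  rw [← integral_shift_mul_eq h.sub hdm hs fun u hu => hB u hu.1,
    ← integral_intervalIntegral_swap_of_bounded (h := fun q x => excess α p G v ε (s - q) (x - q))
      (m2.comp measurable_swap) hs b2, ← integral_add]
  · exact integral_congr_ae (ae_of_all _ e)
  · refine integrable_of_bounded (B := C * s) (measurable_intervalIntegral_param (β := ℝ)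
      measurable_const m2) fun x => ?_
    have := intervalIntegral.norm_integral_le_of_norm_le_const (a := 0) (b := s)
      (f := fun q => excess α p G v ε (s - q) (x - q)) (C := C) fun q hq => by
        rw [Set.uIoc_of_le hs] at hq
        exact b2 q ⟨hq.1.le, hq.2⟩ x
    rwa [sub_zero, abs_of_nonneg hs] at this
  · refine integrable_of_bounded (B := A * B * s) (measurable_intervalIntegral_param (β := ℝ)
      measurable_const m1) fun x => ?_
    have := intervalIntegral.norm_integral_le_of_norm_le_const (a := 0) (b := s)
      (f := fun q => meanRate α p (x - q) * ∫ y, deviation M v ε (s - q) y ∂G) (C := A * B)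
      fun q hq => by
        rw [Set.uIoc_of_le hs] at hq
        exact b1 q ⟨hq.1.le, hq.2⟩ x
    rwa [sub_zero, abs_of_nonneg hs] at this

lemma memB_posOne : MemB posOne := by
  simpa using memB_const_mul_posOne 1

lemma abs_le_mul_posOne {e : ℝ → ℝ} {C z : ℝ} (hC : |e z| ≤ C) (h0 : z ≤ 0 → e z = 0) :
    |e z| ≤ C * posOne z := by
  rcases le_or_gt z 0 with hz | hz
  · rw [h0 hz, memB_posOne.zero_of_nonpos z hz, abs_zero, mul_zero]
  · rwa [posOne, Set.indicator_of_mem (Set.mem_Ioi.2 hz), mul_one]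

/-- The excess vanishes at nonpositive arguments, so its average is at most `C` times the tail
`G((q, ∞))`, which is integrable in `q`. -/
lemma abs_integral_excess_le (h : IsOccupationCumulant α p G F M v) {C : ℝ}
    (hC : ∀ ε > 0, ∀ u ≥ 0, ∀ z, |excess α p G v ε u z| ≤ C) {ε u : ℝ} (hε : 0 < ε)
    (hu : 0 ≤ u) (q : ℝ) :
    |∫ x, excess α p G v ε u (x - q) ∂G| ≤ C * shiftMean G posOne q := by
  have := h.sub.mech.prob
  rw [shiftMean, ← integral_const_mul, ← Real.norm_eq_abs]
  refine norm_integral_le_of_norm_le (Integrable.const_mul (integrable_of_bounded (B := 1)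
    (h := fun x => posOne (x - q)) (measurable_posOne.comp (by fun_prop)) fun x => ?_) C)
    (ae_of_all _ fun x => ?_)
  · rw [abs_of_nonneg (posOne_nonneg _)]; exact posOne_le_one _
  · exact abs_le_mul_posOne (hC ε hε u hu _) (h.excess_of_nonpos ε u)

/-- Linear growth of the deviation, uniformly in `ε` and time. -/
lemma exists_deviation_bound (h : IsOccupationCumulant α p G F M v) :
    ∃ B, 0 ≤ B ∧ ∀ ε > 0, ∀ s ≥ 0, |∫ x, deviation M v ε s x ∂G| ≤ B ∧
      ∀ x, |deviation M v ε s x| ≤ B * max x 0 := by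
  have := h.sub.mech.prob
  have hr := h.sub.isRenewalDensity
  have hρ := h.sub.rho_lt_one
  obtain ⟨C, hC0, hC⟩ := h.exists_excess_bound
  obtain ⟨A, hA⟩ := (memB_meanRate h.sub).bounded
  have hA0 : 0 ≤ A := (abs_nonneg _).trans (hA 0)
  have hpi := memB_posOne.integrableOn_shiftMean (G := G) h.sub.moment_one
  have hp0 : ∀ q, 0 ≤ shiftMean G posOne q := fun q => integral_nonneg fun x => posOne_nonneg _
  set κ := C * ∫ q in Set.Ioi 0, shiftMean G posOne q with hκ
  have hκ0 : 0 ≤ κ := mul_nonneg hC0 (integral_nonneg hp0)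
  set B := κ / (1 - rho α p G)
  have hB0 : 0 ≤ B := div_nonneg hκ0 (by linarith)
  have hd : ∀ ε > 0, ∀ s ≥ 0, |∫ x, deviation M v ε s x ∂G| ≤ B := by
    intro ε hε s hs
    obtain ⟨B', hB'⟩ := h.exists_integral_deviation_bound_of_pos hε
    refine hr.abs_le_of_renewal (m := fun s => ∫ x, deviation M v ε s x ∂G)
      (fun T => ⟨B', fun t ht => hB' t ht.1⟩) (fun t ht => ?_) hs
    rw [h.integral_deviation_eqn hε ht]
    refine (abs_add_le _ _).trans (add_le_add ?_ ?_)
    · have hii : IntervalIntegrable (fun q => C * shiftMean G posOne q) volume 0 t := by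
        rw [intervalIntegrable_iff_integrableOn_Ioc_of_le ht]
        exact (hpi.mono_set Set.Ioc_subset_Ioi_self).const_mul C
      rw [← Real.norm_eq_abs]
      refine (intervalIntegral.norm_integral_le_of_norm_le ht (ae_of_all _ fun q hq =>
        h.abs_integral_excess_le hC hε (by linarith [hq.2]) q) hii).trans ?_
      rw [intervalIntegral.integral_const_mul, hκ, intervalIntegral.integral_of_le ht]
      exact mul_le_mul_of_nonneg_left (setIntegral_mono_set hpi (ae_of_all _ hp0)
        (Set.Ioc_subset_Ioi_self).eventuallyLE) hC0
    · refine (intervalIntegral.abs_integral_le_integral_abs ht).trans (le_of_eq ?_)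
      simp only [abs_mul, abs_of_nonneg (hr.nonneg _)]
  refine ⟨A * B + C + B, by positivity, fun ε hε s hs => ⟨(hd ε hε s hs).trans ?_, fun x => ?_⟩⟩
  · have : 0 ≤ A * B := by positivity
    linarith
  · rw [h.deviation_eqn hε hs]
    have hb := abs_intervalIntegral_le_mul_max (C := A * B + C) (x := x) hs
      (h := fun q => meanRate α p (x - q) * (∫ y, deviation M v ε (s - q) y ∂G) +
        excess α p G v ε (s - q) (x - q)) (fun q hq => ?_) fun q hq => ?_
    · exact hb.trans (mul_le_mul_of_nonneg_right (by linarith) (le_max_right _ _))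
    · have hsq : 0 ≤ s - q := by linarith [hq.2]
      refine (abs_add_le _ _).trans (add_le_add ?_ (hC ε hε _ hsq _))
      rw [abs_mul]
      exact mul_le_mul (hA _) (hd ε hε _ hsq) (abs_nonneg _) hA0
    · rw [(memB_meanRate h.sub).zero_of_nonpos _ (by linarith), zero_mul, zero_add]
      exact h.excess_of_nonpos _ _ (by linarith)

end IsOccupationCumulant

end Deviation

/-! ### Joint limit of the deviation -/

section DeviationLimit

/-- The difference from `(y/e)²/2` is at most `y³/e² = e (y/e)³`, which vanishes with `e`. -/
lemma tendsto_quadRem_div {ι : Type*} {l : Filter ι} {e y : ι → ℝ} {c : ℝ}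
    (he : Tendsto e l (𝓝[>] 0)) (hy0 : ∀ᶠ i in l, 0 ≤ y i)
    (hy : Tendsto (fun i => y i / e i) l (𝓝 c)) :
    Tendsto (fun i => quadRem (y i) / e i ^ 2) l (𝓝 (c ^ 2 / 2)) := by
  have he0 : Tendsto e l (𝓝 0) := he.mono_right nhdsWithin_le_nhds
  have hpos : ∀ᶠ i in l, 0 < e i := he.eventually self_mem_nhdsWithin
  have h1 : Tendsto (fun i => (y i / e i) ^ 2 / 2) l (𝓝 (c ^ 2 / 2)) := (hy.pow 2).div_const 2
  have h2 : Tendsto (fun i => e i * (y i / e i) ^ 3) l (𝓝 0) := by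
    simpa using he0.mul (hy.pow 3)
  have h3 : Tendsto (fun i => quadRem (y i) / e i ^ 2 - (y i / e i) ^ 2 / 2) l (𝓝 0) := by
    refine squeeze_zero_norm' ?_ h2
    filter_upwards [hpos, hy0] with i hi hi0
    have e1 : quadRem (y i) / e i ^ 2 - (y i / e i) ^ 2 / 2 =
        (quadRem (y i) - y i ^ 2 / 2) / e i ^ 2 := by field_simp
    rw [e1, Real.norm_eq_abs, abs_div, abs_of_pos (show 0 < e i ^ 2 by positivity),
      div_le_iff₀ (by positivity)]
    refine (abs_quadRem_sub_le hi0).trans (le_of_eq ?_)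
    field_simp
  simpa using h3.add h1

variable {α : ℝ → ℝ} {p : ℕ → ℝ → ℝ} {G : Measure ℝ} {F : ℝ → ℝ} {M : ℝ → ℝ → ℝ}
  {v : ℝ → ℝ → ℝ → ℝ}

lemma eventually_pos_nonneg :
    ∀ᶠ z : ℝ × ℝ in 𝓝[>] 0 ×ˢ atTop, 0 < z.1 ∧ 0 ≤ z.2 :=
  (tendsto_fst.eventually self_mem_nhdsWithin).and
    (tendsto_snd.eventually (eventually_ge_atTop (0 : ℝ)))

lemma tendsto_fst_zero : Tendsto (fun z : ℝ × ℝ => z.1) (𝓝[>] 0 ×ˢ atTop) (𝓝 0) :=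
  tendsto_fst.mono_right nhdsWithin_le_nhds

namespace IsOccupationCumulant

/-- By definition `v/ε = M - ε · deviation`; the deviation is bounded for fixed `x`, so `v/ε` has
the same limit as the mean. -/
lemma tendsto_cumulant_div (h : IsOccupationCumulant α p G F M v) (x : ℝ) :
    Tendsto (fun z : ℝ × ℝ => v z.1 z.2 x / z.1) (𝓝[>] 0 ×ˢ atTop)
      (𝓝 (PiInf α p G F x)) := by
  obtain ⟨B, hB0, hB⟩ := h.exists_deviation_bound
  have h1 : Tendsto (fun z : ℝ × ℝ => z.1 * (B * max x 0)) (𝓝[>] 0 ×ˢ atTop) (𝓝 0) := by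
    simpa using tendsto_fst_zero.mul_const (B * max x 0)
  have h2 : Tendsto (fun z : ℝ × ℝ => z.1 * deviation M v z.1 z.2 x) (𝓝[>] 0 ×ˢ atTop)
      (𝓝 0) := by
    refine squeeze_zero_norm' ?_ h1
    filter_upwards [eventually_pos_nonneg] with z hz
    rw [norm_mul, Real.norm_of_nonneg hz.1.le]
    exact mul_le_mul_of_nonneg_left ((hB _ hz.1 _ hz.2).2 x) hz.1.le
  have h3 := (h.tendsto_mean x).sub h2
  rw [sub_zero] at h3
  refine h3.congr' ?_
  filter_upwards [eventually_pos_nonneg] with z hz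
  have := hz.1.ne'
  rw [deviation]
  field_simp
  ring

lemma tendsto_integral_oneSubExp_div (h : IsOccupationCumulant α p G F M v) :
    Tendsto (fun z : ℝ × ℝ => (∫ y, oneSubExp (v z.1 z.2 y) ∂G) / z.1) (𝓝[>] 0 ×ˢ atTop)
      (𝓝 (pair G (PiInf α p G F))) := by
  have := h.sub.mech.prob
  obtain ⟨C, hC0, -, -, hv⟩ := h.exists_bound
  simp only [← integral_div]
  refine tendsto_integral_filter_of_dominated_convergence (fun x => C * max x 0) ?_ ?_
    (h.sub.moment_one.const_mul C) (ae_of_all _ fun x => ?_)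
  · exact Eventually.of_forall fun z => ((measurable_oneSubExp.comp
      (h.measurable_cumulant _ _)).div_const _).aestronglyMeasurable
  · filter_upwards [eventually_pos_nonneg] with z hz
    refine ae_of_all _ fun x => ?_
    rw [Real.norm_of_nonneg (div_nonneg (oneSubExp_nonneg ((h.cumulant _ hz.1).nonneg _ _))
      hz.1.le), div_le_iff₀ hz.1]
    refine (oneSubExp_le _).trans (((hv _ hz.1 _ hz.2).1 x).trans (le_of_eq ?_))
    ring
  · have hv0 : ∀ᶠ z : ℝ × ℝ in 𝓝[>] 0 ×ˢ atTop, 0 ≤ v z.1 z.2 x := by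
      filter_upwards [eventually_pos_nonneg] with z hz using (h.cumulant _ hz.1).nonneg _ _
    have h1 := tendsto_quadRem_div (tendsto_fst (f := 𝓝[>] (0 : ℝ)) (g := atTop (α := ℝ))) hv0
      (h.tendsto_cumulant_div x)
    have h2 := (h.tendsto_cumulant_div x).sub (tendsto_fst_zero.mul h1)
    rw [zero_mul, sub_zero] at h2
    refine h2.congr' ?_
    filter_upwards [eventually_pos_nonneg] with z hz
    have := hz.1.ne'
    rw [quadRem]
    field_simp
    ring

lemma tendsto_integral_quadRem_div (h : IsOccupationCumulant α p G F M v) :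
    Tendsto (fun z : ℝ × ℝ => ∫ y, quadRem (v z.1 z.2 y) / z.1 ^ 2 ∂G) (𝓝[>] 0 ×ˢ atTop)
      (𝓝 (pair G (fun y => PiInf α p G F y ^ 2) / 2)) := by
  have := h.sub.mech.prob
  obtain ⟨C, hC0, -, -, hv⟩ := h.exists_bound
  rw [pair, ← integral_div]
  refine tendsto_integral_filter_of_dominated_convergence (fun x => C ^ 2 * max x 0 ^ 2 / 2) ?_ ?_
    ((h.sub.moment.const_mul (C ^ 2)).div_const 2) (ae_of_all _ fun x => ?_)
  · exact Eventually.of_forall fun z => ((measurable_quadRem.comp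
      (h.measurable_cumulant _ _)).div_const _).aestronglyMeasurable
  · filter_upwards [eventually_pos_nonneg] with z hz
    refine ae_of_all _ fun x => ?_
    rw [Real.norm_of_nonneg (div_nonneg (quadRem_nonneg _) (sq_nonneg _))]
    exact (h.integrable_quadRem hz.1 (hv _ hz.1 _ hz.2).1).2 x
  · have hv0 : ∀ᶠ z : ℝ × ℝ in 𝓝[>] 0 ×ˢ atTop, 0 ≤ v z.1 z.2 x := by
      filter_upwards [eventually_pos_nonneg] with z hz using (h.cumulant _ hz.1).nonneg _ _
    exact tendsto_quadRem_div (tendsto_fst (f := 𝓝[>] (0 : ℝ)) (g := atTop (α := ℝ))) hv0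
      (h.tendsto_cumulant_div x)

/-- Pass to the limit in `excess_expand`. The overall factor `1/2` comes from `(e^{-v} - 1 + v) ~
v²/2` and from the value `g''/2` of the remainder of `g` at `0`. -/
lemma tendsto_excess (h : IsOccupationCumulant α p G F M v) (x : ℝ) :
    Tendsto (fun z : ℝ × ℝ => excess α p G v z.1 z.2 x) (𝓝[>] 0 ×ˢ atTop)
      (𝓝 (excessInf α p G F x)) := by
  have := h.sub.mech.prob
  have hy := h.tendsto_integral_oneSubExp_div
  have hy0 : Tendsto (fun z : ℝ × ℝ => ∫ y, oneSubExp (v z.1 z.2 y) ∂G) (𝓝[>] 0 ×ˢ atTop)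
      (𝓝 0) := by
    have := tendsto_fst_zero.mul hy
    rw [zero_mul] at this
    refine this.congr' ?_
    filter_upwards [eventually_pos_nonneg] with z hz
    rw [mul_div_cancel₀ _ hz.1.ne']
  have hg := h.sub.mech.genRem_tendsto h.sub.second x (by
    filter_upwards [eventually_pos_nonneg] with z hz
    exact (integral_oneSubExp_mem (h.measurable_cumulant _ _)
      ((h.cumulant _ hz.1).nonneg _)).2.1) hy0
  have hlim := (h.tendsto_integral_quadRem_div.const_mul (meanRate α p x)).add
    ((hg.const_mul (α x)).mul (hy.pow 2))
  have e : meanRate α p x * (pair G (fun y => PiInf α p G F y ^ 2) / 2) +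
      α x * (gen₂ p x / 2) * pair G (PiInf α p G F) ^ 2 = excessInf α p G F x := by
    rw [excessInf, meanRate]; ring
  rw [e] at hlim
  refine hlim.congr' ?_
  filter_upwards [eventually_pos_nonneg] with z hz
  exact (h.excess_expand hz.1 hz.2 x).symm

/-- This identifies `a₂/2` as the limit of a renewal equation: total mass of the limiting source
divided by `1 - ρ₁`. -/
lemma aTwo_eq (h : IsSubcritical α p G) (f : ℝ → ℝ) :
    aTwo α p G f / 2 = (∫ q in Set.Ioi 0, shiftMean G (excessInf α p G f) q) /
      (1 - rho α p G) := by
  have := h.mech.prob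
  rw [(memB_excessInf h f).integral_shiftMean h.moment_one, aTwo, mul_div_assoc,
    ← integral_div, div_eq_inv_mul]
  congr 2
  funext x
  rw [← intervalIntegral.integral_div]
  rfl

/-- The integrand on the right is the pointwise limit of the integrand in `deviation_eqn`, with the
averaged deviation replaced by its limit `a₂/2`. -/
lemma GammaInf_eq (h : IsSubcritical α p G) (f : ℝ → ℝ) (x : ℝ) :
    GammaInf α p G f x / 2 = ∫ q in Set.Ioi 0, (meanRate α p (x - q) * (aTwo α p G f / 2) +
      excessInf α p G f (x - q)) := by
  have hb : MemB fun z => meanRate α p z * (aTwo α p G f / 2) + excessInf α p G f z := by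
    obtain ⟨A, hA⟩ := (memB_meanRate h).bounded
    obtain ⟨C, hC⟩ := (memB_excessInf h f).bounded
    refine ⟨((memB_meanRate h).measurable.mul_const _).add (memB_excessInf h f).measurable,
      ⟨A * |aTwo α p G f / 2| + C, fun z => (abs_add_le _ _).trans (add_le_add ?_ (hC z))⟩,
      fun z hz => ?_⟩
    · rw [abs_mul]
      exact mul_le_mul_of_nonneg_right (hA z) (abs_nonneg _)
    · rw [(memB_meanRate h).zero_of_nonpos z hz, (memB_excessInf h f).zero_of_nonpos z hz]
      simp
  rw [hb.integral_shift_Ioi x, GammaInf, ← intervalIntegral.integral_div]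
  refine intervalIntegral.integral_congr fun s _ => ?_
  simp only [meanRate, excessInf]
  ring

/-- The sources converge by dominated convergence, with the integrable tail of `G` as majorant; the
renewal theorem with parameter `ε` then gives the joint limit. -/
lemma tendsto_integral_deviation (h : IsOccupationCumulant α p G F M v) :
    Tendsto (fun z : ℝ × ℝ => ∫ x, deviation M v z.1 z.2 x ∂G) (𝓝[>] 0 ×ˢ atTop)
      (𝓝 (aTwo α p G F / 2)) := by
  have := h.sub.mech.prob
  obtain ⟨C, hC0, hC⟩ := h.exists_excess_bound
  obtain ⟨B, hB0, hB⟩ := h.exists_deviation_bound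
  have hpos : ∀ᶠ ε : ℝ in 𝓝[>] 0, 0 < ε := self_mem_nhdsWithin
  have hK := tendsto_integral_convolution (l := 𝓝[>] (0 : ℝ))
    (H := fun ε q u => ∫ x, excess α p G v ε u (x - q) ∂G)
    (w := fun q => C * shiftMean G posOne q) (h := shiftMean G (excessInf α p G F))
    ((memB_posOne.integrableOn_shiftMean h.sub.moment_one).const_mul C)
    (fun ε s => measurable_integral_snd (φ := id)
      (h := fun q x => excess α p G v ε (s - q) (x - q))
      ((h.measurable_excess ε).comp (f := fun z : ℝ × ℝ => (s - z.1, z.2 - z.1)) (by fun_prop))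
      measurable_id)
    (by
      filter_upwards [hpos] with ε hε q _ u hu
      exact h.abs_integral_excess_le hC hε hu q)
    (fun q _ => by
      refine tendsto_integral_filter_of_dominated_convergence (fun _ => C) ?_ ?_
        (integrable_const C) (ae_of_all _ fun x => h.tendsto_excess (x - q))
      · exact Eventually.of_forall fun z => ((h.measurable_excess z.1).comp
          (f := fun x : ℝ => (z.2, x - q)) (by fun_prop)).aestronglyMeasurable
      · filter_upwards [eventually_pos_nonneg] with z hz
        exact ae_of_all _ fun x => hC _ hz.1 _ hz.2 _)
  rw [aTwo_eq h.sub F]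
  exact h.sub.isRenewalDensity.tendsto_of_renewal (l := 𝓝[>] (0 : ℝ))
    (d := fun ε s => ∫ x, deviation M v ε s x ∂G)
    (K := fun ε s => ∫ q in (0 : ℝ)..s, ∫ x, excess α p G v ε (s - q) (x - q) ∂G) (B := B)
    (fun ε => h.measurable_integral_deviation ε)
    (by filter_upwards [hpos] with ε hε s hs using (hB ε hε s hs).1)
    (by filter_upwards [hpos] with ε hε s hs using h.integral_deviation_eqn hε hs) hK

/-- In `deviation_eqn` only births at ages `q < x` count, so the integrand is bounded and supported
in a fixed bounded interval, and dominated convergence applies. -/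
theorem tendsto_deviation (h : IsOccupationCumulant α p G F M v) (x : ℝ) :
    Tendsto (fun z : ℝ × ℝ => deviation M v z.1 z.2 x) (𝓝[>] 0 ×ˢ atTop)
      (𝓝 (GammaInf α p G F x / 2)) := by
  have := h.sub.mech.prob
  obtain ⟨C, hC0, hC⟩ := h.exists_excess_bound
  obtain ⟨B, hB0, hB⟩ := h.exists_deviation_bound
  obtain ⟨A, hA⟩ := (memB_meanRate h.sub).bounded
  have hA0 : 0 ≤ A := (abs_nonneg _).trans (hA 0)
  have hpos : ∀ᶠ ε : ℝ in 𝓝[>] 0, 0 < ε := self_mem_nhdsWithin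
  have hlim := tendsto_integral_convolution (l := 𝓝[>] (0 : ℝ))
    (H := fun ε q u => meanRate α p (x - q) * (∫ y, deviation M v ε u y ∂G) +
        excess α p G v ε u (x - q))
    (h := fun q => meanRate α p (x - q) * (aTwo α p G F / 2) + excessInf α p G F (x - q))
    (integrableOn_indicator_Iic x (A * B + C))
    (fun ε s => (((memB_meanRate h.sub).measurable.comp (by fun_prop)).mul
      ((h.measurable_integral_deviation ε).comp (by fun_prop))).add
      ((h.measurable_excess ε).comp (f := fun q : ℝ => (s - q, x - q)) (by fun_prop)))
    (by
      filter_upwards [hpos] with ε hε q _ u hu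
      refine abs_le_indicator_Iic (h := fun q => meanRate α p (x - q) *
        (∫ y, deviation M v ε u y ∂G) + excess α p G v ε u (x - q)) ?_ fun hq => ?_
      · refine (abs_add_le _ _).trans (add_le_add ?_ (hC ε hε u hu _))
        rw [abs_mul]
        exact mul_le_mul (hA _) (hB ε hε u hu).1 (abs_nonneg _) hA0
      · rw [(memB_meanRate h.sub).zero_of_nonpos _ (by linarith),
          h.excess_of_nonpos _ _ (by linarith), zero_mul, add_zero])
    fun q _ => (h.tendsto_integral_deviation.const_mul _).add (h.tendsto_excess (x - q))
  rw [← GammaInf_eq h.sub F x] at hlim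
  refine hlim.congr' ?_
  filter_upwards [eventually_pos_nonneg] with z hz
  exact (h.deviation_eqn hz.1 hz.2 x).symm

end IsOccupationCumulant

end DeviationLimit

/-! ### Moments of integer-valued measures -/

section Reach

/-- A finite integer-valued measure has bounded support. -/
lemma IntMeas.exists_ae_le (ν : IntMeas) : ∃ n : ℕ, ∀ᵐ x : ℝ ∂ν.1, x ≤ (n : ℝ) := by
  have hanti : Antitone fun n : ℕ => Set.Ioi (n : ℝ) := fun m n hmn =>
    Set.Ioi_subset_Ioi (by exact_mod_cast hmn)
  have hlim := tendsto_measure_iInter_atTop (μ := ν.1) (s := fun n : ℕ => Set.Ioi (n : ℝ))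
    (fun n => measurableSet_Ioi.nullMeasurableSet) hanti ⟨0, measure_ne_top _ _⟩
  have he : ⋂ n : ℕ, Set.Ioi (n : ℝ) = ∅ := by
    refine Set.eq_empty_iff_forall_notMem.2 fun x hx => ?_
    obtain ⟨n, hn⟩ := exists_nat_gt x
    have := Set.mem_iInter.1 hx n
    exact absurd this (not_lt.2 hn.le)
  rw [he, measure_empty] at hlim
  -- The masses of `(n, ∞)` tend to zero and are integers, so one of them is less than `1` and hence
  -- zero.
  obtain ⟨n, hn⟩ := (hlim.eventually_lt_const zero_lt_one).exists
  obtain ⟨k, hk⟩ := ν.2.2.2 (Set.Ioi (n : ℝ)) measurableSet_Ioi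
  have hk0 : k = 0 := by
    have hn' : ν.1 (Set.Ioi (n : ℝ)) < 1 := hn
    rw [hk] at hn'
    have : k < 1 := by exact_mod_cast hn'
    omega
  rw [hk0, Nat.cast_zero] at hk
  refine ⟨n, ?_⟩
  filter_upwards [measure_eq_zero_iff_ae_notMem.1 hk] with x hx
  simpa using hx

/-- `⟨ν, x⟩`, the total residual life. -/
def reach (ν : IntMeas) : ℝ := pair ν.1 fun x => max x 0

lemma measurable_reach : Measurable reach :=
  measurable_pair (measurable_id.max measurable_const)

lemma reach_nonneg (ν : IntMeas) : 0 ≤ reach ν := pair_nonneg _ fun _ => le_max_right _ _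

/-- Bounded support makes functions of linear growth integrable under each `ν` separately, so no
moment condition on the initial measure is needed. -/
lemma IntMeas.integrable_max (ν : IntMeas) : Integrable (fun x => max x 0) ν.1 := by
  obtain ⟨n, hn⟩ := ν.exists_ae_le
  refine Integrable.of_bound (measurable_id.max measurable_const).aestronglyMeasurable (n : ℝ) ?_
  filter_upwards [hn] with x hx
  rw [Real.norm_of_nonneg (le_max_right _ _)]
  exact max_le hx n.cast_nonneg

variable {u : ℝ → ℝ} {C : ℝ}

lemma IntMeas.integrable_of_le_max (ν : IntMeas) (hu : Measurable u)
    (hC : ∀ x, |u x| ≤ C * max x 0) : Integrable u ν.1 :=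
  Integrable.mono' (ν.integrable_max.const_mul C) hu.aestronglyMeasurable (ae_of_all _ hC)

lemma abs_pair_le_reach (ν : IntMeas) (hC : ∀ x, |u x| ≤ C * max x 0) :
    |pair ν.1 u| ≤ C * reach ν := by
  rw [reach, pair, pair, ← integral_const_mul, ← Real.norm_eq_abs]
  exact norm_integral_le_of_norm_le (ν.integrable_max.const_mul C) (ae_of_all _ hC)

variable {L : Measure IntMeas}

lemma integrable_pair_sq_of_le_max (hL : Integrable (fun ν => reach ν ^ 2) L) (hu : Measurable u)
    (hC : ∀ x, |u x| ≤ C * max x 0) : Integrable (fun ν : IntMeas => pair ν.1 u ^ 2) L := by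
  refine Integrable.mono' (hL.const_mul (C ^ 2))
    ((measurable_pair hu).pow_const 2).aestronglyMeasurable (ae_of_all _ fun ν => ?_)
  rw [Real.norm_eq_abs, abs_pow, ← mul_pow]
  exact pow_le_pow_left₀ (abs_nonneg _) (abs_pair_le_reach ν hC) 2

variable [IsFiniteMeasure L]

lemma integrable_reach (hL : Integrable (fun ν => reach ν ^ 2) L) : Integrable reach L := by
  refine Integrable.mono' (hL.add (integrable_const (1 : ℝ)))
    measurable_reach.aestronglyMeasurable (ae_of_all _ fun ν => ?_)
  rw [Real.norm_of_nonneg (reach_nonneg ν)]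
  simp only [Pi.add_apply]
  nlinarith [sq_nonneg (reach ν - 1), reach_nonneg ν]

lemma integrable_pair_of_le_max (hL : Integrable (fun ν => reach ν ^ 2) L) (hu : Measurable u)
    (hC : ∀ x, |u x| ≤ C * max x 0) : Integrable (fun ν : IntMeas => pair ν.1 u) L :=
  Integrable.mono' ((integrable_reach hL).const_mul C) (measurable_pair hu).aestronglyMeasurable
    (ae_of_all _ fun ν => abs_pair_le_reach ν hC)

end Reach

/-! ### Immigration and the exponent of the Laplace transform -/

section Immigration

variable {α : ℝ → ℝ} {p : ℕ → ℝ → ℝ} {G : Measure ℝ} {F : ℝ → ℝ} {M : ℝ → ℝ → ℝ}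
  {v : ℝ → ℝ → ℝ → ℝ} {L : Measure IntMeas} [IsFiniteMeasure L]

/-- The contribution of immigration to the normalized deviation. -/
def immigrationDeviation (L : Measure IntMeas) (M : ℝ → ℝ → ℝ) (v : ℝ → ℝ → ℝ → ℝ) (ε s : ℝ) : ℝ :=
  ∫ ν : IntMeas, (pair ν.1 (deviation M v ε s) + quadRem (pair ν.1 (v ε s)) / ε ^ 2) ∂L

/-- The variance functional of the limit theorem. -/
def limitVariance (α : ℝ → ℝ) (p : ℕ → ℝ → ℝ) (G : Measure ℝ) (L : Measure IntMeas)
    (f : ℝ → ℝ) : ℝ :=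
  ∫ ν : IntMeas, (pair ν.1 (GammaInf α p G f) + pair ν.1 (PiInf α p G f) ^ 2) ∂L

namespace IsOccupationCumulant

lemma measurable_immigrationDeviation (h : IsOccupationCumulant α p G F M v) (ε : ℝ) :
    Measurable (immigrationDeviation L M v ε) := by
  have h1 : Measurable fun q : ℝ × IntMeas => pair q.2.1 (deviation M v ε q.1) +
      quadRem (pair q.2.1 (v ε q.1)) / ε ^ 2 :=
    (measurable_pair_param (h.measurable_deviation ε)).add
      ((measurable_quadRem.comp (measurable_pair_param (h.measurable ε))).div_const _)
  exact (h1.stronglyMeasurable.integral_prod_right' (ν := L)).measurable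

/-- The linear growth bounds in `x` become powers of `reach`. Both majorants are `L`-integrable once
`reach` has a second moment, which justifies every later interchange of limit and integral. -/
lemma exists_immigrationDeviation_dominated (h : IsOccupationCumulant α p G F M v) :
    ∃ B, 0 ≤ B ∧ ∀ ε > 0, ∀ s ≥ 0, ∀ ν : IntMeas, |pair ν.1 (deviation M v ε s)| ≤ B * reach ν ∧
      |quadRem (pair ν.1 (v ε s)) / ε ^ 2| ≤ B * reach ν ^ 2 := by
  obtain ⟨B, hB0, hB⟩ := h.exists_deviation_bound
  obtain ⟨C, hC0, -, -, hv⟩ := h.exists_bound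
  refine ⟨B + C ^ 2, by positivity, fun ε hε s hs ν => ⟨?_, ?_⟩⟩
  · refine (abs_pair_le_reach ν (hB ε hε s hs).2).trans
      (mul_le_mul_of_nonneg_right ?_ (reach_nonneg ν))
    have : 0 ≤ C ^ 2 := sq_nonneg C
    linarith
  · have hy0 : 0 ≤ pair ν.1 (v ε s) := pair_nonneg _ ((h.cumulant ε hε).nonneg s)
    have hy : pair ν.1 (v ε s) ≤ ε * C * reach ν :=
      (le_abs_self _).trans (abs_pair_le_reach ν fun x => by
        rw [abs_of_nonneg ((h.cumulant ε hε).nonneg s x)]; exact (hv ε hε s hs).1 x)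
    rw [abs_of_nonneg (div_nonneg (quadRem_nonneg _) (sq_nonneg _)), div_le_iff₀ (by positivity)]
    refine (quadRem_le hy0).trans ?_
    have h1 := pow_le_pow_left₀ hy0 hy 2
    have h2 : 0 ≤ B * reach ν ^ 2 * ε ^ 2 := by positivity
    have h3 : 0 ≤ (C * reach ν * ε) ^ 2 := sq_nonneg _
    nlinarith

lemma integrable_immigrationDeviation (h : IsOccupationCumulant α p G F M v)
    (hL : Integrable (fun ν => reach ν ^ 2) L) {ε s : ℝ} (hε : 0 < ε) (hs : 0 ≤ s) :
    Integrable (fun ν : IntMeas => pair ν.1 (deviation M v ε s)) L ∧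
    Integrable (fun ν : IntMeas => quadRem (pair ν.1 (v ε s)) / ε ^ 2) L := by
  obtain ⟨B, hB0, hB⟩ := h.exists_immigrationDeviation_dominated
  refine ⟨Integrable.mono' ((integrable_reach hL).const_mul B) (measurable_pair
    ((h.measurable_deviation ε).comp measurable_prodMk_left)).aestronglyMeasurable
    (ae_of_all _ fun ν => (hB ε hε s hs ν).1),
    Integrable.mono' (hL.const_mul B) ((measurable_quadRem.comp (measurable_pair
    (h.measurable_cumulant ε s))).div_const _).aestronglyMeasurable
    (ae_of_all _ fun ν => (hB ε hε s hs ν).2)⟩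

lemma exists_immigrationDeviation_bound (h : IsOccupationCumulant α p G F M v)
    (hL : Integrable (fun ν => reach ν ^ 2) L) :
    ∃ B, 0 ≤ B ∧ ∀ ε > 0, ∀ s ≥ 0, |immigrationDeviation L M v ε s| ≤ B := by
  obtain ⟨B, hB0, hB⟩ := h.exists_immigrationDeviation_dominated
  refine ⟨∫ ν, (B * reach ν + B * reach ν ^ 2) ∂L, integral_nonneg fun ν => ?_,
    fun ε hε s hs => ?_⟩
  · have := reach_nonneg ν
    positivity
  · rw [immigrationDeviation, ← Real.norm_eq_abs]
    exact norm_integral_le_of_norm_le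
      (((integrable_reach hL).const_mul B).add (hL.const_mul B)) (ae_of_all _ fun ν =>
        (abs_add_le _ _).trans (add_le_add (hB ε hε s hs ν).1 (hB ε hε s hs ν).2))

lemma integrable_pair_mean (h : IsOccupationCumulant α p G F M v)
    (hL : Integrable (fun ν => reach ν ^ 2) L) {s : ℝ} (hs : 0 ≤ s) :
    Integrable (fun ν : IntMeas => pair ν.1 (M s)) L := by
  obtain ⟨C, hC0, hM, -, -⟩ := h.exists_bound
  exact integrable_pair_of_le_max hL (h.measurable_mean s) fun x => by
    rw [abs_of_nonneg (h.mean.nonneg s x)]; exact hM s hs x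

/-- Write `1 - e^{-y} = y - (e^{-y} - 1 + y)` with `y = ⟨ν, v^ε⟩ = ε⟨ν, M⟩ - ε²⟨ν, d^ε⟩`, and
integrate against `L`. -/
lemma immigration_cumulant_eq (h : IsOccupationCumulant α p G F M v)
    (hL : Integrable (fun ν => reach ν ^ 2) L) {ε s : ℝ} (hε : 0 < ε) (hs : 0 ≤ s) :
    immigration L (v ε s) = ε * (∫ ν : IntMeas, pair ν.1 (M s) ∂L) -
      ε ^ 2 * immigrationDeviation L M v ε s := by
  obtain ⟨i1, i2⟩ := h.integrable_immigrationDeviation hL hε hs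
  have i3 : Integrable (fun ν : IntMeas => ε ^ 2 * (pair ν.1 (deviation M v ε s) +
      quadRem (pair ν.1 (v ε s)) / ε ^ 2)) L := (i1.add i2).const_mul _
  rw [immigration, immigrationDeviation, ← integral_const_mul, ← integral_const_mul,
    ← integral_sub ((h.integrable_pair_mean hL hs).const_mul ε) i3]
  refine integral_congr_ae (ae_of_all _ fun ν => ?_)
  have e := h.integral_deviation hε hs ν.1
  simp only [pair, quadRem, oneSubExp] at e ⊢
  rw [e]
  have := hε.ne'
  field_simp
  ring

/-- The mean of the occupation time. -/
lemma cumulantExponent_eq (h : IsOccupationCumulant α p G F M v)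
    (hL : Integrable (fun ν => reach ν ^ 2) L) (σ : IntMeas) {ε t : ℝ} (hε : 0 < ε) (ht : 0 ≤ t) :
    cumulantExponent L σ t (v ε) =
      ε * (pair σ.1 (M t) + ∫ s in (0 : ℝ)..t, ∫ ν : IntMeas, pair ν.1 (M s) ∂L) -
      ε ^ 2 * (pair σ.1 (deviation M v ε t) +
        ∫ s in (0 : ℝ)..t, immigrationDeviation L M v ε s) := by
  obtain ⟨B, hB0, hB⟩ := h.exists_immigrationDeviation_bound hL
  obtain ⟨C, hC0, hM, -, -⟩ := h.exists_bound
  have hm : Measurable fun s => ∫ ν : IntMeas, pair ν.1 (M s) ∂L :=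
    ((measurable_pair_param h.mean.measurable).stronglyMeasurable.integral_prod_right'
      (ν := L)).measurable
  have i1 : IntervalIntegrable (fun s => ∫ ν : IntMeas, pair ν.1 (M s) ∂L) volume 0 t :=
    intervalIntegrable_of_bounded (B := ∫ ν, C * reach ν ∂L) hm ht fun s hs => by
      rw [← Real.norm_eq_abs]
      exact norm_integral_le_of_norm_le ((integrable_reach hL).const_mul C)
        (ae_of_all _ fun ν => abs_pair_le_reach ν fun x => by
          rw [abs_of_nonneg (h.mean.nonneg s x)]; exact hM s hs.1 x)
  have i2 : IntervalIntegrable (immigrationDeviation L M v ε) volume 0 t :=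
    intervalIntegrable_of_bounded (h.measurable_immigrationDeviation ε) ht
      fun s hs => hB ε hε s hs.1
  have e1 : ∫ s in (0 : ℝ)..t, immigration L (v ε s) =
      ε * (∫ s in (0 : ℝ)..t, ∫ ν : IntMeas, pair ν.1 (M s) ∂L) -
      ε ^ 2 * ∫ s in (0 : ℝ)..t, immigrationDeviation L M v ε s := by
    rw [← intervalIntegral.integral_const_mul, ← intervalIntegral.integral_const_mul,
      ← intervalIntegral.integral_sub (i1.const_mul ε) (i2.const_mul _)]
    refine intervalIntegral.integral_congr fun s hs => ?_
    rw [Set.uIcc_of_le ht] at hs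
    exact h.immigration_cumulant_eq hL hε hs.1
  have e2 := h.integral_deviation hε ht σ.1
  rw [cumulantExponent, e1]
  simp only [pair] at e2 ⊢
  rw [e2]
  have := hε.ne'
  field_simp
  ring

/-- For each `ν`, the deviation contributes `⟨ν, Γ_∞⟩/2` and the exponential remainder `⟨ν,
Π_∞⟩²/2`; these are the two terms of the variance. -/
lemma tendsto_immigrationDeviation (h : IsOccupationCumulant α p G F M v)
    (hL : Integrable (fun ν => reach ν ^ 2) L) :
    Tendsto (fun z : ℝ × ℝ => immigrationDeviation L M v z.1 z.2) (𝓝[>] 0 ×ˢ atTop)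
      (𝓝 (limitVariance α p G L F / 2)) := by
  obtain ⟨B, hB0, hB⟩ := h.exists_immigrationDeviation_dominated
  obtain ⟨B', hB'0, hB'⟩ := h.exists_deviation_bound
  obtain ⟨C, hC0, -, -, hv⟩ := h.exists_bound
  rw [limitVariance, ← integral_div]
  refine tendsto_integral_filter_of_dominated_convergence
    (fun ν => B * reach ν + B * reach ν ^ 2) ?_ ?_
    (((integrable_reach hL).const_mul B).add (hL.const_mul B)) (ae_of_all _ fun ν => ?_)
  · refine Eventually.of_forall fun z => Measurable.aestronglyMeasurable ?_
    exact (measurable_pair ((h.measurable_deviation z.1).comp measurable_prodMk_left)).add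
      ((measurable_quadRem.comp (measurable_pair (h.measurable_cumulant _ _))).div_const _)
  · filter_upwards [eventually_pos_nonneg] with z hz
    exact ae_of_all _ fun ν => (abs_add_le _ _).trans
      (add_le_add (hB _ hz.1 _ hz.2 ν).1 (hB _ hz.1 _ hz.2 ν).2)
  · have h1 : Tendsto (fun z : ℝ × ℝ => pair ν.1 (deviation M v z.1 z.2)) (𝓝[>] 0 ×ˢ atTop)
        (𝓝 (pair ν.1 (GammaInf α p G F) / 2)) := by
      rw [pair, ← integral_div]
      refine tendsto_integral_filter_of_dominated_convergence (fun x => B' * max x 0) ?_ ?_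
        (ν.integrable_max.const_mul B') (ae_of_all _ fun x => h.tendsto_deviation x)
      · exact Eventually.of_forall fun z => ((h.measurable_deviation z.1).comp
          measurable_prodMk_left).aestronglyMeasurable
      · filter_upwards [eventually_pos_nonneg] with z hz
        exact ae_of_all _ fun x => (hB' _ hz.1 _ hz.2).2 x
    have h2 : Tendsto (fun z : ℝ × ℝ => pair ν.1 (v z.1 z.2) / z.1) (𝓝[>] 0 ×ˢ atTop)
        (𝓝 (pair ν.1 (PiInf α p G F))) := by
      simp only [pair, ← integral_div]
      refine tendsto_integral_filter_of_dominated_convergence (fun x => C * max x 0) ?_ ?_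
        (ν.integrable_max.const_mul C) (ae_of_all _ fun x => h.tendsto_cumulant_div x)
      · exact Eventually.of_forall fun z =>
          ((h.measurable_cumulant _ _).div_const _).aestronglyMeasurable
      · filter_upwards [eventually_pos_nonneg] with z hz
        refine ae_of_all _ fun x => ?_
        rw [Real.norm_of_nonneg (div_nonneg ((h.cumulant _ hz.1).nonneg _ _) hz.1.le),
          div_le_iff₀ hz.1]
        exact ((hv _ hz.1 _ hz.2).1 x).trans (le_of_eq (by ring))
    have h3 := tendsto_quadRem_div (tendsto_fst (f := 𝓝[>] (0 : ℝ)) (g := atTop (α := ℝ)))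
      (by
        filter_upwards [eventually_pos_nonneg] with z hz
        exact pair_nonneg _ ((h.cumulant _ hz.1).nonneg _)) h2
    rw [add_div]
    exact h1.add h3

/-- The limit of the logarithm of the centred Laplace transform. -/
theorem tendsto_exponent (h : IsOccupationCumulant α p G F M v)
    (hL : Integrable (fun ν => reach ν ^ 2) L) (σ : IntMeas) :
    Tendsto (fun t : ℝ => (Real.sqrt t)⁻¹ ^ 2 * (pair σ.1 (deviation M v (Real.sqrt t)⁻¹ t) +
        ∫ s in (0 : ℝ)..t, immigrationDeviation L M v (Real.sqrt t)⁻¹ s)) atTop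
      (𝓝 (limitVariance α p G L F / 2)) := by
  obtain ⟨B, hB0, hB⟩ := h.exists_immigrationDeviation_bound hL
  obtain ⟨B', hB'0, hB'⟩ := h.exists_immigrationDeviation_dominated
  have hε : Tendsto (fun t : ℝ => (Real.sqrt t)⁻¹) atTop (𝓝[>] 0) :=
    tendsto_inv_atTop_nhdsGT_zero.comp Real.tendsto_sqrt_atTop
  have hε0 := hε.mono_right nhdsWithin_le_nhds
  -- The initial measure contributes a bounded quantity multiplied by `1/t`.
  have h1 : Tendsto (fun t : ℝ => (Real.sqrt t)⁻¹ ^ 2 *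
      pair σ.1 (deviation M v (Real.sqrt t)⁻¹ t)) atTop (𝓝 0) := by
    have hz : Tendsto (fun t : ℝ => (Real.sqrt t)⁻¹ ^ 2 * (B' * reach σ)) atTop (𝓝 0) := by
      simpa using (hε0.pow 2).mul_const (B' * reach σ)
    refine squeeze_zero_norm' ?_ hz
    filter_upwards [eventually_gt_atTop (0 : ℝ)] with t ht
    rw [norm_mul, Real.norm_of_nonneg (sq_nonneg _)]
    have hs : 0 < (Real.sqrt t)⁻¹ := inv_pos.2 (Real.sqrt_pos.2 ht)
    exact mul_le_mul_of_nonneg_left (hB' _ hs t ht.le σ).1 (sq_nonneg _)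
  -- With `s = t r` the factor `ε² = 1/t` turns the integral over `[0, t]` into an average over `r ∈
  -- [0, 1]`. For each `r > 0` the pair `(t^{-1/2}, t r)` tends to `(0+, ∞)`, which is why the
  -- limits are taken jointly.
  have h2 : Tendsto (fun t : ℝ => ∫ r in (0 : ℝ)..1,
      immigrationDeviation L M v (Real.sqrt t)⁻¹ (t * r)) atTop
      (𝓝 (∫ _ in (0 : ℝ)..1, limitVariance α p G L F / 2)) := by
    refine intervalIntegral.tendsto_integral_filter_of_dominated_convergence (fun _ => B) ?_ ?_
      intervalIntegrable_const (ae_of_all _ fun r hr => ?_)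
    · exact Eventually.of_forall fun t => ((h.measurable_immigrationDeviation _).comp
        (by fun_prop)).aestronglyMeasurable
    · filter_upwards [eventually_gt_atTop (0 : ℝ)] with t ht
      refine ae_of_all _ fun r hr => ?_
      rw [Set.uIoc_of_le zero_le_one] at hr
      exact hB _ (inv_pos.2 (Real.sqrt_pos.2 ht)) _ (mul_nonneg ht.le hr.1.le)
    · rw [Set.uIoc_of_le zero_le_one] at hr
      have hz : Tendsto (fun t : ℝ => ((Real.sqrt t)⁻¹, t * r)) atTop (𝓝[>] 0 ×ˢ atTop) :=
        hε.prodMk (tendsto_id.atTop_mul_const hr.1)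
      have hlim := (h.tendsto_immigrationDeviation hL).comp hz
      simpa only [Function.comp_def] using hlim
  rw [intervalIntegral.integral_const, sub_zero, one_smul] at h2
  have h3 := h1.add h2
  rw [zero_add] at h3
  refine h3.congr' ?_
  filter_upwards [eventually_gt_atTop (0 : ℝ)] with t ht
  rw [intervalIntegral.integral_comp_mul_left _ ht.ne', mul_add]
  congr 1
  rw [mul_zero, mul_one, smul_eq_mul, inv_pow, Real.sq_sqrt ht.le]

end IsOccupationCumulant

end Immigration

/-! ### Occupation integrals: mean and centred Laplace transform -/

section OccupationTime

variable {α : ℝ → ℝ} {p : ℕ → ℝ → ℝ} {G : Measure ℝ}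
variable {Ω : Type*} {mΩ : MeasurableSpace Ω} {μ : Measure Ω} [IsProbabilityMeasure μ]
  {L : Measure IntMeas} [IsFiniteMeasure L] {ℱ : Filtration ℝ≥0 mΩ} {Y : ℝ≥0 → Ω → IntMeas}
  {σ : IntMeas} {F f g : ℝ → ℝ} {M : ℝ → ℝ → ℝ} {v : ℝ → ℝ → ℝ → ℝ}

/-- The occupation time integral `∫_0^t ⟨Y_s, F⟩ ds`. -/
def occupationTime (Y : ℝ≥0 → Ω → IntMeas) (F : ℝ → ℝ) (t : ℝ) (ω : Ω) : ℝ :=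
  ∫ s in (0 : ℝ)..t, pathPair Y F ω s

lemma measurable_occupationTime (hYm : Measurable (Function.uncurry Y)) (hF : Measurable F)
    (t : ℝ) : Measurable (occupationTime Y F t) :=
  measurable_intervalIntegral_param measurable_const (measurable_pathPair hYm hF)

lemma occupationTime_nonneg (h0 : ∀ x, 0 ≤ F x) {t : ℝ} (ht : 0 ≤ t) (ω : Ω) :
    0 ≤ occupationTime Y F t ω :=
  intervalIntegral.integral_nonneg ht fun _ _ => pair_nonneg _ h0

lemma IsImmigrationProcess.integrable_occupationTime (hm : IsBranchingMechanism α p G)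
    (hY : IsImmigrationProcess α p G L μ ℱ Y) (hYm : Measurable (Function.uncurry Y))
    (hY0 : ∀ᵐ ω ∂μ, Y 0 ω = σ)
    (hL : Integrable (fun ν : IntMeas => ν.1.real Set.univ) L) (hF : MemB F) {t : ℝ}
    (ht : 0 ≤ t) : Integrable (occupationTime Y F t) μ := by
  refine ⟨(measurable_occupationTime hYm hF.measurable t).aestronglyMeasurable, ?_⟩
  rw [hasFiniteIntegral_iff_enorm]
  exact (lintegral_mono fun ω => enorm_intervalIntegral_le ht).trans_lt
    (hY.lintegral_pathPair hm hYm hY0 hL hF t).lt_top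

lemma IsImmigrationProcess.ae_integrableOn_pathPair (hm : IsBranchingMechanism α p G)
    (hY : IsImmigrationProcess α p G L μ ℱ Y) (hYm : Measurable (Function.uncurry Y))
    (hY0 : ∀ᵐ ω ∂μ, Y 0 ω = σ)
    (hL : Integrable (fun ν : IntMeas => ν.1.real Set.univ) L) (hF : MemB F) (t : ℝ) :
    ∀ᵐ ω ∂μ, IntegrableOn (pathPair Y F ω) (Set.Ioc 0 t) := by
  have hpm := measurable_pathPair hYm hF.measurable
  have h1 : Measurable fun ω => ∫⁻ s in Set.Ioc 0 t, ‖pathPair Y F ω s‖ₑ :=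
    Measurable.lintegral_prod_right' (f := fun q : Ω × ℝ => ‖pathPair Y F q.1 q.2‖ₑ) hpm.enorm
  filter_upwards [ae_lt_top h1 (hY.lintegral_pathPair hm hYm hY0 hL hF t)] with ω hω
  refine ⟨(hpm.comp measurable_prodMk_left).aestronglyMeasurable, ?_⟩
  rwa [hasFiniteIntegral_iff_enorm]

lemma MemB.integrable (hF : MemB F) (m : Measure ℝ) [IsFiniteMeasure m] : Integrable F m := by
  obtain ⟨C, hC⟩ := hF.bounded
  exact integrable_of_bounded hF.measurable hC

lemma pathPair_linear (hf : MemB f) (hg : MemB g) (a b : ℝ) (ω : Ω) (s : ℝ) :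
    pathPair Y (fun x => a * f x + b * g x) ω s = a * pathPair Y f ω s + b * pathPair Y g ω s := by
  simp only [pathPair, pair]
  rw [integral_add ((hf.integrable _).const_mul a) ((hg.integrable _).const_mul b),
    integral_const_mul, integral_const_mul]

lemma MemB.linear (hf : MemB f) (hg : MemB g) (a b : ℝ) : MemB fun x => a * f x + b * g x := by
  obtain ⟨C, hC⟩ := (hf.const_mul a).bounded
  obtain ⟨D, hD⟩ := (hg.const_mul b).bounded
  exact ⟨(hf.const_mul a).measurable.add (hg.const_mul b).measurable,
    ⟨C + D, fun x => (abs_add_le _ _).trans (add_le_add (hC x) (hD x))⟩,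
    fun x hx => by simp [hf.zero_of_nonpos x hx, hg.zero_of_nonpos x hx]⟩

lemma IsImmigrationProcess.occupationTime_linear (hm : IsBranchingMechanism α p G)
    (hY : IsImmigrationProcess α p G L μ ℱ Y) (hYm : Measurable (Function.uncurry Y))
    (hY0 : ∀ᵐ ω ∂μ, Y 0 ω = σ)
    (hL : Integrable (fun ν : IntMeas => ν.1.real Set.univ) L) (hf : MemB f) (hg : MemB g)
    (a b : ℝ) {t : ℝ} (ht : 0 ≤ t) :
    ∀ᵐ ω ∂μ, occupationTime Y (fun x => a * f x + b * g x) t ω =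
      a * occupationTime Y f t ω + b * occupationTime Y g t ω := by
  filter_upwards [hY.ae_integrableOn_pathPair hm hYm hY0 hL hf t,
    hY.ae_integrableOn_pathPair hm hYm hY0 hL hg t] with ω h1 h2
  simp only [occupationTime, pathPair_linear hf hg]
  rw [← intervalIntegrable_iff_integrableOn_Ioc_of_le ht] at h1 h2
  rw [intervalIntegral.integral_add (h1.const_mul a) (h2.const_mul b),
    intervalIntegral.integral_const_mul, intervalIntegral.integral_const_mul]

/-- The occupation measure is a composition of kernels, so its integrals are iterated integrals of
integrable functions. Almost surely its total mass is finite, because the mass of `Y` is integrable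
over `(0, t]`; bounded functions are then integrable. -/
lemma IsImmigrationProcess.pair_occupation (hm : IsBranchingMechanism α p G)
    (hY : IsImmigrationProcess α p G L μ ℱ Y) (hYm : Measurable (Function.uncurry Y))
    (hY0 : ∀ᵐ ω ∂μ, Y 0 ω = σ)
    (hL : Integrable (fun ν : IntMeas => ν.1.real Set.univ) L) (hF : MemB F) {t : ℝ}
    (ht : 0 ≤ t) : ∀ᵐ ω ∂μ, pair (occupation Y t ω) F = occupationTime Y F t ω := by
  obtain ⟨C, hC⟩ := hF.bounded
  have h1 := hY.ae_integrableOn_pathPair hm hYm hY0 hL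
    (F := posOne) IsOccupationCumulant.memB_posOne t
  filter_upwards [h1] with ω hω
  have hYω : Measurable fun s : ℝ => Y s.toNNReal ω :=
    hYm.comp (f := fun s : ℝ => (s.toNNReal, ω)) (by fun_prop)
  have hYω' : Measurable fun s : ℝ => (Y s.toNNReal ω).1 := measurable_subtype_coe.comp hYω
  set η : Kernel ℝ ℝ := coordKernel.comap (fun s : ℝ => Y s.toNNReal ω) hYω
  set κ : Kernel Unit ℝ := Kernel.const Unit (volume.restrict (Set.Ioc 0 t))
  have hocc : occupation Y t ω = (η ∘ₖ κ) () := by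
    rw [Kernel.comp_apply]; rfl
  have hfin : IsFiniteMeasure (occupation Y t ω) := by
    refine ⟨?_⟩
    rw [occupation, Measure.bind_apply MeasurableSet.univ hYω'.aemeasurable]
    have h2 := hω.2
    rw [hasFiniteIntegral_iff_enorm] at h2
    refine lt_of_le_of_lt (lintegral_mono fun s => ?_) h2
    have h3 := pair_posOne (Y s.toNNReal ω) 1
    simp only [one_mul] at h3
    change _ ≤ ‖pair (Y s.toNNReal ω).1 (fun x => posOne x)‖ₑ
    rw [h3, Real.enorm_of_nonneg measureReal_nonneg, ofReal_measureReal]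
  have hint : Integrable F ((η ∘ₖ κ) ()) := by
    rw [← hocc]; exact integrable_of_bounded hF.measurable hC
  rw [pair, hocc, Kernel.integral_comp hint, occupationTime, intervalIntegral.integral_of_le ht]
  rfl

/-- The mean of the occupation time. -/
lemma IsImmigrationProcess.integral_occupationTime (h : IsOccupationCumulant α p G F M v)
    (hY : IsImmigrationProcess α p G L μ ℱ Y) (hYm : Measurable (Function.uncurry Y))
    (hY0 : ∀ᵐ ω ∂μ, Y 0 ω = σ)
    (hL : Integrable (fun ν : IntMeas => ν.1.real Set.univ) L)
    (hL2 : Integrable (fun ν => reach ν ^ 2) L) {t : ℝ} (ht : 0 < t) :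
    ∫ ω, occupationTime Y F t ω ∂μ =
      pair σ.1 (M t) + ∫ s in (0 : ℝ)..t, ∫ ν : IntMeas, pair ν.1 (M s) ∂L := by
  set b := pair σ.1 (M t) + ∫ s in (0 : ℝ)..t, ∫ ν : IntMeas, pair ν.1 (M s) ∂L with hb
  set Z := occupationTime Y F t with hZ
  have hZi := hY.integrable_occupationTime h.sub.mech hYm hY0 hL h.memB ht.le
  have hZ0 : ∀ ω, 0 ≤ Z ω := occupationTime_nonneg h.nonneg ht.le
  have hZm : Measurable Z := measurable_occupationTime hYm h.memB.measurable t
  obtain ⟨B, hB0, hB⟩ := h.exists_immigrationDeviation_bound hL2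
  obtain ⟨B', hB'0, hB'⟩ := h.exists_immigrationDeviation_dominated
  have hpos : ∀ᶠ η : ℝ in 𝓝[>] 0, 0 < η := self_mem_nhdsWithin
  have hη0 : Tendsto (fun η : ℝ => η) (𝓝[>] 0) (𝓝 0) := nhdsWithin_le_nhds
  have hlap : ∀ η > 0, ∫ ω, Real.exp (-(η * Z ω)) ∂μ =
      Real.exp (-cumulantExponent L σ t (v η)) := fun η hη => by
    have h1 := hY.laplace_occupation h.sub.mech hYm hY0 hL (h.memB.const_mul η)
      (fun x => mul_nonneg hη.le (h.nonneg x)) ht (h.cumulant η hη)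
    rw [← h1]
    refine integral_congr_ae (ae_of_all _ fun ω => ?_)
    simp only [hZ, occupationTime, pathPair, pair, integral_const_mul,
      intervalIntegral.integral_const_mul]
  -- The mean is found by computing the limit of `(1 - E e^{-ηZ})/η` in two ways: by dominated
  -- convergence, and from the explicit exponent, whose first order coefficient in `η` is `b`.
  have hE : Tendsto (fun η : ℝ => ∫ ω, oneSubExp (η * Z ω) / η ∂μ) (𝓝[>] 0)
      (𝓝 (∫ ω, Z ω ∂μ)) := by
    refine tendsto_integral_filter_of_dominated_convergence Z ?_ ?_ hZi (ae_of_all _ fun ω => ?_)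
    · exact Eventually.of_forall fun η =>
        ((measurable_oneSubExp.comp (hZm.const_mul η)).div_const η).aestronglyMeasurable
    · filter_upwards [hpos] with η hη
      refine ae_of_all _ fun ω => ?_
      rw [Real.norm_of_nonneg (div_nonneg (oneSubExp_nonneg (mul_nonneg hη.le (hZ0 ω))) hη.le),
        div_le_iff₀ hη, mul_comm (Z ω)]
      exact oneSubExp_le _
    · have hc : Tendsto (fun η : ℝ => η * Z ω / η) (𝓝[>] 0) (𝓝 (Z ω)) :=
        tendsto_const_nhds.congr' (by
          filter_upwards [hpos] with η hη
          rw [mul_div_cancel_left₀ _ hη.ne'])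
      have h1 := tendsto_quadRem_div tendsto_id
        (by filter_upwards [hpos] with η hη using mul_nonneg hη.le (hZ0 ω)) hc
      have h2 := hc.sub (hη0.mul h1)
      rw [zero_mul, sub_zero] at h2
      refine h2.congr' ?_
      filter_upwards [hpos] with η hη
      have := hη.ne'
      simp only [quadRem, id]
      field_simp
      ring
  have hBb : Tendsto (fun η : ℝ => cumulantExponent L σ t (v η) / η) (𝓝[>] 0) (𝓝 b) := by
    have hz : Tendsto (fun η : ℝ => η * (B' * reach σ + B * t)) (𝓝[>] 0) (𝓝 0) := by
      simpa using hη0.mul_const (B' * reach σ + B * t)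
    have hd : Tendsto (fun η : ℝ => cumulantExponent L σ t (v η) / η - b) (𝓝[>] 0) (𝓝 0) := by
      refine squeeze_zero_norm' ?_ hz
      filter_upwards [hpos] with η hη
      have e : cumulantExponent L σ t (v η) / η - b = -(η * (pair σ.1 (deviation M v η t) +
          ∫ s in (0 : ℝ)..t, immigrationDeviation L M v η s)) := by
        rw [h.cumulantExponent_eq hL2 σ hη ht.le, ← hb]
        have := hη.ne'
        field_simp
        ring
      rw [e, norm_neg, norm_mul, Real.norm_of_nonneg hη.le]
      refine mul_le_mul_of_nonneg_left ((norm_add_le _ _).trans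
        (add_le_add (hB' η hη t ht.le σ).1 ?_)) hη.le
      have := intervalIntegral.norm_integral_le_of_norm_le_const (a := 0) (b := t)
        (f := immigrationDeviation L M v η) (C := B) fun s hs => by
          rw [Set.uIoc_of_le ht.le] at hs
          exact hB η hη s hs.1.le
      rwa [sub_zero, abs_of_pos ht] at this
    simpa using hd.add_const b
  have hEb : Tendsto (fun η : ℝ => ∫ ω, oneSubExp (η * Z ω) / η ∂μ) (𝓝[>] 0) (𝓝 b) := by
    have h1 := tendsto_quadRem_div (e := id) tendsto_id
      (by
        filter_upwards [hpos] with η hη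
        exact cumulantExponent_nonneg (L := L) (σ := σ) ht.le (h.cumulant η hη).nonneg) hBb
    have h2 := hBb.sub (hη0.mul h1)
    rw [zero_mul, sub_zero] at h2
    refine h2.congr' ?_
    filter_upwards [hpos] with η hη
    have hi : Integrable (fun ω => Real.exp (-(η * Z ω))) μ :=
      integrable_of_bounded (hZm.const_mul η).neg.exp (B := 1) fun ω => by
        rw [abs_of_pos (Real.exp_pos _)]; exact exp_neg_le_one (mul_nonneg hη.le (hZ0 ω))
    rw [integral_div]
    simp only [oneSubExp, quadRem, id]
    rw [integral_sub (integrable_const _) hi, hlap η hη, integral_const, probReal_univ, one_smul]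
    have := hη.ne'
    field_simp
    ring
  exact tendsto_nhds_unique hE hEb

/-- Convergence of the centred Laplace transform. -/
theorem IsImmigrationProcess.tendsto_laplace (h : IsSubcritical α p G) (hF : MemB F)
    (h0 : ∀ x, 0 ≤ F x)
    (hY : IsImmigrationProcess α p G L μ ℱ Y) (hYm : Measurable (Function.uncurry Y))
    (hY0 : ∀ᵐ ω ∂μ, Y 0 ω = σ)
    (hL : Integrable (fun ν : IntMeas => ν.1.real Set.univ) L)
    (hL2 : Integrable (fun ν => reach ν ^ 2) L) :
    Tendsto (fun t : ℝ => ∫ ω, Real.exp (-((Real.sqrt t)⁻¹ * (occupationTime Y F t ω -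
      ∫ ω', occupationTime Y F t ω' ∂μ))) ∂μ) atTop
      (𝓝 (Real.exp (limitVariance α p G L F / 2))) := by
  obtain ⟨M, v, h⟩ := h.exists_isOccupationCumulant hF h0
  refine ((Real.continuous_exp.tendsto _).comp (h.tendsto_exponent hL2 σ)).congr' ?_
  filter_upwards [eventually_gt_atTop (0 : ℝ)] with t ht
  have hε : 0 < (Real.sqrt t)⁻¹ := inv_pos.2 (Real.sqrt_pos.2 ht)
  set ε := (Real.sqrt t)⁻¹
  have h1 := hY.laplace_occupation h.sub.mech hYm hY0 hL (h.memB.const_mul ε)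
    (fun x => mul_nonneg hε.le (h.nonneg x)) ht (h.cumulant ε hε)
  have e : ∀ ω, Real.exp (-(ε * (occupationTime Y F t ω - ∫ ω', occupationTime Y F t ω' ∂μ))) =
      Real.exp (ε * ∫ ω', occupationTime Y F t ω' ∂μ) *
        Real.exp (-∫ s in (0 : ℝ)..t, pathPair Y (fun x => ε * F x) ω s) := fun ω => by
    rw [← Real.exp_add]
    congr 1
    have : ∫ s in (0 : ℝ)..t, pathPair Y (fun x => ε * F x) ω s = ε * occupationTime Y F t ω := by
      simp only [occupationTime, pathPair, pair, integral_const_mul,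
        intervalIntegral.integral_const_mul]
    rw [this]
    ring
  simp only [e]
  -- The first order term of the exponent is `ε` times the mean, so the centring factor cancels it
  -- and only the term of order `ε²` survives.
  rw [integral_const_mul, h1, ← Real.exp_add, h.cumulantExponent_eq hL2 σ hε ht.le,
    hY.integral_occupationTime h hYm hY0 hL hL2 ht]
  simp only [Function.comp]
  congr 1
  ring

end OccupationTime

/-! ### The limit variance as a nonnegative quadratic form -/

section Variance

variable {α : ℝ → ℝ} {p : ℕ → ℝ → ℝ} {G : Measure ℝ} {f g : ℝ → ℝ}
  {L : Measure IntMeas} [IsFiniteMeasure L]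

lemma MemB.intervalIntegrable_shift (hf : MemB f) (x : ℝ) :
    IntervalIntegrable (fun s => f (x - s)) volume 0 x := by
  obtain ⟨C, hC⟩ := hf.bounded
  have key : ∀ a b : ℝ, IntegrableOn (fun s => f (x - s)) (Set.Ioc a b) := fun a b =>
    Measure.integrableOn_of_bounded (M := C) (by simp)
      (hf.measurable.comp (by fun_prop)).aestronglyMeasurable (ae_of_all _ fun _ => hC _)
  exact ⟨key 0 x, key x 0⟩

lemma integral_shift_linear (hf : MemB f) (hg : MemB g) (a b x : ℝ) :
    ∫ s in (0 : ℝ)..x, (a * f (x - s) + b * g (x - s)) =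
      a * (∫ s in (0 : ℝ)..x, f (x - s)) + b * ∫ s in (0 : ℝ)..x, g (x - s) := by
  rw [intervalIntegral.integral_add ((hf.intervalIntegrable_shift x).const_mul a)
    ((hg.intervalIntegrable_shift x).const_mul b), intervalIntegral.integral_const_mul,
    intervalIntegral.integral_const_mul]

lemma PiInf_linear (h : IsSubcritical α p G) (hf : MemB f) (hg : MemB g) (a b x : ℝ) :
    PiInf α p G (fun x => a * f x + b * g x) x =
      a * PiInf α p G f x + b * PiInf α p G g x := by
  rw [PiInf_eq h (hf.linear hg a b), PiInf_eq h hf, PiInf_eq h hg, integral_shift_linear hf hg]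
  have e : meanMass α p G (fun x => a * f x + b * g x) =
      a * meanMass α p G f + b * meanMass α p G g := by
    simp only [meanMass, integral_shift_linear hf hg]
    rw [integral_add ((integrable_integral_shift h hf).const_mul a)
      ((integrable_integral_shift h hg).const_mul b), integral_const_mul, integral_const_mul]
    ring
  rw [e]
  ring

/-- The second order birth rate `α(x) g''(x, 1-)`. -/
def secondRate (α : ℝ → ℝ) (p : ℕ → ℝ → ℝ) (x : ℝ) : ℝ := α x * gen₂ p x

lemma memB_secondRate (h : IsSubcritical α p G) : MemB (secondRate α p) := by
  obtain ⟨C, _, hC⟩ := h.mech.exists_bound₂ h.second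
  exact ⟨h.mech.rate.measurable.mul (h.mech.measurable_gen₂ h.second),
    ⟨C, fun x => by
      rw [secondRate, abs_of_nonneg (mul_nonneg (h.mech.rate.nonneg x) (h.mech.gen₂_nonneg x))]
      exact hC x⟩,
    fun x hx => by rw [secondRate, h.mech.rate.zero_of_nonpos x hx, zero_mul]⟩

lemma integral_shift_self_nonneg (hf : MemB f) (h0 : ∀ x, 0 ≤ f x) (x : ℝ) :
    0 ≤ ∫ s in (0 : ℝ)..x, f (x - s) := by
  rw [← hf.integral_shift_Ioi]
  exact integral_nonneg fun s => h0 _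

lemma integral_rates (h : IsSubcritical α p G) (c d x : ℝ) :
    ∫ s in (0 : ℝ)..x, α (x - s) * (gen₂ p (x - s) * c + gen₁ p (x - s) * d) =
      c * (∫ s in (0 : ℝ)..x, secondRate α p (x - s)) +
        d * ∫ s in (0 : ℝ)..x, meanRate α p (x - s) := by
  rw [← integral_shift_linear (memB_secondRate h) (memB_meanRate h)]
  refine intervalIntegral.integral_congr fun s _ => ?_
  simp only [secondRate, meanRate]
  ring

lemma aTwo_explicit (h : IsSubcritical α p G) (f : ℝ → ℝ) :
    aTwo α p G f = (1 - rho α p G)⁻¹ * (pair G (PiInf α p G f) ^ 2 *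
      (∫ x, (∫ s in (0 : ℝ)..x, secondRate α p (x - s)) ∂G) +
      pair G (fun y => PiInf α p G f y ^ 2) * rho α p G) := by
  rw [aTwo]
  simp only [integral_rates h]
  rw [integral_add ((integrable_integral_shift h (memB_secondRate h)).const_mul _)
    ((integrable_integral_shift h (memB_meanRate h)).const_mul _), integral_const_mul,
    integral_const_mul, ← rho_eq h]

lemma GammaInf_explicit (h : IsSubcritical α p G) (f : ℝ → ℝ) (x : ℝ) :
    GammaInf α p G f x =
      pair G (PiInf α p G f) ^ 2 * (∫ s in (0 : ℝ)..x, secondRate α p (x - s)) +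
      (pair G (fun y => PiInf α p G f y ^ 2) + aTwo α p G f) *
        ∫ s in (0 : ℝ)..x, meanRate α p (x - s) := by
  rw [GammaInf, integral_rates h]

lemma pair_GammaInf (h : IsSubcritical α p G) (f : ℝ → ℝ) (ν : IntMeas) :
    pair ν.1 (GammaInf α p G f) =
      pair G (PiInf α p G f) ^ 2 * pair ν.1 (fun x => ∫ s in (0 : ℝ)..x, secondRate α p (x - s)) +
      (pair G (fun y => PiInf α p G f y ^ 2) + aTwo α p G f) *
        pair ν.1 fun x => ∫ s in (0 : ℝ)..x, meanRate α p (x - s) := by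
  obtain ⟨A, hA⟩ := (memB_secondRate h).bounded
  obtain ⟨B, hB⟩ := (memB_meanRate h).bounded
  simp only [pair, GammaInf_explicit h f]
  rw [integral_add, integral_const_mul, integral_const_mul]
  · exact (ν.integrable_of_le_max (memB_secondRate h).measurable_integral_shift
      ((memB_secondRate h).abs_integral_shift_self_le hA)).const_mul _
  · exact (ν.integrable_of_le_max (memB_meanRate h).measurable_integral_shift
      ((memB_meanRate h).abs_integral_shift_self_le hB)).const_mul _

lemma integrable_limitVariance (h : IsSubcritical α p G)
    (hL : Integrable (fun ν => reach ν ^ 2) L) (hf : MemB f) :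
    Integrable (fun ν : IntMeas => pair ν.1 (GammaInf α p G f)) L ∧
    Integrable (fun ν : IntMeas => pair ν.1 (PiInf α p G f) ^ 2) L := by
  obtain ⟨A, hA⟩ := (memB_secondRate h).bounded
  obtain ⟨B, hB⟩ := (memB_meanRate h).bounded
  obtain ⟨C, _, hC⟩ := exists_abs_PiInf_le h hf
  refine ⟨?_, integrable_pair_sq_of_le_max hL (measurable_PiInf h hf) hC⟩
  simp only [pair_GammaInf h f]
  exact ((integrable_pair_of_le_max hL (memB_secondRate h).measurable_integral_shift
      ((memB_secondRate h).abs_integral_shift_self_le hA)).const_mul _).add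
    ((integrable_pair_of_le_max hL (memB_meanRate h).measurable_integral_shift
      ((memB_meanRate h).abs_integral_shift_self_le hB)).const_mul _)

/-- `Γ_∞f` depends on `f` only through `⟨G, Π_∞f⟩²` and `⟨G, (Π_∞f)²⟩`, also inside `a₂`. The
variance is thus a combination of three squares with nonnegative coefficients independent of `f`;
its sign and its quadratic nature are then visible, `Π_∞` being linear. -/
lemma exists_limitVariance_eq (h : IsSubcritical α p G)
    (hL : Integrable (fun ν => reach ν ^ 2) L) :
    ∃ k₁ k₂ : ℝ, 0 ≤ k₁ ∧ 0 ≤ k₂ ∧ ∀ f, MemB f → limitVariance α p G L f =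
      k₁ * pair G (PiInf α p G f) ^ 2 + k₂ * pair G (fun y => PiInf α p G f y ^ 2) +
        ∫ ν : IntMeas, pair ν.1 (PiInf α p G f) ^ 2 ∂L := by
  obtain ⟨A, hA⟩ := (memB_secondRate h).bounded
  obtain ⟨B, hB⟩ := (memB_meanRate h).bounded
  have hs0 : ∀ x, 0 ≤ secondRate α p x := fun x =>
    mul_nonneg (h.mech.rate.nonneg x) (h.mech.gen₂_nonneg x)
  set U := ∫ x, (∫ s in (0 : ℝ)..x, secondRate α p (x - s)) ∂G
  set l₁ := ∫ ν : IntMeas, pair ν.1 (fun x => ∫ s in (0 : ℝ)..x, meanRate α p (x - s)) ∂L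
  set l₂ := ∫ ν : IntMeas, pair ν.1 (fun x => ∫ s in (0 : ℝ)..x, secondRate α p (x - s)) ∂L
  have hU : 0 ≤ U := integral_nonneg (integral_shift_self_nonneg (memB_secondRate h) hs0)
  have hl₁ : 0 ≤ l₁ := integral_nonneg fun ν => pair_nonneg _
    (integral_shift_self_nonneg (memB_meanRate h) (meanRate_nonneg h))
  have hl₂ : 0 ≤ l₂ := integral_nonneg fun ν => pair_nonneg _
    (integral_shift_self_nonneg (memB_secondRate h) hs0)
  have hρ : 0 ≤ (1 - rho α p G)⁻¹ := inv_nonneg.2 (by linarith [h.rho_lt_one])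
  have hρ0 := h.isRenewalDensity.rho_nonneg
  refine ⟨l₂ + l₁ * ((1 - rho α p G)⁻¹ * U), l₁ * (1 + (1 - rho α p G)⁻¹ * rho α p G),
    by positivity, by positivity, fun f hf => ?_⟩
  obtain ⟨i1, i2⟩ := integrable_limitVariance h hL hf
  rw [limitVariance, integral_add i1 i2]
  simp only [pair_GammaInf h f]
  rw [integral_add ((integrable_pair_of_le_max hL (memB_secondRate h).measurable_integral_shift
      ((memB_secondRate h).abs_integral_shift_self_le hA)).const_mul _)
    ((integrable_pair_of_le_max hL (memB_meanRate h).measurable_integral_shift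
      ((memB_meanRate h).abs_integral_shift_self_le hB)).const_mul _), integral_const_mul,
    integral_const_mul, aTwo_explicit h]
  ring

lemma limitVariance_nonneg (h : IsSubcritical α p G)
    (hL : Integrable (fun ν => reach ν ^ 2) L) (hf : MemB f) : 0 ≤ limitVariance α p G L f := by
  obtain ⟨k₁, k₂, h₁, h₂, hk⟩ := exists_limitVariance_eq h hL
  rw [hk f hf]
  have e1 : 0 ≤ pair G (fun y => PiInf α p G f y ^ 2) := integral_nonneg fun y => sq_nonneg _
  have e2 : 0 ≤ ∫ ν : IntMeas, pair ν.1 (PiInf α p G f) ^ 2 ∂L :=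
    integral_nonneg fun ν => sq_nonneg _
  positivity

/-- The limit variance is a quadratic form. -/
lemma exists_limitVariance_quadForm (h : IsSubcritical α p G)
    (hL : Integrable (fun ν => reach ν ^ 2) L) (hf : MemB f) (hg : MemB g) :
    ∃ B : ℝ, ∀ a b : ℝ, limitVariance α p G L (fun x => a * f x + b * g x) =
      quadForm (limitVariance α p G L f) B (limitVariance α p G L g) a b := by
  have := h.mech.prob
  obtain ⟨k₁, k₂, -, -, hk⟩ := exists_limitVariance_eq h hL
  have mf := memLp_PiInf h hf
  have mg := memLp_PiInf h hg
  have if1 := mf.integrable one_le_two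
  have ig1 := mg.integrable one_le_two
  have if2 := mf.integrable_sq
  have ig2 := mg.integrable_sq
  have ifg : Integrable (fun x => PiInf α p G f x * PiInf α p G g x) G := mf.integrable_mul mg
  obtain ⟨Cf, _, hCf⟩ := exists_abs_PiInf_le h hf
  obtain ⟨Cg, _, hCg⟩ := exists_abs_PiInf_le h hg
  have jf : MemLp (fun ν : IntMeas => pair ν.1 (PiInf α p G f)) 2 L := by
    rw [memLp_two_iff_integrable_sq (measurable_pair (measurable_PiInf h hf)).aestronglyMeasurable]
    exact integrable_pair_sq_of_le_max hL (measurable_PiInf h hf) hCf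
  have jg : MemLp (fun ν : IntMeas => pair ν.1 (PiInf α p G g)) 2 L := by
    rw [memLp_two_iff_integrable_sq (measurable_pair (measurable_PiInf h hg)).aestronglyMeasurable]
    exact integrable_pair_sq_of_le_max hL (measurable_PiInf h hg) hCg
  have jfg : Integrable (fun ν : IntMeas => pair ν.1 (PiInf α p G f) *
    pair ν.1 (PiInf α p G g)) L := jf.integrable_mul jg
  -- The mixed coefficient is the polarization of the three squares, with potentials of `f` and `g`
  -- multiplied.
  refine ⟨k₁ * (pair G (PiInf α p G f) * pair G (PiInf α p G g)) +
    k₂ * (∫ x, PiInf α p G f x * PiInf α p G g x ∂G) +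
    ∫ ν : IntMeas, pair ν.1 (PiInf α p G f) * pair ν.1 (PiInf α p G g) ∂L, fun a b => ?_⟩
  have e0 : PiInf α p G (fun x => a * f x + b * g x) =
      fun x => a * PiInf α p G f x + b * PiInf α p G g x := funext (PiInf_linear h hf hg a b)
  have e1 : pair G (fun x => a * PiInf α p G f x + b * PiInf α p G g x) =
      a * pair G (PiInf α p G f) + b * pair G (PiInf α p G g) := by
    simp only [pair]
    rw [integral_add (if1.const_mul a) (ig1.const_mul b), integral_const_mul, integral_const_mul]
  have e2 : pair G (fun x => (a * PiInf α p G f x + b * PiInf α p G g x) ^ 2) =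
      a ^ 2 * pair G (fun y => PiInf α p G f y ^ 2) +
      2 * a * b * (∫ x, PiInf α p G f x * PiInf α p G g x ∂G) +
      b ^ 2 * pair G (fun y => PiInf α p G g y ^ 2) := by
    have i12 : Integrable (fun x => a ^ 2 * PiInf α p G f x ^ 2 +
        2 * a * b * (PiInf α p G f x * PiInf α p G g x)) G :=
      (if2.const_mul _).add (ifg.const_mul _)
    simp only [pair]
    rw [← integral_const_mul, ← integral_const_mul, ← integral_const_mul,
      ← integral_add (if2.const_mul _) (ifg.const_mul _), ← integral_add i12 (ig2.const_mul _)]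
    exact integral_congr_ae (ae_of_all _ fun x => by ring)
  have e3 : ∫ ν : IntMeas, pair ν.1 (fun x => a * PiInf α p G f x + b * PiInf α p G g x) ^ 2 ∂L =
      a ^ 2 * (∫ ν : IntMeas, pair ν.1 (PiInf α p G f) ^ 2 ∂L) +
      2 * a * b * (∫ ν : IntMeas, pair ν.1 (PiInf α p G f) * pair ν.1 (PiInf α p G g) ∂L) +
      b ^ 2 * ∫ ν : IntMeas, pair ν.1 (PiInf α p G g) ^ 2 ∂L := by
    have j12 : Integrable (fun ν : IntMeas => a ^ 2 * pair ν.1 (PiInf α p G f) ^ 2 +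
        2 * a * b * (pair ν.1 (PiInf α p G f) * pair ν.1 (PiInf α p G g))) L :=
      (jf.integrable_sq.const_mul _).add (jfg.const_mul _)
    rw [← integral_const_mul, ← integral_const_mul, ← integral_const_mul,
      ← integral_add (jf.integrable_sq.const_mul _) (jfg.const_mul _),
      ← integral_add j12 (jg.integrable_sq.const_mul _)]
    refine integral_congr_ae (ae_of_all _ fun ν => ?_)
    have : pair ν.1 (fun x => a * PiInf α p G f x + b * PiInf α p G g x) =
        a * pair ν.1 (PiInf α p G f) + b * pair ν.1 (PiInf α p G g) := by
      simp only [pair]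
      rw [integral_add ((ν.integrable_of_le_max (measurable_PiInf h hf) hCf).const_mul a)
        ((ν.integrable_of_le_max (measurable_PiInf h hg) hCg).const_mul b), integral_const_mul,
        integral_const_mul]
    simp only [this]
    ring
  rw [hk _ (hf.linear hg a b), hk f hf, hk g hg, e0, e1, e2, e3, quadForm]
  ring

end Variance

/-! ### Consequences of the exponential moments -/

section Moments

variable {G : Measure ℝ} {α₁ : ℝ}

lemma max_le_exp_div (hα : 0 < α₁) (x : ℝ) : max x 0 ≤ Real.exp (α₁ * x) / α₁ := by
  rw [le_div_iff₀ hα]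
  rcases le_total x 0 with hx | hx
  · rw [max_eq_right hx, zero_mul]; exact (Real.exp_pos _).le
  · rw [max_eq_left hx, mul_comm]
    linarith [Real.add_one_le_exp (α₁ * x)]

lemma integrable_max_sq_of_exp (hα : 0 < α₁)
    (hG : Integrable (fun x => Real.exp (2 * α₁ * x)) G) :
    Integrable (fun x => max x 0 ^ 2) G := by
  refine Integrable.mono' (hG.div_const (α₁ ^ 2))
    ((measurable_id.max measurable_const).pow_const 2).aestronglyMeasurable
    (ae_of_all _ fun x => ?_)
  rw [Real.norm_of_nonneg (sq_nonneg _)]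
  refine (pow_le_pow_left₀ (le_max_right _ _) (max_le_exp_div hα x) 2).trans (le_of_eq ?_)
  rw [div_pow, ← Real.exp_nat_mul]
  congr 2
  push_cast
  ring

variable {L : Measure IntMeas}

lemma integrable_reach_sq_of_exp (hα : 0 < α₁)
    (hL : ∫⁻ ν : IntMeas, (∫⁻ x, ENNReal.ofReal (Real.exp (α₁ * x)) ∂ν.1) ^ 2 ∂L < ⊤) :
    Integrable (fun ν => reach ν ^ 2) L := by
  refine ⟨(measurable_reach.pow_const 2).aestronglyMeasurable, ?_⟩
  rw [hasFiniteIntegral_iff_enorm]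
  have hle : ∀ ν : IntMeas, ‖reach ν ^ 2‖ₑ ≤ ENNReal.ofReal α₁⁻¹ ^ 2 *
      (∫⁻ x, ENNReal.ofReal (Real.exp (α₁ * x)) ∂ν.1) ^ 2 := fun ν => by
    rw [enorm_pow, ← mul_pow, ← lintegral_const_mul' _ _ ENNReal.ofReal_ne_top]
    refine pow_le_pow_left₀ zero_le ((enorm_integral_le_lintegral_enorm _).trans
      (lintegral_mono fun x => ?_)) 2
    rw [← ENNReal.ofReal_mul (inv_nonneg.2 hα.le), Real.enorm_of_nonneg (le_max_right _ _)]
    refine ENNReal.ofReal_le_ofReal ((max_le_exp_div hα x).trans (le_of_eq ?_))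
    rw [div_eq_inv_mul]
  refine (lintegral_mono hle).trans_lt ?_
  rw [lintegral_const_mul' _ _ (by simp)]
  exact ENNReal.mul_lt_top (by simp) hL

/-- The measures live on `(0, ∞)`, where `e^{α₁x} ≥ 1`, so the mass is at most the exponential
moment `a`; and `a ≤ 1 + a²` with `L` finite. -/
lemma integrable_mass_of_exp [IsFiniteMeasure L] (hα : 0 < α₁)
    (hL : ∫⁻ ν : IntMeas, (∫⁻ x, ENNReal.ofReal (Real.exp (α₁ * x)) ∂ν.1) ^ 2 ∂L < ⊤) :
    Integrable (fun ν : IntMeas => ν.1.real Set.univ) L := by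
  have hmass : Measurable fun ν : IntMeas => ν.1.real Set.univ :=
    ((Measure.measurable_coe MeasurableSet.univ).comp measurable_subtype_coe).ennreal_toReal
  refine ⟨hmass.aestronglyMeasurable, ?_⟩
  rw [hasFiniteIntegral_iff_enorm]
  have hle : ∀ ν : IntMeas, ‖ν.1.real Set.univ‖ₑ ≤ 1 +
      (∫⁻ x, ENNReal.ofReal (Real.exp (α₁ * x)) ∂ν.1) ^ 2 := fun ν => by
    rw [Real.enorm_of_nonneg measureReal_nonneg, ofReal_measureReal]
    have h1 : ν.1 Set.univ ≤ ∫⁻ x, ENNReal.ofReal (Real.exp (α₁ * x)) ∂ν.1 := by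
      rw [← lintegral_one]
      refine lintegral_mono_ae ?_
      filter_upwards [measure_eq_zero_iff_ae_notMem.1 ν.2.2.1] with x hx
      rw [← ENNReal.ofReal_one]
      refine ENNReal.ofReal_le_ofReal (Real.one_le_exp (mul_nonneg hα.le ?_))
      have : 0 < x := by simpa using hx
      exact this.le
    refine h1.trans ?_
    rcases le_total (∫⁻ x, ENNReal.ofReal (Real.exp (α₁ * x)) ∂ν.1) 1 with h | h
    · exact h.trans le_self_add
    · exact (le_self_pow₀ h two_ne_zero).trans le_add_self
  refine (lintegral_mono hle).trans_lt ?_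
  rw [lintegral_add_left measurable_const]
  exact ENNReal.add_lt_top.2 ⟨by simp, hL⟩

end Moments

/-! ### The central limit theorem -/

section Fluctuation

variable {α : ℝ → ℝ} {p : ℕ → ℝ → ℝ} {G : Measure ℝ}
variable {Ω : Type*} {mΩ : MeasurableSpace Ω} {μ : Measure Ω}
  {L : Measure IntMeas} [IsFiniteMeasure L] {ℱ : Filtration ℝ≥0 mΩ} {Y : ℝ≥0 → Ω → IntMeas}
  {σ : IntMeas} {F f g : ℝ → ℝ}

lemma occupation_of_nonpos {t : ℝ} (ht : t ≤ 0) (ω : Ω) : occupation Y t ω = 0 := by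
  simp [occupation, Set.Ioc_eq_empty_of_le ht]

/-- The centred occupation time, scaled by `t ^ (-1/2)`. -/
def fluctuation (μ : Measure Ω) (Y : ℝ≥0 → Ω → IntMeas) (F : ℝ → ℝ) (t : ℝ) (ω : Ω) : ℝ :=
  (Real.sqrt t)⁻¹ * (occupationTime Y F t ω - ∫ ω', occupationTime Y F t ω' ∂μ)

lemma measurable_fluctuation (hYm : Measurable (Function.uncurry Y)) (hF : Measurable F)
    (t : ℝ) : Measurable (fluctuation μ Y F t) :=
  ((measurable_occupationTime hYm hF t).sub_const _).const_mul _

variable [IsProbabilityMeasure μ]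

lemma IsImmigrationProcess.integrable_pair_occupation (hm : IsBranchingMechanism α p G)
    (hY : IsImmigrationProcess α p G L μ ℱ Y) (hYm : Measurable (Function.uncurry Y))
    (hY0 : ∀ᵐ ω ∂μ, Y 0 ω = σ)
    (hL : Integrable (fun ν : IntMeas => ν.1.real Set.univ) L) (hF : MemB F) (t : ℝ) :
    Integrable (fun ω => pair (occupation Y t ω) F) μ := by
  rcases le_total 0 t with ht | ht
  · exact (hY.integrable_occupationTime hm hYm hY0 hL hF ht).congr
      ((hY.pair_occupation hm hYm hY0 hL hF ht).mono fun _ h => h.symm)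
  · simp [occupation_of_nonpos ht, pair]

lemma IsImmigrationProcess.integrable_fluctuation (hm : IsBranchingMechanism α p G)
    (hY : IsImmigrationProcess α p G L μ ℱ Y) (hYm : Measurable (Function.uncurry Y))
    (hY0 : ∀ᵐ ω ∂μ, Y 0 ω = σ)
    (hL : Integrable (fun ν : IntMeas => ν.1.real Set.univ) L) (hF : MemB F) {t : ℝ}
    (ht : 0 ≤ t) :
    Integrable (fluctuation μ Y F t) μ ∧ ∫ ω, fluctuation μ Y F t ω ∂μ = 0 := by
  have h1 := hY.integrable_occupationTime hm hYm hY0 hL hF ht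
  refine ⟨(h1.sub (integrable_const _)).const_mul _, ?_⟩
  simp only [fluctuation]
  rw [integral_const_mul, integral_sub h1 (integrable_const _), integral_const, probReal_univ,
    one_smul, sub_self, mul_zero]

lemma IsImmigrationProcess.fluctuation_linear (hm : IsBranchingMechanism α p G)
    (hY : IsImmigrationProcess α p G L μ ℱ Y) (hYm : Measurable (Function.uncurry Y))
    (hY0 : ∀ᵐ ω ∂μ, Y 0 ω = σ)
    (hL : Integrable (fun ν : IntMeas => ν.1.real Set.univ) L) (hf : MemB f) (hg : MemB g)
    (a b : ℝ) {t : ℝ} (ht : 0 ≤ t) :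
    ∀ᵐ ω ∂μ, fluctuation μ Y (fun x => a * f x + b * g x) t ω =
      a * fluctuation μ Y f t ω + b * fluctuation μ Y g t ω := by
  have h1 := hY.occupationTime_linear hm hYm hY0 hL hf hg a b ht
  filter_upwards [h1] with ω hω
  rw [fluctuation, hω, integral_congr_ae h1,
    integral_add ((hY.integrable_occupationTime hm hYm hY0 hL hf ht).const_mul a)
      ((hY.integrable_occupationTime hm hYm hY0 hL hg ht).const_mul b), integral_const_mul,
    integral_const_mul, fluctuation, fluctuation]
  ring

/-- For `F ≥ 0` the fluctuation is bounded below by minus the scaled mean, so the exponential is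
bounded. This is where nonnegative test functions are essential. -/
lemma integrable_exp_neg_fluctuation (hYm : Measurable (Function.uncurry Y)) (hF : MemB F)
    (h0 : ∀ x, 0 ≤ F x) {t : ℝ} (ht : 0 ≤ t) :
    Integrable (fun ω => Real.exp (-fluctuation μ Y F t ω)) μ := by
  refine integrable_of_bounded (measurable_fluctuation hYm hF.measurable t).neg.exp
    (B := Real.exp ((Real.sqrt t)⁻¹ * ∫ ω', occupationTime Y F t ω' ∂μ)) fun ω => ?_
  rw [abs_of_pos (Real.exp_pos _)]
  refine Real.exp_le_exp.2 ?_
  have := mul_nonneg (inv_nonneg.2 (Real.sqrt_nonneg t))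
    (occupationTime_nonneg (Y := Y) h0 ht ω)
  rw [fluctuation]
  linarith

/-- The central limit theorem for the occupation time integrals. -/
theorem IsImmigrationProcess.tendstoInDistribution_fluctuation (h : IsSubcritical α p G)
    (hY : IsImmigrationProcess α p G L μ ℱ Y) (hYm : Measurable (Function.uncurry Y))
    (hY0 : ∀ᵐ ω ∂μ, Y 0 ω = σ)
    (hL : Integrable (fun ν : IntMeas => ν.1.real Set.univ) L)
    (hL2 : Integrable (fun ν => reach ν ^ 2) L) (hf : MemB f) {v : ℝ≥0}
    (hv : (v : ℝ) = limitVariance α p G L f) :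
    TendstoInDistribution (fluctuation μ Y f) atTop (id : ℝ → ℝ) (fun _ => μ)
      (gaussianReal 0 v) := by
  -- The Laplace formula covers nonnegative functions only. Every combination `a f₁ + b f₂` with `a,
  -- b ≥ 0` is of this kind, so limits for single functions give the joint transform of the pair on
  -- the quadrant.
  set f₁ : ℝ → ℝ := fun x => max (f x) 0
  set f₂ : ℝ → ℝ := fun x => max (-f x) 0
  have hf₁ : MemB f₁ := hf.posPart
  have hf₂ : MemB f₂ := hf.neg.posPart
  have hp₁ : ∀ x, 0 ≤ f₁ x := fun x => le_max_right _ _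
  have hp₂ : ∀ x, 0 ≤ f₂ x := fun x => le_max_right _ _
  have hdec : f = fun x => 1 * f₁ x + -1 * f₂ x := by
    funext x
    rcases le_total 0 (f x) with hx | hx
    · simp [f₁, f₂, hx]
    · simp [f₁, f₂, hx]
  obtain ⟨B, hB⟩ := exists_limitVariance_quadForm h hL2 hf₁ hf₂
  have hev : ∀ᶠ t : ℝ in atTop, 0 ≤ t := eventually_ge_atTop 0
  have hlin := fun a b t (ht : (0 : ℝ) ≤ t) =>
    hY.fluctuation_linear h.mech hYm hY0 hL hf₁ hf₂ a b ht
  have key := tendstoInDistribution_sub_of_laplace (μ := μ) (l := (atTop : Filter ℝ))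
    (X := fluctuation μ Y f₁) (W := fluctuation μ Y f₂) (A := limitVariance α p G L f₁) (B := B)
    (D := limitVariance α p G L f₂) (v := v)
    (measurable_fluctuation hYm hf₁.measurable) (measurable_fluctuation hYm hf₂.measurable)
    (hev.mono fun t ht => (hY.integrable_fluctuation h.mech hYm hY0 hL hf₁ ht).1)
    (hev.mono fun t ht => (hY.integrable_fluctuation h.mech hYm hY0 hL hf₂ ht).1)
    (hev.mono fun t ht => (hY.integrable_fluctuation h.mech hYm hY0 hL hf₁ ht).2)
    (hev.mono fun t ht => (hY.integrable_fluctuation h.mech hYm hY0 hL hf₂ ht).2)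
    (fun a b ha hb => hev.mono fun t ht =>
      (integrable_exp_neg_fluctuation hYm (hf₁.linear hf₂ a b)
        (fun x => add_nonneg (mul_nonneg ha (hp₁ x)) (mul_nonneg hb (hp₂ x))) ht).congr
        ((hlin a b t ht).mono fun ω hω => by simp only [hω]))
    (fun a b ha hb => by
      rw [← hB a b]
      refine (hY.tendsto_laplace h (hf₁.linear hf₂ a b)
        (fun x => add_nonneg (mul_nonneg ha (hp₁ x)) (mul_nonneg hb (hp₂ x)))
        hYm hY0 hL hL2).congr' (hev.mono fun t ht => integral_congr_ae ?_)
      filter_upwards [hlin a b t ht] with ω hω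
      rw [← hω, fluctuation])
    -- The quadratic form at `(1, -1)` is the variance of `f₁ - f₂ = f`.
    (by rw [hv, ← hB, ← hdec])
  refine key.congr (fun t => ?_) (ae_of_all _ fun _ => rfl)
  rcases le_total 0 t with ht | ht
  · rw [hdec]
    filter_upwards [hlin 1 (-1) t ht] with ω hω
    rw [hω]
    ring
  -- For `t ≤ 0` the factor `(√t)⁻¹` is `0⁻¹ = 0`, so both sides vanish and the identity holds for
  -- every `t`.
  · exact ae_of_all _ fun ω => by simp [fluctuation, Real.sqrt_eq_zero_of_nonpos ht]

end Fluctuation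

end RLBranching

end

open RLBranching in
theorem mainTheorem4 {Ω : Type*} {mΩ : MeasurableSpace Ω} (μ : Measure Ω) [IsProbabilityMeasure μ]
    (α : ℝ → ℝ) (p : ℕ → ℝ → ℝ) (G : Measure ℝ) (hmech : IsBranchingMechanism α p G)
    (L : Measure IntMeas) [IsFiniteMeasure L] (hL0 : L {ν | ν.1 = 0} = 0)
    (ℱ : Filtration ℝ≥0 mΩ) (Y : ℝ≥0 → Ω → IntMeas) (σ : IntMeas)
    (hY : IsImmigrationProcess α p G L μ ℱ Y)
    (hYmeas : Measurable (Function.uncurry Y))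
    (hY0 : ∀ᵐ ω ∂μ, Y 0 ω = σ)
    (α₁ : ℝ) (hsub : SubcriticalMalthusian α p G α₁)
    (hG : Integrable (fun x => Real.exp (2 * α₁ * x)) G)
    (hg : SecondMomentBounded p)
    (hL : ∫⁻ ν, (∫⁻ x, ENNReal.ofReal (Real.exp (α₁ * x)) ∂ν.1) ^ 2 ∂L < ⊤)
    (f : ℝ → ℝ) (hf : MemB f) :
    -- the quantities in the limit theorem are well defined
    (∀ x, IntegrableOn (fun s => meanSemigroup α p G f s x) (Set.Ioi 0)) ∧
    MemLp (PiInf α p G f) 2 G ∧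
    Integrable (fun ν : IntMeas =>
      pair ν.1 (GammaInf α p G f) + pair ν.1 (PiInf α p G f) ^ 2) L ∧
    (∀ t : ℝ, Integrable (fun ω => pair (occupation Y t ω) f) μ) ∧
    -- the central limit theorem
    ∃ v : ℝ≥0,
      (v : ℝ) = ∫ ν : IntMeas,
        (pair ν.1 (GammaInf α p G f) + pair ν.1 (PiInf α p G f) ^ 2) ∂L ∧
      TendstoInDistribution
        (fun (t : ℝ) ω => (Real.sqrt t)⁻¹ *
          (pair (occupation Y t ω) f - ∫ ω', pair (occupation Y t ω') f ∂μ))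
        atTop (id : ℝ → ℝ) (fun _ => μ) (gaussianReal 0 v) := by
  -- From here on the exponential moments enter only through a second moment of `G` and, for `L`,
  -- through integrability of the mass and of the squared total residual life.
  have h : IsSubcritical α p G :=
    ⟨hmech, hg, hsub.subcritical, integrable_max_sq_of_exp hsub.pos hG⟩
  have hL1 := integrable_mass_of_exp hsub.pos hL
  have hL2 := integrable_reach_sq_of_exp hsub.pos hL
  have hv := integrable_limitVariance h hL2 hf
  obtain ⟨v, hv'⟩ : ∃ v : ℝ≥0, (v : ℝ) = limitVariance α p G L f :=
    ⟨⟨_, limitVariance_nonneg h hL2 hf⟩, rfl⟩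
  refine ⟨fun x => (meanSemigroup_potential h hf x).1, memLp_PiInf h hf, hv.1.add hv.2,
    hY.integrable_pair_occupation hmech hYmeas hY0 hL1 hf,
    v, hv',
    (hY.tendstoInDistribution_fluctuation h hYmeas hY0 hL1 hL2 hf hv').congr (fun t => ?_)
      (ae_of_all _ fun _ => rfl)⟩
  rcases le_total 0 t with ht | ht
  · have h1 := hY.pair_occupation hmech hYmeas hY0 hL1 hf ht
    filter_upwards [h1] with ω hω
    rw [fluctuation, hω, integral_congr_ae h1]
  -- For `t ≤ 0` the convention `(√t)⁻¹ = 0` makes both variables zero, whatever the occupation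
  -- quantities are.
  · exact ae_of_all _ fun ω => by simp [fluctuation, Real.sqrt_eq_zero_of_nonpos ht]
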